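/- Let $K$ be a totally real cubic number field with ring of integers $\mathcal O_K$, and let $B=\left(\frac{a,b}{K}\right)$ ($a,b\in K^\times$) be a quaternion algebra over $K$, with basis $1,\alpha,\beta,\alpha\beta$, $\alpha^2=a$, $\beta^2=b$, $\alpha\beta=-\beta\alpha$, reduced trace $\mathrm{trd}$ and reduced norm $\mathrm{nrd}$. Let $B^0\subset B$ be the Lie algebra of elements of reduced trace zero and let $Q_B$ be its Killing form multiplied by $\tfrac14$ (so $Q_B$ has matrix $\mathrm{diag}(2a,2b,-2ab)$ in the basis $\alpha,\beta,\alpha\beta$). Let $\mathfrak D\subset\mathcal O_K$ be the product of the finite primes at which $B$ ramifies. For a $K$-vector space $V$ with a symmetric bilinear form $Q$, $\mathrm{Cor}_{K/\mathbb Q}(V,Q)$ denotes the $\mathbb Q$-space of $\mathrm{Gal}(\overline{\mathbb Q}/\mathbb Q)$-invariants in $\bigoplus_{\sigma:K\to\overline{\mathbb Q}}\overline{\mathbb Q}\otimes_{K,\sigma}V$ with the form $\bigoplus_\sigma Q^\sigma$; for an $\mathcal O_K$-lattice $\Lambda\subset V$, $\mathrm{Cor}_{K/\mathbb Q}(\Lambda)$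 is the image of $\Lambda$ under $v\mapsto(1\otimes v)_\sigma$. Likewise $\mathrm{Cor}_{K/\mathbb Q}(B)$ is the $\mathbb Q$-algebra of $\mathrm{Gal}(\overline{\mathbb Q}/\mathbb Q)$-invariants in $\bigotimes_\sigma B^\sigma$, where $B^\sigma=\overline{\mathbb Q}\otimes_{K,\sigma}B$, and $\mathrm{Nm}:B\to\mathrm{Cor}_{K/\mathbb Q}(B)$ is $\gamma\mapsto\bigotimes_\sigma\gamma^\sigma$. (1) Let $O$ be a maximal $\mathcal O_K$-order of $B$. With respect to $Q_B$, $$\mathrm{disc}(O\cap B^0)=2\,\mathfrak D^2$$ as ideals of $\mathcal O_K$. The group $\Lambda_{can}=\mathrm{Cor}_{K/\mathbb Q}(O\cap B^0)$ is an integral $\mathbb Z$-lattice of rank $9$ in $\mathrm{Cor}_{K/\mathbb Q}(B^0,Q_B)$, with discriminant (Gram determinant) $$\mathrm{disc}(\Lambda_{can})=-2^3\,\mathrm{disc}(K/\mathbb Q)^3\,\mathrm{Norm}_{K/\mathbb Q}(\mathfrak D)^2 .$$ (2) Suppose moreover that $B$ satisfies Mumford's conditions: $B\otimes_{\mathbb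 Q}\mathbb R\cong\mathbb H\oplus\mathbb H\oplus M_2(\mathbb R)$, and there is an isomorphism $\rho:\mathrm{Cor}_{K/\mathbb Q}(B)\cong M_8(\mathbb Q)$. Let $V=\mathbb Q^8$, a representation via $\rho\circ\mathrm{Nm}$ of the $\mathbb Q$-group $G$ of elements of reduced norm $1$ of $B$, and let $h(e^{it})\in G(\mathbb R)$ be the rotation by $t$ in the factor $M_2(\mathbb R)$ (for any isomorphism of that factor with $M_2(\mathbb R)$) and $1$ in the other two factors; with the Hodge structure given by $h$, $V$ is the weight-one rational Hodge structure of a Mumford fourfold. Then: (a) $V$ carries a $G$-invariant symplectic form. (b) There is a unique subrepresentation $V_{K3}\subset V\otimes V$ of $G$ with $V_{K3}\otimes\mathbb C\cong\bigoplus_{\sigma}\mathrm{Sym}^2(\mathrm{St}_\sigma)$ as a representation of $G(\mathbb C)=\prod_{\sigma:K\to\mathbb C}SL_2(\mathbb C)$, where $\mathrm{St}_\sigma$ is the standard representation of the factor at $\sigma$. It has dimension $9$, is irreducible over $\mathbb Q$, lies in $\mathrm{Sym}^2V$, and is a Hodge substructure with Hodge numbers $(1,7,1)$. (c) For every $G$-invariant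 symplectic form $\psi$ on $V$, let $Q_{can}$ be the restriction to $V_{K3}$ of the form $(v\otimes w,v'\otimes w')\mapsto-\psi(v,v')\psi(w,w')$. There is a $G$-equivariant isometry of quadratic spaces over $\mathbb Q$ $$(V_{K3},Q_{can})\cong\mathrm{Cor}_{K/\mathbb Q}(B^0,Q_B),$$ where $G$ acts on $B^0$ by conjugation. -/

import Mathlib

open scoped Quaternion TensorProduct NumberField

noncomputable section

namespace Mumford

/-! ### Quaternion algebras -/

/-- Coordinatewise base change of quaternions along a ring homomorphism `f`.  When `c' = f c` and
`d' = f d` this is the canonical `f`-semilinear ring homomorphism `(c, d / L) → (c', d' / L')`. -/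
def qmap {L L' : Type*} [Field L] [Field L'] (f : L →+* L') {c d : L} {c' d' : L'}
    (x : ℍ[L,c,d]) : ℍ[L',c',d'] :=
  ⟨f x.re, f x.imI, f x.imJ, f x.imK⟩

theorem qmap_add {L L' : Type*} [Field L] [Field L'] (f : L →+* L') {c d : L} {c' d' : L'}
    (x y : ℍ[L,c,d]) : (qmap f (x + y) : ℍ[L',c',d']) = qmap f x + qmap f y := by
  ext
  exacts [map_add f _ _, map_add f _ _, map_add f _ _, map_add f _ _]

theorem qmap_smul {L L' : Type*} [Field L] [Field L'] (f : L →+* L') {c d : L} {c' d' : L'}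
    (r : L) (x : ℍ[L,c,d]) : (qmap f (r • x) : ℍ[L',c',d']) = f r • qmap f x := by
  ext
  exacts [map_mul f _ _, map_mul f _ _, map_mul f _ _, map_mul f _ _]

theorem qmap_zero {L L' : Type*} [Field L] [Field L'] (f : L →+* L') {c d : L} {c' d' : L'} :
    (qmap f (0 : ℍ[L,c,d]) : ℍ[L',c',d']) = 0 := by
  ext
  exacts [map_zero f, map_zero f, map_zero f, map_zero f]

theorem qmap_one {L L' : Type*} [Field L] [Field L'] (f : L →+* L') {c d : L} {c' d' : L'} :
    (qmap f (1 : ℍ[L,c,d]) : ℍ[L',c',d']) = 1 := by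
  ext
  exacts [map_one f, map_zero f, map_zero f, map_zero f]

theorem qmap_mul {L L' : Type*} [Field L] [Field L'] (f : L →+* L') {c d : L} {c' d' : L'}
    (hc : c' = f c) (hd : d' = f d) (x y : ℍ[L,c,d]) :
    (qmap f (x * y) : ℍ[L',c',d']) = qmap f x * qmap f y := by
  subst hc hd
  ext <;> simp [qmap]

/-- The reduced trace `x + x̄`. -/
def trd {L : Type*} [Field L] {c d : L} (x : ℍ[L,c,d]) : L := (x + star x).re

/-- The reduced norm `x x̄`. -/
def nrd {L : Type*} [Field L] {c d : L} (x : ℍ[L,c,d]) : L := (x * star x).re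

instance {L : Type*} [Field L] {c d : L} : LieRing ℍ[L,c,d] := LieRing.ofAssociativeRing

instance {L : Type*} [Field L] {c d : L} : LieAlgebra L ℍ[L,c,d] :=
  LieAlgebra.ofAssociativeAlgebra

/-- The Lie algebra `B⁰` of trace-zero elements, with the commutator bracket. -/
def B0 {K : Type*} [Field K] (a b : K) : LieSubalgebra K ℍ[K,a,b] where
  carrier := {x | trd x = 0}
  zero_mem' := by simp [trd]
  add_mem' := by
    intro x y hx hy
    simp only [Set.mem_ofPred_eq, trd, QuaternionAlgebra.re_add, QuaternionAlgebra.re_star] at *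
    linear_combination hx + hy
  smul_mem' := by
    intro c x hx
    simp only [Set.mem_ofPred_eq, trd, QuaternionAlgebra.re_add, QuaternionAlgebra.re_star,
      QuaternionAlgebra.re_smul, QuaternionAlgebra.imI_smul, smul_eq_mul] at *
    linear_combination c * hx
  lie_mem' := by
    intro x y _ _
    change trd (x * y - y * x) = 0
    simp only [trd, QuaternionAlgebra.re_add, QuaternionAlgebra.imI_sub,
      QuaternionAlgebra.re_star, QuaternionAlgebra.re_sub, QuaternionAlgebra.re_mul]
    ring

/-- The form `Q_B` on `B⁰`: the Killing form, normalized by the factor `1/4` (so that its matrix in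
the basis `i, j, k` is `diag(2a, 2b, -2ab)`). -/
def QB {K : Type*} [Field K] (a b : K) : LinearMap.BilinForm K (B0 a b) :=
  (1 / 4 : K) • killingForm K (B0 a b)

/-- Conjugation `x ↦ γ x γ̄` on `B⁰`; for `nrd γ = 1` this is the adjoint action `x ↦ γ x γ⁻¹`. -/
def Ad {K : Type*} [Field K] {a b : K} (γ : ℍ[K,a,b]) : B0 a b →ₗ[K] B0 a b where
  toFun x := ⟨γ * x * star γ, by
    have hx : trd (x : ℍ[K,a,b]) = 0 := x.2
    change trd (γ * (x : ℍ[K,a,b]) * star γ) = 0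
    simp only [trd, QuaternionAlgebra.re_add, QuaternionAlgebra.re_star,
      QuaternionAlgebra.re_mul, QuaternionAlgebra.imI_mul, QuaternionAlgebra.imJ_mul,
      QuaternionAlgebra.imK_mul, QuaternionAlgebra.imI_star, QuaternionAlgebra.imJ_star,
      QuaternionAlgebra.imK_star] at *
    linear_combination (γ.re ^ 2 - a * γ.imI ^ 2 - b * γ.imJ ^ 2 + a * b * γ.imK ^ 2) * hx⟩
  map_add' x y := by ext1; simp [mul_add, add_mul]
  map_smul' c x := by ext1; simp

/-! ### Corestriction of vector spaces, quadratic spaces and lattices -/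

section Cor

variable {K : Type*} [Field K] {L : Type*} [Field L]

/-- The field `L`, viewed as a `K`-algebra through the embedding `σ : K → L`. -/
def Emb (_σ : K →+* L) : Type _ := L

instance (σ : K →+* L) : Field (Emb σ) := inferInstanceAs (Field L)

instance (σ : K →+* L) [CharZero L] : CharZero (Emb σ) := inferInstanceAs (CharZero L)

instance (σ : K →+* L) : Algebra K (Emb σ) := RingHom.toAlgebra (S := Emb σ) σ

/-- The conjugate space `V^σ = L ⊗_{K,σ} V`. -/
abbrev Conj (σ : K →+* L) (V : Type*) [AddCommGroup V] [Module K V] : Type _ := Emb σ ⊗[K] V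

variable {V : Type*} [AddCommGroup V] [Module K V]

/-- An automorphism `τ` of `L`, viewed as a map between copies of `L`. -/
def Emb.gal (τ : L →+* L) (σ σ' : K →+* L) : Emb σ →+* Emb σ' := τ

/-- The semilinear map `V^σ → V^{τσ}`, `c ⊗ v ↦ τ(c) ⊗ v`. -/
def Conj.gal (τ : L →+* L) {σ σ' : K →+* L} (h : ∀ k, τ (σ k) = σ' k) :
    Conj σ V →+ Conj σ' V :=
  TensorProduct.liftAddHom
    ((TensorProduct.mk K (Emb σ') V).toAddMonoidHom.comp (Emb.gal τ σ σ').toAddMonoidHom |>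
      (LinearMap.toAddMonoidHom'.comp ·))
    (fun k c v => by
      change (Emb.gal τ σ σ' (k • c)) ⊗ₜ[K] v = (Emb.gal τ σ σ' c) ⊗ₜ[K] (k • v)
      rw [← TensorProduct.smul_tmul, Algebra.smul_def, Algebra.smul_def, map_mul]
      congr 2
      exact h k)

/-- The form `Q^σ` on `V^σ`, `Q^σ(r ⊗ x, s ⊗ y) = r s σ(Q(x, y))`. -/
def Conj.form (σ : K →+* L) (Q : LinearMap.BilinForm K V) (x y : Conj σ V) : L :=
  LinearMap.BilinForm.baseChange (Emb σ) Q x y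

variable (K V)

/-- The corestriction `Cor_{K/ℚ}(V)`: the elements of `⨁_σ V^σ`, with `σ` running through the
embeddings of `K` into `ℚ̄`, that are fixed by the semilinear action of `Gal(ℚ̄/ℚ)`. -/
def CorSpace : Submodule ℚ (∀ σ : K →+* AlgebraicClosure ℚ, Conj σ V) where
  carrier := {x | ∀ (τ : AlgebraicClosure ℚ ≃ₐ[ℚ] AlgebraicClosure ℚ)
    (σ σ' : K →+* AlgebraicClosure ℚ) (h : ∀ k, (τ : AlgebraicClosure ℚ →+* _) (σ k) = σ' k),
      Conj.gal _ h (x σ) = x σ'}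
  zero_mem' := fun τ σ σ' h => map_zero _
  add_mem' := fun hx hy τ σ σ' h => by
    rw [Pi.add_apply, map_add, hx τ σ σ' h, hy τ σ σ' h]; rfl
  smul_mem' := fun c x hx τ σ σ' h => by
    rw [Pi.smul_apply, map_rat_smul, hx τ σ σ' h]; rfl

variable {K V}

/-- The canonical map `V → Cor_{K/ℚ}(V)`, `v ↦ (1 ⊗ v)_σ`. -/
def corDiag : V →+ CorSpace K V where
  toFun v := ⟨fun σ => (1 : Emb σ) ⊗ₜ[K] v, fun τ σ σ' h => by
    change (Emb.gal (τ : AlgebraicClosure ℚ →+* AlgebraicClosure ℚ) σ σ' 1) ⊗ₜ[K] v =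
      (1 : Emb σ') ⊗ₜ[K] v
    rw [map_one]⟩
  map_zero' := by ext σ; simp
  map_add' v w := by ext σ; simp [TensorProduct.tmul_add]

/-- Functoriality of the corestriction: `(x_σ)_σ ↦ (g^σ x_σ)_σ`. -/
def CorSpace.map (g : V →ₗ[K] V) (x : CorSpace K V) : CorSpace K V :=
  ⟨fun σ => g.baseChange (Emb σ) (x.1 σ), fun τ σ σ' h => by
    change Conj.gal _ h (g.baseChange (Emb σ) (x.1 σ)) = g.baseChange (Emb σ') (x.1 σ')
    rw [← x.2 τ σ σ' h]
    generalize x.1 σ = z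
    induction z using TensorProduct.induction_on with
    | zero => simp
    | tmul c v => rfl
    | add z w hz hw => simp only [map_add, hz, hw]⟩

/-- The corestricted form `Q₀ = ⨁_σ Q^σ` on `Cor_{K/ℚ}(V)` (a priori with values in `ℚ̄`). -/
def corForm [NumberField K] (Q : LinearMap.BilinForm K V) (x y : CorSpace K V) :
    AlgebraicClosure ℚ :=
  ∑ σ : K →+* AlgebraicClosure ℚ, Conj.form σ Q (x.1 σ) (y.1 σ)

/-- The corestriction `Cor_{K/ℚ}(Λ)` of an `𝓞 K`-lattice `Λ` in `V`, a `ℤ`-lattice in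
`Cor_{K/ℚ}(V)`. -/
def corLattice [Module (𝓞 K) V] (Λ : Submodule (𝓞 K) V) : Submodule ℤ (CorSpace K V) :=
  AddSubgroup.toIntSubmodule (Λ.toAddSubgroup.map corDiag)

/-- The discriminant of an `𝓞 K`-lattice `Λ` of rank `n` with respect to a form `Q`: the
`𝓞 K`-submodule of `K` generated by all determinants `det (Q(xᵢ, xⱼ))`, with `x₁, …, xₙ ∈ Λ`.
For `Λ = ⨁ 𝔞ᵢ eᵢ` this is `∏ 𝔞ᵢ² · det (Q(eᵢ, eⱼ))`. -/
def latticeDisc [Module (𝓞 K) V] (n : ℕ) (Q : LinearMap.BilinForm K V) (Λ : Submodule (𝓞 K) V) :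
    Submodule (𝓞 K) K :=
  Submodule.span (𝓞 K)
    {d | ∃ x : Fin n → V, (∀ i, x i ∈ Λ) ∧ d = (Matrix.of fun i j => Q (x i) (x j)).det}

end Cor

/-! ### Orders and discriminants of quaternion algebras -/

section Orders

variable {K : Type*} [Field K] [NumberField K] {a b : K}

/-- An `𝓞 K`-order of `B`: a subring that is a (full) `𝓞 K`-lattice in `B`. -/
def IsOrder (O : Subalgebra (𝓞 K) ℍ[K,a,b]) : Prop :=
  (Subalgebra.toSubmodule O).FG ∧ Submodule.span K (O : Set ℍ[K,a,b]) = ⊤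

/-- A maximal order: an order not properly contained in another order. -/
def IsMaximalOrder (O : Subalgebra (𝓞 K) ℍ[K,a,b]) : Prop := Maximal IsOrder O

/-- The lattice `O ∩ B⁰` in `B⁰`. -/
def traceZeroLattice (O : Subalgebra (𝓞 K) ℍ[K,a,b]) : Submodule (𝓞 K) (B0 a b) where
  carrier := {x | (x : ℍ[K,a,b]) ∈ O}
  zero_mem' := O.zero_mem
  add_mem' := fun hx hy => O.add_mem hx hy
  smul_mem' := fun c _ hx => O.smul_mem hx c

variable (a b)

/-- The quaternion algebra `(a, b / K)` ramifies at the finite place `v`: the conic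
`a x² + b y² = z²` has no point over the completion `K_v`. -/
def IsRamifiedAt (v : IsDedekindDomain.HeightOneSpectrum (𝓞 K)) : Prop :=
  ¬ ∃ x y z : v.adicCompletion K, (x, y, z) ≠ (0, 0, 0) ∧
    algebraMap K (v.adicCompletion K) a * x ^ 2 + algebraMap K (v.adicCompletion K) b * y ^ 2 =
      z ^ 2

/-- The discriminant `𝔇` of `B`: the product of the finite places where `B` ramifies. -/
def quatDisc : Ideal (𝓞 K) :=
  ∏ᶠ (v : IsDedekindDomain.HeightOneSpectrum (𝓞 K)) (_ : IsRamifiedAt a b v), v.asIdeal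

end Orders

/-! ### Corestriction of quaternion algebras -/

section CorAlg

open scoped Classical in
/-- The algebra `⨂_σ B^σ` over `L`, with `σ` running through the embeddings `K → L`; here
`B = (a, b / K)` and `B^σ = L ⊗_{K,σ} B = (σ a, σ b / L)`. -/
abbrev DAlg {K : Type*} [Field K] (L : Type*) [Field L] (a b : K) : Type _ :=
  ⨂[L] σ : K →+* L, ℍ[L,σ a,σ b]

variable {K : Type*} [Field K] {L : Type*} [Field L] {a b : K}

/-- The action of `τ` on pure tensors: the component of the image at `σ` is the image of the
component at `τ⁻¹ σ` under `B^{τ⁻¹ σ} → B^σ`. -/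
def galTuple (τ : L ≃+* L) (x : ∀ σ : K →+* L, ℍ[L,σ a,σ b]) (σ : K →+* L) : ℍ[L,σ a,σ b] :=
  qmap (τ : L →+* L) (x ((τ.symm : L →+* L).comp σ))

theorem galTuple_update [DecidableEq (K →+* L)] (τ : L ≃+* L)
    (x : ∀ σ : K →+* L, ℍ[L,σ a,σ b]) (σ : K →+* L) (m : ℍ[L,σ a,σ b]) :
    galTuple τ (Function.update x σ m) =
      Function.update (galTuple τ x) ((τ : L →+* L).comp σ) (qmap (τ : L →+* L) m) := by
  funext ρ
  by_cases h : ρ = (τ : L →+* L).comp σ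
  · subst h
    have h2 : (τ.symm : L →+* L).comp ((τ : L →+* L).comp σ) = σ := by ext k; simp
    rw [Function.update_self]
    simp only [galTuple]
    have key : ∀ σ₂ (_ : σ₂ = σ), (qmap (τ : L →+* L) (Function.update x σ m σ₂) :
        ℍ[L,((τ : L →+* L).comp σ) a,((τ : L →+* L).comp σ) b]) = qmap (τ : L →+* L) m := by
      rintro _ rfl; rw [Function.update_self]
    exact key _ h2
  · rw [Function.update_of_ne h]
    have h2 : (τ.symm : L →+* L).comp ρ ≠ σ := by
      rintro rfl; apply h; ext k; simp
    simp only [galTuple]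
    rw [Function.update_of_ne h2]

/-- The semilinear automorphism of `⨂_σ B^σ` given by an automorphism `τ` of `L`. -/
def galD (τ : L ≃+* L) : DAlg L a b →+ DAlg L a b :=
  PiTensorProduct.liftAddHom
    (fun p : L × (∀ σ : K →+* L, ℍ[L,σ a,σ b]) =>
      τ p.1 • PiTensorProduct.tprod L (galTuple τ p.2))
    (fun r f σ hf => by
      classical
      have : f = Function.update f σ 0 := by rw [← hf, Function.update_eq_self]
      simp only
      rw [this, galTuple_update, qmap_zero]
      simp [MultilinearMap.map_update_zero])
    (fun f => by simp)
    (fun r f σ m₁ m₂ => by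
      simp only [galTuple_update, qmap_add, MultilinearMap.map_update_add, smul_add])
    (fun r r' f => by simp [add_smul])
    (fun r f σ r' => by
      have h1 := galTuple_update τ f σ (f σ)
      rw [Function.update_eq_self] at h1
      simp only [galTuple_update, qmap_smul, MultilinearMap.map_update_smul]
      rw [← h1, smul_smul, map_mul, mul_comm]
      rfl)

theorem galD_smul_tprod (τ : L ≃+* L) (r : L) (x : ∀ σ : K →+* L, ℍ[L,σ a,σ b]) :
    galD τ (r • PiTensorProduct.tprod L x) = τ r • PiTensorProduct.tprod L (galTuple τ x) := by
  rw [← PiTensorProduct.tprodCoeff_eq_smul_tprod]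
  rfl

theorem galD_mul (τ : L ≃+* L) (x y : DAlg L a b) : galD τ (x * y) = galD τ x * galD τ y := by
  induction x using PiTensorProduct.induction_on with
  | add x x' hx hx' => rw [add_mul, map_add, map_add, hx, hx', add_mul]
  | smul_tprod r f =>
    induction y using PiTensorProduct.induction_on with
    | add y y' hy hy' => rw [mul_add, map_add, map_add, hy, hy', mul_add]
    | smul_tprod s g =>
      have h : galTuple τ (f * g) = galTuple τ f * galTuple τ g := by
        funext σ
        exact qmap_mul _ (by simp) (by simp) _ _
      rw [PiTensorProduct.smul_tprod_mul_smul_tprod, galD_smul_tprod, galD_smul_tprod,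
        galD_smul_tprod, PiTensorProduct.smul_tprod_mul_smul_tprod, h, map_mul]

theorem galD_one (τ : L ≃+* L) : galD τ (1 : DAlg L a b) = 1 := by
  have h : galTuple τ (1 : ∀ σ : K →+* L, ℍ[L,σ a,σ b]) = 1 := by
    funext σ
    exact qmap_one _
  have h2 := galD_smul_tprod τ 1 (1 : ∀ σ : K →+* L, ℍ[L,σ a,σ b])
  rw [h, map_one τ, one_smul] at h2
  exact h2

/-- The norm map `Nm : B → ⨂_σ B^σ`, `γ ↦ ⨂_σ γ^σ`. -/
def Nm (L : Type*) [Field L] (γ : ℍ[K,a,b]) : DAlg L a b :=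
  PiTensorProduct.tprod L fun σ : K →+* L => qmap σ γ

variable (a b)

/-- The corestriction `Cor_{K/ℚ}(B)`: the elements of `⨂_σ B^σ` over `ℚ̄` that are fixed by the
semilinear action of `Gal(ℚ̄/ℚ)`. -/
def CorAlg : Subalgebra ℚ (DAlg (AlgebraicClosure ℚ) a b) where
  carrier := {x | ∀ τ : AlgebraicClosure ℚ ≃ₐ[ℚ] AlgebraicClosure ℚ, galD τ.toRingEquiv x = x}
  mul_mem' := fun hx hy τ => by rw [galD_mul, hx τ, hy τ]
  add_mem' := fun hx hy τ => by rw [map_add, hx τ, hy τ]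
  algebraMap_mem' := fun r τ => by
    rw [Algebra.algebraMap_eq_smul_one, map_rat_smul, galD_one]

variable {a b}

/-- The norm map `Nm : B → Cor_{K/ℚ}(B)`. -/
def NmCor (γ : ℍ[K,a,b]) : CorAlg a b :=
  ⟨Nm (AlgebraicClosure ℚ) γ, fun τ => by
    have h := galD_smul_tprod τ.toRingEquiv 1
      (fun σ : K →+* AlgebraicClosure ℚ => (qmap σ γ : ℍ[AlgebraicClosure ℚ,σ a,σ b]))
    rw [one_smul, map_one, one_smul] at h
    refine h.trans ?_
    unfold Nm
    congr 1
    funext σ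
    simp [galTuple, qmap]⟩

end CorAlg

/-! ### Mumford's construction -/

section Construction

/-- The diagonal action `v ⊗ w ↦ g v ⊗ g w` of a matrix on `Fⁿ ⊗ Fⁿ`. -/
def act {F : Type*} [Field F] {n : ℕ} (g : Matrix (Fin n) (Fin n) F) :
    (Fin n → F) ⊗[F] (Fin n → F) →ₗ[F] (Fin n → F) ⊗[F] (Fin n → F) :=
  TensorProduct.map g.toLin' g.toLin'

/-- The symmetric tensors in `Fⁿ ⊗ Fⁿ`, i.e. `Sym²(Fⁿ)`. -/
def symTensors (F : Type*) [Field F] (n : ℕ) : Submodule F ((Fin n → F) ⊗[F] (Fin n → F)) :=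
  LinearMap.eqLocus (TensorProduct.comm F (Fin n → F) (Fin n → F)).toLinearMap LinearMap.id

/-- The inclusion `V ⊗ V → V_ℂ ⊗ V_ℂ` for `V = ℚⁿ`. -/
def complexify (n : ℕ) :
    (Fin n → ℚ) ⊗[ℚ] (Fin n → ℚ) →ₗ[ℚ] (Fin n → ℂ) ⊗[ℂ] (Fin n → ℂ) :=
  TensorProduct.lift <| LinearMap.mk₂ ℚ
    (fun v w => (fun i => (v i : ℂ)) ⊗ₜ[ℂ] (fun i => (w i : ℂ)))
    (fun v v' w => by
      rw [← TensorProduct.add_tmul]; congr 1; funext i; simp)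
    (fun c v w => by
      rw [TensorProduct.smul_tmul']; congr 1; funext i; simp [Rat.smul_def])
    (fun v w w' => by
      rw [← TensorProduct.tmul_add]; congr 1; funext i; simp)
    (fun c v w => by
      rw [← TensorProduct.tmul_smul]; congr 1; funext i; simp [Rat.smul_def])

/-- The complexification `W_ℂ ⊆ V_ℂ ⊗ V_ℂ` of a subspace `W ⊆ V ⊗ V`. -/
def complexSpan {n : ℕ} (W : Submodule ℚ ((Fin n → ℚ) ⊗[ℚ] (Fin n → ℚ))) :
    Submodule ℂ ((Fin n → ℂ) ⊗[ℂ] (Fin n → ℂ)) :=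
  Submodule.span ℂ (complexify n '' (W : Set ((Fin n → ℚ) ⊗[ℚ] (Fin n → ℚ))))

variable {K : Type*} [Field K] {a b : K}

/-- `ρC` is the complexification of the isomorphism `ρ : Cor_{K/ℚ}(B) ≅ M₈(ℚ)`: the two agree on
all norms `Nm γ` (which span the source of either map). -/
def IsComplexification (ρ : CorAlg a b ≃ₐ[ℚ] Matrix (Fin 8) (Fin 8) ℚ)
    (ρC : DAlg ℂ a b →ₐ[ℂ] Matrix (Fin 8) (Fin 8) ℂ) : Prop :=
  ∀ γ : ℍ[K,a,b], ρC (Nm ℂ γ) = (ρ (NmCor γ)).map (algebraMap ℚ ℂ)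

/-- The action on `V_ℂ ⊗ V_ℂ` of an element `(g_σ)_σ` of
`G(ℂ) = {(g_σ)_σ ∈ ∏_σ B^σ : nrd g_σ = 1}`. -/
def actG (ρC : DAlg ℂ a b →ₐ[ℂ] Matrix (Fin 8) (Fin 8) ℂ)
    (g : ∀ σ : K →+* ℂ, ℍ[ℂ,σ a,σ b]) :
    (Fin 8 → ℂ) ⊗[ℂ] (Fin 8 → ℂ) →ₗ[ℂ] (Fin 8 → ℂ) ⊗[ℂ] (Fin 8 → ℂ) :=
  act (ρC (PiTensorProduct.tprod ℂ g))

/-- `W ⊆ V ⊗ V` is a copy of `V_{K3}`: it is a subrepresentation of `G` and `W_ℂ` is isomorphic, as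
a representation of `G(ℂ) = ∏_σ SL₂(ℂ)`, to `⨁_σ Sym²(St_σ)` (that is,
`W_{2,0,0} ⊕ W_{0,2,0} ⊕ W_{0,0,2}`), where `St_σ = ℂ²` is the standard representation of the factor
indexed by `σ`, given by an isomorphism `θ σ : B^σ ≅ M₂(ℂ)`. -/
def IsVK3 (ρC : DAlg ℂ a b →ₐ[ℂ] Matrix (Fin 8) (Fin 8) ℂ)
    (W : Submodule ℚ ((Fin 8 → ℚ) ⊗[ℚ] (Fin 8 → ℚ))) : Prop :=
  (∀ g : ∀ σ : K →+* ℂ, ℍ[ℂ,σ a,σ b], (∀ σ, nrd (g σ) = 1) →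
    ∀ w ∈ complexSpan W, actG ρC g w ∈ complexSpan W) ∧
  ∃ (θ : ∀ σ : K →+* ℂ, ℍ[ℂ,σ a,σ b] ≃ₐ[ℂ] Matrix (Fin 2) (Fin 2) ℂ)
    (F : complexSpan W ≃ₗ[ℂ] ((K →+* ℂ) → symTensors ℂ 2)),
    ∀ g : ∀ σ : K →+* ℂ, ℍ[ℂ,σ a,σ b], (∀ σ, nrd (g σ) = 1) →
      ∀ w w' : complexSpan W, (w' : (Fin 8 → ℂ) ⊗[ℂ] (Fin 8 → ℂ)) = actG ρC g w →
        ∀ σ, (F w' σ : (Fin 2 → ℂ) ⊗[ℂ] (Fin 2 → ℂ)) = act (θ σ (g σ)) (F w σ)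

/-- `W` is stable under the group `G(ℚ)` of elements of reduced norm `1` of `B`. -/
def IsGStable (ρ : CorAlg a b ≃ₐ[ℚ] Matrix (Fin 8) (Fin 8) ℚ)
    (W : Submodule ℚ ((Fin 8 → ℚ) ⊗[ℚ] (Fin 8 → ℚ))) : Prop :=
  ∀ γ : ℍ[K,a,b], nrd γ = 1 → ∀ w ∈ W, act (ρ (NmCor γ)) w ∈ W

open scoped Classical in
/-- The element `h(e^{it})` of `G(ℝ) ⊆ G(ℂ)`: trivial at all embeddings except `σ₀`, and the rotation
by `t` at the real embedding `σ₀` where `B` is split by `θ₀`. -/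
def torus (σ₀ : K →+* ℝ) (θ₀ : ℍ[ℝ,σ₀ a,σ₀ b] ≃ₐ[ℝ] Matrix (Fin 2) (Fin 2) ℝ) (t : ℝ) :
    ∀ σ : K →+* ℂ, ℍ[ℂ,σ a,σ b] :=
  Pi.mulSingle (M := fun σ : K →+* ℂ => ℍ[ℂ,σ a,σ b]) (Complex.ofRealHom.comp σ₀)
    (qmap Complex.ofRealHom
      (θ₀.symm !![Real.cos t, Real.sin t; -Real.sin t, Real.cos t]))

/-- The part `W^{p,q}` of `W_ℂ` on which `h(e^{it})` acts by `e^{i(p-q)t}`. -/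
def hodgePiece (ρC : DAlg ℂ a b →ₐ[ℂ] Matrix (Fin 8) (Fin 8) ℂ) (σ₀ : K →+* ℝ)
    (θ₀ : ℍ[ℝ,σ₀ a,σ₀ b] ≃ₐ[ℝ] Matrix (Fin 2) (Fin 2) ℝ)
    (W : Submodule ℚ ((Fin 8 → ℚ) ⊗[ℚ] (Fin 8 → ℚ))) (p q : ℤ) :
    Submodule ℂ ((Fin 8 → ℂ) ⊗[ℂ] (Fin 8 → ℂ)) :=
  complexSpan W ⊓ ⨅ t : ℝ,
    LinearMap.ker (actG ρC (torus σ₀ θ₀ t) -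
      Complex.exp (Complex.I * ((p - q : ℤ) : ℂ) * (t : ℂ)) • LinearMap.id)

/-- `ψ` is a symplectic form on `V = ℚ⁸` that is invariant under `G`. -/
def IsInvariantSymplectic (ρ : CorAlg a b ≃ₐ[ℚ] Matrix (Fin 8) (Fin 8) ℚ)
    (ψ : LinearMap.BilinForm ℚ (Fin 8 → ℚ)) : Prop :=
  ψ.IsAlt ∧ ψ.Nondegenerate ∧ ∀ γ : ℍ[K,a,b], nrd γ = 1 → ∀ v w,
    ψ ((ρ (NmCor γ)).mulVec v) ((ρ (NmCor γ)).mulVec w) = ψ v w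

/-- The intersection form on `V ⊗ V` induced by a symplectic form `ψ` on `V`:
`(v ⊗ w, v' ⊗ w') ↦ -ψ(v, v') ψ(w, w')`.  Since `ψ ⊗ ψ` is a polarization up to
sign, the sign here is that of the intersection form of a K3 surface, with signature `(2, 7)` on
`V_{K3}`. -/
def intersectionForm (ψ : LinearMap.BilinForm ℚ (Fin 8 → ℚ)) :
    LinearMap.BilinForm ℚ ((Fin 8 → ℚ) ⊗[ℚ] (Fin 8 → ℚ)) :=
  -LinearMap.BilinForm.tmul ψ ψ

end Construction

end Mumford

end

open scoped Quaternion TensorProduct NumberField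

noncomputable section

namespace Mumford

/-! ### Polynomial curves in subspaces and independence of embeddings -/

/-! The quadratic space. Write tensors in `V ⊗ V` as 8 × 8 matrices. An invariant symplectic form
with Gram matrix `A` identifies `End V` with `V ⊗ V` by M ↦ M A⁻¹. Since g A⁻¹ gᵀ = A⁻¹ for g in G,
the diagonal action becomes conjugation; operators that are skew for the form become symmetric
tensors; and on symmetric tensors the form -ψ ⊗ ψ becomes tr(MN). The space V_{K3} is then the Lie
algebra of G inside `End V`: an element u of B⁰ acts through `corSum u` = ∑_σ 1 ⊗ ⋯ ⊗ u^σ ⊗ ⋯ ⊗ 1,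
the linear term of Nm(1 + tu), and is sent to ½ ρ(corSum u) A⁻¹ (`vEmb`). In the 8-dimensional
representation the trace of an element x of one factor B^σ is 4 trd x, and trace-zero parts of
different factors are orthogonal, so the form at u, v is ¼ · 4 · Tr_{K/ℚ} trd(uv) = Tr_{K/ℚ} Q_B(u,
v) (`intersectionForm_vEmb`). As Cor(B⁰) is B⁰ itself with the form Tr_{K/ℚ} ∘ Q_B
(`corDiag_bijective`, `corForm_corDiag`), this is the isometry.

Two devices carry statements between K, ℚ, ℚ̄ and ℂ. A polynomial curve that meets a subspace at
infinitely many rational points has its coefficients there, which allows differentiation of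
statements about norms; and linear independence of the embeddings K → L separates the summands of
`corSum`. Together they show that norms span ⨂_σ B^σ (`span_range_Nm`).

Uniqueness (`vk3_unique`): a vector in a copy of Sym²(St_σ), viewed as a matrix, commutes with every
B^τ for τ ≠ σ, hence lies in B^σ by a centralizer argument, and averaging shows that its trace is
zero. Irreducibility: a stable subspace is stable under brackets, and B⁰ has no proper nonzero
additive subgroup stable under all brackets. Hodge numbers: the circle has weights 0, 2, -2 on one
of the three copies of B⁰_ℂ and acts trivially on the other two. Existence of ψ: by Skolem–Noether
the involution ⨂ x_σ ↦ ⨂ x̄_σ is adjoint to a bilinear form, which is symmetric or alternating. With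
three factors, a tensor product of nilpotents is a skew element of rank one, which excludes the
symmetric case.

The lattice. At a finite place v the localization of a maximal order is maximal
(`IsMaximalOrder.isMaxLocalOrder`). Over the valuation ring R such an order contains e with trd(e)²
- 4 nrd(e) a unit, and equals S ⊕ Sj with S = R[e], where j is twisted by conjugation of S and nrd j
is a unit or a uniformizer, the latter only if S is inert (`IsMaxLocalOrder.exists_structure`). The
elements trd e - 2e, j, ej have Gram determinant -2 nrd(j)² (trd(e)² - 4 nrd(e))², and Hensel's
lemma shows that B ramifies at v exactly when nrd j is not a unit. This gives disc = 2𝔇² at every v.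

For the ℤ-lattice, take a pseudo-basis ⨁ I_i f_i. The trace form of such a lattice has determinant ∏
disc(I_i) · Norm(det Q(f_i, f_j)) (`det_trace_block`), with disc(I_i) = disc(K) N(I_i)². The norms
of the ideals combine with the determinant to N(2𝔇²) = 2³ N(𝔇)² up to sign. The sign is negative
because the determinant is -8 times a square and the degree is odd. -/

theorem mem_of_sum_pow_smul_mem {M : Type*} [AddCommGroup M] [Module ℚ M] (W : Submodule ℚ M)
    (n : ℕ) (y : ℕ → M) (S : Set ℚ) (hS : S.Infinite)
    (h : ∀ t ∈ S, ∑ i ∈ Finset.range n, t ^ i • y i ∈ W) : ∀ i < n, y i ∈ W := by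
  intro i hi
  by_contra hy
  -- A functional that vanishes on `W` but not on `y i` turns the curve into a nonzero polynomial
  -- with infinitely many roots.
  obtain ⟨l, hl, hW⟩ := Submodule.exists_le_ker_of_notMem hy
  let p : Polynomial ℚ := ∑ j ∈ Finset.range n, Polynomial.C (l (y j)) * Polynomial.X ^ j
  have hp : p = 0 := by
    apply Polynomial.eq_zero_of_infinite_isRoot
    refine hS.mono fun t ht => ?_
    have := hW (h t ht)
    rw [LinearMap.mem_ker, map_sum] at this
    simp only [Set.mem_ofPred_eq, Polynomial.IsRoot, p, Polynomial.eval_finsetSum]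
    rw [← this]
    refine Finset.sum_congr rfl fun j _ => ?_
    rw [map_smul, Polynomial.eval_mul, Polynomial.eval_C, Polynomial.eval_pow, Polynomial.eval_X,
      smul_eq_mul, mul_comm]
  have := congrArg (Polynomial.coeff · i) hp
  simp [p, Polynomial.coeff_C_mul, Polynomial.coeff_X_pow, hi] at this
  exact hl this

/-- The form needed for Cor(B), which is only a ℚ-subspace of a space over ℚ̄. -/
theorem mem_of_sum_ratCast_pow_smul_mem {L M : Type*} [Field L] [CharZero L] [AddCommGroup M]
    [Module L M] (W : AddSubgroup M) (hW : ∀ (q : ℚ), ∀ x ∈ W, (q : L) • x ∈ W) (n : ℕ) (y : ℕ → M)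
    (S : Set ℚ) (hS : S.Infinite) (h : ∀ t ∈ S, ∑ i ∈ Finset.range n, (t : L) ^ i • y i ∈ W) :
    ∀ i < n, y i ∈ W := by
  let : Module ℚ M := Module.compHom M (algebraMap ℚ L)
  have e : ∀ (q : ℚ) (x : M), q • x = (q : L) • x := fun q x => rfl
  refine mem_of_sum_pow_smul_mem
    { W with smul_mem' := fun q x hx => by rw [e]; exact hW q x hx } n y S hS fun t ht => ?_
  simp only [e, Rat.cast_pow]
  exact h t ht

/-- Dedekind's independence of characters: a functional that vanishes on `U` gives a linear relation
among the embeddings, so all its coefficients vanish. -/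
theorem mem_of_forall_sum_embeddings_smul_mem {K L : Type*} [Field K] [Field L]
    [Fintype (K →+* L)] {M : Type*} [AddCommGroup M] [Module L M] (U : Submodule L M)
    (x : (K →+* L) → M) (h : ∀ r : K, ∑ σ : K →+* L, σ r • x σ ∈ U) (σ : K →+* L) : x σ ∈ U := by
  by_contra hx
  obtain ⟨l, hl, hU⟩ := Submodule.exists_le_ker_of_notMem hx
  have hli : LinearIndependent L (fun σ : K →+* L => (σ : K → L)) :=
    (linearIndependent_monoidHom K L).comp (fun σ : K →+* L => (σ : K →* L))
      (fun _ _ h => RingHom.ext fun k => DFunLike.congr_fun h k)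
  refine hl ((Fintype.linearIndependent_iff.1 hli) (fun σ => l (x σ)) ?_ σ)
  funext r
  have := hU (h r)
  rw [LinearMap.mem_ker, map_sum] at this
  simp only [Finset.sum_apply, Pi.smul_apply, Pi.zero_apply, smul_eq_mul]
  rw [← this]
  exact Finset.sum_congr rfl fun σ _ => by simp [mul_comm]

/-! ### Quaternion identities -/

section Quat

variable {L : Type*} [Field L] {c d : L}

theorem trd_eq (x : ℍ[L,c,d]) : trd x = 2 * x.re := by
  simp [trd]; ring

theorem nrd_eq (x : ℍ[L,c,d]) :
    nrd x = x.re ^ 2 - c * x.imI ^ 2 - d * x.imJ ^ 2 + c * d * x.imK ^ 2 := by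
  simp [nrd]; ring

theorem mul_star_eq_nrd (x : ℍ[L,c,d]) : x * star x = algebraMap L _ (nrd x) := by
  rw [QuaternionAlgebra.coe_algebraMap]
  ext <;> simp only [QuaternionAlgebra.re_mul, QuaternionAlgebra.imI_mul, QuaternionAlgebra.imJ_mul,
    QuaternionAlgebra.imK_mul,
    QuaternionAlgebra.re_star, QuaternionAlgebra.imI_star, QuaternionAlgebra.imJ_star,
    QuaternionAlgebra.imK_star,
    QuaternionAlgebra.re_coe, QuaternionAlgebra.imI_coe, QuaternionAlgebra.imJ_coe,
    QuaternionAlgebra.imK_coe,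
    QuaternionAlgebra.re_add, QuaternionAlgebra.imI_add, QuaternionAlgebra.imJ_add,
    QuaternionAlgebra.imK_add,
     nrd_eq] <;> ring

theorem star_mul_eq_nrd (x : ℍ[L,c,d]) : star x * x = algebraMap L _ (nrd x) := by
  rw [QuaternionAlgebra.coe_algebraMap]
  ext <;> simp only [QuaternionAlgebra.re_mul, QuaternionAlgebra.imI_mul, QuaternionAlgebra.imJ_mul,
    QuaternionAlgebra.imK_mul,
    QuaternionAlgebra.re_star, QuaternionAlgebra.imI_star, QuaternionAlgebra.imJ_star,
    QuaternionAlgebra.imK_star,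
    QuaternionAlgebra.re_coe, QuaternionAlgebra.imI_coe, QuaternionAlgebra.imJ_coe,
    QuaternionAlgebra.imK_coe,
    QuaternionAlgebra.re_add, QuaternionAlgebra.imI_add, QuaternionAlgebra.imJ_add,
    QuaternionAlgebra.imK_add,
     nrd_eq] <;> ring

theorem add_star_eq_trd (x : ℍ[L,c,d]) : x + star x = algebraMap L _ (trd x) := by
  rw [QuaternionAlgebra.coe_algebraMap]
  ext <;> simp only [QuaternionAlgebra.re_star, QuaternionAlgebra.imI_star, QuaternionAlgebra.imJ_star,
    QuaternionAlgebra.imK_star,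
    QuaternionAlgebra.re_coe, QuaternionAlgebra.imI_coe, QuaternionAlgebra.imJ_coe,
    QuaternionAlgebra.imK_coe,
    QuaternionAlgebra.re_add, QuaternionAlgebra.imI_add, QuaternionAlgebra.imJ_add,
    QuaternionAlgebra.imK_add,
     trd_eq] <;> ring

theorem nrd_mul (x y : ℍ[L,c,d]) : nrd (x * y) = nrd x * nrd y := by
  simp only [nrd_eq, QuaternionAlgebra.re_mul, QuaternionAlgebra.imI_mul,
    QuaternionAlgebra.imJ_mul, QuaternionAlgebra.imK_mul]
  ring

theorem trd_mul_comm (x y : ℍ[L,c,d]) : trd (x * y) = trd (y * x) := by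
  simp only [trd_eq, QuaternionAlgebra.re_mul]; ring

@[simp] theorem nrd_one : nrd (1 : ℍ[L,c,d]) = 1 := by simp [nrd_eq]

@[simp] theorem nrd_smul (r : L) (x : ℍ[L,c,d]) : nrd (r • x) = r ^ 2 * nrd x := by
  simp [nrd_eq]; ring

theorem trd_add (x y : ℍ[L,c,d]) : trd (x + y) = trd x + trd y := by
  simp [trd_eq]; ring

theorem trd_smul (r : L) (x : ℍ[L,c,d]) : trd (r • x) = r * trd x := by
  simp [trd_eq]; ring

theorem star_eq_neg_of_trd_eq_zero {x : ℍ[L,c,d]} (h : trd x = 0) : star x = -x := by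
  have := add_star_eq_trd x
  rw [h, map_zero] at this
  exact (neg_eq_of_add_eq_zero_right this).symm

theorem nrd_qmap {L' : Type*} [Field L'] (f : L →+* L') {c' d' : L'} (hc : c' = f c)
    (hd : d' = f d) (x : ℍ[L,c,d]) : nrd (qmap f x : ℍ[L',c',d']) = f (nrd x) := by
  subst hc hd
  simp [nrd_eq, qmap]

theorem trd_qmap {L' : Type*} [Field L'] (f : L →+* L') {c' d' : L'}
    (x : ℍ[L,c,d]) : trd (qmap f x : ℍ[L',c',d']) = f (trd x) := by
  simp [trd_eq, qmap, map_ofNat]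

end Quat

/-! ### The norm map and its polarization -/

section Norm

open scoped Classical in
/-- The inclusion of the factor `B^σ` in `⨂_σ B^σ`. -/
def inc {K L : Type*} [Field K] [Field L] (a b : K) (σ : K →+* L) :
    ℍ[L,σ a,σ b] →ₐ[L] DAlg L a b :=
  PiTensorProduct.singleAlgHom (R := L) (A := fun σ : K →+* L => ℍ[L,σ a,σ b]) σ

variable {K : Type*} [Field K] [NumberField K] {L : Type*} [Field L] [CharZero L] {a b : K}

open scoped Classical in
theorem inc_apply (σ : K →+* L) (x : ℍ[L,σ a,σ b]) :
    inc a b σ x = PiTensorProduct.tprod L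
      (Pi.mulSingle (M := fun σ : K →+* L => ℍ[L,σ a,σ b]) σ x) := rfl

theorem inc_commute {σ τ : K →+* L} (h : σ ≠ τ) (x : ℍ[L,σ a,σ b]) (y : ℍ[L,τ a,τ b]) :
    Commute (inc a b σ x) (inc a b τ y) := by
  classical
  rw [inc_apply, inc_apply]
  have := Pi.mulSingle_commute (f := fun σ : K →+* L => ℍ[L,σ a,σ b]) h x y
  rw [commute_iff_eq, PiTensorProduct.tprod_mul_tprod, PiTensorProduct.tprod_mul_tprod]
  exact congrArg _ this

theorem tprod_mul_inc (g : ∀ σ : K →+* L, ℍ[L,σ a,σ b]) (σ : K →+* L) (x x' : ℍ[L,σ a,σ b])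
    (h : g σ * x = x' * g σ) :
    PiTensorProduct.tprod L g * inc a b σ x = inc a b σ x' * PiTensorProduct.tprod L g := by
  classical
  rw [inc_apply, inc_apply, PiTensorProduct.tprod_mul_tprod, PiTensorProduct.tprod_mul_tprod]
  congr 1
  funext τ
  rcases eq_or_ne τ σ with rfl | hτ
  · simpa using h
  · simp [Pi.mulSingle_eq_of_ne hτ]

theorem Nm_mul (γ δ : ℍ[K,a,b]) : Nm L (γ * δ) = Nm L γ * Nm L δ := by
  rw [Nm, Nm, Nm, PiTensorProduct.tprod_mul_tprod]
  congr 1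
  funext σ
  exact qmap_mul σ rfl rfl γ δ

theorem Nm_one : Nm L (1 : ℍ[K,a,b]) = 1 := by
  rw [Nm, PiTensorProduct.one_def]
  congr 1
  funext σ
  exact qmap_one σ

theorem Nm_smul (r : K) (γ : ℍ[K,a,b]) : Nm L (r • γ) = (∏ σ : K →+* L, σ r) • Nm L γ := by
  rw [Nm, Nm, ← MultilinearMap.map_smul_univ]
  congr 1
  funext σ
  exact qmap_smul σ r γ

open scoped Classical in
/-- The part of `Nm (1 + u)` that is homogeneous of degree `k` in `u`. -/
def nmCoeff (L : Type*) [Field L] [CharZero L] (u : ℍ[K,a,b]) (k : ℕ) : DAlg L a b :=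
  ∑ s ∈ Finset.powersetCard k (Finset.univ : Finset (K →+* L)),
    PiTensorProduct.tprod L (s.piecewise (fun σ : K →+* L => (qmap σ u : ℍ[L,σ a,σ b])) 1)

/-- The element `∑_σ 1 ⊗ ⋯ ⊗ u^σ ⊗ ⋯ ⊗ 1` of `⨂_σ B^σ`. -/
def corSum (L : Type*) [Field L] [CharZero L] (u : ℍ[K,a,b]) : DAlg L a b :=
  ∑ σ : K →+* L, inc a b σ (qmap σ u)

theorem nmCoeff_zero (u : ℍ[K,a,b]) : nmCoeff L u 0 = 1 := by
  simp [nmCoeff, PiTensorProduct.one_def]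

theorem nmCoeff_one (u : ℍ[K,a,b]) : nmCoeff L u 1 = corSum L u := by
  classical
  rw [nmCoeff, Finset.powersetCard_one, Finset.sum_map, corSum]
  refine Finset.sum_congr rfl fun σ _ => ?_
  rw [inc_apply]
  congr 1
  funext τ
  rcases eq_or_ne τ σ with rfl | hτ
  · simp
  · simp [hτ]

/-- Expand the tensor multilinearly over subsets of embeddings and group by cardinality; a rational
t is fixed by every embedding, so it leaves the tensor as a power of t. -/
theorem Nm_one_add_smul (u : ℍ[K,a,b]) (t : ℚ) :
    Nm L (1 + (t : K) • u) =
      ∑ k ∈ Finset.range (Fintype.card (K →+* L) + 1), (t : L) ^ k • nmCoeff L u k := by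
  classical
  have h : (fun σ : K →+* L => (qmap σ (1 + (t : K) • u) : ℍ[L,σ a,σ b])) =
      (fun σ : K →+* L => (t : L) • (qmap σ u : ℍ[L,σ a,σ b])) + 1 := by
    funext σ
    rw [qmap_add, qmap_one, qmap_smul, add_comm, map_ratCast]
    rfl
  have key : ∀ s : Finset (K →+* L), PiTensorProduct.tprod L (s.piecewise
      (fun σ : K →+* L => (t : L) • (qmap σ u : ℍ[L,σ a,σ b])) 1) = (t : L) ^ s.card •
      PiTensorProduct.tprod L (s.piecewise (fun σ : K →+* L => (qmap σ u : ℍ[L,σ a,σ b])) 1) := by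
    intro s
    have := MultilinearMap.map_piecewise_smul (PiTensorProduct.tprod L)
      (fun _ : K →+* L => (t : L))
      (s.piecewise (fun σ : K →+* L => (qmap σ u : ℍ[L,σ a,σ b])) 1) s
    rw [Finset.prod_const] at this
    rw [← this]
    congr 1
    funext σ
    by_cases hσ : σ ∈ s <;> simp [hσ]
  rw [Nm, h, MultilinearMap.map_add_univ, ← Finset.powerset_univ, Finset.sum_powerset,
    Finset.card_univ]
  refine Finset.sum_congr rfl fun k _ => ?_
  rw [nmCoeff, Finset.smul_sum]
  refine Finset.sum_congr rfl fun s hs => ?_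
  rw [key, (Finset.mem_powersetCard.1 hs).2]

/-- Differentiation of the curve Nm(1 + tu) at t = 0. -/
theorem corSum_mem_of_forall_Nm_mem (W : AddSubgroup (DAlg L a b))
    (hW : ∀ (q : ℚ), ∀ x ∈ W, (q : L) • x ∈ W)
    (h : ∀ γ : ℍ[K,a,b], Nm L γ ∈ W) (u : ℍ[K,a,b]) : corSum L u ∈ W := by
  rcases Nat.eq_zero_or_pos (Fintype.card (K →+* L)) with hc | hc
  · have : IsEmpty (K →+* L) := Fintype.card_eq_zero_iff.1 hc
    simp [corSum]
  · rw [← nmCoeff_one]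
    refine mem_of_sum_ratCast_pow_smul_mem W hW _ (nmCoeff L u) Set.univ Set.infinite_univ
      (fun t _ => ?_) 1 (Nat.lt_add_of_pos_left hc)
    rw [← Nm_one_add_smul]
    exact h _

theorem qmap_span (σ : K →+* L) (U : Submodule L ℍ[L,σ a,σ b])
    (h : ∀ u : ℍ[K,a,b], qmap σ u ∈ U) (x : ℍ[L,σ a,σ b]) : x ∈ U := by
  have e : x = x.re • (qmap σ (⟨1, 0, 0, 0⟩ : ℍ[K,a,b]) : ℍ[L,σ a,σ b]) +
      x.imI • (qmap σ (⟨0, 1, 0, 0⟩ : ℍ[K,a,b]) : ℍ[L,σ a,σ b]) +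
      x.imJ • (qmap σ (⟨0, 0, 1, 0⟩ : ℍ[K,a,b]) : ℍ[L,σ a,σ b]) +
      x.imK • (qmap σ (⟨0, 0, 0, 1⟩ : ℍ[K,a,b]) : ℍ[L,σ a,σ b]) := by
    ext <;> simp [qmap]
  rw [e]
  exact U.add_mem (U.add_mem (U.add_mem (U.smul_mem _ (h _)) (U.smul_mem _ (h _)))
    (U.smul_mem _ (h _))) (U.smul_mem _ (h _))

theorem subalgebra_eq_top_of_inc_mem (S : Subalgebra L (DAlg L a b))
    (h : ∀ (σ : K →+* L) (x : ℍ[L,σ a,σ b]), inc a b σ x ∈ S) : S = ⊤ := by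
  classical
  rw [eq_top_iff]
  intro x _
  have key : ∀ (s : Finset (K →+* L)) (g : ∀ σ : K →+* L, ℍ[L,σ a,σ b]),
      PiTensorProduct.tprod L (s.piecewise g 1) ∈ S := by
    intro s g
    induction s using Finset.induction_on with
    | empty => rw [Finset.piecewise_empty]; exact S.one_mem
    | insert σ s hσ ih =>
      have : PiTensorProduct.tprod L ((insert σ s).piecewise g 1) =
          inc a b σ (g σ) * PiTensorProduct.tprod L (s.piecewise g 1) := by
        rw [inc_apply, PiTensorProduct.tprod_mul_tprod]
        congr 1
        funext τ
        rcases eq_or_ne τ σ with rfl | hτ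
        · simp [hσ]
        · by_cases hs : τ ∈ s <;> simp [hs, hτ]
      rw [this]
      exact S.mul_mem (h σ _) ih
  induction x using PiTensorProduct.induction_on with
  | smul_tprod r g => exact S.smul_mem (by simpa using key Finset.univ g) r
  | add x y hx hy => exact S.add_mem (hx trivial) (hy trivial)

/-- Replacing u by ru with r in K multiplies the summand at σ by σ(r), so independence of the
embeddings isolates each summand. -/
theorem inc_mem_of_corSum_mem (U : Submodule L (DAlg L a b)) (S : Submodule K ℍ[K,a,b])
    (h : ∀ u ∈ S, corSum L u ∈ U) (σ : K →+* L) (u : ℍ[K,a,b]) (hu : u ∈ S) :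
    inc a b σ (qmap σ u) ∈ U := by
  refine mem_of_forall_sum_embeddings_smul_mem U
    (fun σ : K →+* L => inc a b σ (qmap σ u)) (fun r => ?_) σ
  have := h (r • u) (S.smul_mem r hu)
  rw [corSum] at this
  simpa only [qmap_smul, map_smul] using this

/-- The span is a subalgebra because the norm is multiplicative. It contains the derivatives `corSum
u`, hence each u^σ in its own factor, hence every factor B^σ, and these generate. -/
theorem span_range_Nm : Submodule.span L (Set.range (Nm L : ℍ[K,a,b] → DAlg L a b)) = ⊤ := by
  let S : Subalgebra L (DAlg L a b) :=
    Submodule.toSubalgebra (Submodule.span L (Set.range (Nm L : ℍ[K,a,b] → DAlg L a b)))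
      (Submodule.subset_span ⟨1, Nm_one⟩)
      (fun x y hx hy => by
        have := Submodule.mul_mem_mul hx hy
        rw [Submodule.span_mul_span] at this
        refine Submodule.span_mono ?_ this
        rintro _ ⟨_, ⟨γ, rfl⟩, _, ⟨δ, rfl⟩, rfl⟩
        exact ⟨γ * δ, Nm_mul γ δ⟩)
  have hS : S = ⊤ := by
    refine subalgebra_eq_top_of_inc_mem S fun σ => ?_
    have hc : ∀ u : ℍ[K,a,b], corSum L u ∈ Subalgebra.toSubmodule S := fun u =>
      corSum_mem_of_forall_Nm_mem (Subalgebra.toSubmodule S).toAddSubgroup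
        (fun q x hx => S.smul_mem hx _) (fun γ => Submodule.subset_span ⟨γ, rfl⟩) u
    exact qmap_span σ ((Subalgebra.toSubmodule S).comap (inc a b σ).toLinearMap)
      (fun u => inc_mem_of_corSum_mem (Subalgebra.toSubmodule S) ⊤ (fun u _ => hc u) σ u trivial)
  rw [eq_top_iff]
  intro x _
  have : x ∈ S := hS ▸ trivial
  exact this

end Norm

/-! ### Extension of scalars of representations of the corestriction -/

section Extension

theorem galD_smul {K L : Type*} [Field K] [Field L] {a b : K} (τ : L ≃+* L) (r : L)
    (x : DAlg L a b) : galD τ (r • x) = τ r • galD τ x := by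
  induction x using PiTensorProduct.induction_on with
  | smul_tprod s g => rw [smul_smul, galD_smul_tprod, galD_smul_tprod, map_mul, mul_smul]
  | add x y hx hy => rw [smul_add, map_add, hx, hy, map_add, smul_add]

variable {K : Type*} [Field K] [NumberField K] {a b : K}

instance {L : Type*} [Field L] [CharZero L] : Module.Finite L (DAlg L a b) := by
  have : ∀ σ : K →+* L, Module.Finite L ℍ[L,σ a,σ b] := fun σ =>
    Module.Finite.of_basis (QuaternionAlgebra.basisOneIJK (σ a) 0 (σ b))
  exact Module.Finite.of_basis
    (Basis.piTensorProduct fun σ : K →+* L => QuaternionAlgebra.basisOneIJK (σ a) 0 (σ b))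

instance : IsAlgClosure ℚ (AlgebraicClosure ℚ) where
  isAlgClosed := inferInstance
  isAlgebraic := by
    have h := AlgebraicClosure.isAlgebraic ℚ
    rwa [Subsingleton.elim (AlgebraicClosure.instAlgebra ℚ) DivisionRing.toRatAlgebra] at h

instance : Algebra.IsAlgebraic ℚ (AlgebraicClosure ℚ) := IsAlgClosure.isAlgebraic

instance : IsGalois ℚ (AlgebraicClosure ℚ) where
  to_normal := IsAlgClosure.normal ℚ _

theorem exists_ratCast_eq_of_fixed (c : AlgebraicClosure ℚ)
    (h : ∀ τ : AlgebraicClosure ℚ ≃ₐ[ℚ] AlgebraicClosure ℚ, τ c = c) :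
    ∃ q : ℚ, (q : AlgebraicClosure ℚ) = c := by
  obtain ⟨q, hq⟩ := (InfiniteGalois.mem_range_algebraMap_iff_fixed c).2 h
  exact ⟨q, by rw [← hq, eq_ratCast]⟩

/-- Galois descent: in a basis of fixed vectors, a fixed element has fixed coordinates, and these
are rational. -/
theorem exists_rat_repr_of_mem_CorAlg {ι : Type*} [Fintype ι]
    (β : Module.Basis ι (AlgebraicClosure ℚ) (DAlg (AlgebraicClosure ℚ) a b))
    (hβ : ∀ i, β i ∈ CorAlg a b) (x : CorAlg a b) :
    ∃ q : ι → ℚ, x = ∑ i, q i • (⟨β i, hβ i⟩ : CorAlg a b) := by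
  have key : ∀ i, ∃ q : ℚ, (q : AlgebraicClosure ℚ) = β.repr x i := by
    intro i
    refine exists_ratCast_eq_of_fixed _ fun τ => ?_
    have h1 := x.2 τ
    have h2 : galD τ.toRingEquiv (x : DAlg (AlgebraicClosure ℚ) a b) =
        ∑ i, τ (β.repr x i) • β i := by
      conv_lhs => rw [← β.sum_repr x]
      rw [map_sum]
      exact Finset.sum_congr rfl fun i _ => by rw [galD_smul, hβ i τ]; rfl
    rw [h1] at h2
    have := congrArg (fun y => β.repr y i) h2
    simp only [β.repr_sum_self] at this
    exact this.symm
  choose q hq using key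
  refine ⟨q, Subtype.ext ?_⟩
  conv_lhs => rw [← β.sum_repr x]
  rw [AddSubmonoidClass.coe_finsetSum]
  refine Finset.sum_congr rfl fun i _ => ?_
  rw [← hq]
  exact Rat.cast_smul_eq_qsmul _ (q i) (β i)

theorem DAlg_smul_mul {L : Type*} [Field L] (r : L) (x y : DAlg L a b) :
    (r • x) * y = r • (x * y) := Algebra.smul_mul_assoc r x y

theorem DAlg_mul_smul {L : Type*} [Field L] (r : L) (x y : DAlg L a b) :
    x * (r • y) = r • (x * y) := Algebra.mul_smul_comm r x y

theorem map_mul_of_map_Nm_mul {L : Type*} [Field L] [CharZero L] {A : Type*} [Ring A] [Algebra L A]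
    (f : DAlg L a b →ₗ[L] A)
    (hf : ∀ γ δ : ℍ[K,a,b], f (Nm L γ * Nm L δ) = f (Nm L γ) * f (Nm L δ)) (x y : DAlg L a b) :
    f (x * y) = f x * f y := by
  have hx : x ∈ Submodule.span L (Set.range (Nm L : ℍ[K,a,b] → DAlg L a b)) :=
    span_range_Nm (K := K) (L := L) (a := a) (b := b) ▸ Submodule.mem_top
  have hy : y ∈ Submodule.span L (Set.range (Nm L : ℍ[K,a,b] → DAlg L a b)) :=
    span_range_Nm (K := K) (L := L) (a := a) (b := b) ▸ Submodule.mem_top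
  induction hx using Submodule.span_induction with
  | mem x hx =>
    obtain ⟨γ, rfl⟩ := hx
    induction hy using Submodule.span_induction with
    | mem y hy => obtain ⟨δ, rfl⟩ := hy; exact hf γ δ
    | zero => simp
    | add x y _ _ hx hy => rw [mul_add, map_add, map_add, hx, hy, mul_add]
    | smul r x _ hx => rw [DAlg_mul_smul, map_smul, map_smul, hx, mul_smul_comm]
  | zero => simp
  | add x y _ _ hx hy => rw [add_mul, map_add, map_add, hx, hy, add_mul]
  | smul r x _ hx => rw [DAlg_smul_mul, map_smul, map_smul, hx, smul_mul_assoc]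

/-- Choose a basis of ⨂ B^σ consisting of norms. It also gives rational coordinates on Cor(B), so
the extension can be prescribed on it; multiplicativity has to be checked only on norms, where it
holds for ρ. -/
theorem exists_algClosure_extension {n : ℕ} (ρ : CorAlg a b →ₐ[ℚ] Matrix (Fin n) (Fin n) ℚ) :
    ∃ ρ' : DAlg (AlgebraicClosure ℚ) a b →ₐ[AlgebraicClosure ℚ]
      Matrix (Fin n) (Fin n) (AlgebraicClosure ℚ),
      ∀ x : CorAlg a b, ρ' x = (ρ x).map (algebraMap ℚ (AlgebraicClosure ℚ)) := by
  let β := Module.Basis.ofSpan (span_range_Nm (K := K) (L := AlgebraicClosure ℚ)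
    (a := a) (b := b)).ge
  have := Module.Finite.finite_basis β
  have := Fintype.ofFinite ((linearIndepOn_empty (AlgebraicClosure ℚ) id).extend
    (Set.empty_subset (Set.range (Nm (AlgebraicClosure ℚ) : ℍ[K,a,b] → _))))
  have hβ : ∀ i, β i ∈ CorAlg a b := by
    intro i
    obtain ⟨γ, hγ⟩ := Module.Basis.ofSpan_subset (span_range_Nm (K := K)
      (L := AlgebraicClosure ℚ) (a := a) (b := b)).ge ⟨i, rfl⟩
    exact hγ ▸ (NmCor γ).2
  let m : Matrix (Fin n) (Fin n) ℚ →ₐ[ℚ] Matrix (Fin n) (Fin n) (AlgebraicClosure ℚ) :=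
    (Algebra.ofId ℚ (AlgebraicClosure ℚ)).mapMatrix
  let f := β.constr (AlgebraicClosure ℚ) fun i => m (ρ ⟨β i, hβ i⟩)
  have hf : ∀ x : CorAlg a b, f x = m (ρ x) := by
    intro x
    obtain ⟨q, hq⟩ := exists_rat_repr_of_mem_CorAlg β hβ x
    have h1 : (x : DAlg (AlgebraicClosure ℚ) a b) =
        ∑ i, (q i : AlgebraicClosure ℚ) • β i := by
      conv_lhs => rw [hq, AddSubmonoidClass.coe_finsetSum]
      exact Finset.sum_congr rfl fun i _ => (Rat.cast_smul_eq_qsmul _ (q i) (β i)).symm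
    rw [h1, map_sum, hq, map_sum, map_sum]
    refine Finset.sum_congr rfl fun i _ => ?_
    rw [map_smul, map_smul, map_smul, Rat.cast_smul_eq_qsmul, Module.Basis.constr_basis]
  refine ⟨AlgHom.ofLinearMap f ?_ ?_, fun x => hf x⟩
  · have := hf 1
    rwa [map_one, map_one] at this
  · refine map_mul_of_map_Nm_mul f fun γ δ => ?_
    have h3 := hf (NmCor γ * NmCor δ)
    rw [map_mul, map_mul, ← hf, ← hf] at h3
    exact h3

/-- Composition with ι is injective on embeddings, and K has equally many embeddings into ℚ̄ and
into ℂ. -/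
theorem exists_comp_eq (ι : AlgebraicClosure ℚ →+* ℂ) :
    ∃ s : (K →+* ℂ) ≃ (K →+* AlgebraicClosure ℚ), ∀ σ, ι.comp (s σ) = σ := by
  have hb : Function.Bijective fun σ : K →+* AlgebraicClosure ℚ => ι.comp σ := by
    rw [Fintype.bijective_iff_injective_and_card]
    refine ⟨fun σ τ h => RingHom.ext fun k => ι.injective (DFunLike.congr_fun h k), ?_⟩
    rw [NumberField.Embeddings.card, NumberField.Embeddings.card]
  exact ⟨(Equiv.ofBijective _ hb).symm, (Equiv.ofBijective _ hb).apply_symm_apply⟩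

/-- The homomorphism from a quaternion algebra over `L'` to a matrix algebra obtained from a
homomorphism over `L` by extension of scalars along `f : L → L'`. -/
def quatExtend {L L' : Type*} [Field L] [Field L'] (f : L →+* L') {c d : L} {c' d' : L'}
    (hc : c' = f c) (hd : d' = f d) {n : ℕ} (h : ℍ[L,c,d] →ₐ[L] Matrix (Fin n) (Fin n) L) :
    ℍ[L',c',d'] →ₐ[L'] Matrix (Fin n) (Fin n) L' :=
  QuaternionAlgebra.Basis.liftHom
    { i := (h ⟨0, 1, 0, 0⟩).map f
      j := (h ⟨0, 0, 1, 0⟩).map f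
      k := (h ⟨0, 0, 0, 1⟩).map f
      i_mul_i := by
        have : (⟨0, 1, 0, 0⟩ * ⟨0, 1, 0, 0⟩ : ℍ[L,c,d]) = c • 1 := by ext <;> simp
        rw [← Matrix.map_mul, ← map_mul, this, map_smul, map_one, hc]
        ext i j; simp [Matrix.one_apply, apply_ite f]
      j_mul_j := by
        have : (⟨0, 0, 1, 0⟩ * ⟨0, 0, 1, 0⟩ : ℍ[L,c,d]) = d • 1 := by ext <;> simp
        rw [← Matrix.map_mul, ← map_mul, this, map_smul, map_one, hd]
        ext i j; simp [Matrix.one_apply, apply_ite f]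
      i_mul_j := by
        rw [← Matrix.map_mul, ← map_mul]
        congr 2
        ext <;> simp
      j_mul_i := by
        have : (⟨0, 0, 1, 0⟩ * ⟨0, 1, 0, 0⟩ : ℍ[L,c,d]) = -⟨0, 0, 0, 1⟩ := by ext <;> simp
        rw [← Matrix.map_mul, ← map_mul, this, map_neg]
        ext i j; simp }

theorem quatExtend_qmap {L L' : Type*} [Field L] [Field L'] (f : L →+* L') {c d : L} {c' d' : L'}
    (hc : c' = f c) (hd : d' = f d) {n : ℕ} (h : ℍ[L,c,d] →ₐ[L] Matrix (Fin n) (Fin n) L)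
    (x : ℍ[L,c,d]) : quatExtend f hc hd h (qmap f x) = (h x).map f := by
  have e : x = x.re • 1 + x.imI • ⟨0, 1, 0, 0⟩ + x.imJ • ⟨0, 0, 1, 0⟩ + x.imK • ⟨0, 0, 0, 1⟩ := by
    ext <;> simp
  conv_rhs => rw [e]
  simp only [map_add, map_smul, map_one]
  ext i j
  simp [quatExtend, qmap, QuaternionAlgebra.Basis.lift, Matrix.one_apply, apply_ite f,
    Algebra.algebraMap_eq_smul_one]

theorem quatExtend_commute {L L' : Type*} [Field L] [Field L'] (f : L →+* L') {c d e g : L}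
    {c' d' e' g' : L'} (hc : c' = f c) (hd : d' = f d) (he : e' = f e) (hg : g' = f g) {n : ℕ}
    (h : ℍ[L,c,d] →ₐ[L] Matrix (Fin n) (Fin n) L) (k : ℍ[L,e,g] →ₐ[L] Matrix (Fin n) (Fin n) L)
    (hk : ∀ x y, Commute (h x) (k y)) (x : ℍ[L',c',d']) (y : ℍ[L',e',g']) :
    Commute (quatExtend f hc hd h x) (quatExtend f he hg k y) := by
  have hm : ∀ x y, Commute ((h x).map f) ((k y).map f) := fun x y => by
    rw [commute_iff_eq, ← Matrix.map_mul, ← Matrix.map_mul, (hk x y).eq]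
  simp only [quatExtend, QuaternionAlgebra.Basis.liftHom_apply, QuaternionAlgebra.Basis.lift]
  refine Commute.add_left (Commute.add_left (Commute.add_left ?_ ?_) ?_) ?_
  · exact Algebra.commutes _ _
  all_goals
    refine Commute.smul_left (Commute.add_right (Commute.add_right (Commute.add_right ?_ ?_) ?_) ?_) _
    · exact (Algebra.commutes _ _).symm
    all_goals exact (hm _ _).smul_right _

/-- The algebra homomorphism from a tensor product of algebras given by commuting homomorphisms of
the factors. -/
def piTensorLift {ι : Type*} [Fintype ι] [DecidableEq ι] {R : Type*} [CommRing R]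
    {A : ι → Type*} [∀ i, Ring (A i)] [∀ i, Algebra R (A i)] {S : Type*} [Ring S] [Algebra R S]
    (h : ∀ i, A i →ₐ[R] S) (hc : Pairwise fun i j => ∀ x y, Commute (h i x) (h j y)) :
    (⨂[R] i, A i) →ₐ[R] S :=
  let φ := MonoidHom.noncommPiCoprod (fun i => ((h i : A i →ₐ[R] S) : A i →* S)) hc
  -- As the images commute, the i-th entry can be pulled out as a left factor; linearity in that
  -- entry then follows from linearity of `h i`.
  have key : ∀ (m : ∀ i, A i) (i : ι) (x : A i),
      φ (Function.update m i x) = h i x * φ (Function.update m i 1) := fun m i x => by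
    have : Function.update m i x = Pi.mulSingle i x * Function.update m i 1 := by
      funext j
      rcases eq_or_ne j i with rfl | hj
      · simp
      · simp [hj]
    rw [this, map_mul]
    exact congrArg (· * _) (MonoidHom.noncommPiCoprod_mulSingle _ i x)
  PiTensorProduct.liftAlgHom
    { toFun := φ
      map_update_add' := fun {D} m i x y => by
        rw [Subsingleton.elim D]
        rw [key, key m i x, key m i y, map_add, add_mul]
      map_update_smul' := fun {D} m i c x => by
        rw [Subsingleton.elim D]
        rw [key, key m i x, map_smul, smul_mul_assoc] }
    (map_one φ) (map_mul φ)

theorem piTensorLift_tprod {ι : Type*} [Fintype ι] [DecidableEq ι] {R : Type*} [CommRing R]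
    {A : ι → Type*} [∀ i, Ring (A i)] [∀ i, Algebra R (A i)] {S : Type*} [Ring S] [Algebra R S]
    (h : ∀ i, A i →ₐ[R] S) (hc : Pairwise fun i j => ∀ x y, Commute (h i x) (h j y))
    (x : ∀ i, A i) : piTensorLift h hc (PiTensorProduct.tprod R x) =
      MonoidHom.noncommPiCoprod (fun i => ((h i : A i →ₐ[R] S) : A i →* S)) hc x := by
  simp [piTensorLift]

/-- Each factor B^σ over ℂ is the scalar extension along ι of the corresponding factor over ℚ̄. The
homomorphism is extended on each factor separately, and the extensions are glued because they still
commute. -/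
theorem exists_complex_extension {n : ℕ} (ρ' : DAlg (AlgebraicClosure ℚ) a b →ₐ[AlgebraicClosure ℚ]
    Matrix (Fin n) (Fin n) (AlgebraicClosure ℚ)) (ι : AlgebraicClosure ℚ →+* ℂ) :
    ∃ ρC : DAlg ℂ a b →ₐ[ℂ] Matrix (Fin n) (Fin n) ℂ, ∀ γ : ℍ[K,a,b],
      ρC (Nm ℂ γ) = (ρ' (Nm _ γ)).map ι := by
  classical
  obtain ⟨s, hs⟩ := exists_comp_eq (K := K) ι
  have hs' : ∀ (σ : K →+* ℂ) (k : K), σ k = ι (s σ k) := fun σ k =>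
    (DFunLike.congr_fun (hs σ) k).symm
  obtain ⟨h, hh⟩ : ∃ h : ∀ σ : K →+* ℂ, ℍ[ℂ,σ a,σ b] →ₐ[ℂ] Matrix (Fin n) (Fin n) ℂ,
      ∀ σ, h σ = quatExtend ι (hs' σ a) (hs' σ b) (ρ'.comp (inc a b (s σ))) := ⟨_, fun _ => rfl⟩
  have hc : Pairwise fun σ τ => ∀ x y, Commute (h σ x) (h τ y) := fun σ τ hστ x y => by
    rw [hh, hh]
    refine quatExtend_commute ι (hs' σ a) (hs' σ b) (hs' τ a) (hs' τ b) _ _ (fun x y => ?_) x y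
    rw [commute_iff_eq, AlgHom.comp_apply, AlgHom.comp_apply, ← map_mul, ← map_mul,
      (inc_commute (s.injective.ne hστ) x y).eq]
  refine ⟨piTensorLift h hc, fun γ => ?_⟩
  let P : (∀ σ : K →+* AlgebraicClosure ℚ, ℍ[AlgebraicClosure ℚ,σ a,σ b]) →*
      (∀ σ : K →+* ℂ, ℍ[ℂ,σ a,σ b]) :=
    { toFun := fun x σ => qmap ι (x (s σ))
      map_one' := by funext σ; exact qmap_one ι
      map_mul' := fun x y => by funext σ; exact qmap_mul ι (hs' σ a) (hs' σ b) _ _ }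
  have hPa : ∀ x σ, P x σ = qmap ι (x (s σ)) := fun _ _ => rfl
  let R : (∀ σ : K →+* AlgebraicClosure ℚ, ℍ[AlgebraicClosure ℚ,σ a,σ b]) →*
      Matrix (Fin n) (Fin n) ℂ :=
    { toFun := fun x => (ρ' (PiTensorProduct.tprod _ x)).map ι
      map_one' := by
        rw [← PiTensorProduct.one_def, map_one]
        exact Matrix.map_one _ (map_zero ι) (map_one ι)
      map_mul' := fun x y => by
        rw [← PiTensorProduct.tprod_mul_tprod, map_mul, Matrix.map_mul] }
  have hRa : ∀ x, R x = (ρ' (PiTensorProduct.tprod _ x)).map ι := fun _ => rfl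
  have hP : ∀ (σ : K →+* ℂ) (u : ℍ[AlgebraicClosure ℚ,s σ a,s σ b]),
      P (Pi.mulSingle (s σ) u) = Pi.mulSingle σ (qmap ι u) := by
    intro σ u
    funext τ
    rw [hPa]
    rcases eq_or_ne τ σ with rfl | hτ
    · rw [Pi.mulSingle_eq_same, Pi.mulSingle_eq_same]
    · rw [Pi.mulSingle_eq_of_ne hτ, Pi.mulSingle_eq_of_ne (s.injective.ne hτ), qmap_one]
  -- Both sides are multiplicative on the product of the factors, so it is enough to compare them on
  -- a single factor.
  have key : (MonoidHom.noncommPiCoprod (fun i => ((h i : _ →ₐ[ℂ] _) : _ →* _)) hc).comp P = R := by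
    refine MonoidHom.pi_ext fun σ' u => ?_
    obtain ⟨σ, rfl⟩ := s.surjective σ'
    rw [MonoidHom.comp_apply, hP, hRa]
    refine (MonoidHom.noncommPiCoprod_mulSingle _ σ _).trans ?_
    change h σ (qmap ι u) = _
    rw [hh, quatExtend_qmap ι (hs' σ a) (hs' σ b) (ρ'.comp (inc a b (s σ))) u]
    rfl
  have := DFunLike.congr_fun key fun σ => qmap σ γ
  have hPγ : P (fun σ => qmap σ γ) = fun σ : K →+* ℂ => (qmap σ γ : ℍ[ℂ,σ a,σ b]) := by
    funext σ
    rw [hPa]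
    ext <;> simp [qmap, hs']
  rw [MonoidHom.comp_apply, hPγ, hRa] at this
  rw [Nm, piTensorLift_tprod, this]
  rfl

theorem exists_isComplexification (ρ : CorAlg a b ≃ₐ[ℚ] Matrix (Fin 8) (Fin 8) ℚ) :
    ∃ ρC, IsComplexification ρ ρC := by
  obtain ⟨ρ', hρ'⟩ := exists_algClosure_extension ρ.toAlgHom
  obtain ⟨ρC, hρC⟩ := exists_complex_extension ρ' (IsAlgClosed.lift : AlgebraicClosure ℚ →ₐ[ℚ] ℂ)
  refine ⟨ρC, fun γ => ?_⟩
  have := hρ' (NmCor γ)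
  rw [hρC]
  refine (congrArg (fun M => Matrix.map M _) this).trans ?_
  rw [Matrix.map_map]
  ext i j
  simp

theorem IsComplexification.unique {ρ : CorAlg a b ≃ₐ[ℚ] Matrix (Fin 8) (Fin 8) ℚ}
    {ρ₁ ρ₂ : DAlg ℂ a b →ₐ[ℂ] Matrix (Fin 8) (Fin 8) ℂ} (h₁ : IsComplexification ρ ρ₁)
    (h₂ : IsComplexification ρ ρ₂) : ρ₁ = ρ₂ := by
  refine AlgHom.toLinearMap_injective (LinearMap.ext_on_range (v := (Nm ℂ : ℍ[K,a,b] → _))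
    span_range_Nm fun γ => ?_)
  exact (h₁ γ).trans (h₂ γ).symm

end Extension

/-! ### Tensors as matrices -/

section TensorMat

variable (F : Type*) [Field F] (n : ℕ)

/-- The identification of `Fⁿ ⊗ Fⁿ` with `n × n` matrices, `v ⊗ w ↦ v wᵀ`. -/
def tmat : (Fin n → F) ⊗[F] (Fin n → F) ≃ₗ[F] Matrix (Fin n) (Fin n) F :=
  LinearEquiv.ofLinearMap
    (TensorProduct.lift (LinearMap.mk₂ F Matrix.vecMulVec Matrix.add_vecMulVec
      Matrix.smul_vecMulVec Matrix.vecMulVec_add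
      (fun c v w => by ext i j; simp [Matrix.vecMulVec_apply]; ring)))
    (∑ i, ∑ j, (LinearMap.toSpanSingleton F _
      ((Pi.single i 1 : Fin n → F) ⊗ₜ[F] (Pi.single j 1 : Fin n → F))).comp
        (Matrix.entryLinearMap F F i j))
    (by
      ext i j k l
      simp [Matrix.entryLinearMap_apply, Matrix.single_apply, Matrix.vecMulVec_apply,
        Pi.single_apply, Matrix.sum_apply, ite_and, eq_comm])
    (by
      ext i j
      simp [Matrix.entryLinearMap_apply, Matrix.vecMulVec_apply, Pi.single_apply])

variable {F n}

@[simp] theorem tmat_tmul (v w : Fin n → F) : tmat F n (v ⊗ₜ w) = Matrix.vecMulVec v w := rfl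

theorem tmat_act (g : Matrix (Fin n) (Fin n) F) (x : (Fin n → F) ⊗[F] (Fin n → F)) :
    tmat F n (act g x) = g * tmat F n x * g.transpose := by
  induction x using TensorProduct.induction_on with
  | zero => simp
  | add x y hx hy => simp only [map_add, hx, hy, mul_add, add_mul]
  | tmul v w =>
    simp only [act, TensorProduct.map_tmul, tmat_tmul, Matrix.toLin'_apply]
    rw [Matrix.mul_vecMulVec, Matrix.vecMulVec_mul, Matrix.vecMul_transpose]

theorem mem_symTensors_iff (x : (Fin n → F) ⊗[F] (Fin n → F)) :
    x ∈ symTensors F n ↔ (tmat F n x).transpose = tmat F n x := by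
  have h : ∀ x, tmat F n (TensorProduct.comm F _ _ x) = (tmat F n x).transpose := by
    intro x
    induction x using TensorProduct.induction_on with
    | zero => simp
    | add x y hx hy => simp only [map_add, hx, hy, Matrix.transpose_add]
    | tmul v w =>
      rw [TensorProduct.comm_tmul, tmat_tmul, tmat_tmul, Matrix.transpose_vecMulVec]
  rw [← h, (tmat F n).injective.eq_iff]
  rfl

theorem tmat_complexify (x : (Fin n → ℚ) ⊗[ℚ] (Fin n → ℚ)) :
    tmat ℂ n (complexify n x) = (tmat ℚ n x).map (algebraMap ℚ ℂ) := by
  induction x using TensorProduct.induction_on with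
  | zero => simp
  | add x y hx hy => simp only [map_add, hx, hy, Matrix.map_add _ (map_add (algebraMap ℚ ℂ))]
  | tmul v w => ext i j; simp [complexify, Matrix.vecMulVec_apply]

theorem tmul_form_eq_trace (ψ : LinearMap.BilinForm ℚ (Fin 8 → ℚ)) (A : Matrix (Fin 8) (Fin 8) ℚ)
    (hA : ∀ v w, ψ v w = v ⬝ᵥ A.mulVec w) (x y : (Fin 8 → ℚ) ⊗[ℚ] (Fin 8 → ℚ)) :
    LinearMap.BilinForm.tmul ψ ψ x y =
      ((tmat ℚ 8 x).transpose * A * tmat ℚ 8 y * A.transpose).trace := by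
  induction x using TensorProduct.induction_on with
  | zero => simp
  | add x x' hx hx' => simp only [map_add, LinearMap.add_apply, hx, hx', Matrix.transpose_add,
      add_mul, Matrix.trace_add]
  | tmul v w =>
    induction y using TensorProduct.induction_on with
    | zero => simp
    | add y y' hy hy' => simp only [map_add, hy, hy', mul_add, add_mul, Matrix.trace_add]
    | tmul v' w' =>
      rw [LinearMap.BilinForm.tensorDistrib_tmul, hA, hA, tmat_tmul, tmat_tmul,
        Matrix.transpose_vecMulVec, Matrix.mul_assoc, Matrix.vecMulVec_mul (x := v'),
        Matrix.vecMul_transpose, Matrix.vecMulVec_mul, Matrix.vecMulVec_mul_vecMulVec,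
        Matrix.trace_vecMulVec, dotProduct_smul, ← Matrix.dotProduct_mulVec, smul_eq_mul,
        smul_eq_mul, mul_comm]

/-- A rational functional that separates x from `W` extends ℂ-linearly and separates the
complexifications. -/
theorem mem_of_complexify_mem (W : Submodule ℚ ((Fin n → ℚ) ⊗[ℚ] (Fin n → ℚ)))
    (x : (Fin n → ℚ) ⊗[ℚ] (Fin n → ℚ)) (hx : complexify n x ∈ complexSpan W) : x ∈ W := by
  by_contra hW
  obtain ⟨l, hl, hker⟩ := Submodule.exists_le_ker_of_notMem hW
  let m : (Fin n → ℂ) ⊗[ℂ] (Fin n → ℂ) →ₗ[ℂ] ℂ :=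
    (∑ i, ∑ j, (l ((tmat ℚ n).symm (Matrix.single i j 1)) : ℂ) • Matrix.entryLinearMap ℂ ℂ i j).comp
      (tmat ℂ n).toLinearMap
  have hm : ∀ y, m (complexify n y) = (l y : ℂ) := by
    intro y
    have : l y = ∑ i, ∑ j, l ((tmat ℚ n).symm (Matrix.single i j 1)) * tmat ℚ n y i j := by
      conv_lhs => rw [← (tmat ℚ n).symm_apply_apply y, Matrix.matrix_eq_sum_single (tmat ℚ n y)]
      simp only [map_sum]
      refine Finset.sum_congr rfl fun i _ => Finset.sum_congr rfl fun j _ => ?_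
      rw [show Matrix.single i j (tmat ℚ n y i j) = tmat ℚ n y i j • Matrix.single i j (1 : ℚ) by
        simp, map_smul, map_smul, smul_eq_mul, mul_comm]
    rw [this]
    simp [m, tmat_complexify]
  have h0 : complexSpan W ≤ LinearMap.ker m := by
    refine Submodule.span_le.2 ?_
    rintro _ ⟨w, hw, rfl⟩
    change m _ = 0
    rw [hm, LinearMap.mem_ker.1 (hker hw), Rat.cast_zero]
  have := h0 hx
  rw [LinearMap.mem_ker, hm, Rat.cast_eq_zero] at this
  exact hl this

theorem eq_of_complexSpan_eq {W W' : Submodule ℚ ((Fin n → ℚ) ⊗[ℚ] (Fin n → ℚ))}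
    (h : complexSpan W = complexSpan W') : W = W' := by
  refine le_antisymm (fun x hx => ?_) (fun x hx => ?_)
  · exact mem_of_complexify_mem W' x (h ▸ Submodule.subset_span ⟨x, hx, rfl⟩)
  · exact mem_of_complexify_mem W x (h ▸ Submodule.subset_span ⟨x, hx, rfl⟩)

end TensorMat

/-! ### First order expansions of polynomial curves -/

section Jets

variable (L : Type*) [Field L] [CharZero L]

/-- The vector-valued polynomial functions of a rational variable. -/
def polyFun (M : Type*) [AddCommGroup M] [Module L M] : Submodule L (ℚ → M) :=
  Submodule.span L {p | ∃ (i : ℕ) (m : M), p = fun t : ℚ => (t : L) ^ i • m}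

/-- The polynomial curve `p` is `y₀ + t y₁ + O(t²)`. -/
def HasJet {M : Type*} [AddCommGroup M] [Module L M] (p : ℚ → M) (y₀ y₁ : M) : Prop :=
  ∃ r ∈ polyFun L M, ∀ t, p t = y₀ + (t : L) • y₁ + (t : L) ^ 2 • r t

variable {L} {M N P : Type*} [AddCommGroup M] [Module L M] [AddCommGroup N] [Module L N]
  [AddCommGroup P] [Module L P]

theorem polyFun_const (m : M) : (fun _ => m) ∈ polyFun L M :=
  Submodule.subset_span ⟨0, m, by simp⟩

theorem polyFun_pow_smul {r : ℚ → M} (hr : r ∈ polyFun L M) (k : ℕ) :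
    (fun t : ℚ => (t : L) ^ k • r t) ∈ polyFun L M := by
  induction hr using Submodule.span_induction with
  | mem r hr =>
    obtain ⟨i, m, rfl⟩ := hr
    exact Submodule.subset_span ⟨k + i, m, by funext t; rw [smul_smul, pow_add]⟩
  | zero =>
    simp only [Pi.zero_apply, smul_zero, map_zero, LinearMap.zero_apply]
    exact (polyFun L M).zero_mem
  | add r s _ _ hr hs =>
    convert (polyFun L M).add_mem hr hs using 1
    funext t; simp
  | smul c r _ hr =>
    convert (polyFun L M).smul_mem c hr using 1
    funext t; simp [smul_smul, mul_comm]

theorem polyFun_bilin (B : M →ₗ[L] N →ₗ[L] P) {r : ℚ → M} (hr : r ∈ polyFun L M) {s : ℚ → N}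
    (hs : s ∈ polyFun L N) : (fun t => B (r t) (s t)) ∈ polyFun L P := by
  induction hr using Submodule.span_induction with
  | mem r hr =>
    obtain ⟨i, m, rfl⟩ := hr
    induction hs using Submodule.span_induction with
    | mem s hs =>
      obtain ⟨j, n, rfl⟩ := hs
      exact Submodule.subset_span ⟨i + j, B m n, by funext t; simp [smul_smul, pow_add, mul_comm]⟩
    | zero =>
      simp only [Pi.zero_apply, smul_zero, map_zero, LinearMap.zero_apply]
      exact (polyFun L P).zero_mem
    | add r s _ _ hr hs =>
      convert (polyFun L P).add_mem hr hs using 1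
      funext t; simp
    | smul c r _ hr =>
      convert (polyFun L P).smul_mem c hr using 1
      funext t; simp [smul_smul, mul_comm]
  | zero =>
    simp only [Pi.zero_apply, smul_zero, map_zero, LinearMap.zero_apply]
    exact (polyFun L P).zero_mem
  | add r s _ _ hr hs =>
    convert (polyFun L P).add_mem hr hs using 1
    funext t; simp
  | smul c r _ hr =>
    convert (polyFun L P).smul_mem c hr using 1
    funext t; simp

theorem exists_sum_of_mem_polyFun {r : ℚ → M} (hr : r ∈ polyFun L M) :
    ∃ (n : ℕ) (y : ℕ → M), ∀ t, r t = ∑ i ∈ Finset.range n, (t : L) ^ i • y i := by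
  induction hr using Submodule.span_induction with
  | mem r hr =>
    obtain ⟨i, m, rfl⟩ := hr
    exact ⟨i + 1, Pi.single i m, fun t => by
      simp [Finset.sum_range_succ, Pi.single_apply, Finset.sum_ite_eq']⟩
  | zero => exact ⟨0, 0, fun t => by simp⟩
  | add r s _ _ hr hs =>
    obtain ⟨n, y, hy⟩ := hr
    obtain ⟨m, z, hz⟩ := hs
    refine ⟨max n m, fun i => (if i < n then y i else 0) + (if i < m then z i else 0), fun t => ?_⟩
    have aux : ∀ (n k : ℕ) (y : ℕ → M), n ≤ k → ∑ i ∈ Finset.range k,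
        (t : L) ^ i • (if i < n then y i else 0) = ∑ i ∈ Finset.range n, (t : L) ^ i • y i := by
      intro n k y h
      rw [← Finset.sum_subset (Finset.range_mono h)]
      · exact Finset.sum_congr rfl fun i hi => by rw [if_pos (Finset.mem_range.1 hi)]
      · intro i _ hi
        rw [if_neg (by simpa using hi), smul_zero]
    simp only [smul_add, Finset.sum_add_distrib, aux n _ y (le_max_left _ _),
      aux m _ z (le_max_right _ _), Pi.add_apply, hy, hz]
  | smul c r _ hr =>
    obtain ⟨n, y, hy⟩ := hr
    exact ⟨n, fun i => c • y i, fun t => by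
      simp only [Pi.smul_apply, hy, Finset.smul_sum, smul_smul, mul_comm]⟩

/-- The Leibniz rule. -/
theorem HasJet.bilin (B : M →ₗ[L] N →ₗ[L] P) {p : ℚ → M} {y₀ y₁ : M} (hp : HasJet L p y₀ y₁)
    {q : ℚ → N} {z₀ z₁ : N} (hq : HasJet L q z₀ z₁) :
    HasJet L (fun t => B (p t) (q t)) (B y₀ z₀) (B y₀ z₁ + B y₁ z₀) := by
  obtain ⟨r, hr, hp⟩ := hp
  obtain ⟨s, hs, hq⟩ := hq
  refine ⟨(fun _ => B y₁ z₁) + (fun t => B y₀ (s t)) + (fun t => B (r t) z₀) +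
    (fun t : ℚ => (t : L) ^ 1 • (B y₁ (s t))) + (fun t : ℚ => (t : L) ^ 1 • (B (r t) z₁)) +
    (fun t : ℚ => (t : L) ^ 2 • (B (r t) (s t))), ?_, fun t => ?_⟩
  · refine add_mem (add_mem (add_mem (add_mem (add_mem (polyFun_const _) ?_) ?_) ?_) ?_) ?_
    · exact polyFun_bilin B (polyFun_const y₀) hs
    · exact polyFun_bilin B hr (polyFun_const z₀)
    · exact polyFun_pow_smul (polyFun_bilin B (polyFun_const y₁) hs) 1
    · exact polyFun_pow_smul (polyFun_bilin B hr (polyFun_const z₁)) 1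
    · exact polyFun_pow_smul (polyFun_bilin B hr hs) 2
  · simp only [hp, hq, map_add, LinearMap.add_apply, map_smul, LinearMap.smul_apply, Pi.add_apply]
    module

theorem HasJet.map (f : M →ₗ[L] N) {p : ℚ → M} {y₀ y₁ : M} (hp : HasJet L p y₀ y₁) :
    HasJet L (fun t => f (p t)) (f y₀) (f y₁) := by
  obtain ⟨r, hr, hp⟩ := hp
  refine ⟨fun t => f (r t), ?_, fun t => by simp [hp]⟩
  have := polyFun_bilin ((LinearMap.lsmul L N).compl₂ f) (polyFun_const (1 : L)) hr
  simpa using this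

theorem HasJet.sub {p q : ℚ → M} {y₀ y₁ z₀ z₁ : M} (hp : HasJet L p y₀ y₁)
    (hq : HasJet L q z₀ z₁) : HasJet L (fun t => p t - q t) (y₀ - z₀) (y₁ - z₁) := by
  obtain ⟨r, hr, hp⟩ := hp
  obtain ⟨s, hs, hq⟩ := hq
  exact ⟨r - s, sub_mem hr hs, fun t => by simp only [hp, hq, Pi.sub_apply]; module⟩

theorem HasJet.neg_arg {p : ℚ → M} {y₀ y₁ : M} (hp : HasJet L p y₀ y₁) :
    HasJet L (fun t => p (-t)) y₀ (-y₁) := by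
  obtain ⟨r, hr, hp⟩ := hp
  refine ⟨fun t => r (-t), ?_, fun t => by simp only [hp]; simp⟩
  clear hp
  induction hr using Submodule.span_induction with
  | mem r hr =>
    obtain ⟨i, m, rfl⟩ := hr
    exact Submodule.subset_span ⟨i, (-1 : L) ^ i • m, by
      funext t; simp [smul_smul, ← mul_pow]⟩
  | zero =>
    simp only [Pi.zero_apply, smul_zero, map_zero, LinearMap.zero_apply]
    exact (polyFun L M).zero_mem
  | add r s _ _ hr hs => exact (polyFun L M).add_mem hr hs
  | smul c r _ hr => exact (polyFun L M).smul_mem c hr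

/-- Allows differentiation of a curve known to lie in `W` only on an infinite set of parameters, for
instance where nrd(1 + tu) ≠ 0. -/
theorem HasJet.mem {p : ℚ → M} {y₀ y₁ : M} (hp : HasJet L p y₀ y₁) (W : AddSubgroup M)
    (hW : ∀ (q : ℚ), ∀ x ∈ W, (q : L) • x ∈ W) (S : Set ℚ) (hS : S.Infinite)
    (h : ∀ t ∈ S, p t ∈ W) : y₁ ∈ W := by
  obtain ⟨r, hr, hp⟩ := hp
  obtain ⟨n, y, hy⟩ := exists_sum_of_mem_polyFun hr
  -- The coefficients of the remainder are shifted by two, so that index 1 is the derivative.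
  refine mem_of_sum_ratCast_pow_smul_mem (L := L) W hW (n + 2)
    (fun i => match i with | 0 => y₀ | 1 => y₁ | (i + 2) => y i) S hS (fun t ht => ?_) 1 (by omega)
  rw [Finset.sum_range_succ', Finset.sum_range_succ']
  convert h t ht using 1
  rw [hp, hy, Finset.smul_sum]
  simp only [smul_smul, ← pow_add]
  rw [add_assoc, add_comm, add_comm _ (_ • y₁)]
  simp [add_comm 2, add_assoc]

theorem HasJet.eq_zero {p : ℚ → M} {y₀ y₁ : M} (hp : HasJet L p y₀ y₁) (S : Set ℚ)
    (hS : S.Infinite) (h : ∀ t ∈ S, p t = 0) : y₁ = 0 :=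
  AddSubgroup.mem_bot.1 (hp.mem ⊥ (fun q x hx => by
    rw [AddSubgroup.mem_bot.1 hx, smul_zero]; exact AddSubgroup.mem_bot.2 rfl) S hS
    fun t ht => AddSubgroup.mem_bot.2 (h t ht))

theorem hasJet_sum {n : ℕ} (hn : 2 ≤ n) (y : ℕ → M) :
    HasJet L (fun t => ∑ k ∈ Finset.range n, (t : L) ^ k • y k) (y 0) (y 1) := by
  obtain ⟨m, rfl⟩ := Nat.exists_eq_add_of_le hn
  refine ⟨fun t => ∑ k ∈ Finset.range m, (t : L) ^ k • y (k + 2), ?_, fun t => ?_⟩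
  · have : (fun t : ℚ => ∑ k ∈ Finset.range m, (t : L) ^ k • y (k + 2)) =
        ∑ k ∈ Finset.range m, fun t : ℚ => (t : L) ^ k • y (k + 2) := by
      funext t; simp
    rw [this]
    exact sum_mem fun k _ => Submodule.subset_span ⟨k, y (k + 2), rfl⟩
  · beta_reduce
    rw [add_comm 2 m, Finset.sum_range_succ', Finset.sum_range_succ', Finset.smul_sum]
    simp only [smul_smul, ← pow_add]
    rw [add_assoc, add_comm, add_comm _ (_ • y 1)]
    simp [add_comm 2]

end Jets

/-! ### The derivative of the norm map -/

section NmJet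

variable {K : Type*} [Field K] [NumberField K] {a b : K}

theorem hasJet_Nm (L : Type*) [Field L] [CharZero L] (h : 0 < Fintype.card (K →+* L))
    (u : ℍ[K,a,b]) : HasJet L (fun t : ℚ => Nm L (1 + (t : K) • u)) 1 (corSum L u) := by
  rw [← nmCoeff_one, ← nmCoeff_zero u]
  simp only [Nm_one_add_smul]
  exact hasJet_sum (by omega) _

theorem corSum_mem_CorAlg (u : ℍ[K,a,b]) : corSum (AlgebraicClosure ℚ) u ∈ CorAlg a b :=
  corSum_mem_of_forall_Nm_mem (Subalgebra.toSubmodule (CorAlg a b)).toAddSubgroup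
    (fun q x hx => by
      have := (CorAlg a b).smul_mem hx q
      rwa [← Rat.cast_smul_eq_qsmul (AlgebraicClosure ℚ)] at this) (fun γ => (NmCor γ).2) u

/-- The element `∑_σ 1 ⊗ ⋯ ⊗ u^σ ⊗ ⋯ ⊗ 1` of the corestriction. -/
def corSumQ (u : ℍ[K,a,b]) : CorAlg a b := ⟨corSum _ u, corSum_mem_CorAlg u⟩

theorem card_embeddings_pos (L : Type*) [Field L] [CharZero L] [IsAlgClosed L] :
    0 < Fintype.card (K →+* L) := by
  rw [NumberField.Embeddings.card]
  exact Module.finrank_pos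

theorem nmCoeff_mem_CorAlg (u : ℍ[K,a,b]) (k : ℕ)
    (hk : k < Fintype.card (K →+* AlgebraicClosure ℚ) + 1) :
    nmCoeff (AlgebraicClosure ℚ) u k ∈ CorAlg a b := by
  refine mem_of_sum_ratCast_pow_smul_mem (L := AlgebraicClosure ℚ)
    (Subalgebra.toSubmodule (CorAlg a b)).toAddSubgroup
    (fun q x hx => by
      have := (CorAlg a b).smul_mem hx q
      rwa [← Rat.cast_smul_eq_qsmul (AlgebraicClosure ℚ)] at this) _
    (nmCoeff (AlgebraicClosure ℚ) u) Set.univ Set.infinite_univ (fun t _ => ?_) k hk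
  rw [← Nm_one_add_smul]
  exact (NmCor _).2

end NmJet

/-! ### Invariant symplectic forms and skewness of the Lie algebra -/

section Rep

variable {K : Type*} [Field K] [NumberField K] {a b : K}
  {ρ : CorAlg a b ≃ₐ[ℚ] Matrix (Fin 8) (Fin 8) ℚ}
  {ρC : DAlg ℂ a b →ₐ[ℂ] Matrix (Fin 8) (Fin 8) ℂ}

theorem NmCor_one_add_smul (u : ℍ[K,a,b]) : ∃ y : ℕ → CorAlg a b, y 1 = corSumQ u ∧
    ∀ t : ℚ, NmCor (1 + (t : K) • u) =
      ∑ k ∈ Finset.range (Fintype.card (K →+* AlgebraicClosure ℚ) + 1), t ^ k • y k := by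
  classical
  have h1 : 1 < Fintype.card (K →+* AlgebraicClosure ℚ) + 1 := by
    have := card_embeddings_pos (K := K) (AlgebraicClosure ℚ)
    omega
  refine ⟨fun k => if hk : k < Fintype.card (K →+* AlgebraicClosure ℚ) + 1 then
    ⟨nmCoeff _ u k, nmCoeff_mem_CorAlg u k hk⟩ else 0, ?_, fun t => Subtype.ext ?_⟩
  · beta_reduce
    rw [dif_pos h1]
    exact Subtype.ext (nmCoeff_one u)
  · rw [AddSubmonoidClass.coe_finsetSum]
    refine (Nm_one_add_smul u t).trans (Finset.sum_congr rfl fun k hk => ?_)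
    beta_reduce
    rw [dif_pos (Finset.mem_range.1 hk), ← Rat.cast_pow]
    exact Rat.cast_smul_eq_qsmul _ (t ^ k) (nmCoeff _ u k)

/-- The defining identity on Nm(1 + tu) is an identity between two polynomial curves in t; compare
their linear terms. -/
theorem IsComplexification.map_corSum (hC : IsComplexification ρ ρC) (u : ℍ[K,a,b]) :
    ρC (corSum ℂ u) = (ρ (corSumQ u)).map (algebraMap ℚ ℂ) := by
  obtain ⟨y, hy1, hy⟩ := NmCor_one_add_smul u
  let m : Matrix (Fin 8) (Fin 8) ℚ →ₐ[ℚ] Matrix (Fin 8) (Fin 8) ℂ :=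
    (Algebra.ofId ℚ ℂ).mapMatrix
  have hm : ∀ M, m M = M.map (algebraMap ℚ ℂ) := fun _ => rfl
  have j1 := (hasJet_Nm ℂ (card_embeddings_pos ℂ) u).map ρC.toLinearMap
  have j2 := hasJet_sum (L := ℂ) (n := Fintype.card (K →+* AlgebraicClosure ℚ) + 1)
    (by have := card_embeddings_pos (K := K) (AlgebraicClosure ℚ); omega)
    (fun k => m (ρ (y k)))
  have := (j1.sub j2).eq_zero Set.univ Set.infinite_univ fun t _ => by
    rw [AlgHom.toLinearMap_apply, hC, hy, map_sum, ← hm, map_sum, sub_eq_zero]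
    refine Finset.sum_congr rfl fun k _ => ?_
    rw [map_smul, map_smul, ← Rat.cast_pow]
    exact (Rat.cast_smul_eq_qsmul ℂ (t ^ k) (m (ρ (y k)))).symm
  rw [← hm, ← hy1]
  exact sub_eq_zero.1 this

/-- `A` is the Gram matrix of an invariant symplectic form. -/
structure IsInvariantGram (ρ : CorAlg a b ≃ₐ[ℚ] Matrix (Fin 8) (Fin 8) ℚ)
    (A : Matrix (Fin 8) (Fin 8) ℚ) : Prop where
  transpose : A.transpose = -A
  isUnit : IsUnit A
  inv : ∀ γ : ℍ[K,a,b], nrd γ = 1 → (ρ (NmCor γ)).transpose * A * ρ (NmCor γ) = A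

theorem IsInvariantSymplectic.exists_gram {ψ : LinearMap.BilinForm ℚ (Fin 8 → ℚ)}
    (h : IsInvariantSymplectic ρ ψ) :
    ∃ A, IsInvariantGram ρ A ∧ ∀ v w, ψ v w = v ⬝ᵥ A.mulVec w := by
  have hA : ∀ v w, ψ v w = v ⬝ᵥ (LinearMap.BilinForm.toMatrix' ψ).mulVec w := fun v w => by
    conv_lhs => rw [← Matrix.toBilin'_toMatrix' ψ]
    rw [Matrix.toBilin'_apply']
  have hext : ∀ M N : Matrix (Fin 8) (Fin 8) ℚ, (∀ v w, v ⬝ᵥ M.mulVec w = v ⬝ᵥ N.mulVec w) →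
      M = N := fun M N hMN => by
    ext i j
    simpa using hMN (Pi.single i 1) (Pi.single j 1)
  refine ⟨_, ⟨hext _ _ fun v w => ?_, ?_, fun γ hγ => hext _ _ fun v w => ?_⟩, hA⟩
  · rw [Matrix.neg_mulVec, dotProduct_neg, ← hA, Matrix.mulVec_transpose,
      dotProduct_comm, ← Matrix.dotProduct_mulVec, ← hA]
    exact (h.1.neg_eq v w).symm
  · rw [Matrix.isUnit_iff_isUnit_det, isUnit_iff_ne_zero]
    exact (LinearMap.BilinForm.nondegenerate_toMatrix'_iff.2 h.2.1).det_ne_zero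
  · have := h.2.2 γ hγ v w
    rw [hA, hA] at this
    rw [← this, Matrix.mul_assoc, ← Matrix.mulVec_mulVec, Matrix.dotProduct_mulVec,
      Matrix.vecMul_transpose, Matrix.mulVec_mulVec]

/-- The function is the polynomial 1 + trd(u) t + nrd(u) t², whose constant term is nonzero. -/
theorem infinite_nrd_ne_zero (u : ℍ[K,a,b]) : {t : ℚ | nrd (1 + (t : K) • u) ≠ 0}.Infinite := by
  let p : Polynomial K := 1 + Polynomial.C (trd u) * Polynomial.X +
    Polynomial.C (nrd u) * Polynomial.X ^ 2
  have hp : p ≠ 0 := fun h => by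
    have := congrArg (Polynomial.eval 0) h
    simp [p] at this
  have hfin : {t : ℚ | nrd (1 + (t : K) • u) = 0}.Finite := by
    refine Set.Finite.of_finite_image (f := ((↑) : ℚ → K)) ?_ Rat.cast_injective.injOn
    refine (Polynomial.finite_setOfPred_isRoot hp).subset ?_
    rintro _ ⟨t, ht, rfl⟩
    change Polynomial.eval (t : K) p = 0
    rw [← (show nrd (1 + (t : K) • u) = 0 from ht)]
    simp [p, nrd_eq, trd_eq]
    ring
  exact hfin.infinite_compl

/-- Invariance is known only for norm-one elements. For u of trace zero the Cayley transform of x =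
1 + tu, that is x divided by x̄ = 1 - tu, is such an element, and it carries the form at x̄ to the
form at x. -/
theorem Nm_cayley (hC : IsComplexification ρ ρC) {A : Matrix (Fin 8) (Fin 8) ℚ}
    (hA : IsInvariantGram ρ A) (u : ℍ[K,a,b]) (hu : trd u = 0) (t : ℚ)
    (ht : nrd (1 + (t : K) • u) ≠ 0) :
    (ρC (Nm ℂ (1 + (t : K) • u))).transpose * A.map (algebraMap ℚ ℂ) *
        ρC (Nm ℂ (1 + (t : K) • u)) =
      (ρC (Nm ℂ (1 + ((-t : ℚ) : K) • u))).transpose * A.map (algebraMap ℚ ℂ) *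
        ρC (Nm ℂ (1 + ((-t : ℚ) : K) • u)) := by
  have hs : star (1 + (t : K) • u) = 1 + ((-t : ℚ) : K) • u := by
    rw [star_add, star_one, QuaternionAlgebra.star_smul, star_eq_neg_of_trd_eq_zero hu]
    simp
  set x := 1 + (t : K) • u
  rw [← hs]
  -- This is x x̄⁻¹, written without inverting a quaternion.
  let γ := (nrd x)⁻¹ • (x * x)
  have hγ : nrd γ = 1 := by
    simp only [γ, nrd_smul, nrd_mul]
    field_simp
  have hγx : γ * star x = x := by
    simp only [γ, smul_mul_assoc, mul_assoc, mul_star_eq_nrd]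
    rw [← Algebra.commutes, ← Algebra.smul_def, smul_smul, inv_mul_cancel₀ ht, one_smul]
  have h := congrArg (fun M => Matrix.map M (algebraMap ℚ ℂ)) (hA.inv γ hγ)
  simp only [Matrix.map_mul, Matrix.transpose_map, ← hC γ] at h
  conv_rhs => rw [← h]
  conv_lhs => rw [← hγx, Nm_mul, map_mul, Matrix.transpose_mul]
  simp only [Matrix.mul_assoc]

/-- By `Nm_cayley` the curve t ↦ gᵀ A g with g = ρ(Nm(1 + tu)) is even wherever nrd(1 + tu) ≠ 0, so
its linear term vanishes. -/
theorem corSum_skew (hC : IsComplexification ρ ρC) {A : Matrix (Fin 8) (Fin 8) ℚ}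
    (hA : IsInvariantGram ρ A) (u : ℍ[K,a,b]) (hu : trd u = 0) :
    (ρC (corSum ℂ u)).transpose * A.map (algebraMap ℚ ℂ) =
      -(A.map (algebraMap ℚ ℂ) * ρC (corSum ℂ u)) := by
  have j1 := (hasJet_Nm ℂ (card_embeddings_pos ℂ) u).map ρC.toLinearMap
  let B : Matrix (Fin 8) (Fin 8) ℂ →ₗ[ℂ] Matrix (Fin 8) (Fin 8) ℂ →ₗ[ℂ] Matrix (Fin 8) (Fin 8) ℂ :=
    (LinearMap.mul ℂ _).comp ((LinearMap.mulRight ℂ (A.map (algebraMap ℚ ℂ))).comp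
      (Matrix.transposeLinearEquiv (Fin 8) (Fin 8) ℂ ℂ).toLinearMap)
  have hB : ∀ M N, B M N = M.transpose * A.map (algebraMap ℚ ℂ) * N := fun _ _ => rfl
  have j2 := HasJet.bilin B j1 j1
  have := (j2.sub j2.neg_arg).eq_zero _ (infinite_nrd_ne_zero u) fun t ht => by
    rw [sub_eq_zero, hB, hB]
    exact Nm_cayley hC hA u hu t ht
  simp only [hB, AlgHom.toLinearMap_apply, map_one, Matrix.transpose_one, one_mul, mul_one,
    sub_neg_eq_add, ← two_smul ℂ, smul_eq_zero, OfNat.ofNat_ne_zero, false_or] at this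
  rw [add_comm] at this
  exact eq_neg_of_add_eq_zero_left this

end Rep

/-! ### The factors of the complexified algebra and their traces -/

section Rep

/-- Averaging over the conjugations by `1, i, j, k`. -/
theorem quat_average {L : Type*} [Field L] {c d : L} (hc : c ≠ 0) (hd : d ≠ 0) (x : ℍ[L,c,d]) :
    x + c⁻¹ • (⟨0, 1, 0, 0⟩ * x * ⟨0, 1, 0, 0⟩) + d⁻¹ • (⟨0, 0, 1, 0⟩ * x * ⟨0, 0, 1, 0⟩) +
      (-(c * d)⁻¹) • (⟨0, 0, 0, 1⟩ * x * ⟨0, 0, 0, 1⟩) = algebraMap L _ (2 * trd x) := by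
  rw [QuaternionAlgebra.coe_algebraMap, trd_eq]
  have h1 : c⁻¹ * c = 1 := inv_mul_cancel₀ hc
  have h2 : d⁻¹ * d = 1 := inv_mul_cancel₀ hd
  rw [mul_inv]
  ext
  · simp only [QuaternionAlgebra.re_mul, QuaternionAlgebra.imI_mul, QuaternionAlgebra.imJ_mul,
      QuaternionAlgebra.imK_mul, QuaternionAlgebra.re_add, QuaternionAlgebra.re_smul,
      QuaternionAlgebra.re_coe, smul_eq_mul]
    linear_combination (x.re + x.re * d⁻¹ * d) * h1 + 2 * x.re * h2
  · simp only [QuaternionAlgebra.re_mul, QuaternionAlgebra.imI_mul, QuaternionAlgebra.imJ_mul,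
      QuaternionAlgebra.imK_mul, QuaternionAlgebra.imI_add, QuaternionAlgebra.imI_smul,
      QuaternionAlgebra.imI_coe, smul_eq_mul]
    linear_combination (x.imI - x.imI * d⁻¹ * d) * h1 - 2 * x.imI * h2
  · simp only [QuaternionAlgebra.re_mul, QuaternionAlgebra.imI_mul, QuaternionAlgebra.imJ_mul,
      QuaternionAlgebra.imK_mul, QuaternionAlgebra.imJ_add, QuaternionAlgebra.imJ_smul,
      QuaternionAlgebra.imJ_coe, smul_eq_mul]
    linear_combination (-x.imJ - x.imJ * d⁻¹ * d) * h1
  · simp only [QuaternionAlgebra.re_mul, QuaternionAlgebra.imI_mul, QuaternionAlgebra.imJ_mul,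
      QuaternionAlgebra.imK_mul, QuaternionAlgebra.imK_add, QuaternionAlgebra.imK_smul,
      QuaternionAlgebra.imK_coe, smul_eq_mul]
    linear_combination (-x.imK + x.imK * d⁻¹ * d) * h1

variable {K : Type*} [Field K] [NumberField K] {a b : K}
  {ρ : CorAlg a b ≃ₐ[ℚ] Matrix (Fin 8) (Fin 8) ℚ}
  {ρC : DAlg ℂ a b →ₐ[ℂ] Matrix (Fin 8) (Fin 8) ℂ}

theorem mem_B0_iff {L : Type*} [Field L] {c d : L} (x : ℍ[L,c,d]) : x ∈ B0 c d ↔ trd x = 0 :=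
  Iff.rfl

/-- Independence of the embeddings splits `corSum_skew` into its summands. Scalars satisfy the
identity trivially, and the images of the elements of B span B^σ over ℂ. -/
theorem inc_skew (hC : IsComplexification ρ ρC) {A : Matrix (Fin 8) (Fin 8) ℚ}
    (hA : IsInvariantGram ρ A) (σ : K →+* ℂ) (x : ℍ[ℂ,σ a,σ b]) :
    (ρC (inc a b σ x)).transpose * A.map (algebraMap ℚ ℂ) =
      A.map (algebraMap ℚ ℂ) * ρC (inc a b σ (star x)) := by
  let U : Submodule ℂ (DAlg ℂ a b) :=
    { carrier := {z | (ρC z).transpose * A.map (algebraMap ℚ ℂ) =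
        -(A.map (algebraMap ℚ ℂ) * ρC z)}
      zero_mem' := by simp
      add_mem' := fun {x y} hx hy => by
        change _ = _ at hx hy ⊢
        rw [map_add, Matrix.transpose_add, add_mul, hx, hy, mul_add, neg_add]
      smul_mem' := fun c x hx => by
        change _ = _ at hx ⊢
        rw [map_smul, Matrix.transpose_smul, smul_mul_assoc, hx, mul_smul_comm, smul_neg] }
  have hU : ∀ u : ℍ[K,a,b], trd u = 0 → inc a b σ (qmap σ u) ∈ U := fun u hu =>
    inc_mem_of_corSum_mem U (B0 a b).toSubmodule (fun u hu => corSum_skew hC hA u hu) σ u hu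
  let V : Submodule ℂ ℍ[ℂ,σ a,σ b] :=
    { carrier := {x | (ρC (inc a b σ x)).transpose * A.map (algebraMap ℚ ℂ) =
        A.map (algebraMap ℚ ℂ) * ρC (inc a b σ (star x))}
      zero_mem' := by simp
      add_mem' := fun {x y} hx hy => by
        change _ = _ at hx hy ⊢
        rw [map_add, map_add, Matrix.transpose_add, add_mul, hx, hy, star_add, map_add, map_add,
          mul_add]
      smul_mem' := fun c x hx => by
        change _ = _ at hx ⊢
        rw [map_smul, map_smul, Matrix.transpose_smul, smul_mul_assoc, hx,
          QuaternionAlgebra.star_smul, map_smul, map_smul, mul_smul_comm] }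
  refine qmap_span σ V (fun u => ?_) x
  have e : u = u.re • 1 + ⟨0, u.imI, u.imJ, u.imK⟩ := by ext <;> simp
  rw [e, qmap_add, qmap_smul, qmap_one]
  refine V.add_mem (V.smul_mem _ ?_) ?_
  · change _ = _
    simp
  · have h0 : trd (⟨0, u.imI, u.imJ, u.imK⟩ : ℍ[K,a,b]) = 0 := by simp [trd_eq]
    have := hU _ h0
    change _ = _ at this ⊢
    rw [this, star_eq_neg_of_trd_eq_zero (by rw [trd_qmap, h0, map_zero]), map_neg, map_neg,
      mul_neg]

/-- Passes from G(ℚ) to G(ℂ) one factor at a time: the adjoint of g_σ is ḡ_σ, and ḡ_σ g_σ = nrd g_σ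
= 1. -/
theorem tprod_preserves (hC : IsComplexification ρ ρC) {A : Matrix (Fin 8) (Fin 8) ℚ}
    (hA : IsInvariantGram ρ A) (g : ∀ σ : K →+* ℂ, ℍ[ℂ,σ a,σ b]) (hg : ∀ σ, nrd (g σ) = 1) :
    (ρC (PiTensorProduct.tprod ℂ g)).transpose * A.map (algebraMap ℚ ℂ) *
      ρC (PiTensorProduct.tprod ℂ g) = A.map (algebraMap ℚ ℂ) := by
  classical
  have key : ∀ s : Finset (K →+* ℂ), (ρC (PiTensorProduct.tprod ℂ (s.piecewise g 1))).transpose *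
      A.map (algebraMap ℚ ℂ) * ρC (PiTensorProduct.tprod ℂ (s.piecewise g 1)) =
      A.map (algebraMap ℚ ℂ) := by
    intro s
    induction s using Finset.induction_on with
    | empty =>
      rw [Finset.piecewise_empty, ← PiTensorProduct.one_def, map_one]
      simp
    | insert σ s hσ ih =>
      have : PiTensorProduct.tprod ℂ ((insert σ s).piecewise g 1) =
          inc a b σ (g σ) * PiTensorProduct.tprod ℂ (s.piecewise g 1) := by
        rw [inc_apply, PiTensorProduct.tprod_mul_tprod]
        congr 1
        funext τ
        rcases eq_or_ne τ σ with rfl | hτ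
        · simp [hσ]
        · by_cases hs : τ ∈ s <;> simp [hs, hτ]
      rw [this, map_mul, Matrix.transpose_mul]
      have h2 : (ρC (inc a b σ (g σ))).transpose * A.map (algebraMap ℚ ℂ) *
          ρC (inc a b σ (g σ)) = A.map (algebraMap ℚ ℂ) := by
        rw [inc_skew hC hA, Matrix.mul_assoc, ← map_mul, ← map_mul, star_mul_eq_nrd, hg, map_one,
          map_one, map_one, mul_one]
      calc _ = (ρC (PiTensorProduct.tprod ℂ (s.piecewise g 1))).transpose *
          ((ρC (inc a b σ (g σ))).transpose * A.map (algebraMap ℚ ℂ) * ρC (inc a b σ (g σ))) *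
          ρC (PiTensorProduct.tprod ℂ (s.piecewise g 1)) := by simp only [Matrix.mul_assoc]
        _ = _ := by rw [h2, ih]
  simpa using key Finset.univ

/-- Conjugation by 1, i, j, k does not change the trace against a matrix commuting with the factor,
while the sum of the four conjugates of a trace-zero element is zero. -/
theorem trace_inc_mul (ρC : DAlg ℂ a b →ₐ[ℂ] Matrix (Fin 8) (Fin 8) ℂ) (ha : a ≠ 0) (hb : b ≠ 0)
    (σ : K →+* ℂ) (x : ℍ[ℂ,σ a,σ b]) (hx : trd x = 0) (M : Matrix (Fin 8) (Fin 8) ℂ)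
    (hM : ∀ y, Commute (ρC (inc a b σ y)) M) : (ρC (inc a b σ x) * M).trace = 0 := by
  have ha' : σ a ≠ 0 := (map_ne_zero σ).2 ha
  have hb' : σ b ≠ 0 := (map_ne_zero σ).2 hb
  have hconj : ∀ (r : ℂ) (y : ℍ[ℂ,σ a,σ b]), r • (y * y) = 1 →
      (ρC (inc a b σ (r • (y * x * y))) * M).trace = (ρC (inc a b σ x) * M).trace := by
    intro r y hy
    rw [map_smul, map_smul, map_mul, map_mul, map_mul, map_mul, smul_mul_assoc, Matrix.trace_smul,
      Matrix.mul_assoc, (hM y).eq, ← Matrix.mul_assoc, Matrix.trace_mul_comm, ← Matrix.mul_assoc,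
      ← Matrix.mul_assoc, ← Matrix.trace_smul, ← smul_mul_assoc, ← smul_mul_assoc, ← map_mul,
      ← map_mul, ← map_smul, ← map_smul, hy, map_one, map_one, one_mul]
  have h := quat_average ha' hb' x
  rw [hx, mul_zero, map_zero] at h
  have h' := congrArg (fun z => (ρC (inc a b σ z) * M).trace) h
  simp only [map_add, add_mul, Matrix.trace_add, map_zero, zero_mul, Matrix.trace_zero] at h'
  rw [hconj, hconj, hconj] at h'
  · linear_combination h' / 4
  · ext <;> simp
    field_simp
  · ext <;> simp [hb']
  · ext <;> simp [ha']

/-- The trace-zero part contributes nothing, and the unit has trace 8 and reduced trace 2. -/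
theorem trace_inc (ρC : DAlg ℂ a b →ₐ[ℂ] Matrix (Fin 8) (Fin 8) ℂ) (ha : a ≠ 0) (hb : b ≠ 0)
    (σ : K →+* ℂ) (x : ℍ[ℂ,σ a,σ b]) : (ρC (inc a b σ x)).trace = 4 * trd x := by
  have e : x = x.re • 1 + ⟨0, x.imI, x.imJ, x.imK⟩ := by ext <;> simp
  have h0 : trd (⟨0, x.imI, x.imJ, x.imK⟩ : ℍ[ℂ,σ a,σ b]) = 0 := by simp [trd_eq]
  have := trace_inc_mul ρC ha hb σ _ h0 1 (fun y => Commute.one_right _)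
  rw [mul_one] at this
  conv_lhs => rw [e, map_add, map_add, Matrix.trace_add, this]
  simp [trd_eq]
  ring

/-- The map `(x_σ)_σ ↦ ∑_σ 1 ⊗ ⋯ ⊗ x_σ ⊗ ⋯ ⊗ 1`, followed by a representation. -/
def famSum (ρC : DAlg ℂ a b →ₐ[ℂ] Matrix (Fin 8) (Fin 8) ℂ) :
    (∀ σ : K →+* ℂ, B0 (σ a) (σ b)) →ₗ[ℂ] Matrix (Fin 8) (Fin 8) ℂ :=
  ∑ σ : K →+* ℂ, (ρC.toLinearMap.comp (inc a b σ).toLinearMap).comp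
    ((B0 (σ a) (σ b)).toSubmodule.subtype.comp (LinearMap.proj σ))

theorem famSum_apply (x : ∀ σ : K →+* ℂ, B0 (σ a) (σ b)) :
    famSum ρC x = ∑ σ : K →+* ℂ, ρC (inc a b σ (x σ)) := by
  simp [famSum]

/-- Cross terms vanish by `trace_inc_mul`, since different factors commute. -/
theorem trace_famSum_mul (ha : a ≠ 0) (hb : b ≠ 0) (x y : ∀ σ : K →+* ℂ, B0 (σ a) (σ b)) :
    (famSum ρC x * famSum ρC y).trace =
      4 * ∑ σ : K →+* ℂ, trd ((x σ : ℍ[ℂ,σ a,σ b]) * (y σ : ℍ[ℂ,σ a,σ b])) := by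
  classical
  rw [famSum_apply, famSum_apply, Finset.sum_mul_sum, Matrix.trace_sum, Finset.mul_sum]
  refine Finset.sum_congr rfl fun σ _ => ?_
  rw [Matrix.trace_sum, Finset.sum_eq_single σ]
  · rw [← map_mul, ← map_mul, trace_inc ρC ha hb]
  · intro τ _ hτ
    refine trace_inc_mul ρC ha hb σ _ (x σ).2 _ fun z => ?_
    rw [commute_iff_eq, ← map_mul, ← map_mul, (inc_commute hτ.symm z (y τ)).eq]
  · simp

/-- The trace form is nondegenerate on every B⁰_σ; test against families supported at one embedding.
-/
theorem famSum_injective (ha : a ≠ 0) (hb : b ≠ 0) : Function.Injective (famSum ρC) := by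
  classical
  rw [← LinearMap.ker_eq_bot, LinearMap.ker_eq_bot']
  intro x hx
  funext σ
  have ha' : σ a ≠ 0 := (map_ne_zero σ).2 ha
  have hb' : σ b ≠ 0 := (map_ne_zero σ).2 hb
  have key : ∀ y : B0 (σ a) (σ b), trd ((x σ : ℍ[ℂ,σ a,σ b]) * (y : ℍ[ℂ,σ a,σ b])) = 0 := by
    intro y
    have := trace_famSum_mul (ρC := ρC) ha hb x (Pi.single σ y)
    rw [hx, zero_mul, Matrix.trace_zero, Finset.sum_eq_single σ] at this
    · simpa using this.symm
    · intro τ _ hτ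
      simp [Pi.single_eq_of_ne hτ, trd_eq]
    · simp
  have h1 := key ⟨⟨0, 1, 0, 0⟩, by simp [mem_B0_iff, trd_eq]⟩
  have h2 := key ⟨⟨0, 0, 1, 0⟩, by simp [mem_B0_iff, trd_eq]⟩
  have h3 := key ⟨⟨0, 0, 0, 1⟩, by simp [mem_B0_iff, trd_eq]⟩
  have h0 : trd (x σ : ℍ[ℂ,σ a,σ b]) = 0 := (x σ).2
  ext
  · simpa [trd_eq] using h0
  · simpa [trd_eq, ha'] using h1
  · simpa [trd_eq, hb'] using h2
  · simpa [trd_eq, ha', hb'] using h3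

end Rep

/-! ### The corestriction of a vector space -/

section CorDiag

variable {K : Type*} [Field K] [NumberField K] {V : Type*} [AddCommGroup V] [Module K V]

/-- An embedding of `K` in `ℚ̄` makes `ℚ̄` an algebraic closure of `K`. -/
instance (σ : K →+* AlgebraicClosure ℚ) : IsAlgClosure K (Emb σ) where
  isAlgClosed := inferInstanceAs (IsAlgClosed (AlgebraicClosure ℚ))
  isAlgebraic := by
    have : Algebra.IsAlgebraic ℚ (Emb σ) :=
      inferInstanceAs (Algebra.IsAlgebraic ℚ (AlgebraicClosure ℚ))
    exact Algebra.IsAlgebraic.tower_top (K := ℚ) K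

/-- Galois theory of ℚ̄ over the subfield σ(K). -/
theorem exists_map_eq_of_fixed (σ : K →+* AlgebraicClosure ℚ) (c : AlgebraicClosure ℚ)
    (h : ∀ τ : AlgebraicClosure ℚ ≃ₐ[ℚ] AlgebraicClosure ℚ, (∀ k, τ (σ k) = σ k) → τ c = c) :
    ∃ k : K, σ k = c := by
  have : Algebra.IsAlgebraic K (Emb σ) := IsAlgClosure.isAlgebraic
  have : IsGalois K (Emb σ) := { to_normal := IsAlgClosure.normal K _ }
  obtain ⟨k, hk⟩ := (InfiniteGalois.mem_range_algebraMap_iff_fixed (k := K) (K := Emb σ) c).2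
    fun τ => h (AlgEquiv.ofRingEquiv (f := (τ.toRingEquiv :
      AlgebraicClosure ℚ ≃+* AlgebraicClosure ℚ)) (fun q => by
        rw [eq_ratCast]; exact map_ratCast (τ.toRingEquiv : Emb σ ≃+* Emb σ) q))
      fun k => τ.commutes k
  exact ⟨k, hk⟩

theorem exists_gal_comp_eq (σ σ' : K →+* AlgebraicClosure ℚ) :
    ∃ τ : AlgebraicClosure ℚ ≃ₐ[ℚ] AlgebraicClosure ℚ, ∀ k, τ (σ k) = σ' k := by
  let e : Emb σ ≃ₐ[K] Emb σ' := IsAlgClosure.equiv K (Emb σ) (Emb σ')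
  exact ⟨AlgEquiv.ofRingEquiv (f := (e.toRingEquiv :
      AlgebraicClosure ℚ ≃+* AlgebraicClosure ℚ)) (fun q => by
        rw [eq_ratCast]; exact map_ratCast (e.toRingEquiv : Emb σ ≃+* Emb σ') q), fun k => e.commutes k⟩

theorem repr_gal {ι : Type*} (β : Module.Basis ι K V) {L : Type*} [Field L] (τ : L →+* L)
    {σ σ' : K →+* L} (h : ∀ k, τ (σ k) = σ' k) (x : Conj σ V) (i : ι) :
    (Algebra.TensorProduct.basis (Emb σ') β).repr (Conj.gal τ h x) i =
      τ ((Algebra.TensorProduct.basis (Emb σ) β).repr x i) := by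
  induction x using TensorProduct.induction_on with
  | zero =>
    simp only [map_zero, Finsupp.coe_zero, Pi.zero_apply]
    exact (map_zero τ).symm
  | add x y hx hy =>
    simp only [map_add, Finsupp.add_apply, hx, hy]
    exact (map_add τ _ _).symm
  | tmul c v =>
    have : Conj.gal (V := V) τ h (c ⊗ₜ v) = (Emb.gal τ σ σ' c) ⊗ₜ v := rfl
    rw [this, Algebra.TensorProduct.basis_repr_tmul, Algebra.TensorProduct.basis_repr_tmul]
    simp only [Finsupp.smul_apply, smul_eq_mul, Finsupp.mapRange_apply]
    refine Eq.trans ?_ (map_mul τ _ _).symm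
    congr 1
    exact (h _).symm

/-- The Galois group is transitive on embeddings, so an invariant family is determined by its
component at one σ₀. That component is fixed by the automorphisms over σ₀(K), so its coordinates in
a K-basis lie in σ₀(K). -/
theorem corDiag_bijective [FiniteDimensional K V] :
    Function.Bijective (corDiag : V → CorSpace K V) := by
  let β := Module.finBasis K V
  obtain ⟨σ₀⟩ : Nonempty (K →+* AlgebraicClosure ℚ) :=
    Fintype.card_pos_iff.1 (card_embeddings_pos (K := K) (AlgebraicClosure ℚ))
  have hrep : ∀ (σ : K →+* AlgebraicClosure ℚ) (v : V) i,
      (Algebra.TensorProduct.basis (Emb σ) β).repr ((1 : Emb σ) ⊗ₜ[K] v) i = σ (β.repr v i) := by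
    intro σ v i
    rw [Algebra.TensorProduct.basis_repr_tmul, one_smul]
    rfl
  constructor
  · rw [injective_iff_map_eq_zero]
    intro v hv
    have h0 : (1 : Emb σ₀) ⊗ₜ[K] v = 0 := congrFun (congrArg Subtype.val hv) σ₀
    refine β.repr.injective (Finsupp.ext fun i => σ₀.injective ?_)
    rw [← hrep, h0]
    simp
    rfl
  · intro x
    have : ∀ i, ∃ k : K, σ₀ k = (Algebra.TensorProduct.basis (Emb σ₀) β).repr (x.1 σ₀) i := by
      intro i
      refine exists_map_eq_of_fixed σ₀ _ fun τ hτ => ?_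
      have := repr_gal β (τ : AlgebraicClosure ℚ →+* AlgebraicClosure ℚ) hτ (x.1 σ₀) i
      rw [x.2 τ σ₀ σ₀ hτ] at this
      exact this.symm
    choose k hk using this
    have h0 : (1 : Emb σ₀) ⊗ₜ[K] (∑ i, k i • β i) = x.1 σ₀ := by
      refine (Algebra.TensorProduct.basis (Emb σ₀) β).repr.injective (Finsupp.ext fun i => ?_)
      rw [hrep, ← hk]
      congr 1
      simp [Finsupp.single_apply]
    refine ⟨∑ i, k i • β i, Subtype.ext (funext fun σ => ?_)⟩
    obtain ⟨τ, hτ⟩ := exists_gal_comp_eq σ₀ σ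
    have h1 := (corDiag (∑ i, k i • β i)).2 τ σ₀ σ hτ
    rw [← x.2 τ σ₀ σ hτ, ← h0]
    exact h1.symm

theorem sum_embeddings_eq_trace (L : Type*) [Field L] [CharZero L] [IsAlgClosed L] (k : K) :
    ∑ σ : K →+* L, σ k = ((Algebra.trace ℚ K k : ℚ) : L) := by
  have := trace_eq_sum_embeddings L (K := ℚ) (x := k)
  rw [eq_ratCast] at this
  rw [this]
  exact Fintype.sum_equiv (RingHom.equivRatAlgHom K L) _ _ fun σ => rfl

/-- Under `corDiag` the corestricted form is the trace form of `Q`; all later computations with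
Cor(B⁰) take place on B⁰ with this form. -/
theorem corForm_corDiag (Q : LinearMap.BilinForm K V) (u v : V) :
    corForm Q (corDiag u) (corDiag v) =
      ((Algebra.trace ℚ K (Q u v) : ℚ) : AlgebraicClosure ℚ) := by
  rw [← sum_embeddings_eq_trace, corForm]
  refine Finset.sum_congr rfl fun σ _ => ?_
  change LinearMap.BilinForm.baseChange (Emb σ) Q ((1 : Emb σ) ⊗ₜ u) ((1 : Emb σ) ⊗ₜ v) = _
  rw [LinearMap.BilinForm.baseChange_tmul, mul_one, Algebra.smul_def, mul_one]
  rfl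

end CorDiag

/-! ### The Killing form of the trace-zero quaternions -/

section Killing

variable {K : Type*} [Field K] {a b : K}

/-- The basis `i, j, k` of `B⁰`. -/
def B0basis [CharZero K] (a b : K) : Module.Basis (Fin 3) K (B0 a b) :=
  Module.Basis.ofEquivFun
    { toFun := fun x => ![(x : ℍ[K,a,b]).imI, (x : ℍ[K,a,b]).imJ, (x : ℍ[K,a,b]).imK]
      invFun := fun v => ⟨⟨0, v 0, v 1, v 2⟩, by simp [mem_B0_iff, trd_eq]⟩
      map_add' := fun x y => by ext i; fin_cases i <;> rfl
      map_smul' := fun c x => by ext i; fin_cases i <;> rfl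
      left_inv := fun x => by
        have hx : trd (x : ℍ[K,a,b]) = 0 := x.2
        have : (x : ℍ[K,a,b]).re = 0 := by simpa [trd_eq] using hx
        ext <;> simp [this]
      right_inv := fun v => by ext i; fin_cases i <;> rfl }

/-- The Killing form is four times the reduced trace form, as is seen from the matrices of the
brackets in the basis i, j, k. -/
theorem QB_apply [CharZero K] (x y : B0 a b) :
    QB a b x y = trd ((x : ℍ[K,a,b]) * (y : ℍ[K,a,b])) := by
  have hx : trd (x : ℍ[K,a,b]) = 0 := x.2
  have hy : trd (y : ℍ[K,a,b]) = 0 := y.2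
  have hx : (x : ℍ[K,a,b]).re = 0 := by simpa [trd_eq] using hx
  have hy : (y : ℍ[K,a,b]).re = 0 := by simpa [trd_eq] using hy
  rw [QB, LinearMap.smul_apply, LinearMap.smul_apply, killingForm_apply_apply,
    LinearMap.trace_eq_matrix_trace K (B0basis a b), Matrix.trace, Fin.sum_univ_three]
  simp only [Matrix.diag_apply, LinearMap.toMatrix_apply]
  have hlie : ∀ u v : B0 a b, ((⁅u, v⁆ : B0 a b) : ℍ[K,a,b]) =
      (u : ℍ[K,a,b]) * (v : ℍ[K,a,b]) - (v : ℍ[K,a,b]) * (u : ℍ[K,a,b]) := fun _ _ => rfl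
  simp [B0basis, hlie, trd_eq, hx, hy]
  ring

end Killing

/-! ### The quadratic space `V_{K3}` -/

section VK3

variable {K : Type*} [Field K] [NumberField K] {a b : K}
  {ρ : CorAlg a b ≃ₐ[ℚ] Matrix (Fin 8) (Fin 8) ℚ}
  {ρC : DAlg ℂ a b →ₐ[ℂ] Matrix (Fin 8) (Fin 8) ℂ} {A : Matrix (Fin 8) (Fin 8) ℚ}

theorem corSum_add (L : Type*) [Field L] [CharZero L] (u v : ℍ[K,a,b]) :
    corSum L (u + v) = corSum L u + corSum L v := by
  simp only [corSum, qmap_add, map_add, Finset.sum_add_distrib]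

/-- The embedding of `B⁰` in `V ⊗ V` attached to an invariant symplectic form with Gram
matrix `A`. -/
def vEmb (ρ : CorAlg a b ≃ₐ[ℚ] Matrix (Fin 8) (Fin 8) ℚ) (A : Matrix (Fin 8) (Fin 8) ℚ) :
    B0 a b →+ (Fin 8 → ℚ) ⊗[ℚ] (Fin 8 → ℚ) where
  -- The factor 1/2 makes the map an isometry: its square cancels the 4 in `trace_inc`.
  toFun u := (tmat ℚ 8).symm ((1 / 2 : ℚ) • (ρ (corSumQ (u : ℍ[K,a,b])) * A⁻¹))
  map_zero' := by
    have : corSumQ ((0 : B0 a b) : ℍ[K,a,b]) = 0 := Subtype.ext (by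
      have h : corSum (AlgebraicClosure ℚ) (0 : ℍ[K,a,b]) = 0 := by
        simp only [corSum, qmap_zero, map_zero, Finset.sum_const_zero]
      exact h)
    rw [this, map_zero, zero_mul, smul_zero, map_zero]
  map_add' u v := by
    have : corSumQ ((u + v : B0 a b) : ℍ[K,a,b]) =
        corSumQ (u : ℍ[K,a,b]) + corSumQ (v : ℍ[K,a,b]) :=
      Subtype.ext (corSum_add _ _ _)
    rw [this, map_add, add_mul, smul_add, map_add]

theorem tmat_vEmb (u : B0 a b) :
    tmat ℚ 8 (vEmb ρ A u) = (1 / 2 : ℚ) • (ρ (corSumQ (u : ℍ[K,a,b])) * A⁻¹) :=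
  (tmat ℚ 8).apply_symm_apply _

/-- Conjugate families of an element of `B⁰`. -/
def fam (u : B0 a b) (σ : K →+* ℂ) : B0 (σ a) (σ b) :=
  ⟨qmap σ (u : ℍ[K,a,b]), by
    rw [mem_B0_iff, trd_qmap, (show trd (u : ℍ[K,a,b]) = 0 from u.2), map_zero]⟩

theorem famSum_fam (ρC : DAlg ℂ a b →ₐ[ℂ] Matrix (Fin 8) (Fin 8) ℂ) (u : B0 a b) :
    famSum ρC (fam u) = ρC (corSum ℂ (u : ℍ[K,a,b])) := by
  rw [famSum_apply, corSum, map_sum]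
  rfl

theorem IsInvariantGram.det_isUnit (hA : IsInvariantGram ρ A) : IsUnit A.det :=
  (Matrix.isUnit_iff_isUnit_det A).1 hA.isUnit

theorem map_injective_ratCast {n : ℕ} :
    Function.Injective fun M : Matrix (Fin n) (Fin n) ℚ => M.map (algebraMap ℚ ℂ) :=
  Matrix.map_injective (algebraMap ℚ ℂ).injective

theorem corSumQ_skew (hC : IsComplexification ρ ρC) (hA : IsInvariantGram ρ A) (u : B0 a b) :
    (ρ (corSumQ (u : ℍ[K,a,b]))).transpose * A = -(A * ρ (corSumQ (u : ℍ[K,a,b]))) := by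
  have := corSum_skew hC hA (u : ℍ[K,a,b]) u.2
  rw [hC.map_corSum, ← Matrix.transpose_map, ← Matrix.map_mul, ← Matrix.map_mul] at this
  apply map_injective_ratCast
  beta_reduce
  rw [this]
  ext i j
  rw [Matrix.neg_apply, Matrix.map_apply, Matrix.map_apply, Matrix.neg_apply, map_neg]

theorem inv_transpose (hA : IsInvariantGram ρ A) : A⁻¹.transpose = -A⁻¹ := by
  rw [Matrix.transpose_nonsing_inv, hA.transpose]
  refine Matrix.inv_eq_right_inv ?_
  rw [neg_mul_neg, Matrix.mul_nonsing_inv _ hA.det_isUnit]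

/-- If M is skew for the alternating form `A`, then M A⁻¹ is symmetric. -/
theorem vEmb_mem_symTensors (hC : IsComplexification ρ ρC) (hA : IsInvariantGram ρ A)
    (u : B0 a b) : vEmb ρ A u ∈ symTensors ℚ 8 := by
  rw [mem_symTensors_iff, tmat_vEmb, Matrix.transpose_smul, Matrix.transpose_mul, inv_transpose hA]
  congr 1
  have h := corSumQ_skew hC hA u
  have h1 := Matrix.mul_nonsing_inv A hA.det_isUnit
  have h2 := Matrix.nonsing_inv_mul A hA.det_isUnit
  calc -A⁻¹ * (ρ (corSumQ (u : ℍ[K,a,b]))).transpose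
      = -A⁻¹ * ((ρ (corSumQ (u : ℍ[K,a,b]))).transpose * A) * A⁻¹ := by
        rw [Matrix.mul_assoc, Matrix.mul_assoc, h1, Matrix.mul_one]
    _ = A⁻¹ * A * ρ (corSumQ (u : ℍ[K,a,b])) * A⁻¹ := by
        rw [h, neg_mul_neg]; simp only [Matrix.mul_assoc]
    _ = _ := by rw [h2, Matrix.one_mul]

theorem NmCor_mul_corSumQ (γ : ℍ[K,a,b]) (hγ : nrd γ = 1) (u : B0 a b) :
    NmCor γ * corSumQ (u : ℍ[K,a,b]) = corSumQ (Ad γ u : ℍ[K,a,b]) * NmCor γ := by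
  refine Subtype.ext ?_
  change Nm _ γ * corSum _ (u : ℍ[K,a,b]) = corSum _ (γ * (u : ℍ[K,a,b]) * star γ) * Nm _ γ
  rw [corSum, corSum, Finset.mul_sum, Finset.sum_mul]
  refine Finset.sum_congr rfl fun σ _ => ?_
  refine tprod_mul_inc _ σ _ _ ?_
  rw [← qmap_mul σ rfl rfl, ← qmap_mul σ rfl rfl, mul_assoc _ (star γ), star_mul_eq_nrd, hγ,
    map_one, mul_one]

/-- Invariance of `A` gives g A⁻¹ gᵀ = A⁻¹, so g M A⁻¹ gᵀ = (g M g⁻¹) A⁻¹, and conjugation of the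
Lie algebra is the adjoint action. -/
theorem act_vEmb (hA : IsInvariantGram ρ A) (γ : ℍ[K,a,b]) (hγ : nrd γ = 1) (u : B0 a b) :
    act (ρ (NmCor γ)) (vEmb ρ A u) = vEmb ρ A (Ad γ u) := by
  refine (tmat ℚ 8).injective ?_
  rw [tmat_act, tmat_vEmb, tmat_vEmb, mul_smul_comm, smul_mul_assoc]
  congr 1
  have hinv : ρ (NmCor γ) * A⁻¹ * (ρ (NmCor γ)).transpose = A⁻¹ := by
    have h := hA.inv γ hγ
    have hg : IsUnit (ρ (NmCor γ)).det := by
      have := congrArg Matrix.det h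
      rw [Matrix.det_mul] at this
      have h3 := hA.det_isUnit
      rw [← this] at h3
      exact isUnit_of_mul_isUnit_right h3
    have h4 := congrArg (·⁻¹) h
    simp only [Matrix.mul_inv_rev] at h4
    conv_lhs => rw [← h4]
    have h5 := Matrix.mul_nonsing_inv _ hg
    have h6 := Matrix.nonsing_inv_mul _ (Matrix.isUnit_det_transpose _ hg)
    calc _ = (ρ (NmCor γ) * (ρ (NmCor γ))⁻¹) * A⁻¹ *
          ((ρ (NmCor γ)).transpose⁻¹ * (ρ (NmCor γ)).transpose) := by simp only [Matrix.mul_assoc]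
      _ = _ := by rw [h5, h6, Matrix.one_mul, Matrix.mul_one]
  rw [← Matrix.mul_assoc, ← map_mul, NmCor_mul_corSumQ γ hγ u, map_mul]
  conv_rhs => rw [← hinv]
  simp only [Matrix.mul_assoc]

theorem vEmb_injective (hC : IsComplexification ρ ρC) (hA : IsInvariantGram ρ A) (ha : a ≠ 0)
    (hb : b ≠ 0) : Function.Injective (vEmb ρ A) := by
  rw [injective_iff_map_eq_zero]
  intro u hu
  have h1 : ρ (corSumQ (u : ℍ[K,a,b])) = 0 := by
    have := tmat_vEmb (ρ := ρ) (A := A) u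
    rw [hu, map_zero, eq_comm, smul_eq_zero] at this
    have h2 := this.resolve_left (by norm_num)
    have h3 := congrArg (· * A) h2
    simpa only [Matrix.mul_assoc, Matrix.nonsing_inv_mul A hA.det_isUnit, Matrix.mul_one,
      Matrix.zero_mul] using h3
  have h2 : famSum ρC (fam u) = 0 := by
    rw [famSum_fam, hC.map_corSum, h1]
    ext i j
    simp
  obtain ⟨σ⟩ : Nonempty (K →+* ℂ) := Fintype.card_pos_iff.1 (card_embeddings_pos (K := K) ℂ)
  have h3 := (famSum_injective (ρC := ρC) ha hb) (h2.trans (map_zero _).symm)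
  have h4 : (qmap σ (u : ℍ[K,a,b]) : ℍ[ℂ,σ a,σ b]) = 0 := congrArg Subtype.val (congrFun h3 σ)
  ext
  · simpa [qmap] using congrArg QuaternionAlgebra.re h4
  · simpa [qmap] using congrArg QuaternionAlgebra.imI h4
  · simpa [qmap] using congrArg QuaternionAlgebra.imJ h4
  · simpa [qmap] using congrArg QuaternionAlgebra.imK h4

theorem qmap_trd_mul (σ : K →+* ℂ) (u v : ℍ[K,a,b]) :
    trd ((qmap σ u : ℍ[ℂ,σ a,σ b]) * qmap σ v) = σ (trd (u * v)) := by
  rw [← qmap_mul σ rfl rfl, trd_qmap]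

theorem intersectionForm_vEmb (hC : IsComplexification ρ ρC) (hA : IsInvariantGram ρ A)
    (ha : a ≠ 0) (hb : b ≠ 0) (ψ : LinearMap.BilinForm ℚ (Fin 8 → ℚ))
    (hψ : ∀ v w, ψ v w = v ⬝ᵥ A.mulVec w) (u v : B0 a b) :
    intersectionForm ψ (vEmb ρ A u) (vEmb ρ A v) = Algebra.trace ℚ K (QB a b u v) := by
  have h1 : intersectionForm ψ (vEmb ρ A u) (vEmb ρ A v) =
      -- With X = ½ M A⁻¹ symmetric and Aᵀ = -A, the value -tr(Xᵀ A Y Aᵀ) is tr(XAYA), which is ¼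
      -- tr(MN).
      1 / 4 * (ρ (corSumQ (u : ℍ[K,a,b])) * ρ (corSumQ (v : ℍ[K,a,b]))).trace := by
    have hs := (mem_symTensors_iff _).1 (vEmb_mem_symTensors hC hA u)
    rw [intersectionForm, LinearMap.neg_apply, LinearMap.neg_apply, tmul_form_eq_trace ψ A hψ, hs,
      hA.transpose, tmat_vEmb, tmat_vEmb]
    simp only [smul_mul_assoc, mul_smul_comm, mul_neg, Matrix.trace_neg, Matrix.trace_smul,
      Matrix.mul_assoc, Matrix.nonsing_inv_mul A hA.det_isUnit, Matrix.mul_one, neg_neg,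
      smul_eq_mul]
    ring
  rw [h1]
  have h2 := trace_famSum_mul (ρC := ρC) ha hb (fam u) (fam v)
  rw [famSum_fam, famSum_fam, hC.map_corSum, hC.map_corSum, ← Matrix.map_mul] at h2
  have h3 : ∀ M : Matrix (Fin 8) (Fin 8) ℚ, (M.map (algebraMap ℚ ℂ)).trace = (M.trace : ℂ) :=
    fun M => by simp [Matrix.trace]
  have h4 : ∑ σ : K →+* ℂ, trd ((fam u σ : ℍ[ℂ,σ a,σ b]) * (fam v σ : ℍ[ℂ,σ a,σ b])) =
      ((Algebra.trace ℚ K (QB a b u v) : ℚ) : ℂ) := by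
    rw [← sum_embeddings_eq_trace, QB_apply]
    exact Finset.sum_congr rfl fun σ _ => qmap_trd_mul σ _ _
  rw [h3, h4] at h2
  have h5 : (ρ (corSumQ (u : ℍ[K,a,b])) * ρ (corSumQ (v : ℍ[K,a,b]))).trace =
      4 * Algebra.trace ℚ K (QB a b u v) := by exact_mod_cast h2
  rw [h5]
  ring

end VK3

section VK3

variable {K : Type*} [Field K] [NumberField K] {a b : K}
  {ρ : CorAlg a b ≃ₐ[ℚ] Matrix (Fin 8) (Fin 8) ℚ}
  {ρC : DAlg ℂ a b →ₐ[ℂ] Matrix (Fin 8) (Fin 8) ℂ} {A : Matrix (Fin 8) (Fin 8) ℚ}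

instance : FiniteDimensional K (B0 a b) := Module.Finite.of_basis (B0basis a b)

/-- The canonical identification of `B⁰` with its corestriction. -/
def corEquiv : B0 a b ≃+ CorSpace K (B0 a b) :=
  AddEquiv.ofBijective corDiag corDiag_bijective

/-- The linear map `Cor(B⁰) → V ⊗ V` induced by `vEmb`. -/
def vCor (ρ : CorAlg a b ≃ₐ[ℚ] Matrix (Fin 8) (Fin 8) ℚ) (A : Matrix (Fin 8) (Fin 8) ℚ) :
    CorSpace K (B0 a b) →ₗ[ℚ] (Fin 8 → ℚ) ⊗[ℚ] (Fin 8 → ℚ) where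
  toFun x := vEmb ρ A (corEquiv.symm x)
  map_add' x y := by rw [map_add, map_add]
  map_smul' q x :=
    map_rat_smul ((vEmb ρ A).comp (corEquiv (a := a) (b := b)).symm.toAddMonoidHom) q x

theorem vCor_corDiag (u : B0 a b) : vCor ρ A (corDiag u) = vEmb ρ A u := by
  change vEmb ρ A (corEquiv.symm (corEquiv u)) = _
  rw [AddEquiv.symm_apply_apply]

/-- The subspace `V_{K3}` of `V ⊗ V` cut out by an invariant symplectic form. -/
def vk3 (ρ : CorAlg a b ≃ₐ[ℚ] Matrix (Fin 8) (Fin 8) ℚ) (A : Matrix (Fin 8) (Fin 8) ℚ) :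
    Submodule ℚ ((Fin 8 → ℚ) ⊗[ℚ] (Fin 8 → ℚ)) :=
  LinearMap.range (vCor ρ A)

theorem mem_vk3 {x : (Fin 8 → ℚ) ⊗[ℚ] (Fin 8 → ℚ)} : x ∈ vk3 ρ A ↔ ∃ u, vEmb ρ A u = x := by
  constructor
  · rintro ⟨y, rfl⟩
    obtain ⟨u, rfl⟩ := corDiag_bijective.2 y
    exact ⟨u, (vCor_corDiag u).symm⟩
  · rintro ⟨u, rfl⟩
    exact ⟨corDiag u, vCor_corDiag u⟩

theorem vCor_injective (hC : IsComplexification ρ ρC) (hA : IsInvariantGram ρ A) (ha : a ≠ 0)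
    (hb : b ≠ 0) : Function.Injective (vCor ρ A) := by
  intro x y h
  obtain ⟨u, rfl⟩ := corDiag_bijective.2 x
  obtain ⟨v, rfl⟩ := corDiag_bijective.2 y
  rw [vCor_corDiag, vCor_corDiag] at h
  rw [vEmb_injective hC hA ha hb h]

theorem vk3_le_symTensors (hC : IsComplexification ρ ρC) (hA : IsInvariantGram ρ A) :
    vk3 ρ A ≤ symTensors ℚ 8 := by
  intro x hx
  obtain ⟨u, rfl⟩ := mem_vk3.1 hx
  exact vEmb_mem_symTensors hC hA u

theorem isGStable_vk3 (hA : IsInvariantGram ρ A) : IsGStable ρ (vk3 ρ A) := by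
  intro γ hγ x hx
  obtain ⟨u, rfl⟩ := mem_vk3.1 hx
  rw [act_vEmb hA γ hγ]
  exact mem_vk3.2 ⟨_, rfl⟩

theorem CorSpace_map_corDiag {V : Type*} [AddCommGroup V] [Module K V] (g : V →ₗ[K] V) (v : V) :
    CorSpace.map g (corDiag v) = corDiag (g v) := by
  refine Subtype.ext ?_
  funext σ
  exact LinearMap.baseChange_tmul ..

theorem exists_isometry (hC : IsComplexification ρ ρC) (hA : IsInvariantGram ρ A)
    (ha : a ≠ 0) (hb : b ≠ 0) (ψ : LinearMap.BilinForm ℚ (Fin 8 → ℚ))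
    (hψ : ∀ v w, ψ v w = v ⬝ᵥ A.mulVec w) :
    ∃ f : CorSpace K (B0 a b) ≃ₗ[ℚ] vk3 ρ A,
      (∀ x y, algebraMap ℚ (AlgebraicClosure ℚ) (intersectionForm ψ (f x) (f y)) =
        corForm (QB a b) x y) ∧
      ∀ γ : ℍ[K,a,b], nrd γ = 1 → ∀ x,
        (f (CorSpace.map (Ad γ) x) : (Fin 8 → ℚ) ⊗[ℚ] (Fin 8 → ℚ)) =
          act (ρ (NmCor γ)) (f x) := by
  refine ⟨LinearEquiv.ofInjective (vCor ρ A) (vCor_injective hC hA ha hb), fun x y => ?_,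
    fun γ hγ x => ?_⟩
  · obtain ⟨u, rfl⟩ := corDiag_bijective.2 x
    obtain ⟨v, rfl⟩ := corDiag_bijective.2 y
    change algebraMap ℚ (AlgebraicClosure ℚ) (intersectionForm ψ (vCor ρ A _) (vCor ρ A _)) = _
    rw [vCor_corDiag, vCor_corDiag, intersectionForm_vEmb hC hA ha hb ψ hψ, corForm_corDiag, eq_ratCast]
  · obtain ⟨u, rfl⟩ := corDiag_bijective.2 x
    change vCor ρ A _ = act (ρ (NmCor γ)) (vCor ρ A _)
    rw [CorSpace_map_corDiag, vCor_corDiag, vCor_corDiag, act_vEmb hA γ hγ]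

theorem finrank_vk3 (hC : IsComplexification ρ ρC) (hA : IsInvariantGram ρ A) (ha : a ≠ 0)
    (hb : b ≠ 0) : Module.finrank ℚ (vk3 ρ A) = Module.finrank ℚ K * 3 := by
  let e : (Fin 3 → K) ≃+ CorSpace K (B0 a b) :=
    (B0basis a b).equivFun.symm.toAddEquiv.trans corEquiv
  have e' : (Fin 3 → K) ≃ₗ[ℚ] CorSpace K (B0 a b) :=
    { e with map_smul' := fun q x => map_rat_smul e q x }
  rw [vk3, ← (LinearEquiv.ofInjective (vCor ρ A) (vCor_injective hC hA ha hb)).finrank_eq,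
    ← e'.finrank_eq, Module.finrank_pi_fintype]
  simp [mul_comm]

/-! ### Complexification of `V_{K3}` -/

/-- A complex matrix `M`, viewed as the tensor with matrix `M A⁻¹`. -/
def vMat (A : Matrix (Fin 8) (Fin 8) ℚ) :
    Matrix (Fin 8) (Fin 8) ℂ →ₗ[ℂ] (Fin 8 → ℂ) ⊗[ℂ] (Fin 8 → ℂ) :=
  (tmat ℂ 8).symm.toLinearMap.comp (LinearMap.mulRight ℂ (A.map (algebraMap ℚ ℂ))⁻¹)

theorem tmat_vMat (M : Matrix (Fin 8) (Fin 8) ℂ) :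
    tmat ℂ 8 (vMat A M) = M * (A.map (algebraMap ℚ ℂ))⁻¹ :=
  (tmat ℂ 8).apply_symm_apply _

theorem IsInvariantGram.det_map_isUnit (hA : IsInvariantGram ρ A) :
    IsUnit (A.map (algebraMap ℚ ℂ)).det := by
  have := hA.det_isUnit.map (algebraMap ℚ ℂ)
  rwa [RingHom.map_det] at this

theorem vMat_bijective (hA : IsInvariantGram ρ A) : Function.Bijective (vMat A) := by
  refine ⟨fun M N h => ?_, fun w => ⟨tmat ℂ 8 w * A.map (algebraMap ℚ ℂ), ?_⟩⟩
  · have := congrArg (fun w => tmat ℂ 8 w * A.map (algebraMap ℚ ℂ)) h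
    simpa only [tmat_vMat, Matrix.mul_assoc, Matrix.nonsing_inv_mul _ hA.det_map_isUnit,
      Matrix.mul_one] using this
  · refine (tmat ℂ 8).injective ?_
    rw [tmat_vMat, Matrix.mul_assoc, Matrix.mul_nonsing_inv _ hA.det_map_isUnit, Matrix.mul_one]

theorem mul_inv_mul_transpose {F : Type*} [Field F] {n : ℕ} {g A : Matrix (Fin n) (Fin n) F}
    (hA : IsUnit A.det) (h : g.transpose * A * g = A) :
    IsUnit g.det ∧ g * A⁻¹ * g.transpose = A⁻¹ := by
  have hg : IsUnit g.det := by
    have := congrArg Matrix.det h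
    rw [Matrix.det_mul] at this
    rw [← this] at hA
    exact isUnit_of_mul_isUnit_right hA
  refine ⟨hg, ?_⟩
  have h4 := congrArg (·⁻¹) h
  simp only [Matrix.mul_inv_rev] at h4
  conv_lhs => rw [← h4]
  have h5 := Matrix.mul_nonsing_inv _ hg
  have h6 := Matrix.nonsing_inv_mul _ (Matrix.isUnit_det_transpose _ hg)
  calc _ = (g * g⁻¹) * A⁻¹ * (g.transpose⁻¹ * g.transpose) := by simp only [Matrix.mul_assoc]
    _ = _ := by rw [h5, h6, Matrix.one_mul, Matrix.mul_one]

/-- The action of G(ℂ) on tensors is conjugation of matrices; the form without inverses is the one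
used for commutation arguments. -/
theorem actG_vMat_eq_iff (hC : IsComplexification ρ ρC)
    (hA : IsInvariantGram ρ A) {g : ∀ σ : K →+* ℂ, ℍ[ℂ,σ a,σ b]} (hg : ∀ σ, nrd (g σ) = 1)
    (M N : Matrix (Fin 8) (Fin 8) ℂ) : actG ρC g (vMat A M) = vMat A N ↔
      ρC (PiTensorProduct.tprod ℂ g) * M = N * ρC (PiTensorProduct.tprod ℂ g) := by
  obtain ⟨hu, hinv⟩ := mul_inv_mul_transpose hA.det_map_isUnit (tprod_preserves hC hA g hg)
  have hA' := Matrix.nonsing_inv_mul _ hA.det_map_isUnit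
  set G := ρC (PiTensorProduct.tprod ℂ g)
  have e : G * M * (A.map (algebraMap ℚ ℂ))⁻¹ * G.transpose =
      G * M * G⁻¹ * (A.map (algebraMap ℚ ℂ))⁻¹ := by
    conv_rhs => rw [← hinv]
    simp only [← Matrix.mul_assoc]
    rw [Matrix.mul_assoc (G * M) G⁻¹ G, Matrix.nonsing_inv_mul _ hu, Matrix.mul_one]
  have e2 : actG ρC g (vMat A M) = vMat A (G * M * G⁻¹) := by
    refine (tmat ℂ 8).injective ?_
    rw [actG, tmat_act, tmat_vMat, tmat_vMat, ← Matrix.mul_assoc, e]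
  rw [e2, (vMat_bijective hA).1.eq_iff]
  constructor
  · intro h
    rw [← h, Matrix.mul_assoc, Matrix.nonsing_inv_mul _ hu, Matrix.mul_one]
  · intro h
    rw [h, Matrix.mul_assoc, Matrix.mul_nonsing_inv _ hu, Matrix.mul_one]

/-- The action of `G(ℂ)` on `∏_σ B⁰_σ` by conjugation. -/
def adFam (g : ∀ σ : K →+* ℂ, ℍ[ℂ,σ a,σ b]) :
    (∀ σ : K →+* ℂ, B0 (σ a) (σ b)) →ₗ[ℂ] (∀ σ : K →+* ℂ, B0 (σ a) (σ b)) :=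
  LinearMap.pi fun σ => (Ad (g σ)).comp (LinearMap.proj σ)

theorem adFam_apply (g : ∀ σ : K →+* ℂ, ℍ[ℂ,σ a,σ b]) (x : ∀ σ : K →+* ℂ, B0 (σ a) (σ b))
    (σ : K →+* ℂ) : adFam g x σ = Ad (g σ) (x σ) := rfl

theorem mul_eq_Ad_mul {L : Type*} [Field L] {c d : L} {g : ℍ[L,c,d]} (hg : nrd g = 1)
    (x : B0 c d) : g * (x : ℍ[L,c,d]) = (Ad g x : ℍ[L,c,d]) * g := by
  change g * (x : ℍ[L,c,d]) = g * (x : ℍ[L,c,d]) * star g * g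
  rw [mul_assoc _ (star g), star_mul_eq_nrd, hg, map_one, mul_one]

/-- The embedding of `∏_σ B⁰_σ` in `V_ℂ ⊗ V_ℂ`. -/
def xi (ρC : DAlg ℂ a b →ₐ[ℂ] Matrix (Fin 8) (Fin 8) ℂ) (A : Matrix (Fin 8) (Fin 8) ℚ) :
    (∀ σ : K →+* ℂ, B0 (σ a) (σ b)) →ₗ[ℂ] (Fin 8 → ℂ) ⊗[ℂ] (Fin 8 → ℂ) :=
  (vMat A).comp (famSum ρC)

theorem xi_injective (hA : IsInvariantGram ρ A) (ha : a ≠ 0) (hb : b ≠ 0) :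
    Function.Injective (xi ρC A) :=
  (vMat_bijective hA).1.comp (famSum_injective ha hb)

theorem actG_xi (hC : IsComplexification ρ ρC)
    (hA : IsInvariantGram ρ A) {g : ∀ σ : K →+* ℂ, ℍ[ℂ,σ a,σ b]} (hg : ∀ σ, nrd (g σ) = 1)
    (x : ∀ σ : K →+* ℂ, B0 (σ a) (σ b)) : actG ρC g (xi ρC A x) = xi ρC A (adFam g x) := by
  refine (actG_vMat_eq_iff hC hA hg _ _).2 ?_
  rw [famSum_apply, famSum_apply, Finset.mul_sum, Finset.sum_mul]
  refine Finset.sum_congr rfl fun σ _ => ?_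
  rw [← map_mul, ← map_mul, tprod_mul_inc g σ _ _ (mul_eq_Ad_mul (hg σ) _)]
  rfl

theorem complexify_vEmb (hC : IsComplexification ρ ρC) (hA : IsInvariantGram ρ A) (u : B0 a b) :
    complexify 8 (vEmb ρ A u) = (1 / 2 : ℂ) • xi ρC A (fam u) := by
  refine (tmat ℂ 8).injective ?_
  rw [tmat_complexify, tmat_vEmb, map_smul, xi, LinearMap.comp_apply, tmat_vMat, famSum_fam,
    hC.map_corSum]
  have h1 : (A⁻¹).map (algebraMap ℚ ℂ) = (A.map (algebraMap ℚ ℂ))⁻¹ := by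
    symm
    refine Matrix.inv_eq_right_inv ?_
    rw [← Matrix.map_mul, Matrix.mul_nonsing_inv _ hA.det_isUnit]
    exact Matrix.map_one _ (map_zero _) (map_one _)
  rw [← h1, ← Matrix.map_mul]
  ext i j
  rw [Matrix.map_apply, Matrix.smul_apply, Matrix.smul_apply, Matrix.map_apply, smul_eq_mul,
    smul_eq_mul, map_mul]
  norm_num

theorem B0_span {σ : K →+* ℂ} (U : Submodule ℂ ℍ[ℂ,σ a,σ b])
    (h : ∀ u : B0 a b, qmap σ (u : ℍ[K,a,b]) ∈ U) (x : B0 (σ a) (σ b)) :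
    (x : ℍ[ℂ,σ a,σ b]) ∈ U := by
  have hx : (x : ℍ[ℂ,σ a,σ b]).re = 0 := by
    have : trd (x : ℍ[ℂ,σ a,σ b]) = 0 := x.2
    rw [trd_eq] at this
    simpa using this
  have e : (x : ℍ[ℂ,σ a,σ b]) =
      (x : ℍ[ℂ,σ a,σ b]).imI • (qmap σ (⟨0, 1, 0, 0⟩ : ℍ[K,a,b]) : ℍ[ℂ,σ a,σ b]) +
      (x : ℍ[ℂ,σ a,σ b]).imJ • (qmap σ (⟨0, 0, 1, 0⟩ : ℍ[K,a,b]) : ℍ[ℂ,σ a,σ b]) +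
      (x : ℍ[ℂ,σ a,σ b]).imK • (qmap σ (⟨0, 0, 0, 1⟩ : ℍ[K,a,b]) : ℍ[ℂ,σ a,σ b]) := by
    ext <;> simp [qmap, hx]
  rw [e]
  refine U.add_mem (U.add_mem (U.smul_mem _ ?_) (U.smul_mem _ ?_)) (U.smul_mem _ ?_)
  · exact h ⟨⟨0, 1, 0, 0⟩, by rw [mem_B0_iff, trd_eq]; simp⟩
  · exact h ⟨⟨0, 0, 1, 0⟩, by rw [mem_B0_iff, trd_eq]; simp⟩
  · exact h ⟨⟨0, 0, 0, 1⟩, by rw [mem_B0_iff, trd_eq]; simp⟩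

/-- The nontrivial inclusion is that each single component x_σ is reached: the complex span contains
all `corSum u` with u in B⁰, and independence of the embeddings separates the components. -/
theorem complexSpan_vk3 (hC : IsComplexification ρ ρC) (hA : IsInvariantGram ρ A) :
    complexSpan (vk3 ρ A) = LinearMap.range (xi ρC A) := by
  apply le_antisymm
  · refine Submodule.span_le.2 ?_
    rintro _ ⟨w, hw, rfl⟩
    obtain ⟨u, rfl⟩ := mem_vk3.1 hw
    rw [complexify_vEmb hC hA]
    exact Submodule.smul_mem _ _ ⟨_, rfl⟩
  · rintro _ ⟨x, rfl⟩
    let φ : DAlg ℂ a b →ₗ[ℂ] (Fin 8 → ℂ) ⊗[ℂ] (Fin 8 → ℂ) := (vMat A).comp ρC.toLinearMap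
    have h1 : ∀ u ∈ (B0 a b).toSubmodule, corSum ℂ u ∈ (complexSpan (vk3 ρ A)).comap φ := by
      intro u hu
      have h2 : complexify 8 (vEmb ρ A ⟨u, hu⟩) ∈ complexSpan (vk3 ρ A) :=
        Submodule.subset_span ⟨_, mem_vk3.2 ⟨_, rfl⟩, rfl⟩
      rw [complexify_vEmb hC hA] at h2
      have h3 := Submodule.smul_mem _ (2 : ℂ) h2
      rw [smul_smul, xi, LinearMap.comp_apply, famSum_fam] at h3
      norm_num at h3
      exact h3
    rw [xi, LinearMap.comp_apply, famSum_apply, map_sum]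
    refine Submodule.sum_mem _ fun σ _ => ?_
    exact B0_span (((complexSpan (vk3 ρ A)).comap φ).comap (inc a b σ).toLinearMap)
      (fun u => inc_mem_of_corSum_mem _ _ h1 σ _ u.2) (x σ)

end VK3

/-! ### Splittings of quaternion algebras over `ℂ` -/

section Split

variable {c d : ℂ}

theorem exists_split (hc : c ≠ 0) (hd : d ≠ 0) :
    Nonempty (ℍ[ℂ,c,d] ≃ₐ[ℂ] Matrix (Fin 2) (Fin 2) ℂ) := by
  obtain ⟨s, hs⟩ := IsAlgClosed.exists_eq_mul_self c
  have hs0 : s ≠ 0 := fun h => hc (by rw [hs, h, mul_zero])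
  subst hs
  let f : ℍ[ℂ,s * s,d] →ₐ[ℂ] Matrix (Fin 2) (Fin 2) ℂ :=
    QuaternionAlgebra.Basis.liftHom
      -- With s² = c, the subalgebra generated by i becomes diagonal and j exchanges its two
      -- eigenlines.
      { i := !![s, 0; 0, -s]
        j := !![0, d; 1, 0]
        k := !![0, s * d; -s, 0]
        i_mul_i := by ext i j; fin_cases i <;> fin_cases j <;> simp
        j_mul_j := by ext i j; fin_cases i <;> fin_cases j <;> simp
        i_mul_j := by ext i j; fin_cases i <;> fin_cases j <;> simp
        j_mul_i := by ext i j; fin_cases i <;> fin_cases j <;> simp [mul_comm] }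
  have hf : ∀ x : ℍ[ℂ,s * s,d], f x = !![x.re + s * x.imI, d * (x.imJ + s * x.imK);
      x.imJ - s * x.imK, x.re - s * x.imI] := by
    intro x
    ext i j
    fin_cases i <;> fin_cases j <;>
      simp [f, QuaternionAlgebra.Basis.liftHom, QuaternionAlgebra.Basis.lift,
        Algebra.algebraMap_eq_smul_one] <;> ring
  refine ⟨AlgEquiv.ofBijective f ⟨?_, ?_⟩⟩
  · rw [injective_iff_map_eq_zero]
    intro x hx
    rw [hf] at hx
    have h00 : x.re + s * x.imI = 0 := by simpa using congrFun (congrFun hx 0) 0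
    have h01 : d * (x.imJ + s * x.imK) = 0 := by simpa using congrFun (congrFun hx 0) 1
    have h10 : x.imJ - s * x.imK = 0 := by simpa using congrFun (congrFun hx 1) 0
    have h11 : x.re - s * x.imI = 0 := by simpa using congrFun (congrFun hx 1) 1
    have h01' := (mul_eq_zero.1 h01).resolve_left hd
    ext
    · change x.re = 0
      linear_combination (h00 + h11) / 2
    · change x.imI = 0
      refine mul_left_cancel₀ hs0 ?_
      linear_combination (h00 - h11) / 2
    · change x.imJ = 0
      linear_combination (h01' + h10) / 2
    · change x.imK = 0
      refine mul_left_cancel₀ hs0 ?_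
      linear_combination (h01' - h10) / 2
  · intro M
    refine ⟨⟨(M 0 0 + M 1 1) / 2, (M 0 0 - M 1 1) / (2 * s), (M 0 1 / d + M 1 0) / 2,
      (M 0 1 / d - M 1 0) / (2 * s)⟩, ?_⟩
    rw [hf]
    ext i j
    fin_cases i <;> fin_cases j <;> simp <;> field_simp <;> ring

variable (θ : ℍ[ℂ,c,d] ≃ₐ[ℂ] Matrix (Fin 2) (Fin 2) ℂ)

/-- The trace is invariant under conjugation by 1, i, j, k, and the sum of the four conjugates of x
is the scalar 2 trd x. -/
theorem trace_split (hc : c ≠ 0) (hd : d ≠ 0) (x : ℍ[ℂ,c,d]) : (θ x).trace = trd x := by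
  have hconj : ∀ (r : ℂ) (y : ℍ[ℂ,c,d]), r • (y * y) = 1 →
      (θ (r • (y * x * y))).trace = (θ x).trace := by
    intro r y hy
    have h1 : r • (θ y * θ y) = 1 := by rw [← map_mul, ← map_smul, hy, map_one]
    rw [map_smul, map_mul, map_mul, Matrix.trace_smul, Matrix.trace_mul_comm, ← Matrix.mul_assoc,
      ← Matrix.trace_smul, ← smul_mul_assoc, h1, one_mul]
  have h := congrArg (fun z => (θ z).trace) (quat_average hc hd x)
  simp only [map_add, Matrix.trace_add] at h
  rw [hconj _ _ (by ext <;> simp [hc]), hconj _ _ (by ext <;> simp [hd]),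
    hconj _ _ (by ext <;> simp; field_simp), AlgEquiv.commutes, Algebra.algebraMap_eq_smul_one,
    Matrix.trace_smul, Matrix.trace_one] at h
  simp only [Fintype.card_fin, smul_eq_mul] at h
  push_cast at h
  linear_combination h / 4

/-- For 2 × 2 matrices twice the determinant is tr(M)² - tr(M²), and the same identity relates nrd
and trd. -/
theorem det_split (hc : c ≠ 0) (hd : d ≠ 0) (x : ℍ[ℂ,c,d]) : (θ x).det = nrd x := by
  have h1 : ∀ M : Matrix (Fin 2) (Fin 2) ℂ, 2 * M.det = M.trace ^ 2 - (M * M).trace := by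
    intro M
    simp [Matrix.det_fin_two, Matrix.trace_fin_two, Matrix.mul_apply, Fin.sum_univ_two]
    ring
  have h2 := h1 (θ x)
  rw [← map_mul, trace_split θ hc hd, trace_split θ hc hd] at h2
  have h3 : trd x ^ 2 - trd (x * x) = 2 * nrd x := by
    rw [trd_eq, trd_eq, nrd_eq]
    simp only [QuaternionAlgebra.re_mul]
    ring
  rw [h3] at h2
  exact mul_left_cancel₀ two_ne_zero h2

/-- The isomorphism of `B⁰` with `Sym²(St)` given by a splitting. -/
def symEquiv (hc : c ≠ 0) (hd : d ≠ 0) : B0 c d ≃ₗ[ℂ] symTensors ℂ 2 where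
  -- The matrix on the right is the invariant symplectic form of SL₂; multiplication by it exchanges
  -- trace-zero and symmetric matrices, as `vEmb` does for G.
  toFun x := ⟨(tmat ℂ 2).symm (θ (x : ℍ[ℂ,c,d]) * !![0, 1; -1, 0]), by
    have h : (θ (x : ℍ[ℂ,c,d])).trace = 0 := by rw [trace_split θ hc hd]; exact x.2
    rw [Matrix.trace_fin_two] at h
    rw [mem_symTensors_iff, LinearEquiv.apply_symm_apply]
    generalize θ (x : ℍ[ℂ,c,d]) = M at h
    ext i j
    fin_cases i <;> fin_cases j <;> simp [Matrix.mul_apply, Fin.sum_univ_two]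
    · linear_combination -h
    · linear_combination h⟩
  map_add' x y := Subtype.ext (by
    change (tmat ℂ 2).symm (θ ((x : ℍ[ℂ,c,d]) + (y : ℍ[ℂ,c,d])) * _) = _ + _
    rw [map_add, add_mul, map_add])
  map_smul' r x := Subtype.ext (by
    change (tmat ℂ 2).symm (θ (r • (x : ℍ[ℂ,c,d])) * _) = r • _
    rw [map_smul, smul_mul_assoc, map_smul])
  invFun w := ⟨θ.symm (tmat ℂ 2 (w : (Fin 2 → ℂ) ⊗[ℂ] (Fin 2 → ℂ)) * !![0, -1; 1, 0]), by
    have h := (mem_symTensors_iff _).1 w.2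
    rw [mem_B0_iff, ← trace_split θ hc hd, AlgEquiv.apply_symm_apply]
    generalize tmat ℂ 2 (w : (Fin 2 → ℂ) ⊗[ℂ] (Fin 2 → ℂ)) = M at h
    have h01 := congrFun (congrFun h 0) 1
    rw [Matrix.transpose_apply] at h01
    simp [Matrix.trace_fin_two, Matrix.mul_apply, Fin.sum_univ_two]
    linear_combination -h01⟩
  left_inv x := Subtype.ext (by
    have h : (!![0, 1; -1, 0] : Matrix (Fin 2) (Fin 2) ℂ) * !![0, -1; 1, 0] = 1 := by
      ext i j; fin_cases i <;> fin_cases j <;> simp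
    change θ.symm (tmat ℂ 2 ((tmat ℂ 2).symm _) * _) = _
    rw [LinearEquiv.apply_symm_apply, Matrix.mul_assoc, h, Matrix.mul_one,
      AlgEquiv.symm_apply_apply])
  right_inv w := Subtype.ext (by
    have h : (!![0, -1; 1, 0] : Matrix (Fin 2) (Fin 2) ℂ) * !![0, 1; -1, 0] = 1 := by
      ext i j; fin_cases i <;> fin_cases j <;> simp
    change (tmat ℂ 2).symm (θ (θ.symm _) * _) = _
    rw [AlgEquiv.apply_symm_apply, Matrix.mul_assoc, h, Matrix.mul_one,
      LinearEquiv.symm_apply_apply])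

theorem tmat_symEquiv (hc : c ≠ 0) (hd : d ≠ 0) (x : B0 c d) :
    tmat ℂ 2 (symEquiv θ hc hd x : (Fin 2 → ℂ) ⊗[ℂ] (Fin 2 → ℂ)) =
      θ (x : ℍ[ℂ,c,d]) * !![0, 1; -1, 0] :=
  (tmat ℂ 2).apply_symm_apply _

theorem act_symEquiv (hc : c ≠ 0) (hd : d ≠ 0) {g : ℍ[ℂ,c,d]} (hg : nrd g = 1) (x : B0 c d) :
    act (θ g) (symEquiv θ hc hd x : (Fin 2 → ℂ) ⊗[ℂ] (Fin 2 → ℂ)) =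
      symEquiv θ hc hd (Ad g x) := by
  refine (tmat ℂ 2).injective ?_
  rw [tmat_act, tmat_symEquiv, tmat_symEquiv, ← Matrix.mul_assoc, ← map_mul, mul_eq_Ad_mul hg,
    map_mul]
  have hdet := det_split θ hc hd g
  rw [hg, Matrix.det_fin_two] at hdet
  -- A 2 × 2 matrix of determinant one preserves the standard symplectic form.
  have key : θ g * !![0, 1; -1, 0] * (θ g).transpose = !![0, 1; -1, 0] := by
    generalize θ g = M at hdet
    ext i j
    fin_cases i <;> fin_cases j <;> simp [Matrix.mul_apply, Fin.sum_univ_two]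
    · ring
    · linear_combination hdet
    · linear_combination -hdet
    · ring
  rw [Matrix.mul_assoc, Matrix.mul_assoc, ← Matrix.mul_assoc (θ g), key]

end Split

/-! ### Existence and uniqueness of V_{K3} -/

section Uniqueness

variable {K : Type*} [Field K] [NumberField K] {a b : K}
  {ρ : CorAlg a b ≃ₐ[ℚ] Matrix (Fin 8) (Fin 8) ℚ}
  {ρC : DAlg ℂ a b →ₐ[ℂ] Matrix (Fin 8) (Fin 8) ℂ} {A : Matrix (Fin 8) (Fin 8) ℚ}

theorem isVK3_vk3 (hC : IsComplexification ρ ρC) (hA : IsInvariantGram ρ A) (ha : a ≠ 0)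
    (hb : b ≠ 0) : IsVK3 ρC (vk3 ρ A) := by
  rw [IsVK3, complexSpan_vk3 hC hA]
  have ha' : ∀ σ : K →+* ℂ, σ a ≠ 0 := fun σ => (map_ne_zero σ).2 ha
  have hb' : ∀ σ : K →+* ℂ, σ b ≠ 0 := fun σ => (map_ne_zero σ).2 hb
  let θ := fun σ : K →+* ℂ => (exists_split (ha' σ) (hb' σ)).some
  refine ⟨?_, θ, ((LinearEquiv.ofInjective (xi ρC A) (xi_injective hA ha hb)).symm).trans
    (LinearEquiv.piCongrRight fun σ => symEquiv (θ σ) (ha' σ) (hb' σ)), ?_⟩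
  · rintro g hg _ ⟨x, rfl⟩
    exact ⟨_, (actG_xi hC hA hg x).symm⟩
  · intro g hg w w' hw σ
    obtain ⟨x, rfl⟩ := (LinearEquiv.ofInjective (xi ρC A) (xi_injective hA ha hb)).surjective w
    obtain ⟨x', rfl⟩ := (LinearEquiv.ofInjective (xi ρC A) (xi_injective hA ha hb)).surjective w'
    rw [LinearEquiv.ofInjective_apply, LinearEquiv.ofInjective_apply, actG_xi hC hA hg,
      (xi_injective hA ha hb).eq_iff] at hw
    subst hw
    rw [LinearEquiv.trans_apply, LinearEquiv.trans_apply, LinearEquiv.symm_apply_apply,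
      LinearEquiv.symm_apply_apply]
    exact (act_symEquiv (θ σ) (ha' σ) (hb' σ) (hg σ) (x σ)).symm

/-- Sym²(St_σ) is replaced by B⁰_σ with the adjoint action. The choice of splittings disappears, so
any two candidates can be compared. -/
theorem IsVK3.exists_equiv {W : Submodule ℚ ((Fin 8 → ℚ) ⊗[ℚ] (Fin 8 → ℚ))} (hW : IsVK3 ρC W)
    (ha : a ≠ 0) (hb : b ≠ 0) :
    ∃ F : complexSpan W ≃ₗ[ℂ] (∀ σ : K →+* ℂ, B0 (σ a) (σ b)),
      ∀ g : ∀ σ : K →+* ℂ, ℍ[ℂ,σ a,σ b], (∀ σ, nrd (g σ) = 1) → ∀ x,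
        actG ρC g (F.symm x) = F.symm (adFam g x) := by
  have ha' : ∀ σ : K →+* ℂ, σ a ≠ 0 := fun σ => (map_ne_zero σ).2 ha
  have hb' : ∀ σ : K →+* ℂ, σ b ≠ 0 := fun σ => (map_ne_zero σ).2 hb
  obtain ⟨h1, θ, F, hF⟩ := hW
  let E := LinearEquiv.piCongrRight fun σ => symEquiv (θ σ) (ha' σ) (hb' σ)
  refine ⟨F.trans E.symm, fun g hg x => ?_⟩
  have h2 := h1 g hg _ (F.symm (E x)).2
  have h3 := hF g hg (F.symm (E x)) ⟨_, h2⟩ rfl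
  have h4 : F ⟨_, h2⟩ = E (adFam g x) := by
    funext σ
    refine Subtype.ext ((h3 σ).trans ?_)
    rw [LinearEquiv.apply_symm_apply]
    exact act_symEquiv (θ σ) (ha' σ) (hb' σ) (hg σ) (x σ)
  have h5 : (⟨_, h2⟩ : complexSpan W) = F.symm (E (adFam g x)) := by
    rw [← h4, LinearEquiv.symm_apply_apply]
  exact congrArg Subtype.val h5

theorem span_range_NmCor :
    Submodule.span ℚ (Set.range (NmCor : ℍ[K,a,b] → CorAlg a b)) = ⊤ := by
  let β := Module.Basis.ofSpan (span_range_Nm (K := K) (L := AlgebraicClosure ℚ)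
    (a := a) (b := b)).ge
  have : Fintype _ := FiniteDimensional.fintypeBasisIndex β
  have hβ : ∀ i, ∃ γ : ℍ[K,a,b], Nm _ γ = β i := fun i => by
    obtain ⟨γ, hγ⟩ := Module.Basis.ofSpan_subset (span_range_Nm (K := K)
      (L := AlgebraicClosure ℚ) (a := a) (b := b)).ge (Set.mem_range_self i)
    exact ⟨γ, hγ⟩
  choose γ hγ using hβ
  have hmem : ∀ i, β i ∈ CorAlg a b := fun i => hγ i ▸ (NmCor (γ i)).2
  have hNm : ∀ i, (⟨β i, hmem i⟩ : CorAlg a b) = NmCor (γ i) := fun i =>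
    Subtype.ext (hγ i).symm
  refine eq_top_iff.2 fun x _ => ?_
  obtain ⟨q, rfl⟩ := exists_rat_repr_of_mem_CorAlg β hmem x
  exact Submodule.sum_mem _ fun i _ => Submodule.smul_mem _ _
    (Submodule.subset_span ⟨γ i, (hNm i).symm⟩)

/-- Norms span Cor(B) over ℚ, so the image contains every rational matrix, and these span over ℂ. -/
theorem surjective_of_isComplexification (hC : IsComplexification ρ ρC) :
    Function.Surjective ρC := by
  let m : Matrix (Fin 8) (Fin 8) ℚ →ₐ[ℚ] Matrix (Fin 8) (Fin 8) ℂ :=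
    (Algebra.ofId ℚ ℂ).mapMatrix
  have hrat : ∀ M : Matrix (Fin 8) (Fin 8) ℚ, m M ∈ LinearMap.range ρC.toLinearMap := by
    intro M
    obtain ⟨x, rfl⟩ := ρ.surjective M
    suffices h : x ∈ ((LinearMap.range ρC.toLinearMap).restrictScalars ℚ).comap
        (m.toLinearMap.comp ρ.toLinearMap) from h
    refine (Submodule.span_le.2 ?_ : Submodule.span ℚ (Set.range NmCor) ≤ _)
      (by rw [span_range_NmCor]; trivial)
    rintro _ ⟨γ, rfl⟩
    exact ⟨Nm ℂ γ, hC γ⟩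
  intro M
  suffices h : M ∈ LinearMap.range ρC.toLinearMap from h
  rw [Matrix.matrix_eq_sum_single M]
  refine Submodule.sum_mem _ fun i _ => Submodule.sum_mem _ fun j _ => ?_
  have h1 : Matrix.single i j (M i j) =
      M i j • (Matrix.single i j (1 : ℚ)).map (algebraMap ℚ ℂ) := by
    ext k l
    simp [Matrix.single_apply]
  rw [h1]
  exact Submodule.smul_mem _ _ (hrat _)

open scoped Classical in
theorem inc_mul_tprod_mul_inc (τ : K →+* ℂ) (p q : ℍ[ℂ,τ a,τ b])
    (x : ∀ σ : K →+* ℂ, ℍ[ℂ,σ a,σ b]) :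
    inc a b τ p * PiTensorProduct.tprod ℂ x * inc a b τ q =
      PiTensorProduct.tprod ℂ (Function.update x τ (p * x τ * q)) := by
  rw [inc_apply, inc_apply, PiTensorProduct.tprod_mul_tprod, PiTensorProduct.tprod_mul_tprod]
  congr 1
  funext σ
  by_cases h : σ = τ
  · subst h
    simp
  · simp [Function.update_of_ne h, Pi.mulSingle_eq_of_ne h]

/-- A matrix that commutes with the factors `B^τ` for `τ ∈ s` comes from the other factors. -/
theorem mem_map_span_of_commute (hC : IsComplexification ρ ρC) (ha : a ≠ 0) (hb : b ≠ 0)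
    (s : Finset (K →+* ℂ)) (X : Matrix (Fin 8) (Fin 8) ℂ)
    (hX : ∀ τ ∈ s, ∀ x : ℍ[ℂ,τ a,τ b], Commute (ρC (inc a b τ x)) X) :
    X ∈ (Submodule.span ℂ {z : DAlg ℂ a b | ∃ x : ∀ σ : K →+* ℂ, ℍ[ℂ,σ a,σ b],
      (∀ τ ∈ s, x τ = 1) ∧ z = PiTensorProduct.tprod ℂ x}).map ρC.toLinearMap := by
  classical
  induction s using Finset.induction_on with
  | empty =>
    obtain ⟨z, rfl⟩ := surjective_of_isComplexification hC X
    refine ⟨z, ?_, rfl⟩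
    have := PiTensorProduct.span_tprod_eq_top (R := ℂ) (s := fun σ : K →+* ℂ => ℍ[ℂ,σ a,σ b])
    have hz : z ∈ (⊤ : Submodule ℂ (DAlg ℂ a b)) := trivial
    rw [← this] at hz
    refine Submodule.span_mono ?_ hz
    rintro _ ⟨x, rfl⟩
    exact ⟨x, by simp, rfl⟩
  | insert τ s hτ ih =>
    obtain ⟨z, hz, rfl⟩ := ih fun σ hσ => hX σ (Finset.mem_insert_of_mem hσ)
    have hc : τ a ≠ 0 := (map_ne_zero τ).2 ha
    have hd : τ b ≠ 0 := (map_ne_zero τ).2 hb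
    let S : ℍ[ℂ,τ a,τ b] → DAlg ℂ a b →ₗ[ℂ] DAlg ℂ a b := fun p =>
      { toFun := fun z => inc a b τ p * z * inc a b τ p
        map_add' := fun y z => by rw [mul_add, add_mul]
        map_smul' := fun r z => by
          rw [DAlg_mul_smul, DAlg_smul_mul, RingHom.id_apply] }
    have hS : ∀ p z, S p z = inc a b τ p * z * inc a b τ p := fun _ _ => rfl
    -- Averaging over the factor at τ: it replaces the τ-component of a pure tensor by a scalar,
    -- while it multiplies by 4 the image of an element whose image commutes with B^τ.
    let E : DAlg ℂ a b →ₗ[ℂ] DAlg ℂ a b := LinearMap.id + (τ a)⁻¹ • S ⟨0, 1, 0, 0⟩ +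
      (τ b)⁻¹ • S ⟨0, 0, 1, 0⟩ + (-(τ a * τ b)⁻¹) • S ⟨0, 0, 0, 1⟩
    have hE : ∀ x : ∀ σ : K →+* ℂ, ℍ[ℂ,σ a,σ b], E (PiTensorProduct.tprod ℂ x) =
        (2 * trd (x τ)) • PiTensorProduct.tprod ℂ (Function.update x τ 1) := by
      intro x
      simp only [E, LinearMap.add_apply, LinearMap.smul_apply, LinearMap.id_apply, hS,
        inc_mul_tprod_mul_inc]
      rw [← MultilinearMap.map_update_smul, ← MultilinearMap.map_update_smul,
        ← MultilinearMap.map_update_smul, ← MultilinearMap.map_update_smul]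
      nth_rw 1 [← Function.update_eq_self τ x]
      rw [← MultilinearMap.map_update_add, ← MultilinearMap.map_update_add,
        ← MultilinearMap.map_update_add, quat_average hc hd, Algebra.algebraMap_eq_smul_one]
    have hEz : ρC (E z) = (4 : ℂ) • ρC z := by
      have h1 : ∀ (r : ℂ) (p : ℍ[ℂ,τ a,τ b]), r • (p * p) = 1 → ρC (r • S p z) = ρC z := by
        intro r p hp
        have hcomm := hX τ (Finset.mem_insert_self _ _) p
        rw [hS, map_smul, map_mul, map_mul]
        rw [AlgHom.toLinearMap_apply] at hcomm
        rw [hcomm.eq]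
        rw [mul_assoc, ← mul_smul_comm, ← map_mul, ← map_mul, ← map_smul, ← map_smul, hp, map_one,
          map_one, mul_one]
      simp only [E, LinearMap.add_apply, LinearMap.smul_apply, LinearMap.id_apply, map_add]
      rw [h1 _ _ (by ext <;> simp [hc]), h1 _ _ (by ext <;> simp [hd]),
        h1 _ _ (by ext <;> simp; field_simp)]
      module
    refine ⟨(1 / 4 : ℂ) • E z, Submodule.smul_mem _ _ ?_, ?_⟩
    · suffices h : z ∈ Submodule.comap E (Submodule.span ℂ {z : DAlg ℂ a b |
          ∃ x : ∀ σ : K →+* ℂ, ℍ[ℂ,σ a,σ b],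
            (∀ σ ∈ insert τ s, x σ = 1) ∧ z = PiTensorProduct.tprod ℂ x}) from h
      refine Submodule.span_le.2 ?_ hz
      rintro _ ⟨x, hx, rfl⟩
      rw [SetLike.mem_coe, Submodule.mem_comap, hE]
      refine Submodule.smul_mem _ _ (Submodule.subset_span ⟨_, fun σ hσ => ?_, rfl⟩)
      by_cases h : σ = τ
      · subst h
        simp
      · rw [Function.update_of_ne h]
        exact hx σ ((Finset.mem_insert.1 hσ).resolve_left h)
    · change ρC ((1 / 4 : ℂ) • E z) = ρC z
      rw [map_smul, hEz, smul_smul]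
      norm_num

/-- The centralizer of all factors other than B^σ is B^σ: average over every other factor. -/
theorem exists_inc_of_commute (hC : IsComplexification ρ ρC) (ha : a ≠ 0) (hb : b ≠ 0)
    (σ : K →+* ℂ) (X : Matrix (Fin 8) (Fin 8) ℂ)
    (hX : ∀ τ ≠ σ, ∀ x : ℍ[ℂ,τ a,τ b], Commute (ρC (inc a b τ x)) X) :
    ∃ x, X = ρC (inc a b σ x) := by
  classical
  obtain ⟨z, hz, rfl⟩ := mem_map_span_of_commute hC ha hb (Finset.univ.erase σ) X
    fun τ hτ => hX τ (Finset.ne_of_mem_erase hτ)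
  suffices h : z ∈ LinearMap.range (inc a b σ).toLinearMap by
    obtain ⟨x, rfl⟩ := h
    exact ⟨x, rfl⟩
  refine Submodule.span_le.2 ?_ hz
  rintro _ ⟨x, hx, rfl⟩
  refine ⟨x σ, ?_⟩
  rw [AlgHom.toLinearMap_apply, inc_apply]
  congr 1
  funext τ
  by_cases h : τ = σ
  · subst h
    rw [Pi.mulSingle_eq_same]
  · rw [Pi.mulSingle_eq_of_ne h, hx τ (by simp [h])]

/-- The elements of reduced norm one span a quaternion algebra over `ℂ`. -/
theorem span_nrd_one {c d : ℂ} (hc : c ≠ 0) (hd : d ≠ 0) (U : Submodule ℂ ℍ[ℂ,c,d])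
    (h : ∀ g, nrd g = 1 → g ∈ U) (x : ℍ[ℂ,c,d]) : x ∈ U := by
  have key : ∀ y : ℍ[ℂ,c,d], nrd y ≠ 0 → y ∈ U := by
    intro y hy
    obtain ⟨s, hs⟩ := IsAlgClosed.exists_eq_mul_self (nrd y)
    have hs0 : s ≠ 0 := fun h0 => hy (by rw [hs, h0, mul_zero])
    have h1 : s⁻¹ • y ∈ U := h _ (by rw [nrd_smul, hs]; field_simp)
    have h2 := U.smul_mem s h1
    rwa [smul_smul, mul_inv_cancel₀ hs0, one_smul] at h2
  have e : x = x.re • ⟨1, 0, 0, 0⟩ + x.imI • ⟨0, 1, 0, 0⟩ + x.imJ • ⟨0, 0, 1, 0⟩ +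
      x.imK • ⟨0, 0, 0, 1⟩ := by
    ext <;> simp
  rw [e]
  refine U.add_mem (U.add_mem (U.add_mem (U.smul_mem _ ?_) (U.smul_mem _ ?_)) (U.smul_mem _ ?_))
    (U.smul_mem _ ?_) <;> refine key _ ?_ <;> rw [nrd_eq] <;> simp [hc, hd]

/-- The averaging over 1, i, j, k is rescaled to norm-one elements, so that it takes place inside
G(ℂ). -/
theorem exists_average {c d : ℂ} (hc : c ≠ 0) (hd : d ≠ 0) :
    ∃ g : Fin 4 → ℍ[ℂ,c,d], (∀ i, nrd (g i) = 1) ∧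
      ∀ x, ∑ i, g i * x * star (g i) = algebraMap ℂ _ (2 * trd x) := by
  obtain ⟨r, hr⟩ := IsAlgClosed.exists_eq_mul_self (-c)⁻¹
  obtain ⟨s, hs⟩ := IsAlgClosed.exists_eq_mul_self (-d)⁻¹
  obtain ⟨t, ht⟩ := IsAlgClosed.exists_eq_mul_self (c * d)⁻¹
  refine ⟨![1, r • ⟨0, 1, 0, 0⟩, s • ⟨0, 0, 1, 0⟩, t • ⟨0, 0, 0, 1⟩], fun i => ?_, fun x => ?_⟩
  · fin_cases i
    · exact nrd_one
    · change nrd (r • (⟨0, 1, 0, 0⟩ : ℍ[ℂ,c,d])) = 1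
      rw [nrd_smul, nrd_eq, sq, ← hr]
      simp [hc]
    · change nrd (s • (⟨0, 0, 1, 0⟩ : ℍ[ℂ,c,d])) = 1
      rw [nrd_smul, nrd_eq, sq, ← hs]
      simp [hd]
    · change nrd (t • (⟨0, 0, 0, 1⟩ : ℍ[ℂ,c,d])) = 1
      rw [nrd_smul, nrd_eq, sq, ← ht]
      simp
      field_simp
  · have hI : star (⟨0, 1, 0, 0⟩ : ℍ[ℂ,c,d]) = -⟨0, 1, 0, 0⟩ := by ext <;> simp
    have hJ : star (⟨0, 0, 1, 0⟩ : ℍ[ℂ,c,d]) = -⟨0, 0, 1, 0⟩ := by ext <;> simp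
    have hK : star (⟨0, 0, 0, 1⟩ : ℍ[ℂ,c,d]) = -⟨0, 0, 0, 1⟩ := by ext <;> simp
    rw [← quat_average hc hd x, Fin.sum_univ_four]
    have h1 : ∀ (r c : ℂ) (p : ℍ[ℂ,_,_]), star p = -p → (-c)⁻¹ = r * r →
        (r • p) * x * star (r • p) = c⁻¹ • (p * x * p) := by
      intro r c p hp hr
      have : star (r • p) = -(r • p) := by
        rw [← smul_neg, ← hp]; ext <;> simp
      rw [this, mul_neg, smul_mul_assoc, smul_mul_assoc, mul_smul_comm, smul_smul, ← hr, inv_neg,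
        neg_smul, neg_neg]
    have h2 := h1 r c _ hI hr
    have h3 := h1 s d _ hJ hs
    have h4 := h1 t (-(c * d)) _ hK (by rw [neg_neg, ht])
    rw [inv_neg] at h4
    rw [← h2, ← h3, ← h4]
    simp

/-- A matrix fixed by the norm-one elements of B^τ commutes with them, and they span B^τ. -/
theorem commute_of_adFam_eq (hC : IsComplexification ρ ρC) (hA : IsInvariantGram ρ A)
    (ha : a ≠ 0) (hb : b ≠ 0) (τ : K →+* ℂ) (M : Matrix (Fin 8) (Fin 8) ℂ)
    (h : ∀ g : ∀ σ : K →+* ℂ, ℍ[ℂ,σ a,σ b], (∀ σ, nrd (g σ) = 1) → (∀ σ ≠ τ, g σ = 1) →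
      actG ρC g (vMat A M) = vMat A M) (x : ℍ[ℂ,τ a,τ b]) : Commute (ρC (inc a b τ x)) M := by
  classical
  let U : Submodule ℂ ℍ[ℂ,τ a,τ b] :=
    LinearMap.ker (((LinearMap.mulRight ℂ M) - (LinearMap.mulLeft ℂ M)).comp
      (ρC.toLinearMap.comp (inc a b τ).toLinearMap))
  have hU : ∀ x, x ∈ U ↔ Commute (ρC (inc a b τ x)) M := fun x => by
    rw [LinearMap.mem_ker]
    exact sub_eq_zero
  rw [← hU]
  refine span_nrd_one ((map_ne_zero τ).2 ha) ((map_ne_zero τ).2 hb) U (fun g hg => ?_) x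
  rw [hU]
  have hn : ∀ σ, nrd (Pi.mulSingle (M := fun σ : K →+* ℂ => ℍ[ℂ,σ a,σ b]) τ g σ) = 1 := by
    intro σ
    by_cases h : σ = τ
    · subst h
      rw [Pi.mulSingle_eq_same, hg]
    · rw [Pi.mulSingle_eq_of_ne h, nrd_one]
  have h1 := (actG_vMat_eq_iff hC hA hn M M).1 (h _ hn fun σ hσ => Pi.mulSingle_eq_of_ne hσ _)
  exact h1

/-- A vector in the summand at σ is fixed by all other factors of G(ℂ), so as a matrix it lies in
B^σ. It has trace zero by averaging, so it lies in the image of `xi`. -/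
theorem complexSpan_le_of_isVK3 (hC : IsComplexification ρ ρC) (hA : IsInvariantGram ρ A)
    (ha : a ≠ 0) (hb : b ≠ 0) {W : Submodule ℚ ((Fin 8 → ℚ) ⊗[ℚ] (Fin 8 → ℚ))}
    (hW : IsVK3 ρC W) : complexSpan W ≤ LinearMap.range (xi ρC A) := by
  classical
  obtain ⟨F, hF⟩ := hW.exists_equiv ha hb
  have key : ∀ (σ : K →+* ℂ) (y : B0 (σ a) (σ b)),
      (F.symm (Pi.single σ y) : (Fin 8 → ℂ) ⊗[ℂ] (Fin 8 → ℂ)) ∈ LinearMap.range (xi ρC A) := by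
    intro σ y
    obtain ⟨M, hM⟩ := (vMat_bijective hA).2 (F.symm (Pi.single σ y))
    obtain ⟨x, rfl⟩ := exists_inc_of_commute hC ha hb σ M fun τ hτ =>
      commute_of_adFam_eq hC hA ha hb τ M fun g hg hg1 => by
        rw [hM, hF g hg]
        congr 2
        funext τ'
        rw [adFam_apply]
        by_cases h : τ' = σ
        · subst h
          rw [hg1 τ' hτ.symm, Pi.single_eq_same]
          refine Subtype.ext ?_
          change 1 * (y : ℍ[ℂ,τ' a,τ' b]) * star 1 = _
          rw [star_one, one_mul, mul_one]
        · rw [Pi.single_eq_of_ne h, map_zero]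
    have hc : σ a ≠ 0 := (map_ne_zero σ).2 ha
    have hd : σ b ≠ 0 := (map_ne_zero σ).2 hb
    -- Average over the norm-one elements at σ. On the abstract side the trace-zero element y
    -- averages to zero; on the matrix side x averages to the scalar 2 trd x.
    have hx : trd x = 0 := by
      obtain ⟨g, hg, hsum⟩ := exists_average hc hd
      have hn : ∀ i τ, nrd (Pi.mulSingle (M := fun σ : K →+* ℂ => ℍ[ℂ,σ a,σ b]) σ (g i) τ) = 1 := by
        intro i τ
        by_cases h : τ = σ
        · subst h
          rw [Pi.mulSingle_eq_same, hg]
        · rw [Pi.mulSingle_eq_of_ne h, nrd_one]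
      have h1 : ∀ i, actG ρC (Pi.mulSingle σ (g i)) (vMat A (ρC (inc a b σ x))) =
          vMat A (ρC (inc a b σ (g i * x * star (g i)))) := by
        intro i
        refine (actG_vMat_eq_iff hC hA (hn i) _ _).2 ?_
        rw [← map_mul, ← map_mul, tprod_mul_inc _ σ x (g i * x * star (g i))]
        rw [Pi.mulSingle_eq_same, mul_assoc _ (star _), star_mul_eq_nrd, hg, map_one, mul_one]
      have h2 : ∀ i, adFam (Pi.mulSingle σ (g i)) (Pi.single σ y) =
          Pi.single σ (Ad (g i) y) := by
        intro i
        funext τ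
        rw [adFam_apply]
        by_cases h : τ = σ
        · subst h
          rw [Pi.single_eq_same, Pi.single_eq_same, Pi.mulSingle_eq_same]
        · rw [Pi.single_eq_of_ne h, Pi.single_eq_of_ne h, map_zero]
      have h3 : ∑ i, Ad (g i) y = 0 := by
        refine Subtype.ext ?_
        have h4 := hsum (y : ℍ[ℂ,σ a,σ b])
        rw [(show trd (y : ℍ[ℂ,σ a,σ b]) = 0 from y.2), mul_zero, map_zero] at h4
        refine Eq.trans ?_ h4
        exact map_sum (B0 (σ a) (σ b)).toSubmodule.subtype (fun i => Ad (g i) y) Finset.univ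
      have h5 : vMat A (ρC (inc a b σ (∑ i, g i * x * star (g i)))) = 0 := by
        simp only [map_sum, ← h1, hM, hF _ (hn _), h2]
        rw [← Submodule.coe_sum, ← map_sum]
        have h6 : ∑ i, (Pi.single σ (Ad (g i) y) : ∀ σ : K →+* ℂ, B0 (σ a) (σ b)) = 0 := by
          have := map_sum (AddMonoidHom.single (fun σ : K →+* ℂ => B0 (σ a) (σ b)) σ)
            (fun i => Ad (g i) y) Finset.univ
          rw [h3, map_zero] at this
          exact this.symm
        rw [h6, map_zero]
        rfl
      rw [hsum, AlgHom.commutes, AlgHom.commutes,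
        (map_eq_zero_iff _ (vMat_bijective hA).1), map_eq_zero_iff _
          (FaithfulSMul.algebraMap_injective ℂ (Matrix (Fin 8) (Fin 8) ℂ))] at h5
      simpa using h5
    refine ⟨Pi.single σ ⟨x, hx⟩, ?_⟩
    rw [← hM, xi, LinearMap.comp_apply, famSum_apply, Finset.sum_eq_single σ]
    · rw [Pi.single_eq_same]
    · intro τ _ hτ
      rw [Pi.single_eq_of_ne hτ]
      exact (congrArg ρC (map_zero (inc a b τ))).trans (map_zero ρC)
    · simp
  intro w hw
  have h1 : F ⟨w, hw⟩ = ∑ σ, Pi.single σ (F ⟨w, hw⟩ σ) := (Finset.univ_sum_single _).symm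
  have h2 : (⟨w, hw⟩ : complexSpan W) = ∑ σ, F.symm (Pi.single σ (F ⟨w, hw⟩ σ)) := by
    rw [← map_sum, ← h1, LinearEquiv.symm_apply_apply]
  have h3 : w = ∑ σ, (F.symm (Pi.single σ (F ⟨w, hw⟩ σ)) : (Fin 8 → ℂ) ⊗[ℂ] (Fin 8 → ℂ)) := by
    have := congrArg Subtype.val h2
    rwa [Submodule.coe_sum] at this
  rw [h3]
  exact Submodule.sum_mem _ fun σ _ => key σ _

/-- The inclusion of complexifications is an equality because both are isomorphic to ∏_σ B⁰_σ. -/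
theorem vk3_unique (hC : IsComplexification ρ ρC) (hA : IsInvariantGram ρ A)
    (ha : a ≠ 0) (hb : b ≠ 0) {W : Submodule ℚ ((Fin 8 → ℚ) ⊗[ℚ] (Fin 8 → ℚ))}
    (hW : IsVK3 ρC W) : W = vk3 ρ A := by
  refine eq_of_complexSpan_eq ?_
  rw [complexSpan_vk3 hC hA]
  refine Submodule.eq_of_le_of_finrank_eq (complexSpan_le_of_isVK3 hC hA ha hb hW) ?_
  obtain ⟨F, -⟩ := hW.exists_equiv ha hb
  rw [F.finrank_eq, LinearMap.finrank_range_of_inj (xi_injective hA ha hb)]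

end Uniqueness

/-! ### Irreducibility over the rationals -/

section Irreducible

variable {K : Type*} [Field K] [NumberField K] {a b : K}
  {ρ : CorAlg a b ≃ₐ[ℚ] Matrix (Fin 8) (Fin 8) ℚ}
  {ρC : DAlg ℂ a b →ₐ[ℂ] Matrix (Fin 8) (Fin 8) ℂ} {A : Matrix (Fin 8) (Fin 8) ℚ}

theorem corSum_lie (L : Type*) [Field L] [CharZero L] (u v : ℍ[K,a,b]) :
    corSum L (u * v - v * u) = corSum L u * corSum L v - corSum L v * corSum L u := by
  have h1 : ∀ σ : K →+* L, inc a b σ (qmap σ u) * corSum L v - corSum L v * inc a b σ (qmap σ u) =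
      inc a b σ (qmap σ (u * v - v * u)) := by
    intro σ
    rw [corSum, Finset.mul_sum, Finset.sum_mul, ← Finset.sum_sub_distrib,
      Finset.sum_eq_single σ]
    · rw [← map_mul, ← map_mul, ← map_sub, ← qmap_mul σ rfl rfl, ← qmap_mul σ rfl rfl]
      congr 1
      rw [sub_eq_iff_eq_add, ← qmap_add, sub_add_cancel]
    · intro τ _ hτ
      rw [(inc_commute hτ.symm _ _).eq, sub_self]
    · simp
  conv_rhs => rw [corSum, Finset.sum_mul, Finset.mul_sum, ← Finset.sum_sub_distrib]
  exact Finset.sum_congr rfl fun σ _ => (h1 σ).symm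

theorem complexify_act {n : ℕ} (g : Matrix (Fin n) (Fin n) ℚ)
    (x : (Fin n → ℚ) ⊗[ℚ] (Fin n → ℚ)) :
    complexify n (act g x) = act (g.map (algebraMap ℚ ℂ)) (complexify n x) := by
  refine (tmat ℂ n).injective ?_
  rw [tmat_complexify, tmat_act, tmat_act, tmat_complexify, Matrix.map_mul, Matrix.map_mul,
    Matrix.transpose_map]

/-- Differentiates stability under G(ℚ). With q = 1 + tu, the action of q²/nrd q is, up to scalars,
that of q², a polynomial curve whose derivative at t = 0 is twice the action of u. -/
theorem vEmb_lie_mem (hC : IsComplexification ρ ρC) (hA : IsInvariantGram ρ A)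
    {W : Submodule ℚ ((Fin 8 → ℚ) ⊗[ℚ] (Fin 8 → ℚ))} (hW : IsGStable ρ W) (u x : B0 a b)
    (hx : vEmb ρ A x ∈ W) : vEmb ρ A ⁅u, x⁆ ∈ W := by
  refine mem_of_complexify_mem W _ ?_
  set h := ρC (corSum ℂ (u : ℍ[K,a,b])) with hh
  set X := ρC (corSum ℂ (x : ℍ[K,a,b])) with hX
  set AC := A.map (algebraMap ℚ ℂ) with hAC
  have j1 := (hasJet_Nm ℂ (card_embeddings_pos ℂ) (u : ℍ[K,a,b])).map ρC.toLinearMap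
  have j2 := j1.bilin (LinearMap.mul ℂ (Matrix (Fin 8) (Fin 8) ℂ)) j1
  let B : Matrix (Fin 8) (Fin 8) ℂ →ₗ[ℂ] Matrix (Fin 8) (Fin 8) ℂ →ₗ[ℂ]
      (Fin 8 → ℂ) ⊗[ℂ] (Fin 8 → ℂ) :=
    LinearMap.mk₂ ℂ (fun Y Z => (tmat ℂ 8).symm
        (Y * tmat ℂ 8 (complexify 8 (vEmb ρ A x)) * Z.transpose))
      (fun Y Y' Z => by rw [add_mul, add_mul, map_add])
      (fun c Y Z => by rw [smul_mul_assoc, smul_mul_assoc, map_smul])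
      (fun Y Z Z' => by rw [Matrix.transpose_add, mul_add, map_add])
      (fun c Y Z => by rw [Matrix.transpose_smul, mul_smul_comm, map_smul])
  have hB : ∀ Y, B Y Y = act Y (complexify 8 (vEmb ρ A x)) := fun Y => by
    refine (tmat ℂ 8).injective ?_
    rw [tmat_act]
    exact (tmat ℂ 8).apply_symm_apply _
  have j3 := j2.bilin B j2
  have key := j3.mem (complexSpan W).toAddSubgroup (fun q y hy => (complexSpan W).smul_mem _ hy) _
    (infinite_nrd_ne_zero (u : ℍ[K,a,b])) (fun t ht => by
      set q : ℍ[K,a,b] := 1 + (t : K) • (u : ℍ[K,a,b]) with hq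
      -- The scalar normalization is what puts q² into G(ℚ); it is removed again below, because
      -- membership in a subspace ignores nonzero scalars.
      have hγ : nrd ((nrd q)⁻¹ • (q * q)) = 1 := by
        rw [nrd_smul, nrd_mul]
        have : nrd q ≠ 0 := ht
        field_simp
      have h1 : complexify 8 (act (ρ (NmCor ((nrd q)⁻¹ • (q * q)))) (vEmb ρ A x)) ∈
          complexSpan W := Submodule.subset_span ⟨_, hW _ hγ _ hx, rfl⟩
      rw [complexify_act, ← hC, Nm_smul, map_smul, Nm_mul, map_mul] at h1
      have hc : (∏ σ : K →+* ℂ, σ (nrd q)⁻¹) ≠ 0 :=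
        Finset.prod_ne_zero_iff.2 fun σ _ => (map_ne_zero σ).2 (inv_ne_zero ht)
      rw [← hB, map_smul, map_smul, LinearMap.smul_apply, smul_smul] at h1
      have h2 := (complexSpan W).smul_mem
        ((∏ σ : K →+* ℂ, σ (nrd q)⁻¹) * (∏ σ : K →+* ℂ, σ (nrd q)⁻¹))⁻¹ h1
      rw [smul_smul, inv_mul_cancel₀ (mul_ne_zero hc hc), one_smul] at h2
      exact h2)
  have hskew : AC⁻¹ * h.transpose = -(h * AC⁻¹) := by
    have h1 := corSum_skew hC hA (u : ℍ[K,a,b]) u.2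
    have h2 := Matrix.mul_nonsing_inv _ hA.det_map_isUnit
    have h3 := Matrix.nonsing_inv_mul _ hA.det_map_isUnit
    calc AC⁻¹ * h.transpose = AC⁻¹ * (h.transpose * AC) * AC⁻¹ := by
          rw [Matrix.mul_assoc, Matrix.mul_assoc, h2, Matrix.mul_one]
      _ = -((AC⁻¹ * AC) * h * AC⁻¹) := by
          rw [h1]
          simp only [Matrix.mul_neg, Matrix.neg_mul, Matrix.mul_assoc]
          rfl
      _ = _ := by rw [h3, Matrix.one_mul]
  have hw : tmat ℂ 8 (complexify 8 (vEmb ρ A x)) = (1 / 2 : ℂ) • (X * AC⁻¹) := by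
    rw [complexify_vEmb hC hA, map_smul, xi, LinearMap.comp_apply, tmat_vMat, famSum_fam]
  have hl : complexify 8 (vEmb ρ A ⁅u, x⁆) = (1 / 2 : ℂ) • vMat A (h * X - X * h) := by
    rw [complexify_vEmb hC hA, xi, LinearMap.comp_apply, famSum_fam, hh, hX, ← map_mul, ← map_mul,
      ← map_sub, ← corSum_lie]
    rfl
  rw [hl]
  refine (complexSpan W).smul_mem _ ?_
  refine (congrArg (· ∈ complexSpan W) ?_).mpr key
  refine (tmat ℂ 8).injective ?_
  change _ = tmat ℂ 8 ((tmat ℂ 8).symm _ + (tmat ℂ 8).symm _)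
  rw [map_add, LinearEquiv.apply_symm_apply, LinearEquiv.apply_symm_apply, hw, tmat_vMat]
  simp only [AlgHom.toLinearMap_apply, map_one, LinearMap.mul_apply', one_mul, mul_one,
    Matrix.transpose_one, Matrix.transpose_add]
  rw [← hh, smul_mul_assoc, mul_smul_comm, mul_add, Matrix.mul_assoc, hskew, sub_mul]
  simp only [add_mul, Matrix.mul_neg, Matrix.mul_assoc]
  module

/-- A nonzero additive subgroup of `B⁰` stable under brackets with `B⁰` is everything. -/
theorem eq_top_of_lie_mem (ha : a ≠ 0) (hb : b ≠ 0) (S : AddSubgroup (B0 a b))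
    (hS : ∀ u : B0 a b, ∀ x ∈ S, ⁅u, x⁆ ∈ S) (x : B0 a b) (hx : x ∈ S) (hx0 : x ≠ 0)
    (y : B0 a b) : y ∈ S := by
  have mk : ∀ p q r : K, trd (⟨0, p, q, r⟩ : ℍ[K,a,b]) = 0 := fun p q r => by
    rw [trd_eq]; simp
  let v : K → K → K → B0 a b := fun p q r => ⟨⟨0, p, q, r⟩, mk p q r⟩
  have hv : ∀ z : B0 a b, ∃ p q r, z = v p q r := fun z => by
    refine ⟨(z : ℍ[K,a,b]).imI, (z : ℍ[K,a,b]).imJ, (z : ℍ[K,a,b]).imK, Subtype.ext ?_⟩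
    have : trd (z : ℍ[K,a,b]) = 0 := z.2
    rw [trd_eq] at this
    have h0 : (z : ℍ[K,a,b]).re = 0 := by simpa using this
    ext
    · exact h0
    all_goals rfl
  have hl : ∀ p q r p' q' r', ⁅v p q r, v p' q' r'⁆ = v (-2 * b * (q * r' - r * q'))
      (2 * a * (p * r' - r * p')) (2 * (p * q' - q * p')) := by
    intro p q r p' q' r'
    refine Subtype.ext ?_
    change (⟨0, p, q, r⟩ : ℍ[K,a,b]) * ⟨0, p', q', r'⟩ - ⟨0, p', q', r'⟩ * ⟨0, p, q, r⟩ =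
      ⟨0, _, _, _⟩
    ext <;> simp <;> ring
  have hadd : ∀ p q r p' q' r', v p q r + v p' q' r' = v (p + p') (q + q') (r + r') := by
    intro p q r p' q' r'
    refine Subtype.ext ?_
    change (⟨0, p, q, r⟩ : ℍ[K,a,b]) + ⟨0, p', q', r'⟩ = ⟨0, _, _, _⟩
    ext <;> simp
  have h2 : (2 : K) ≠ 0 := two_ne_zero
  have hIJ : (∀ p, v p 0 0 ∈ S) → ∀ q, v 0 q 0 ∈ S := fun h q => by
    have := hS (v 0 0 (-q / (2 * a))) _ (h 1)
    rw [hl] at this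
    convert this using 2 <;> field_simp <;> ring
  have hIK : (∀ p, v p 0 0 ∈ S) → ∀ q, v 0 0 q ∈ S := fun h q => by
    have := hS (v 0 (-q / 2) 0) _ (h 1)
    rw [hl] at this
    convert this using 2 <;> field_simp <;> ring
  have hJI : (∀ p, v 0 p 0 ∈ S) → ∀ q, v q 0 0 ∈ S := fun h q => by
    have := hS (v 0 0 (q / (2 * b))) _ (h 1)
    rw [hl] at this
    convert this using 2 <;> field_simp <;> ring
  have hall : (∀ p, v p 0 0 ∈ S) → y ∈ S := fun h => by
    obtain ⟨p, q, r, rfl⟩ := hv y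
    have := S.add_mem (S.add_mem (h p) (hIJ h q)) (hIK h r)
    rw [hadd, hadd] at this
    simpa using this
  obtain ⟨p, q, r, rfl⟩ := hv x
  by_cases hq : q = 0
  · by_cases hr : r = 0
    · have hp : p ≠ 0 := by
        rintro rfl
        subst hq hr
        exact hx0 rfl
      -- The group `S` is not assumed to be a K-subspace: arbitrary K-multiples are produced by
      -- scaling the element with which the bracket is taken. Here x = p i; a bracket with j gives a
      -- multiple of k, and a bracket with a multiple of i gives any multiple of j.
      refine hall (hJI fun s => ?_)
      have := hS (v (s / (-4 * a * p)) 0 0) _ (hS (v 0 1 0) _ hx)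
      rw [hl, hl] at this
      convert this using 2 <;> field_simp <;> ring
    -- A bracket with i removes the i-coordinate, and a second bracket leads back to the line of i
    -- with an arbitrary coefficient.
    · refine hall fun s => ?_
      have := hS (v 0 0 (s / (4 * a * b * r))) _ (hS (v 1 0 0) _ hx)
      rw [hl, hl] at this
      subst hq
      convert this using 2 <;> field_simp <;> ring
  · refine hall fun s => ?_
    have := hS (v 0 (s / (-4 * b * q)) 0) _ (hS (v 1 0 0) _ hx)
    rw [hl, hl] at this
    convert this using 2 <;> field_simp <;> ring

theorem vk3_irreducible (hC : IsComplexification ρ ρC) (hA : IsInvariantGram ρ A)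
    (ha : a ≠ 0) (hb : b ≠ 0) {W : Submodule ℚ ((Fin 8 → ℚ) ⊗[ℚ] (Fin 8 → ℚ))}
    (hle : W ≤ vk3 ρ A) (hW : IsGStable ρ W) : W = ⊥ ∨ W = vk3 ρ A := by
  by_cases h : W = ⊥
  · exact Or.inl h
  refine Or.inr (le_antisymm hle fun w hw => ?_)
  obtain ⟨w₀, hw₀, hne⟩ := (Submodule.ne_bot_iff W).1 h
  obtain ⟨x, rfl⟩ := mem_vk3.1 (hle hw₀)
  obtain ⟨y, rfl⟩ := mem_vk3.1 hw
  exact eq_top_of_lie_mem ha hb (W.toAddSubgroup.comap (vEmb ρ A))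
    (fun u x hx => vEmb_lie_mem hC hA hW u x hx) x hw₀ (fun h0 => hne (by rw [h0, map_zero])) y

end Irreducible

/-! ### Hodge decomposition -/

section Weights

variable {E ι : Type*} [AddCommGroup E] [Module ℂ E] [Fintype ι]

theorem exists_exp_ne {m k : ℤ} (h : m ≠ k) :
    ∃ t : ℝ, Complex.exp (Complex.I * (m : ℂ) * t) ≠ Complex.exp (Complex.I * (k : ℂ) * t) := by
  have h0 : ((m - k : ℤ) : ℂ) ≠ 0 := by exact_mod_cast sub_ne_zero.2 h
  -- At this t the two exponentials differ by the factor e^{πi} = -1.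
  refine ⟨Real.pi / ((m - k : ℤ) : ℝ), fun he => ?_⟩
  have h1 : Complex.exp (Complex.I * (m : ℂ) * (Real.pi / ((m - k : ℤ) : ℝ) : ℝ) -
      Complex.I * (k : ℂ) * (Real.pi / ((m - k : ℤ) : ℝ) : ℝ)) = 1 := by
    rw [Complex.exp_sub, he, div_self (Complex.exp_ne_zero _)]
  have h2 : Complex.I * (m : ℂ) * (Real.pi / ((m - k : ℤ) : ℝ) : ℝ) -
      Complex.I * (k : ℂ) * (Real.pi / ((m - k : ℤ) : ℝ) : ℝ) = Real.pi * Complex.I := by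
    push_cast at h0 ⊢
    field_simp
  rw [h2, Complex.exp_pi_mul_I] at h1
  norm_num at h1

/-- The weight spaces of a circle action that is diagonal in a linearly independent family. -/
theorem weightSpace_eq_span {v : ι → E} (hv : LinearIndependent ℂ v) (wt : ι → ℤ)
    (T : ℝ → E →ₗ[ℂ] E)
    (hT : ∀ t i, T t (v i) = Complex.exp (Complex.I * (wt i : ℂ) * t) • v i) (k : ℤ) :
    Submodule.span ℂ (Set.range v) ⊓ ⨅ t : ℝ,
      LinearMap.ker (T t - Complex.exp (Complex.I * (k : ℂ) * (t : ℂ)) • LinearMap.id) =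
    Submodule.span ℂ (v '' {i | wt i = k}) := by
  apply le_antisymm
  · rintro x ⟨hx, hk⟩
    obtain ⟨c, rfl⟩ := (Submodule.mem_span_range_iff_exists_fun ℂ).1 hx
    refine Submodule.sum_mem _ fun i _ => ?_
    by_cases hi : wt i = k
    · exact Submodule.smul_mem _ _ (Submodule.subset_span ⟨i, hi, rfl⟩)
    · obtain ⟨t, ht⟩ := exists_exp_ne hi
      have h1 := (Submodule.mem_iInf _).1 hk t
      rw [LinearMap.mem_ker, LinearMap.sub_apply, map_sum, LinearMap.smul_apply,
        LinearMap.id_apply, Finset.smul_sum, ← Finset.sum_sub_distrib] at h1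
      have h2 : ∑ i, (c i * (Complex.exp (Complex.I * (wt i : ℂ) * t) -
          Complex.exp (Complex.I * (k : ℂ) * t))) • v i = 0 := by
        rw [← h1]
        refine Finset.sum_congr rfl fun i _ => ?_
        rw [map_smul, hT]
        module
      have h3 := Fintype.linearIndependent_iff.1 hv _ h2 i
      rw [(mul_eq_zero.1 h3).resolve_right (sub_ne_zero.2 ht), zero_smul]
      exact Submodule.zero_mem _
  · refine Submodule.span_le.2 ?_
    rintro _ ⟨i, rfl, rfl⟩
    refine ⟨Submodule.subset_span ⟨i, rfl⟩, (Submodule.mem_iInf _).2 fun t => ?_⟩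
    rw [LinearMap.mem_ker, LinearMap.sub_apply, hT, LinearMap.smul_apply, LinearMap.id_apply,
      sub_self]

theorem finrank_span_image {v : ι → E} (hv : LinearIndependent ℂ v) (s : Set ι) :
    Module.finrank ℂ (Submodule.span ℂ (v '' s)) = s.ncard := by
  classical
  have h := (hv.comp (Subtype.val : s → ι) Subtype.val_injective)
  have h2 := finrank_span_eq_card (R := ℂ) h
  rw [Set.range_comp, Subtype.range_coe] at h2
  rw [h2, ← Nat.card_eq_fintype_card]
  rfl

end Weights

section Hodge

/-- A circle in the norm-one group of a split quaternion algebra acts diagonally on `B⁰`, with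
weights `0, 2, -2`. -/
theorem exists_rotation_basis {c d : ℝ} {c' d' : ℂ} (hc : c' = Complex.ofRealHom c)
    (hd : d' = Complex.ofRealHom d) (θ : ℍ[ℝ,c,d] ≃ₐ[ℝ] Matrix (Fin 2) (Fin 2) ℝ) :
    (∀ t : ℝ, nrd (qmap Complex.ofRealHom
      (θ.symm !![Real.cos t, Real.sin t; -Real.sin t, Real.cos t]) : ℍ[ℂ,c',d']) = 1) ∧
    ∃ e : Module.Basis (Fin 3) ℂ (B0 c' d'), ∀ (t : ℝ) (i : Fin 3),
      Ad (qmap Complex.ofRealHom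
        (θ.symm !![Real.cos t, Real.sin t; -Real.sin t, Real.cos t])) (e i) =
        Complex.exp (Complex.I * ((![0, 2, -2] i : ℤ) : ℂ) * t) • e i := by
  let Q : Matrix (Fin 2) (Fin 2) ℝ → ℍ[ℂ,c',d'] := fun M => qmap Complex.ofRealHom (θ.symm M)
  have Qmul : ∀ M N, Q (M * N) = Q M * Q N := fun M N => by
    simp only [Q, map_mul, qmap_mul _ hc hd]
  have Qadd : ∀ M N, Q (M + N) = Q M + Q N := fun M N => by simp only [Q, map_add, qmap_add]
  have Qsmul : ∀ (r : ℝ) M, Q (r • M) = (r : ℂ) • Q M := fun r M => by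
    simp only [Q, map_smul, qmap_smul]; rfl
  have Qone : Q 1 = 1 := by simp only [Q, map_one, qmap_one]
  have Qneg : ∀ M, Q (-M) = -Q M := fun M => by
    have := Qsmul (-1) M
    simpa using this
  -- The infinitesimal rotation, followed by the two symmetric traceless matrices y and z that it
  -- rotates into each other.
  set s := Q !![0, 1; -1, 0] with hs
  set y := Q !![1, 0; 0, -1] with hy
  set z := Q !![0, 1; 1, 0] with hz
  have hss : s * s = -1 := by
    rw [hs, ← Qmul, ← Qone, ← Qneg]; congr 1
    ext i j; fin_cases i <;> fin_cases j <;> simp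
  have hsy : s * y = -z := by
    rw [hs, hy, hz, ← Qmul, ← Qneg]; congr 1
    ext i j; fin_cases i <;> fin_cases j <;> simp
  have hys : y * s = z := by
    rw [hs, hy, hz, ← Qmul]; congr 1
    ext i j; fin_cases i <;> fin_cases j <;> simp
  have hsz : s * z = y := by
    rw [hs, hy, hz, ← Qmul]; congr 1
    ext i j; fin_cases i <;> fin_cases j <;> simp
  have hzs : z * s = -y := by
    rw [hs, hy, hz, ← Qmul, ← Qneg]; congr 1
    ext i j; fin_cases i <;> fin_cases j <;> simp
  have hyz : y * z = s := by
    rw [hs, hy, hz, ← Qmul]; congr 1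
    ext i j; fin_cases i <;> fin_cases j <;> simp
  have hyy : y * y = 1 := by
    rw [hy, ← Qmul, ← Qone]; congr 1
    ext i j; fin_cases i <;> fin_cases j <;> simp
  have hzz : z * z = 1 := by
    rw [hz, ← Qmul, ← Qone]; congr 1
    ext i j; fin_cases i <;> fin_cases j <;> simp
  have trneg : ∀ x : ℍ[ℂ,c',d'], trd (-x) = -trd x := fun x => by
    rw [trd_eq, trd_eq, QuaternionAlgebra.re_neg]; ring
  -- The element y anticommutes with s and s² = -1, so cyclicity of the trace gives trd y = -trd y.
  have ty : trd y = 0 := by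
    have h := trd_mul_comm s (y * s)
    rw [mul_assoc, hss, hys, hsz, mul_neg, mul_one, trneg] at h
    linear_combination h / 2
  have tz : trd z = 0 := by
    have h := trd_mul_comm s (z * s)
    rw [mul_assoc, hss, hzs, mul_neg, hsy, mul_neg, mul_one, trneg, trneg] at h
    linear_combination h / 2
  have ts : trd s = 0 := by
    have h := trd_mul_comm y (s * y)
    rw [mul_assoc s, hyy, hsy, mul_neg, hyz, mul_one, trneg] at h
    linear_combination -h / 2
  have hstar : star s = -s := star_eq_neg_of_trd_eq_zero ts
  have hg : ∀ t : ℝ, (qmap Complex.ofRealHom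
      (θ.symm !![Real.cos t, Real.sin t; -Real.sin t, Real.cos t]) : ℍ[ℂ,c',d']) =
      (Real.cos t : ℂ) • 1 + (Real.sin t : ℂ) • s := by
    intro t
    rw [hs, ← Qone, ← Qsmul, ← Qsmul, ← Qadd]
    change Q _ = Q _
    congr 1
    ext i j; fin_cases i <;> fin_cases j <;> simp
  have hstarg : ∀ t : ℝ, star ((Real.cos t : ℂ) • 1 + (Real.sin t : ℂ) • s) =
      (Real.cos t : ℂ) • 1 - (Real.sin t : ℂ) • s := by
    intro t
    have h1 : ∀ (r : ℂ) (x : ℍ[ℂ,c',d']), star (r • x) = r • star x := fun r x => by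
      ext <;> simp
    rw [star_add, h1, h1, star_one, hstar, smul_neg, sub_eq_add_neg]
  have hcs : ∀ t : ℝ, (Real.cos t : ℂ) * Real.cos t + (Real.sin t : ℂ) * Real.sin t = 1 := by
    intro t
    have := Real.cos_sq_add_sin_sq t
    rw [sq, sq] at this
    exact_mod_cast this
  refine ⟨fun t => ?_, ?_⟩
  · have h1 := mul_star_eq_nrd ((Real.cos t : ℂ) • 1 + (Real.sin t : ℂ) • s)
    have h2 : ((Real.cos t : ℂ) • 1 + (Real.sin t : ℂ) • s) *
        star ((Real.cos t : ℂ) • 1 + (Real.sin t : ℂ) • s) = 1 := by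
      rw [hstarg, add_mul, mul_sub, mul_sub]
      simp only [smul_mul_assoc, mul_smul_comm, one_mul, mul_one, hss, smul_smul]
      have := hcs t
      rw [mul_comm (Real.sin t : ℂ) (Real.cos t : ℂ), add_sub, sub_add_cancel, smul_neg,
        sub_neg_eq_add, ← add_smul, this, one_smul]
    rw [hg]
    rw [h2] at h1
    have h3 := congrArg QuaternionAlgebra.re h1
    simpa using h3.symm
  · let v : Fin 3 → ℍ[ℂ,c',d'] := ![s, y + Complex.I • z, y - Complex.I • z]
    have tv : ∀ i, trd (v i) = 0 := by
      intro i
      fin_cases i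
      · exact ts
      · change trd (y + Complex.I • z) = 0
        rw [trd_add, trd_smul, ty, tz, mul_zero, add_zero]
      · change trd (y - Complex.I • z) = 0
        rw [sub_eq_add_neg, trd_add, trneg, trd_smul, ty, tz, mul_zero, neg_zero, add_zero]
    -- The vectors y ± iz are eigenvectors for left and right multiplication by s with opposite
    -- eigenvalues, so conjugation by cos t + s sin t multiplies them by (cos t ± i sin t)².
    have hsv : ∀ i, s * v i = (![0, 1, -1] i * Complex.I) • v i + (if i = 0 then -1 else 0) := by
      intro i
      fin_cases i
      · simpa [v] using hss
      · change s * (y + Complex.I • z) = (1 * Complex.I) • (y + Complex.I • z) + 0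
        rw [mul_add, mul_smul_comm, hsy, hsz, smul_add, smul_smul, one_mul, Complex.I_mul_I]
        module
      · change s * (y - Complex.I • z) = (-1 * Complex.I) • (y - Complex.I • z) + 0
        rw [mul_sub, mul_smul_comm, hsy, hsz, smul_sub, smul_smul, mul_assoc, Complex.I_mul_I]
        module
    have hvs : ∀ i, v i * s = -(![0, 1, -1] i * Complex.I) • v i + (if i = 0 then -1 else 0) := by
      intro i
      fin_cases i
      · simpa [v] using hss
      · change (y + Complex.I • z) * s = -(1 * Complex.I) • (y + Complex.I • z) + 0
        rw [add_mul, smul_mul_assoc, hys, hzs, smul_add, smul_smul, one_mul, neg_mul,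
          Complex.I_mul_I]
        module
      · change (y - Complex.I • z) * s = -(-1 * Complex.I) • (y - Complex.I • z) + 0
        rw [sub_mul, smul_mul_assoc, hys, hzs, smul_sub, smul_smul]
        have : -(-1 * Complex.I) * Complex.I = -1 := by
          linear_combination Complex.I_mul_I
        rw [this]
        module
    have hne : ∀ i, v i ≠ 0 := by
      have key : ∀ r : ℂ, r * r = -1 → y + r • z ≠ 0 := by
        intro r hr h
        have h1 : y = -(r • z) := eq_neg_of_add_eq_zero_left h
        have h2 := hyy
        rw [h1, neg_mul_neg, smul_mul_assoc, mul_smul_comm, smul_smul, hr, hzz] at h2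
        have := congrArg QuaternionAlgebra.re h2
        norm_num at this
      intro i
      fin_cases i
      · intro h
        have h1 : s = 0 := h
        rw [h1, mul_zero] at hss
        have := congrArg QuaternionAlgebra.re hss
        norm_num at this
      · exact key _ Complex.I_mul_I
      · have := key (-Complex.I) (by rw [neg_mul_neg, Complex.I_mul_I])
        rwa [neg_smul, ← sub_eq_add_neg] at this
    have hli : LinearIndependent ℂ v := by
      -- The three vectors have distinct eigenvalues 0, 2i, -2i under the bracket with s.
      refine Module.End.eigenvectors_linearIndependent'
        (LinearMap.mulLeft ℂ s - LinearMap.mulRight ℂ s)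
        (fun i => 2 * ((![0, 1, -1] i : ℂ) * Complex.I)) ?_ v fun i => ?_
      · intro i j h
        have h2 : (![0, 1, -1] i : ℂ) = ![0, 1, -1] j :=
          mul_right_cancel₀ Complex.I_ne_zero (mul_left_cancel₀ two_ne_zero h)
        fin_cases i <;> fin_cases j <;> first | rfl | (exfalso; norm_num at h2)
      · rw [Module.End.hasEigenvector_iff, Module.End.mem_eigenspace_iff]
        refine ⟨?_, hne i⟩
        rw [LinearMap.sub_apply, LinearMap.mulLeft_apply, LinearMap.mulRight_apply, hsv, hvs]
        module
    let w : Fin 3 → B0 c' d' := fun i => ⟨v i, tv i⟩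
    have hw : LinearIndependent ℂ w :=
      LinearIndependent.of_comp (B0 c' d').toSubmodule.subtype hli
    let e := basisOfLinearIndependentOfCardEqFinrank hw (by
      rw [Module.finrank_eq_card_basis (B0basis c' d')])
    refine ⟨e, fun t i => Subtype.ext ?_⟩
    have hei : e i = w i := by rw [coe_basisOfLinearIndependentOfCardEqFinrank]
    rw [hei, hg]
    change ((Real.cos t : ℂ) • 1 + (Real.sin t : ℂ) • s) * v i *
      star ((Real.cos t : ℂ) • 1 + (Real.sin t : ℂ) • s) = _ • v i
    have he : ∀ m : ℂ, m = 1 ∨ m = -1 → Complex.exp (Complex.I * (2 * m) * t) =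
        (Real.cos t + Real.sin t * (m * Complex.I)) ^ 2 := by
      rintro m (rfl | rfl)
      · rw [show Complex.I * (2 * 1) * (t : ℂ) = (2 : ℕ) * ((t : ℂ) * Complex.I) by push_cast; ring,
          Complex.exp_nat_mul, Complex.exp_mul_I, Complex.ofReal_cos, Complex.ofReal_sin, one_mul]
      · rw [show Complex.I * (2 * -1) * (t : ℂ) = (2 : ℕ) * ((-t : ℂ) * Complex.I) by push_cast; ring,
          Complex.exp_nat_mul, Complex.exp_mul_I, Complex.ofReal_cos, Complex.ofReal_sin,
          Complex.cos_neg, Complex.sin_neg]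
        ring
    rw [hstarg]
    by_cases hi : i = 0
    · subst hi
      have hc0 : Complex.exp (Complex.I * ((![0, 2, -2] 0 : ℤ) : ℂ) * t) = 1 := by simp
      rw [hc0, one_smul]
      change (_ + _) * s * _ = s
      have hcomm : ((Real.cos t : ℂ) • 1 + (Real.sin t : ℂ) • s) * s =
          s * ((Real.cos t : ℂ) • 1 + (Real.sin t : ℂ) • s) := by
        simp only [add_mul, mul_add, smul_mul_assoc, mul_smul_comm, one_mul, mul_one]
      rw [hcomm, mul_assoc]
      have : ((Real.cos t : ℂ) • (1 : ℍ[ℂ,c',d']) + (Real.sin t : ℂ) • s) *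
          ((Real.cos t : ℂ) • 1 - (Real.sin t : ℂ) • s) = 1 := by
        rw [add_mul, mul_sub, mul_sub]
        simp only [smul_mul_assoc, mul_smul_comm, one_mul, mul_one, hss, smul_smul]
        rw [mul_comm (Real.sin t : ℂ) (Real.cos t : ℂ), add_sub, sub_add_cancel, smul_neg,
          sub_neg_eq_add, ← add_smul, hcs t, one_smul]
      rw [this, mul_one]
    · have h1 := hsv i
      have h2 := hvs i
      rw [if_neg hi, add_zero] at h1 h2
      set m : ℂ := ![0, 1, -1] i with hm
      have hm' : m = 1 ∨ m = -1 := by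
        fin_cases i
        · exact absurd rfl hi
        · left; simp [hm]
        · right; simp [hm]
      have hwt : ((![0, 2, -2] i : ℤ) : ℂ) = 2 * m := by
        fin_cases i
        · exact absurd rfl hi
        · simp [hm]
        · simp [hm]
      rw [hwt, he m hm', add_mul, smul_mul_assoc, smul_mul_assoc, one_mul, h1, smul_smul,
        ← add_smul, smul_mul_assoc, mul_sub, mul_smul_comm, mul_smul_comm, mul_one, h2]
      module

variable {K : Type*} [Field K] [NumberField K] {a b : K}
  {ρ : CorAlg a b ≃ₐ[ℚ] Matrix (Fin 8) (Fin 8) ℚ}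
  {ρC : DAlg ℂ a b →ₐ[ℂ] Matrix (Fin 8) (Fin 8) ℂ} {A : Matrix (Fin 8) (Fin 8) ℚ}

theorem hodge_vk3 (hK : Module.finrank ℚ K = 3) (hC : IsComplexification ρ ρC)
    (hA : IsInvariantGram ρ A) (ha : a ≠ 0) (hb : b ≠ 0) (σ₀ : K →+* ℝ)
    (θ₀ : ℍ[ℝ,σ₀ a,σ₀ b] ≃ₐ[ℝ] Matrix (Fin 2) (Fin 2) ℝ) :
    hodgePiece ρC σ₀ θ₀ (vk3 ρ A) 2 0 ⊔ hodgePiece ρC σ₀ θ₀ (vk3 ρ A) 1 1 ⊔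
        hodgePiece ρC σ₀ θ₀ (vk3 ρ A) 0 2 = complexSpan (vk3 ρ A) ∧
      Module.finrank ℂ (hodgePiece ρC σ₀ θ₀ (vk3 ρ A) 2 0) = 1 ∧
      Module.finrank ℂ (hodgePiece ρC σ₀ θ₀ (vk3 ρ A) 1 1) = 7 ∧
      Module.finrank ℂ (hodgePiece ρC σ₀ θ₀ (vk3 ρ A) 0 2) = 1 := by
  classical
  set σr : K →+* ℂ := Complex.ofRealHom.comp σ₀ with hσr
  obtain ⟨hn, e, he⟩ := exists_rotation_basis (c' := σr a) (d' := σr b) rfl rfl θ₀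
  have hnt : ∀ t σ, nrd (torus σ₀ θ₀ t σ) = 1 := by
    intro t σ
    by_cases h : σ = σr
    · subst h
      rw [torus, Pi.mulSingle_eq_same]
      exact hn t
    · rw [torus, Pi.mulSingle_eq_of_ne h, nrd_one]
  -- Only the copy of B⁰ at the split real place is rotated, so only there an adapted basis is
  -- needed. Of the nine basis vectors, one has weight 2, one has weight -2 and seven have weight 0.
  let c : ∀ σ : K →+* ℂ, Module.Basis (Fin 3) ℂ (B0 (σ a) (σ b)) :=
    Function.update (fun σ => B0basis (σ a) (σ b)) σr e
  let P := Pi.basis c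
  let wt : (Σ _ : K →+* ℂ, Fin 3) → ℤ := fun p => if p.1 = σr then ![0, 2, -2] p.2 else 0
  have hT : ∀ t p, actG ρC (torus σ₀ θ₀ t) (xi ρC A (P p)) =
      Complex.exp (Complex.I * (wt p : ℂ) * t) • xi ρC A (P p) := by
    rintro t ⟨σ, j⟩
    rw [actG_xi hC hA (hnt t), ← map_smul]
    congr 1
    funext τ
    rw [adFam_apply, Pi.smul_apply, Pi.basis_apply]
    by_cases h : τ = σ
    · subst h
      rw [Pi.single_eq_same]
      by_cases h2 : τ = σr
      · subst h2
        have hc : c σr = e := Function.update_self ..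
        rw [hc, torus, Pi.mulSingle_eq_same]
        simp only [wt, if_true]
        exact he t j
      · simp only [wt, if_neg h2, torus]
        rw [Pi.mulSingle_eq_of_ne h2]
        refine Subtype.ext ?_
        change 1 * (c τ j : ℍ[ℂ,τ a,τ b]) * star 1 = _ • (c τ j : ℍ[ℂ,τ a,τ b])
        simp
    · rw [Pi.single_eq_of_ne h, map_zero, smul_zero]
  have hli : LinearIndependent ℂ fun p => xi ρC A (P p) :=
    P.linearIndependent.map' _ (LinearMap.ker_eq_bot.2 (xi_injective hA ha hb))
  have hspan : complexSpan (vk3 ρ A) = Submodule.span ℂ (Set.range fun p => xi ρC A (P p)) := by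
    rw [complexSpan_vk3 hC hA, LinearMap.range_eq_map, ← P.span_eq, Submodule.map_span,
      ← Set.range_comp]
    rfl
  have hpiece : ∀ p q : ℤ, hodgePiece ρC σ₀ θ₀ (vk3 ρ A) p q =
      Submodule.span ℂ ((fun p => xi ρC A (P p)) '' {i | wt i = p - q}) := by
    intro p q
    rw [hodgePiece, hspan, weightSpace_eq_span hli wt _ hT]
  have hcard : Fintype.card (K →+* ℂ) = 3 := by
    rw [NumberField.Embeddings.card, hK]
  have h2 : {i | wt i = 2} = {⟨σr, 1⟩} := by
    ext ⟨σ, j⟩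
    simp only [wt, Set.mem_ofPred_eq, Set.mem_singleton_iff]
    by_cases h : σ = σr
    · subst h
      fin_cases j <;> simp
    · simp [h]
  have hm2 : {i | wt i = -2} = {⟨σr, 2⟩} := by
    ext ⟨σ, j⟩
    simp only [wt, Set.mem_ofPred_eq, Set.mem_singleton_iff]
    by_cases h : σ = σr
    · subst h
      fin_cases j <;> simp
    · simp [h]
  have h0 : {i | wt i = 0} = ({⟨σr, 1⟩, ⟨σr, 2⟩} : Set (Σ _ : K →+* ℂ, Fin 3))ᶜ := by
    ext ⟨σ, j⟩
    simp only [wt, Set.mem_ofPred_eq, Set.mem_compl_iff, Set.mem_insert_iff,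
      Set.mem_singleton_iff]
    by_cases h : σ = σr
    · subst h
      fin_cases j <;> simp
    · simp [h]
  refine ⟨?_, ?_, ?_, ?_⟩
  · rw [hpiece, hpiece, hpiece, ← Submodule.span_union, ← Submodule.span_union, ← Set.image_union,
      ← Set.image_union, hspan, ← Set.image_univ]
    congr 2
    norm_num
    rw [h2, hm2, h0]
    ext p
    simp only [Set.mem_union, Set.mem_compl_iff, Set.mem_insert_iff, Set.mem_singleton_iff,
      Set.mem_univ, iff_true]
    tauto
  · rw [hpiece, finrank_span_image hli, show (2 : ℤ) - 0 = 2 by norm_num, h2, Set.ncard_singleton]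
  · rw [hpiece, finrank_span_image hli, show (1 : ℤ) - 1 = 0 by norm_num, h0, Set.ncard_compl,
      Set.ncard_pair (by simp), Nat.card_eq_fintype_card,
      Fintype.card_sigma]
    simp [hcard]
  · rw [hpiece, finrank_span_image hli, show (0 : ℤ) - 2 = -2 by norm_num, hm2,
      Set.ncard_singleton]

end Hodge

/-! ### Existence of an invariant symplectic form -/

section Involution

variable {K : Type*} [Field K] [NumberField K] {a b : K}

/-- Quaternion conjugation as a linear map. -/
def starL {L : Type*} [Field L] (c d : L) : ℍ[L,c,d] →ₗ[L] ℍ[L,c,d] where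
  toFun := star
  map_add' := star_add
  map_smul' r x := by ext <;> simp

/-- The involution `⨂_σ x_σ ↦ ⨂_σ x̄_σ` of `⨂_σ B^σ`. -/
def starD (L : Type*) [Field L] (a b : K) : DAlg L a b →ₗ[L] DAlg L a b :=
  PiTensorProduct.map fun σ : K →+* L => starL (σ a) (σ b)

theorem starD_tprod (L : Type*) [Field L] (x : ∀ σ : K →+* L, ℍ[L,σ a,σ b]) :
    starD L a b (PiTensorProduct.tprod L x) = PiTensorProduct.tprod L fun σ => star (x σ) :=
  PiTensorProduct.map_tprod _ _

theorem starD_Nm (L : Type*) [Field L] (γ : ℍ[K,a,b]) :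
    starD L a b (Nm L γ) = Nm L (star γ) := by
  rw [Nm, starD_tprod, Nm]
  congr 1
  funext σ
  ext <;> simp [qmap]

theorem starD_mul (L : Type*) [Field L] [CharZero L] (x y : DAlg L a b) :
    starD L a b (x * y) = starD L a b y * starD L a b x := by
  induction x using PiTensorProduct.induction_on with
  | add x x' hx hx' => rw [add_mul, map_add, map_add, hx, hx', mul_add]
  | smul_tprod r f =>
    induction y using PiTensorProduct.induction_on with
    | add y y' hy hy' => rw [mul_add, map_add, map_add, hy, hy', add_mul]
    | smul_tprod s g =>
      rw [PiTensorProduct.smul_tprod_mul_smul_tprod, map_smul, map_smul, map_smul, starD_tprod,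
        starD_tprod, starD_tprod, PiTensorProduct.smul_tprod_mul_smul_tprod, mul_comm r]
      congr 2
      funext σ
      exact star_mul _ _

/-- Norms span Cor(B) over ℚ, and the involution maps the norm of γ to that of γ̄. -/
theorem starD_mem_CorAlg (x : CorAlg a b) :
    starD (AlgebraicClosure ℚ) a b x ∈ CorAlg a b := by
  let T : DAlg (AlgebraicClosure ℚ) a b →ₗ[ℚ] DAlg (AlgebraicClosure ℚ) a b :=
    (starD (AlgebraicClosure ℚ) a b).restrictScalars ℚ
  suffices h : x ∈ ((Subalgebra.toSubmodule (CorAlg a b)).comap T).comap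
      (CorAlg a b).val.toLinearMap from h
  refine (Submodule.span_le.2 ?_ : Submodule.span ℚ (Set.range NmCor) ≤ _)
    (by rw [span_range_NmCor]; trivial)
  rintro _ ⟨γ, rfl⟩
  have h : starD (AlgebraicClosure ℚ) a b (Nm _ γ) ∈ CorAlg a b := by
    rw [starD_Nm]
    exact (NmCor (star γ)).2
  exact h

/-- The involution of `Cor(B)` induced by conjugation. -/
def starCor (a b : K) : CorAlg a b →ₗ[ℚ] CorAlg a b where
  toFun x := ⟨starD (AlgebraicClosure ℚ) a b x, starD_mem_CorAlg x⟩
  map_add' x y := Subtype.ext (map_add _ _ _)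
  map_smul' q x := Subtype.ext (map_rat_smul (starD (AlgebraicClosure ℚ) a b) q _)

theorem starCor_NmCor (γ : ℍ[K,a,b]) : starCor a b (NmCor γ) = NmCor (star γ) :=
  Subtype.ext (starD_Nm _ γ)

theorem starCor_mul (x y : CorAlg a b) :
    starCor a b (x * y) = starCor a b y * starCor a b x :=
  Subtype.ext (starD_mul _ _ _)

theorem starCor_starCor (x : CorAlg a b) : starCor a b (starCor a b x) = x := by
  suffices h : (starCor a b).comp (starCor a b) = LinearMap.id from LinearMap.congr_fun h x
  refine LinearMap.ext_on_range (v := (NmCor : ℍ[K,a,b] → _)) span_range_NmCor fun γ => ?_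
  rw [LinearMap.comp_apply, starCor_NmCor, starCor_NmCor, star_star, LinearMap.id_apply]

theorem NmCor_one : NmCor (1 : ℍ[K,a,b]) = 1 := Subtype.ext Nm_one

theorem NmCor_mul (γ δ : ℍ[K,a,b]) : NmCor (γ * δ) = NmCor γ * NmCor δ :=
  Subtype.ext (Nm_mul γ δ)

/-- The involution followed by transposition is an automorphism of M₈(ℚ), hence inner by
Skolem–Noether. The transpose of the conjugating matrix is the Gram matrix of a form for which the
involution is the adjoint. -/
theorem exists_adjoint_matrix (ρ : CorAlg a b ≃ₐ[ℚ] Matrix (Fin 8) (Fin 8) ℚ) :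
    ∃ A : Matrix (Fin 8) (Fin 8) ℚ, IsUnit A ∧
      ∀ x, (ρ x).transpose * A = A * ρ (starCor a b x) := by
  let α : Matrix (Fin 8) (Fin 8) ℚ →ₐ[ℚ] Matrix (Fin 8) (Fin 8) ℚ :=
    AlgHom.ofLinearMap ((Matrix.transposeLinearEquiv (Fin 8) (Fin 8) ℚ ℚ).toLinearMap.comp
      (ρ.toLinearMap.comp ((starCor a b).comp ρ.symm.toLinearMap)))
      (by
        have : starCor a b 1 = 1 := by rw [← NmCor_one, starCor_NmCor, star_one]
        change (ρ (starCor a b (ρ.symm 1))).transpose = 1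
        rw [map_one, this, map_one, Matrix.transpose_one])
      (fun M N => by
        change (ρ (starCor a b (ρ.symm (M * N)))).transpose =
          (ρ (starCor a b (ρ.symm M))).transpose * (ρ (starCor a b (ρ.symm N))).transpose
        rw [map_mul, starCor_mul, map_mul, Matrix.transpose_mul])
  have hα : ∀ M, α M = (ρ (starCor a b (ρ.symm M))).transpose := fun _ => rfl
  have hbij : Function.Bijective α := by
    refine Function.bijective_iff_has_inverse.2
      ⟨fun M => ρ (starCor a b (ρ.symm M.transpose)), fun M => ?_, fun M => ?_⟩
    · beta_reduce
      rw [hα, Matrix.transpose_transpose, AlgEquiv.symm_apply_apply, starCor_starCor,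
        AlgEquiv.apply_symm_apply]
    · beta_reduce
      rw [hα, AlgEquiv.symm_apply_apply, starCor_starCor, AlgEquiv.apply_symm_apply,
        Matrix.transpose_transpose]
  let α' : Matrix (Fin 8) (Fin 8) ℚ ≃ₐ[ℚ] Matrix (Fin 8) (Fin 8) ℚ := AlgEquiv.ofBijective α hbij
  let l := Matrix.toLinAlgEquiv' (R := ℚ) (n := Fin 8)
  obtain ⟨T, hT⟩ := AlgEquiv.eq_linearEquivConjAlgEquiv ((l.symm.trans α').trans l)
  let P := l.symm T.toLinearMap
  let P' := l.symm T.symm.toLinearMap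
  have hPP' : P * P' = 1 := by
    rw [← map_mul]
    refine l.injective ?_
    rw [AlgEquiv.apply_symm_apply, map_one]
    exact LinearMap.ext fun v => T.apply_symm_apply v
  have hP'P : P' * P = 1 := by
    rw [← map_mul]
    refine l.injective ?_
    rw [AlgEquiv.apply_symm_apply, map_one]
    exact LinearMap.ext fun v => T.symm_apply_apply v
  have key : ∀ M, α M * P = P * M := by
    intro M
    have h1 := DFunLike.congr_fun hT (l M)
    have h2 : l (α M) = T.toLinearMap ∘ₗ l M ∘ₗ T.symm.toLinearMap := by
      have h3 : ((l.symm.trans α').trans l) (l M) = l (α M) := by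
        change l (α' (l.symm (l M))) = _
        rw [AlgEquiv.symm_apply_apply]
        rfl
      rw [← h3, h1]
      rfl
    refine l.injective ?_
    rw [map_mul, map_mul, AlgEquiv.apply_symm_apply, h2]
    refine LinearMap.ext fun v => ?_
    change T (l M (T.symm (T v))) = T (l M v)
    rw [T.symm_apply_apply]
  refine ⟨P.transpose, ?_, fun x => ?_⟩
  · exact (Matrix.isUnit_transpose P).2 ⟨⟨P, P', hPP', hP'P⟩, rfl⟩
  · have h := congrArg Matrix.transpose (key (ρ x))
    rw [hα, AlgEquiv.symm_apply_apply, Matrix.transpose_mul, Matrix.transpose_transpose,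
      Matrix.transpose_mul] at h
    exact h.symm

/-- The involution extends to the complexification. -/
theorem adjoint_complex {ρ : CorAlg a b ≃ₐ[ℚ] Matrix (Fin 8) (Fin 8) ℚ}
    {ρC : DAlg ℂ a b →ₐ[ℂ] Matrix (Fin 8) (Fin 8) ℂ} (hC : IsComplexification ρ ρC)
    {A : Matrix (Fin 8) (Fin 8) ℚ} (hA : ∀ x, (ρ x).transpose * A = A * ρ (starCor a b x))
    (z : DAlg ℂ a b) : (ρC z).transpose * A.map (algebraMap ℚ ℂ) =
      A.map (algebraMap ℚ ℂ) * ρC (starD ℂ a b z) := by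
  let f : DAlg ℂ a b →ₗ[ℂ] Matrix (Fin 8) (Fin 8) ℂ :=
    (LinearMap.mulRight ℂ (A.map (algebraMap ℚ ℂ))).comp
      ((Matrix.transposeLinearEquiv (Fin 8) (Fin 8) ℂ ℂ).toLinearMap.comp ρC.toLinearMap)
  let g : DAlg ℂ a b →ₗ[ℂ] Matrix (Fin 8) (Fin 8) ℂ :=
    (LinearMap.mulLeft ℂ (A.map (algebraMap ℚ ℂ))).comp
      (ρC.toLinearMap.comp (starD ℂ a b))
  suffices h : f = g from LinearMap.congr_fun h z
  refine LinearMap.ext_on_range (v := (Nm ℂ : ℍ[K,a,b] → _)) span_range_Nm fun γ => ?_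
  change (ρC (Nm ℂ γ)).transpose * _ = _ * ρC (starD ℂ a b (Nm ℂ γ))
  rw [starD_Nm, hC, hC, ← Matrix.transpose_map, ← Matrix.map_mul, hA, starCor_NmCor,
    Matrix.map_mul]

theorem exists_nilpotent {c d : ℂ} (hc : c ≠ 0) (hd : d ≠ 0) :
    ∃ n n' : ℍ[ℂ,c,d], star n = -n ∧ n * n' + n' * n = 1 ∧ ∀ x, ∃ r : ℂ, n * x * n = r • n := by
  obtain ⟨s, hs⟩ := IsAlgClosed.exists_eq_mul_self (-d)
  obtain ⟨t, ht⟩ := IsAlgClosed.exists_eq_mul_self c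
  have hs0 : s ≠ 0 := by
    rintro rfl
    exact hd (by linear_combination -hs)
  -- The element n = si + tj has square cs² + dt² = 0. It anticommutes with j up to a scalar and
  -- with i up to a scalar; n' is the multiple of i normalized by nn' + n'n = 1.
  refine ⟨⟨0, s, t, 0⟩, ⟨0, 1 / (2 * c * s), 0, 0⟩, ?_, ?_, fun x => ?_⟩
  · ext <;> simp
  · ext <;> simp <;> field_simp <;> norm_num
  -- Multiply nx + x̄ n̄ = trd(nx) by n on the right; the second term dies because n̄ = -n and n² =
  -- 0.
  · refine ⟨trd (⟨0, s, t, 0⟩ * x), ?_⟩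
    have hn : (⟨0, s, t, 0⟩ : ℍ[ℂ,c,d]) * ⟨0, s, t, 0⟩ = 0 := by
      ext <;> simp
      linear_combination -c * hs - d * ht
      ring
    have hstar : star (⟨0, s, t, 0⟩ : ℍ[ℂ,c,d]) = -⟨0, s, t, 0⟩ := by ext <;> simp
    have h := add_star_eq_trd ((⟨0, s, t, 0⟩ : ℍ[ℂ,c,d]) * x)
    rw [star_mul, hstar] at h
    have h2 := congrArg (· * (⟨0, s, t, 0⟩ : ℍ[ℂ,c,d])) h
    simp only [add_mul, mul_neg, neg_mul, mul_assoc, hn, mul_zero, neg_zero, add_zero] at h2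
    rw [mul_assoc, h2, Algebra.algebraMap_eq_smul_one, smul_mul_assoc, one_mul]

/-- An element of `⨂_σ B^σ` of rank one that is skew for the involution if the number of factors is
odd. -/
theorem exists_rank_one {ρ : CorAlg a b ≃ₐ[ℚ] Matrix (Fin 8) (Fin 8) ℚ}
    {ρC : DAlg ℂ a b →ₐ[ℂ] Matrix (Fin 8) (Fin 8) ℂ} (hC : IsComplexification ρ ρC)
    (hK : Module.finrank ℚ K = 3) (ha : a ≠ 0) (hb : b ≠ 0) :
    ∃ N : DAlg ℂ a b, starD ℂ a b N = -N ∧ ρC N ≠ 0 ∧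
      ∀ X : Matrix (Fin 8) (Fin 8) ℂ, ∃ r : ℂ, ρC N * X * ρC N = r • ρC N := by
  classical
  choose n n' hstar hnn hr using fun σ : K →+* ℂ =>
    exists_nilpotent ((map_ne_zero σ).2 ha) ((map_ne_zero σ).2 hb)
  choose r hr using hr
  refine ⟨PiTensorProduct.tprod ℂ n, ?_, fun h0 => ?_, fun X => ?_⟩
  · rw [starD_tprod]
    have h1 : (fun σ => star (n σ)) = fun σ => (-1 : ℂ) • n σ := by
      funext σ
      rw [hstar, neg_one_smul]
    -- The sign is (-1)³, since K has three embeddings.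
    rw [h1, MultilinearMap.map_smul_univ, Finset.prod_const, Finset.card_univ,
      NumberField.Embeddings.card, hK]
    norm_num
  -- If the image were zero, the relation nn' + n'n = 1 would replace the factors by 1 one at a time
  -- and force the image of 1 to vanish.
  · have key : ∀ s : Finset (K →+* ℂ), ρC (PiTensorProduct.tprod ℂ (s.piecewise 1 n)) = 0 := by
      intro s
      induction s using Finset.induction_on with
      | empty => rwa [Finset.piecewise_empty]
      | insert τ s hτ ih =>
        have h1 := congrArg₂ (· + ·) (inc_mul_tprod_mul_inc τ (n' τ) 1 (s.piecewise 1 n))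
          (inc_mul_tprod_mul_inc τ 1 (n' τ) (s.piecewise 1 n))
        simp only [map_one, one_mul, mul_one] at h1
        rw [← MultilinearMap.map_update_add, Finset.piecewise_eq_of_notMem _ _ _ hτ,
          add_comm (n' τ * n τ), hnn, ← Pi.one_apply (M := fun σ : K →+* ℂ => ℍ[ℂ,σ a,σ b]) τ,
          ← Finset.piecewise_insert] at h1
        rw [← h1, map_add, map_mul, map_mul, ih, mul_zero, zero_mul, add_zero]
    have h2 := key Finset.univ
    rw [Finset.piecewise_univ] at h2
    have h3 : ρC 1 = 0 := h2
    rw [map_one] at h3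
    exact one_ne_zero h3
  · obtain ⟨z, rfl⟩ := surjective_of_isComplexification hC X
    induction z using PiTensorProduct.induction_on with
    | smul_tprod c x =>
      refine ⟨c * ∏ σ, r σ (x σ), ?_⟩
      rw [← map_mul, ← map_mul, ← map_smul ρC (c * _)]
      congr 1
      rw [DAlg_mul_smul, DAlg_smul_mul, PiTensorProduct.tprod_mul_tprod,
        PiTensorProduct.tprod_mul_tprod, mul_smul, ← MultilinearMap.map_smul_univ]
      congr 2
      funext σ
      exact hr σ (x σ)
    | add x y hx hy =>
      obtain ⟨p, hp⟩ := hx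
      obtain ⟨q, hq⟩ := hy
      exact ⟨p + q, by rw [map_add, mul_add, add_mul, hp, hq, add_smul]⟩

/-- The form from `exists_adjoint_matrix` is unique up to a scalar, so Aᵀ = cA with c² = 1. The case
c = 1 is excluded by a rank-one element: `A` times it would be a nonzero antisymmetric matrix of
rank one. -/
theorem exists_isInvariantSymplectic (ρ : CorAlg a b ≃ₐ[ℚ] Matrix (Fin 8) (Fin 8) ℚ)
    (hK : Module.finrank ℚ K = 3) (ha : a ≠ 0) (hb : b ≠ 0) :
    ∃ ψ, IsInvariantSymplectic ρ ψ := by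
  obtain ⟨A, hA, hadj⟩ := exists_adjoint_matrix ρ
  have hdet : IsUnit A.det := (Matrix.isUnit_iff_isUnit_det A).1 hA
  have h1 := Matrix.mul_nonsing_inv A hdet
  have h2 := Matrix.nonsing_inv_mul A hdet
  -- Both `A` and its transpose intertwine the same involution, so A⁻¹ Aᵀ is central and therefore
  -- scalar.
  have hcomm : ∀ M : Matrix (Fin 8) (Fin 8) ℚ, A⁻¹ * A.transpose * M = M * (A⁻¹ * A.transpose) := by
    intro M
    obtain ⟨x, rfl⟩ := ρ.surjective M
    have e1 := hadj (starCor a b x)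
    rw [starCor_starCor] at e1
    have e2 := congrArg Matrix.transpose (hadj x)
    rw [Matrix.transpose_mul, Matrix.transpose_mul, Matrix.transpose_transpose] at e2
    have e3 : A⁻¹ * (ρ (starCor a b x)).transpose = ρ x * A⁻¹ := by
      calc A⁻¹ * (ρ (starCor a b x)).transpose
          = A⁻¹ * ((ρ (starCor a b x)).transpose * A) * A⁻¹ := by
            rw [Matrix.mul_assoc, Matrix.mul_assoc, h1, Matrix.mul_one]
        _ = A⁻¹ * A * ρ x * A⁻¹ := by rw [e1]; simp only [Matrix.mul_assoc]
        _ = _ := by rw [h2, Matrix.one_mul]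
    rw [Matrix.mul_assoc, e2, ← Matrix.mul_assoc, e3, Matrix.mul_assoc]
  obtain ⟨c, hc⟩ : ∃ c : ℚ, A⁻¹ * A.transpose = Matrix.scalar (Fin 8) c := by
    have := Matrix.mem_range_scalar_of_commute_single (M := A⁻¹ * A.transpose)
      fun i j _ => (hcomm (Matrix.single i j 1)).symm
    obtain ⟨c, hc⟩ := this
    exact ⟨c, hc.symm⟩
  have hAt : A.transpose = c • A := by
    calc A.transpose = A * (A⁻¹ * A.transpose) := by rw [← Matrix.mul_assoc, h1, Matrix.one_mul]
      _ = _ := by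
        rw [hc]
        ext i j
        simp [mul_comm]
  have hA0 : A ≠ 0 := hA.ne_zero
  have hcc : c * c = 1 := by
    have e := congrArg Matrix.transpose hAt
    rw [Matrix.transpose_transpose, Matrix.transpose_smul, hAt, smul_smul] at e
    have e2 : (c * c - 1) • A = 0 := by rw [sub_smul, ← e, one_smul, sub_self]
    linear_combination (smul_eq_zero.1 e2).resolve_right hA0
  have hneg : A.transpose = -A := by
    rcases mul_self_eq_one_iff.1 hcc with rfl | rfl
    · exfalso
      rw [one_smul] at hAt
      obtain ⟨ρC, hC⟩ := exists_isComplexification ρ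
      obtain ⟨N, hN, hN0, hrank⟩ := exists_rank_one hC hK ha hb
      set AC := A.map (algebraMap ℚ ℂ) with hAC
      have hACdet : IsUnit AC.det := by
        have := hdet.map (algebraMap ℚ ℂ)
        rwa [RingHom.map_det] at this
      have hskew : (AC * ρC N).transpose = -(AC * ρC N) := by
        have := adjoint_complex hC hadj N
        rw [hN, map_neg, mul_neg] at this
        rw [Matrix.transpose_mul, ← this, hAC, ← Matrix.transpose_map, hAt]
      have hR0 : AC * ρC N ≠ 0 := fun h => hN0 (by
        have e := congrArg (AC⁻¹ * ·) h
        simpa only [← Matrix.mul_assoc, Matrix.nonsing_inv_mul AC hACdet, Matrix.one_mul,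
          Matrix.mul_zero] using e)
      have hR : ∀ X, ∃ r : ℂ, AC * ρC N * X * (AC * ρC N) = r • (AC * ρC N) := by
        intro X
        obtain ⟨r, hr⟩ := hrank (X * AC)
        refine ⟨r, ?_⟩
        rw [← mul_smul_comm, ← hr]
        simp only [Matrix.mul_assoc]
      generalize AC * ρC N = R at hskew hR0 hR
      refine hR0 ?_
      ext p q
      -- The (p, p) entry of R E_qq R = rR reads R_pq R_qp = r R_pp = 0, while R_qp = -R_pq.
      obtain ⟨r, hr⟩ := hR (Matrix.single q q 1)
      have e1 := congrFun (congrFun hr p) p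
      have hpp := congrFun (congrFun hskew p) p
      have hpq := congrFun (congrFun hskew p) q
      rw [Matrix.transpose_apply, Matrix.neg_apply] at hpp hpq
      have hpp0 : R p p = 0 := by linear_combination hpp / 2
      rw [Matrix.smul_apply, hpp0, smul_zero, Matrix.mul_apply, Finset.sum_eq_single q] at e1
      · rw [Matrix.mul_single_apply_same, mul_one, hpq] at e1
        have : R p q * R p q = 0 := by linear_combination -e1
        exact mul_self_eq_zero.1 this
      · intro j _ hj
        rw [Matrix.mul_single_apply_of_ne _ _ _ _ _ hj, zero_mul]
      · simp
    · rw [hAt, neg_one_smul]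
  refine ⟨Matrix.toBilin' A, fun v => ?_, ?_, fun γ hγ v w => ?_⟩
  · have h : Matrix.toBilin' A v v = -Matrix.toBilin' A v v := by
      conv_lhs => rw [Matrix.toBilin'_apply', Matrix.dotProduct_mulVec, ← Matrix.mulVec_transpose,
        hneg, dotProduct_comm, Matrix.neg_mulVec, dotProduct_neg, ← Matrix.toBilin'_apply']
    linarith
  · exact LinearMap.BilinForm.nondegenerate_toBilin'_of_det_ne_zero' A hdet.ne_zero
  · have h3 : (ρ (NmCor γ)).transpose * A * ρ (NmCor γ) = A := by
      rw [hadj, starCor_NmCor, Matrix.mul_assoc, ← map_mul, ← NmCor_mul, star_mul_eq_nrd, hγ,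
        map_one, NmCor_one, map_one, Matrix.mul_one]
    rw [Matrix.toBilin'_apply', Matrix.toBilin'_apply', Matrix.mulVec_mulVec]
    conv_rhs => rw [← h3, Matrix.mul_assoc, ← Matrix.mulVec_mulVec, Matrix.dotProduct_mulVec,
      Matrix.vecMul_transpose]

theorem mumford_vk3 (hK : Module.finrank ℚ K = 3) (ha : a ≠ 0) (hb : b ≠ 0)
    (ρ : CorAlg a b ≃ₐ[ℚ] Matrix (Fin 8) (Fin 8) ℚ) :
    (∃ ψ, IsInvariantSymplectic ρ ψ) ∧
      (∃! ρC, IsComplexification ρ ρC) ∧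
      ∀ ρC, IsComplexification ρ ρC →
        ∃ W, IsVK3 ρC W ∧ (∀ W', IsVK3 ρC W' → W' = W) ∧
          Module.finrank ℚ W = 9 ∧ W ≤ symTensors ℚ 8 ∧
          IsGStable ρ W ∧ (∀ W' ≤ W, IsGStable ρ W' → W' = ⊥ ∨ W' = W) ∧
          (∀ σ₀ θ₀,
            hodgePiece ρC σ₀ θ₀ W 2 0 ⊔ hodgePiece ρC σ₀ θ₀ W 1 1 ⊔ hodgePiece ρC σ₀ θ₀ W 0 2 =
              complexSpan W ∧
            Module.finrank ℂ (hodgePiece ρC σ₀ θ₀ W 2 0) = 1 ∧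
            Module.finrank ℂ (hodgePiece ρC σ₀ θ₀ W 1 1) = 7 ∧
            Module.finrank ℂ (hodgePiece ρC σ₀ θ₀ W 0 2) = 1) ∧
          ∀ ψ, IsInvariantSymplectic ρ ψ →
            ∃ f : CorSpace K (B0 a b) ≃ₗ[ℚ] W,
              (∀ x y, algebraMap ℚ (AlgebraicClosure ℚ) (intersectionForm ψ (f x) (f y)) =
                corForm (QB a b) x y) ∧
              ∀ γ : ℍ[K,a,b], nrd γ = 1 → ∀ x,
                (f (CorSpace.map (Ad γ) x) : (Fin 8 → ℚ) ⊗[ℚ] (Fin 8 → ℚ)) =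
                  act (ρ (NmCor γ)) (f x) := by
  refine ⟨exists_isInvariantSymplectic ρ hK ha hb, ?_, fun ρC hC => ?_⟩
  · obtain ⟨ρC, hC⟩ := exists_isComplexification ρ
    exact ⟨ρC, hC, fun ρC' hC' => hC'.unique hC⟩
  · obtain ⟨ψ₀, hψ₀⟩ := exists_isInvariantSymplectic ρ hK ha hb
    obtain ⟨A, hA, -⟩ := hψ₀.exists_gram
    refine ⟨vk3 ρ A, isVK3_vk3 hC hA ha hb, fun W' hW' => vk3_unique hC hA ha hb hW', ?_,
      vk3_le_symTensors hC hA, isGStable_vk3 hA,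
      fun W' hle hW' => vk3_irreducible hC hA ha hb hle hW',
      fun σ₀ θ₀ => hodge_vk3 hK hC hA ha hb σ₀ θ₀, fun ψ hψ => ?_⟩
    · rw [finrank_vk3 hC hA ha hb, hK]
    · obtain ⟨A', hA', hgram⟩ := hψ.exists_gram
      -- By uniqueness the space does not depend on the symplectic form used to construct it.
      have e : vk3 ρ A' = vk3 ρ A := vk3_unique hC hA ha hb (isVK3_vk3 hC hA' ha hb)
      rw [← e]
      exact exists_isometry hC hA' ha hb ψ hgram

end Involution

/-! ### Orders over discrete valuation rings -/

section LocalOrders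

open WithZero

/-- The value group is discrete, so a bounded set of values has a greatest element. -/
theorem exists_ne_zero_forall_le {T : Type*} (f : T → ℤᵐ⁰) (C : ℤᵐ⁰) (hC : ∀ x, f x ≤ C)
    (hne : ∃ x, f x ≠ 0) : ∃ x, f x ≠ 0 ∧ ∀ y, f y ≤ f x := by
  obtain ⟨x₀, hx₀⟩ := hne
  have hC0 : C ≠ 0 := fun h => hx₀ (le_zero_iff.1 (h ▸ hC x₀))
  obtain ⟨m, ⟨x, hx, rfl⟩, hm⟩ := Int.exists_greatest_of_bdd
    (P := fun m => ∃ x, f x ≠ 0 ∧ log (f x) = m)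
    ⟨log C, fun m ⟨x, hx, h⟩ => h ▸ (log_le_log hx hC0).2 (hC x)⟩ ⟨_, x₀, hx₀, rfl⟩
  refine ⟨x, hx, fun y => ?_⟩
  by_cases hy : f y = 0
  · rw [hy]; exact zero_le
  · exact (log_le_log hy hx).1 (hm _ ⟨y, hy, rfl⟩)

theorem le_one_of_pow_le {x C : ℤᵐ⁰} (h : ∀ n : ℕ, x ^ n ≤ C) : x ≤ 1 := by
  by_contra hx
  obtain ⟨n, hn⟩ := MulArchimedean.arch C (not_le.1 hx)
  have h1 := h (n + 1)
  have h2 : x ^ n < x ^ (n + 1) := pow_lt_pow_right₀ (not_le.1 hx) (Nat.lt_succ_self n)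
  exact absurd (hn.trans_lt h2) (not_lt.2 h1)

theorem lt_one_iff_le_exp {x : ℤᵐ⁰} : x < 1 ↔ x ≤ exp (-1 : ℤ) := by
  by_cases hx : x = 0
  · simp [hx]
  · rw [← log_le_log hx (by simp), ← log_lt_log hx one_ne_zero, log_one, log_exp]
    omega

variable {K : Type*} [Field K] [CharZero K] {a b : K} {ν : Valuation K ℤᵐ⁰}

theorem nrd_add (x y : ℍ[K,a,b]) : nrd (x + y) = nrd x + nrd y + trd (x * star y) := by
  rw [nrd_eq, nrd_eq, nrd_eq, trd_eq]
  simp only [QuaternionAlgebra.re_add, QuaternionAlgebra.imI_add, QuaternionAlgebra.imJ_add,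
    QuaternionAlgebra.imK_add, QuaternionAlgebra.re_mul, QuaternionAlgebra.re_star,
    QuaternionAlgebra.imI_star, QuaternionAlgebra.imJ_star, QuaternionAlgebra.imK_star]
  ring

theorem star_eq_trd_sub (x : ℍ[K,a,b]) : star x = trd x • 1 - x := by
  rw [eq_sub_iff_add_eq, add_comm, add_star_eq_trd, Algebra.algebraMap_eq_smul_one]

theorem mul_self_eq (x : ℍ[K,a,b]) : x * x = trd x • x - nrd x • 1 := by
  have h := mul_star_eq_nrd x
  rw [star_eq_trd_sub, mul_sub, mul_smul_comm, mul_one, Algebra.algebraMap_eq_smul_one] at h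
  rw [← h, sub_sub_cancel]

theorem trd_star (x : ℍ[K,a,b]) : trd (star x) = trd x := by
  rw [trd_eq, trd_eq]; simp

theorem mul_left_cancel_of_nrd_ne_zero {x : ℍ[K,a,b]} (hx : nrd x ≠ 0) {y y' : ℍ[K,a,b]}
    (h : x * y = x * y') : y = y' := by
  have := congrArg (fun w => (nrd x)⁻¹ • (star x * w)) h
  simp only [← mul_assoc, star_mul_eq_nrd, Algebra.algebraMap_eq_smul_one, smul_mul_assoc,
    one_mul, smul_smul, inv_mul_cancel₀ hx, one_smul] at this
  exact this

theorem mul_lt_one_left {x y : ℤᵐ⁰} (hx : x < 1) (hy : y ≤ 1) : x * y < 1 :=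
  (mul_le_of_le_one_right' hy).trans_lt hx

theorem map_natCast_le_one (ν : Valuation K ℤᵐ⁰) (n : ℕ) : ν (n : K) ≤ 1 := by
  induction n with
  | zero => simp
  | succ n ih => rw [Nat.cast_succ]; exact (ν.map_add _ _).trans (max_le ih (map_one ν).le)

variable (ν) in
/-- An order of `B` over the valuation ring of `ν`. -/
structure IsLocalOrder (O : Subring ℍ[K,a,b]) : Prop where
  smul_mem : ∀ r, ν r ≤ 1 → ∀ x ∈ O, r • x ∈ O
  bounded : ∃ C, ∀ x ∈ O, ν x.re ≤ C ∧ ν x.imI ≤ C ∧ ν x.imJ ≤ C ∧ ν x.imK ≤ C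
  spans : ∀ x : ℍ[K,a,b], ∃ r : K, r ≠ 0 ∧ r • x ∈ O

namespace IsLocalOrder

variable {O : Subring ℍ[K,a,b]}

theorem functional_bounded (hO : IsLocalOrder ν O) (l : ℍ[K,a,b] →ₗ[K] K) :
    ∃ C, ∀ x ∈ O, ν (l x) ≤ C := by
  obtain ⟨C, hC⟩ := hO.bounded
  refine ⟨max (max (C * ν (l ⟨1, 0, 0, 0⟩)) (C * ν (l ⟨0, 1, 0, 0⟩)))
    (max (C * ν (l ⟨0, 0, 1, 0⟩)) (C * ν (l ⟨0, 0, 0, 1⟩))), fun x hx => ?_⟩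
  obtain ⟨h1, h2, h3, h4⟩ := hC x hx
  have e : x = x.re • ⟨1, 0, 0, 0⟩ + x.imI • ⟨0, 1, 0, 0⟩ +
      (x.imJ • ⟨0, 0, 1, 0⟩ + x.imK • ⟨0, 0, 0, 1⟩) := by
    ext <;> simp
  rw [e]
  simp only [map_add, map_smul, smul_eq_mul]
  refine (ν.map_add _ _).trans (max_le_max ((ν.map_add _ _).trans (max_le_max ?_ ?_))
    ((ν.map_add _ _).trans (max_le_max ?_ ?_))) <;> rw [map_mul] <;> gcongr

/-- The powers of x stay in the bounded set `O`, so the powers of nrd x are bounded. -/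
theorem nrd_le_one (hO : IsLocalOrder ν O) {x : ℍ[K,a,b]} (hx : x ∈ O) : ν (nrd x) ≤ 1 := by
  obtain ⟨C, hC⟩ := hO.bounded
  have hb : ∃ C', ∀ x ∈ O, ν (nrd x) ≤ C' := by
    refine ⟨max (max (C ^ 2) (ν a * C ^ 2)) (max (ν b * C ^ 2) (ν a * ν b * C ^ 2)),
      fun x hx => ?_⟩
    obtain ⟨h1, h2, h3, h4⟩ := hC x hx
    have e : nrd x = (x.re ^ 2 - a * x.imI ^ 2) - (b * x.imJ ^ 2 - a * b * x.imK ^ 2) := by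
      rw [nrd_eq]; ring
    rw [e]
    refine (ν.map_sub _ _).trans (max_le_max ((ν.map_sub _ _).trans (max_le_max ?_ ?_))
      ((ν.map_sub _ _).trans (max_le_max ?_ ?_))) <;> simp only [map_mul, map_pow] <;> gcongr
  obtain ⟨C', hC'⟩ := hb
  refine le_one_of_pow_le (C := C') fun n => ?_
  have hp : ∀ n : ℕ, nrd (x ^ n) = nrd x ^ n := by
    intro n
    induction n with
    | zero => rw [pow_zero, pow_zero, nrd_one]
    | succ n ih => rw [pow_succ, pow_succ, nrd_mul, ih]
  rw [← map_pow, ← hp]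
  exact hC' _ (O.pow_mem hx n)

/-- The trace is expressed by norms: trd x = nrd(x + 1) - nrd x - 1. -/
theorem trd_le_one (hO : IsLocalOrder ν O) {x : ℍ[K,a,b]} (hx : x ∈ O) : ν (trd x) ≤ 1 := by
  have h := nrd_add x 1
  rw [star_one, mul_one, nrd_one] at h
  have e : trd x = nrd (x + 1) - (nrd x + 1) := by linear_combination -h
  rw [e]
  refine (ν.map_sub _ _).trans (max_le (hO.nrd_le_one (O.add_mem hx O.one_mem))
    ((ν.map_add _ _).trans (max_le (hO.nrd_le_one hx) ?_)))
  rw [map_one]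

theorem star_mem (hO : IsLocalOrder ν O) {x : ℍ[K,a,b]} (hx : x ∈ O) : star x ∈ O := by
  rw [star_eq_trd_sub]
  exact O.sub_mem (hO.smul_mem _ (hO.trd_le_one hx) _ O.one_mem) hx

theorem exists_inverse (hO : IsLocalOrder ν O) {x : ℍ[K,a,b]} (hx : x ∈ O) (h : ν (nrd x) = 1) :
    ∃ y ∈ O, x * y = 1 ∧ y * x = 1 := by
  have h0 : nrd x ≠ 0 := fun h0 => by simp [h0] at h
  refine ⟨(nrd x)⁻¹ • star x, hO.smul_mem _ (by rw [map_inv₀, h, inv_one]) _ (hO.star_mem hx),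
    ?_, ?_⟩
  · rw [mul_smul_comm, mul_star_eq_nrd, Algebra.algebraMap_eq_smul_one, smul_smul,
      inv_mul_cancel₀ h0, one_smul]
  · rw [smul_mul_assoc, star_mul_eq_nrd, Algebra.algebraMap_eq_smul_one, smul_smul,
      inv_mul_cancel₀ h0, one_smul]

theorem smul_one_mem (hO : IsLocalOrder ν O) {r : K} (hr : ν r ≤ 1) : r • (1 : ℍ[K,a,b]) ∈ O :=
  hO.smul_mem r hr 1 O.one_mem

theorem trd_lt_one (hO : IsLocalOrder ν O) (hB : ∀ x ∈ O, ν (trd x ^ 2 - 4 * nrd x) < 1)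
    {x : ℍ[K,a,b]} (hx : x ∈ O) (hn : ν (nrd x) < 1) : ν (trd x) < 1 := by
  have h4 : ν (4 * nrd x) < 1 := by
    rw [map_mul, mul_comm]
    exact mul_lt_one_left hn (by exact_mod_cast map_natCast_le_one ν 4)
  have h2 : ν (trd x ^ 2) < 1 := by
    have := ν.map_add_lt (hB x hx) h4
    rwa [sub_add_cancel] at this
  rw [map_pow] at h2
  exact (pow_lt_one_iff two_ne_zero).1 h2

/-- If all elements of an order have a characteristic polynomial with a double root modulo the
maximal ideal, then the elements of non-unit norm form an additive group. -/
theorem nrd_add_lt_one (hO : IsLocalOrder ν O)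
    (hB : ∀ x ∈ O, ν (trd x ^ 2 - 4 * nrd x) < 1) {x y : ℍ[K,a,b]}
    (hx : x ∈ O) (hy : y ∈ O) (hnx : ν (nrd x) < 1) (hny : ν (nrd y) < 1) :
    ν (nrd (x + y)) < 1 := by
  rw [nrd_add]
  refine ν.map_add_lt (ν.map_add_lt hnx hny) ?_
  refine hO.trd_lt_one hB (O.mul_mem hx (hO.star_mem hy)) ?_
  rw [nrd_mul, map_mul]
  exact mul_lt_one_left hnx (hO.nrd_le_one (hO.star_mem hy))

theorem nrd_mul_lt_one_left (hO : IsLocalOrder ν O) {x y : ℍ[K,a,b]} (hy : y ∈ O)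
    (hnx : ν (nrd x) < 1) : ν (nrd (x * y)) < 1 := by
  rw [nrd_mul, map_mul]
  exact mul_lt_one_left hnx (hO.nrd_le_one hy)

end IsLocalOrder

variable (ν) in
/-- A maximal order of `B` over the valuation ring of `ν`. -/
structure IsMaxLocalOrder (O : Subring ℍ[K,a,b]) : Prop extends IsLocalOrder ν O where
  le_of_le : ∀ O', IsLocalOrder ν O' → O ≤ O' → O' ≤ O

end LocalOrders

/-! ### Maximal local orders contain a separable quadratic order -/

section LocalOrders

open WithZero

variable {K : Type*} [Field K] [CharZero K] {a b : K} {ν : Valuation K ℤᵐ⁰}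

/-- A dependent chain of at least five vectors: the leading coefficient of a linear relation may be
normalized so that it is the first among those of maximal valuation. -/
theorem exists_normalized_relation (z : Fin 5 → ℍ[K,a,b]) (ν : Valuation K ℤᵐ⁰) :
    ∃ (d : Fin 5 → K) (i : Fin 5), ∑ k, d k • z k = 0 ∧ d i = 1 ∧ (∀ k, ν (d k) ≤ 1) ∧
      ∀ k < i, ν (d k) < 1 := by
  have hdep : ¬ LinearIndependent K z := by
    intro h
    have := h.fintype_card_le_finrank
    rw [QuaternionAlgebra.finrank_eq_four, Fintype.card_fin] at this
    omega
  obtain ⟨c, hc, j, hj⟩ := Fintype.not_linearIndependent_iff.1 hdep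
  obtain ⟨m, -, hm⟩ := Finset.exists_max_image Finset.univ (fun k => ν (c k)) ⟨j, Finset.mem_univ _⟩
  have hex : ∃ i, ∀ k, ν (c k) ≤ ν (c i) := ⟨m, fun k => hm k (Finset.mem_univ _)⟩
  classical
  obtain ⟨i, hi⟩ := Finset.exists_minimal (s := Finset.univ.filter fun i => ∀ k, ν (c k) ≤ ν (c i))
    -- Among the coefficients of maximal valuation take the one of least index; dividing by it makes
    -- all earlier coefficients non-units.
    ⟨m, by simpa using fun k => hm k (Finset.mem_univ _)⟩
  have hi1 : ∀ k, ν (c k) ≤ ν (c i) := by simpa using hi.1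
  have hci : c i ≠ 0 := by
    intro h0
    have := hi1 j
    rw [h0, map_zero, le_zero_iff, map_eq_zero] at this
    exact hj this
  have hpos : 0 < ν (c i) := zero_lt_iff.2 ((map_ne_zero ν).2 hci)
  refine ⟨fun k => (c i)⁻¹ * c k, i, ?_, inv_mul_cancel₀ hci, fun k => ?_, fun k hk => ?_⟩
  · simp_rw [mul_smul, ← Finset.smul_sum, hc, smul_zero]
  · rw [map_mul, map_inv₀, inv_mul_le_iff₀ hpos, mul_one]
    exact hi1 k
  · rw [map_mul, map_inv₀, inv_mul_lt_iff₀ hpos, mul_one]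
    refine lt_of_le_of_ne (hi1 k) fun he => ?_
    have hk2 := hi.2 (y := k) (by simpa [he] using hi1) hk.le
    exact absurd hk (not_lt.2 hk2)

namespace IsLocalOrder

variable {O : Subring ℍ[K,a,b]} {ϖ : K}

/-- Let J be the set of elements of non-unit norm. The claim is that J acts nilpotently on O/ϖO.
Otherwise an infinite chain 1, x₁, x₂x₁, … with xᵢ in J would avoid ϖO, and a linear relation among
five of its terms contradicts the invertibility of 1 + J. -/
theorem exists_annihilated (hO : IsLocalOrder ν O) (hϖ : ν ϖ = exp (-1 : ℤ))
    (hB : ∀ x ∈ O, ν (trd x ^ 2 - 4 * nrd x) < 1) :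
    ∃ z ∈ O, ϖ⁻¹ • z ∉ O ∧ ∀ x ∈ O, ν (nrd x) < 1 → ϖ⁻¹ • (x * z) ∈ O := by
  by_contra! H
  have h1 : ϖ⁻¹ • (1 : ℍ[K,a,b]) ∉ O := by
    intro h
    have := hO.nrd_le_one h
    rw [nrd_smul, nrd_one, mul_one, map_pow, map_inv₀, hϖ, ← exp_neg, ← exp_nsmul, ← exp_zero,
      exp_le_exp] at this
    simp at this
  have step : ∀ z : {z : ℍ[K,a,b] // z ∈ O ∧ ϖ⁻¹ • z ∉ O}, ∃ z' : {z // z ∈ O ∧ ϖ⁻¹ • z ∉ O},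
      ∃ x ∈ O, ν (nrd x) < 1 ∧ (z' : ℍ[K,a,b]) = x * z := by
    rintro ⟨z, hz, hz'⟩
    obtain ⟨x, hx, hn, h⟩ := H z hz hz'
    exact ⟨⟨x * z, O.mul_mem hx hz, h⟩, x, hx, hn, rfl⟩
  choose f x hx hnx hf using step
  let z : ℕ → {z : ℍ[K,a,b] // z ∈ O ∧ ϖ⁻¹ • z ∉ O} := fun n => f^[n] ⟨1, O.one_mem, h1⟩
  have hz : ∀ n, (z (n + 1) : ℍ[K,a,b]) = x (z n) * z n := fun n => by
    simp only [z, Function.iterate_succ_apply']; exact hf _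
  have hchain : ∀ i k : ℕ, ∃ w ∈ O, ν (nrd w) < 1 ∧ (z (i + k + 1) : ℍ[K,a,b]) = w * z i := by
    intro i k
    induction k with
    | zero => exact ⟨_, hx _, hnx _, hz i⟩
    | succ k ih =>
      obtain ⟨w, hw, hnw, h⟩ := ih
      exact ⟨x (z (i + k + 1)) * w, O.mul_mem (hx _) hw, hO.nrd_mul_lt_one_left hw (hnx _),
        by rw [mul_assoc, ← h, ← hz]; rfl⟩
  obtain ⟨d, i, hsum, hdi, hd1, hdlt⟩ := exists_normalized_relation (fun k : Fin 5 =>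
    (z k : ℍ[K,a,b])) ν
  have hϖ0 : ϖ ≠ 0 := (map_ne_zero ν).1 (by rw [hϖ]; exact exp_ne_zero)
  -- In the normalized relation, terms before the i-th lie in ϖO because their coefficients are
  -- non-units, and terms after it lie in J zᵢ by construction of the chain.
  have hlt : ∀ s : Finset (Fin 5), ∃ w ∈ O, ν (nrd w) < 1 ∧ ∃ u ∈ O,
      ∑ k ∈ s, (if k = i then 0 else d k • (z k : ℍ[K,a,b])) = w * z i + ϖ • u := by
    intro s
    induction s using Finset.induction_on with
    | empty => exact ⟨0, O.zero_mem, by simp [nrd_eq], 0, O.zero_mem, by simp⟩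
    | insert k s hk ih =>
      obtain ⟨w, hw, hnw, u, hu, h⟩ := ih
      rw [Finset.sum_insert hk, h]
      rcases lt_trichotomy k i with hki | hki | hki
      · refine ⟨w, hw, hnw, (ϖ⁻¹ * d k) • z k + u, O.add_mem (hO.smul_mem _ ?_ _ (z k).2.1) hu, ?_⟩
        · rw [map_mul, map_inv₀, hϖ, ← exp_neg]
          refine (mul_le_mul_right (lt_one_iff_le_exp.1 (hdlt k hki)) _).trans ?_
          rw [← exp_add]; simp
        · rw [if_neg hki.ne, smul_add, smul_smul, mul_inv_cancel_left₀ hϖ0]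
          abel
      · exact ⟨w, hw, hnw, u, hu, by rw [if_pos hki, zero_add]⟩
      · obtain ⟨m, hm⟩ := Nat.exists_eq_add_of_lt (Fin.lt_def.1 hki)
        obtain ⟨w', hw', hnw', h'⟩ := hchain i m
        have hdw : d k • w' ∈ O := hO.smul_mem _ (hd1 k) _ hw'
        refine ⟨d k • w' + w, O.add_mem hdw hw, hO.nrd_add_lt_one hB hdw hw ?_ hnw, u, hu, ?_⟩
        · rw [nrd_smul, map_mul, mul_comm, map_pow]
          exact mul_lt_one_left hnw' (pow_le_one' (hd1 k) 2)
        · rw [if_neg hki.ne', hm, h', add_mul, smul_mul_assoc, add_assoc]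
  obtain ⟨w, hw, hnw, u, hu, h⟩ := hlt Finset.univ
  have hrel : (1 + w) * z i = -(ϖ • u) := by
    rw [← Finset.add_sum_erase _ _ (Finset.mem_univ i), hdi, one_smul] at hsum
    rw [← Finset.add_sum_erase _ _ (Finset.mem_univ i), if_pos rfl, zero_add,
      Finset.sum_congr rfl (g := fun k => d k • (z k : ℍ[K,a,b]))
        (fun k hk => if_neg (Finset.ne_of_mem_erase hk))] at h
    rw [h] at hsum
    rw [add_mul, one_mul, eq_neg_iff_add_eq_zero, add_assoc]
    exact hsum
  -- nrd(1 + w) = 1 + nrd w + trd w, where both corrections are non-units.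
  have hu1 : ν (nrd (1 + w)) = 1 := by
    have ht : trd (1 * star w) = trd w := by rw [one_mul, trd_star]
    rw [nrd_add, nrd_one, add_assoc, ht]
    refine (ν.map_add_eq_of_lt_left ?_).trans (map_one ν)
    rw [map_one]
    exact ν.map_add_lt hnw (hO.trd_lt_one hB hw hnw)
  obtain ⟨y, hy, -, hy2⟩ := hO.exists_inverse (O.add_mem O.one_mem hw) hu1
  refine (z i).2.2 ?_
  have : (z i : ℍ[K,a,b]) = -(ϖ • (y * u)) := by
    rw [← one_mul (z i : ℍ[K,a,b]), ← hy2, mul_assoc, hrel, mul_neg, mul_smul_comm]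
  rw [this, smul_neg, smul_smul, inv_mul_cancel₀ hϖ0, one_smul]
  exact O.neg_mem (O.mul_mem hy hu)

/-- The right order of the ideal of elements of non-unit norm. -/
def rightOrder (hO : IsLocalOrder ν O)
    (hB : ∀ x ∈ O, ν (trd x ^ 2 - 4 * nrd x) < 1) : Subring ℍ[K,a,b] where
  carrier := {y | ∀ x ∈ O, ν (nrd x) < 1 → x * y ∈ O ∧ ν (nrd (x * y)) < 1}
  zero_mem' := fun x _ _ => by rw [mul_zero]; exact ⟨O.zero_mem, by simp [nrd_eq]⟩
  one_mem' := fun x hx hn => by rw [mul_one]; exact ⟨hx, hn⟩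
  add_mem' := fun {y y'} hy hy' x hx hn => by
    rw [mul_add]
    exact ⟨O.add_mem (hy x hx hn).1 (hy' x hx hn).1, hO.nrd_add_lt_one hB (hy x hx hn).1
      (hy' x hx hn).1 (hy x hx hn).2 (hy' x hx hn).2⟩
  neg_mem' := fun {y} hy x hx hn => by
    rw [mul_neg]
    refine ⟨O.neg_mem (hy x hx hn).1, ?_⟩
    have := (hy x hx hn).2
    rwa [nrd_eq, QuaternionAlgebra.re_neg, QuaternionAlgebra.imI_neg, QuaternionAlgebra.imJ_neg,
      QuaternionAlgebra.imK_neg, neg_sq, neg_sq, neg_sq, neg_sq, ← nrd_eq]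
  mul_mem' := fun {y y'} hy hy' x hx hn => by
    rw [← mul_assoc]
    exact hy' _ (hy x hx hn).1 (hy x hx hn).2

theorem isLocalOrder_rightOrder (hO : IsLocalOrder ν O) (hϖ : ν ϖ = exp (-1 : ℤ))
    (hB : ∀ x ∈ O, ν (trd x ^ 2 - 4 * nrd x) < 1) : IsLocalOrder ν (hO.rightOrder hB) where
  smul_mem r hr y hy x hx hn := by
    rw [mul_smul_comm]
    refine ⟨hO.smul_mem r hr _ (hy x hx hn).1, ?_⟩
    rw [nrd_smul, map_mul, map_pow, mul_comm]
    exact mul_lt_one_left (hy x hx hn).2 (pow_le_one' hr 2)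
  bounded := by
    obtain ⟨C, hC⟩ := hO.bounded
    have hϖ0 : 0 < ν ϖ := by rw [hϖ]; exact exp_pos
    have hlt : ν ϖ < 1 := by rw [hϖ]; exact lt_one_iff_le_exp.2 le_rfl
    refine ⟨(ν ϖ)⁻¹ * C, fun y hy => ?_⟩
    -- The scalar ϖ belongs to J, so the right order is contained in ϖ⁻¹O.
    have h := (hy (ϖ • 1) (hO.smul_one_mem hlt.le) (by
      rw [nrd_smul, nrd_one, mul_one, map_pow]; exact pow_lt_one' hlt two_ne_zero)).1
    rw [smul_mul_assoc, one_mul] at h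
    have h' := hC _ h
    simp only [QuaternionAlgebra.re_smul, QuaternionAlgebra.imI_smul, QuaternionAlgebra.imJ_smul,
      QuaternionAlgebra.imK_smul, smul_eq_mul, map_mul] at h'
    simpa only [le_inv_mul_iff₀ hϖ0] using h'
  spans x := by
    obtain ⟨r, hr, h⟩ := hO.spans x
    exact ⟨r, hr, fun y hy hn => ⟨O.mul_mem hy h, hO.nrd_mul_lt_one_left h hn⟩⟩

/-- Says that O/J is the residue field. If 2 is a unit, r is half the trace, and the norm of x - r
is the discriminant up to a unit. In residue characteristic two the trace is a non-unit and r is a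
square root of the norm modulo the maximal ideal. -/
theorem exists_sub_nrd_lt_one (hO : IsLocalOrder ν O)
    (hperf : ∀ n, ν n ≤ 1 → ν (2 : K) < 1 → ∃ m, ν m ≤ 1 ∧ ν (n - m ^ 2) < 1)
    (hB : ∀ x ∈ O, ν (trd x ^ 2 - 4 * nrd x) < 1) {x : ℍ[K,a,b]} (hx : x ∈ O) :
    ∃ r, ν r ≤ 1 ∧ ν (nrd (x - r • 1)) < 1 := by
  have e : ∀ r : K, nrd (x - r • 1) = nrd x - r * trd x + r ^ 2 := by
    intro r
    rw [nrd_eq, nrd_eq, trd_eq]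
    simp
    ring
  have h2 : ν (2 : K) ≤ 1 := by exact_mod_cast map_natCast_le_one ν 2
  rcases h2.lt_or_eq with h2 | h2
  · have hB' := hB x hx
    have h4 : ν (4 * nrd x) < 1 := by
      rw [show (4 : K) * nrd x = 2 * (2 * nrd x) by ring, map_mul]
      refine mul_lt_one_left h2 ?_
      rw [map_mul]
      exact mul_le_one' h2.le (hO.nrd_le_one hx)
    have ht : ν (trd x) < 1 := by
      have := ν.map_add_lt hB' h4
      rw [sub_add_cancel, map_pow] at this
      exact (pow_lt_one_iff two_ne_zero).1 this
    obtain ⟨m, hm, h⟩ := hperf (nrd x) (hO.nrd_le_one hx) h2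
    refine ⟨m, hm, ?_⟩
    rw [e, show nrd x - m * trd x + m ^ 2 = (nrd x - m ^ 2) - (trd x * m - 2 * m ^ 2) by ring]
    refine ν.map_sub_lt h (ν.map_sub_lt ?_ ?_)
    · rw [map_mul]; exact mul_lt_one_left ht hm
    · rw [map_mul, map_pow]; exact mul_lt_one_left h2 (pow_le_one' hm 2)
  · refine ⟨trd x / 2, by rw [map_div₀, h2, div_one]; exact hO.trd_le_one hx, ?_⟩
    rw [e, show nrd x - trd x / 2 * trd x + (trd x / 2) ^ 2 = -((trd x ^ 2 - 4 * nrd x) / 2 ^ 2) by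
      ring, ν.map_neg, map_div₀, map_pow, h2, one_pow, div_one]
    exact hB x hx

end IsLocalOrder

theorem exists_functional (x : ℍ[K,a,b]) : ∃ l : ℍ[K,a,b] →ₗ[K] K, l 1 = 0 ∧ l x = 0 ∧ l ≠ 0 := by
  have hlt : Submodule.span K {1, x} < ⊤ := by
    refine lt_of_le_of_ne le_top fun h => ?_
    classical
    have := finrank_span_finset_le_card (R := K) ({1, x} : Finset ℍ[K,a,b])
    rw [Set.finrank, Finset.coe_pair, h, finrank_top, QuaternionAlgebra.finrank_eq_four] at this
    exact absurd (this.trans Finset.card_le_two) (by norm_num)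
  obtain ⟨l, hl0, hl⟩ := Submodule.exists_le_ker_of_lt_top _ hlt
  exact ⟨l, hl (Submodule.subset_span (by simp)), hl (Submodule.subset_span (by simp)), hl0⟩

/-- A maximal order contains an element generating a separable quadratic algebra modulo the maximal
ideal. -/
theorem IsMaxLocalOrder.exists_disc_eq_one {O : Subring ℍ[K,a,b]} (hO : IsMaxLocalOrder ν O) {ϖ : K}
    (hϖ : ν ϖ = exp (-1 : ℤ))
    (hperf : ∀ n, ν n ≤ 1 → ν (2 : K) < 1 → ∃ m, ν m ≤ 1 ∧ ν (n - m ^ 2) < 1) :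
    ∃ x ∈ O, ν (trd x ^ 2 - 4 * nrd x) = 1 := by
  -- If every discriminant is a non-unit, then J is an ideal. Maximality makes it principal, J = Ox,
  -- and then `O` would have rank at most two.
  by_contra! H
  have hOl := hO.toIsLocalOrder
  have hϖ0 : ϖ ≠ 0 := (map_ne_zero ν).1 (by rw [hϖ]; exact exp_ne_zero)
  have hB : ∀ x ∈ O, ν (trd x ^ 2 - 4 * nrd x) < 1 := fun x hx => by
    refine lt_of_le_of_ne ((ν.map_sub _ _).trans (max_le ?_ ?_)) (H x hx)
    · rw [map_pow]; exact pow_le_one' (hOl.trd_le_one hx) 2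
    · rw [map_mul]
      exact mul_le_one' (by exact_mod_cast map_natCast_le_one ν 4) (hOl.nrd_le_one hx)
  obtain ⟨z, hz, hz1, hz2⟩ := hOl.exists_annihilated hϖ hB
  -- The right order of J contains `O`, so by maximality it equals `O` and cannot contain ϖ⁻¹z. As J
  -- ϖ⁻¹z is contained in `O`, some product xϖ⁻¹z must have unit norm.
  have hnot : ϖ⁻¹ • z ∉ hOl.rightOrder hB := fun h => hz1
    (hO.le_of_le _ (hOl.isLocalOrder_rightOrder hϖ hB)
      (fun y hy x hx hn => ⟨O.mul_mem hx hy, hOl.nrd_mul_lt_one_left hy hn⟩) h)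
  have hnot' : ∃ x ∈ O, ν (nrd x) < 1 ∧ ν (nrd (x * ϖ⁻¹ • z)) = 1 := by
    by_contra! h'
    refine hnot fun x hx hn => ?_
    have hm : x * ϖ⁻¹ • z ∈ O := by rw [mul_smul_comm]; exact hz2 x hx hn
    exact ⟨hm, lt_of_le_of_ne (hOl.nrd_le_one hm) (h' x hx hn)⟩
  obtain ⟨x, hx, hnx, hun⟩ := hnot'
  obtain ⟨u, hu, hu1, hu2⟩ := hOl.exists_inverse (x := x * ϖ⁻¹ • z)
    (by rw [mul_smul_comm]; exact hz2 x hx hnx) hun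
  have hux : (ϖ⁻¹ • z) * (u * x) = 1 := by
    have hne : nrd x ≠ 0 := by
      intro h0
      rw [nrd_mul, h0, zero_mul, map_zero] at hun
      exact zero_ne_one hun
    apply mul_left_cancel_of_nrd_ne_zero hne
    rw [← mul_assoc, ← mul_assoc, hu1, one_mul, mul_one]
  -- Since (ϖ⁻¹z)(ux) = 1, every w in J equals (wϖ⁻¹z u) x.
  have hJ : ∀ w ∈ O, ν (nrd w) < 1 → ∃ y ∈ O, w = y * x := fun w hw hnw =>
    ⟨w * ϖ⁻¹ • z * u, O.mul_mem (by rw [mul_smul_comm]; exact hz2 w hw hnw) hu, by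
      rw [mul_assoc, mul_assoc, hux, mul_one]⟩
  -- Apply O = R + Ox twice; the remainder involves x² = trd(x) x - nrd(x), which lies in ϖO.
  have hdec : ∀ w ∈ O, ∃ r s : K, ∃ y ∈ O, w = r • 1 + s • x + ϖ • y := by
    intro w hw
    have key : ∀ w ∈ O, ∃ r : K, ν r ≤ 1 ∧ ∃ y ∈ O, w = r • 1 + y * x := by
      intro w hw
      obtain ⟨r, hr, h⟩ := hOl.exists_sub_nrd_lt_one hperf hB hw
      obtain ⟨y, hy, h⟩ := hJ _ (O.sub_mem hw (hOl.smul_one_mem hr)) h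
      exact ⟨r, hr, y, hy, by rw [← h]; abel⟩
    obtain ⟨r, hr, y, hy, rfl⟩ := key w hw
    obtain ⟨s, hs, y', hy', rfl⟩ := key y hy
    have hsm : ∀ t : K, ν t < 1 → ν (ϖ⁻¹ * t) ≤ 1 := fun t ht => by
      rw [map_mul, map_inv₀, hϖ, ← exp_neg]
      refine (mul_le_mul_right (lt_one_iff_le_exp.1 ht) _).trans ?_
      rw [← exp_add]; simp
    refine ⟨r, s, y' * ((ϖ⁻¹ * trd x) • x - (ϖ⁻¹ * nrd x) • 1), O.mul_mem hy' (O.sub_mem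
      (hOl.smul_mem _ (hsm _ (hOl.trd_lt_one hB hx hnx)) _ hx) (hOl.smul_one_mem (hsm _ hnx))), ?_⟩
    rw [add_mul, smul_mul_assoc, one_mul, mul_assoc, mul_self_eq, ← mul_smul_comm, smul_sub,
      smul_smul, smul_smul, mul_inv_cancel_left₀ hϖ0, mul_inv_cancel_left₀ hϖ0, add_assoc]
  -- A functional killing 1 and x attains a maximal valuation on `O`, but by the decomposition every
  -- value is ϖ times another one.
  obtain ⟨l, hl1, hlx, hl0⟩ := exists_functional x
  obtain ⟨C, hC⟩ := hOl.functional_bounded l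
  have hne : ∃ w : O, ν (l w) ≠ 0 := by
    by_contra! h
    refine hl0 (LinearMap.ext fun y => ?_)
    obtain ⟨r, hr, hy⟩ := hOl.spans y
    have := h ⟨_, hy⟩
    rw [map_eq_zero, map_smul, smul_eq_mul, mul_eq_zero] at this
    exact this.resolve_left hr
  obtain ⟨w, hw0, hw⟩ := exists_ne_zero_forall_le (fun w : O => ν (l w)) C (fun w => hC w w.2) hne
  obtain ⟨r, s, y, hy, h⟩ := hdec w w.2
  have h2 := hw ⟨y, hy⟩
  simp only [h, map_add, map_smul, hl1, hlx, smul_zero, zero_add, smul_eq_mul, mul_zero,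
    map_mul] at h2
  have hy0 : ν (l y) ≠ 0 := fun h0 => hw0 (by
    simp only [h, map_add, map_smul, hl1, hlx, smul_zero, zero_add, smul_eq_mul, map_mul, h0,
      mul_zero, map_zero])
  have hlt : ν ϖ < 1 := by rw [hϖ]; exact lt_one_iff_le_exp.2 le_rfl
  exact absurd h2 (not_le.2 (mul_lt_of_lt_one_left (zero_lt_iff.2 hy0) hlt))

end LocalOrders

/-! ### Decomposition along a quadratic order, and twisted orders -/

section LocalOrders

open WithZero

variable {K : Type*} [Field K] [CharZero K] {a b : K} {ν : Valuation K ℤᵐ⁰}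

theorem mul_right_cancel_of_nrd_ne_zero {x : ℍ[K,a,b]} (hx : nrd x ≠ 0) {y y' : ℍ[K,a,b]}
    (h : y * x = y' * x) : y = y' := by
  have := congrArg (fun w => (nrd x)⁻¹ • (w * star x)) h
  simp only [mul_assoc, mul_star_eq_nrd, Algebra.algebraMap_eq_smul_one, mul_smul_comm,
    mul_one, smul_smul, inv_mul_cancel₀ hx, one_smul] at this
  exact this

theorem trd_one : trd (1 : ℍ[K,a,b]) = 2 := by rw [trd_eq]; simp

theorem trd_sub (x y : ℍ[K,a,b]) : trd (x - y) = trd x - trd y := by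
  rw [trd_eq, trd_eq, trd_eq, QuaternionAlgebra.re_sub, mul_sub]

theorem trd_mul_self (x : ℍ[K,a,b]) : trd (x * x) = trd x ^ 2 - 2 * nrd x := by
  rw [mul_self_eq, trd_sub, trd_smul, trd_smul, trd_one]; ring

theorem trd_mul_star_right (x e : ℍ[K,a,b]) : trd (x * star e) = trd e * trd x - trd (x * e) := by
  rw [star_eq_trd_sub, mul_sub, trd_sub, mul_smul_comm, mul_one, trd_smul]

theorem eq_zero_of_trd_mul_star (ha : a ≠ 0) (hb : b ≠ 0) {m : ℍ[K,a,b]}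
    (h : ∀ x, trd (m * star x) = 0) : m = 0 := by
  have h1 := h ⟨1, 0, 0, 0⟩
  have h2 := h ⟨0, 1, 0, 0⟩
  have h3 := h ⟨0, 0, 1, 0⟩
  have h4 := h ⟨0, 0, 0, 1⟩
  simp [trd_eq] at h1 h2 h3 h4
  ext
  · exact h1
  · simpa [ha] using h2
  · simpa [hb] using h3
  · simpa [ha, hb] using h4

theorem mul_eq_star_mul {e m : ℍ[K,a,b]} (h0 : trd m = 0) (h1 : trd (m * e) = 0) :
    m * e = star e * m := by
  have h2 := add_star_eq_trd (m * star e)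
  rw [trd_mul_star_right, h0, h1, mul_zero, sub_zero, map_zero, star_mul, star_star,
    star_eq_neg_of_trd_eq_zero h0, mul_neg, ← sub_eq_add_neg, sub_eq_zero] at h2
  rw [star_eq_trd_sub] at h2 ⊢
  rw [mul_sub, mul_smul_comm, mul_one] at h2
  rw [sub_mul, smul_mul_assoc, one_mul, ← h2, sub_sub_cancel]

/-- The decomposition of `B` with respect to a separable quadratic subalgebra `K(e)`. -/
theorem exists_decomposition {e : ℍ[K,a,b]} (he : ν (trd e ^ 2 - 4 * nrd e) = 1)
    (het : ν (trd e) ≤ 1) (hen : ν (nrd e) ≤ 1) (x : ℍ[K,a,b]) :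
    ∃ (p q : K) (m : ℍ[K,a,b]), x = p • 1 + q • e + m ∧ trd m = 0 ∧ trd (m * e) = 0 ∧
      (ν (trd x) ≤ 1 → ν (trd (x * e)) ≤ 1 → ν p ≤ 1 ∧ ν q ≤ 1) := by
  set t := trd e
  set n := nrd e
  have hΔ : t ^ 2 - 4 * n ≠ 0 := fun h => by simp [h] at he
  set T := trd x
  set u := trd (x * e)
  have hi := mul_inv_cancel₀ hΔ
  have h2 : ν (2 : K) ≤ 1 := by exact_mod_cast map_natCast_le_one ν 2
  -- Cramer's rule for T = 2p + tq and u = tp + (t² - 2n)q. The determinant is t² - 4n, a unit by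
  -- hypothesis, so p and q are integral.
  refine ⟨((t ^ 2 - 2 * n) * T - t * u) / (t ^ 2 - 4 * n), (2 * u - t * T) / (t ^ 2 - 4 * n),
    x - (((t ^ 2 - 2 * n) * T - t * u) / (t ^ 2 - 4 * n)) • 1 -
      ((2 * u - t * T) / (t ^ 2 - 4 * n)) • e, by abel, ?_, ?_, fun hT hu => ?_⟩
  · rw [trd_sub, trd_sub, trd_smul, trd_smul, trd_one]
    change T - _ - _ * t = 0
    linear_combination (-T) * hi
  · rw [sub_mul, sub_mul, smul_mul_assoc, smul_mul_assoc, one_mul, trd_sub, trd_sub, trd_smul,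
      trd_smul, trd_mul_self]
    change u - _ * t - _ * (t ^ 2 - 2 * n) = 0
    linear_combination (-u) * hi
  · rw [map_div₀, map_div₀, he, div_one, div_one]
    constructor
    · refine (ν.map_sub _ _).trans (max_le ?_ ?_) <;> rw [map_mul]
      · refine mul_le_one' ((ν.map_sub _ _).trans (max_le ?_ ?_)) hT
        · rw [map_pow]; exact pow_le_one' het 2
        · rw [map_mul]; exact mul_le_one' h2 hen
      · exact mul_le_one' het hu
    · refine (ν.map_sub _ _).trans (max_le ?_ ?_) <;> rw [map_mul]
      · exact mul_le_one' h2 hu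
      · exact mul_le_one' het hT

variable (ν) in
/-- The quadratic order generated by `e`. -/
def quadOrder (e : ℍ[K,a,b]) (het : ν (trd e) ≤ 1) (hen : ν (nrd e) ≤ 1) : Subring ℍ[K,a,b] where
  carrier := {x | ∃ p q : K, ν p ≤ 1 ∧ ν q ≤ 1 ∧ x = p • 1 + q • e}
  zero_mem' := ⟨0, 0, by simp, by simp, by simp⟩
  one_mem' := ⟨1, 0, by simp, by simp, by simp⟩
  add_mem' := by
    rintro _ _ ⟨p, q, hp, hq, rfl⟩ ⟨p', q', hp', hq', rfl⟩
    exact ⟨p + p', q + q', (ν.map_add _ _).trans (max_le hp hp'),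
      (ν.map_add _ _).trans (max_le hq hq'), by rw [add_smul, add_smul]; abel⟩
  neg_mem' := by
    rintro _ ⟨p, q, hp, hq, rfl⟩
    exact ⟨-p, -q, by rwa [ν.map_neg], by rwa [ν.map_neg], by rw [neg_smul, neg_smul]; abel⟩
  mul_mem' := by
    rintro _ _ ⟨p, q, hp, hq, rfl⟩ ⟨p', q', hp', hq', rfl⟩
    refine ⟨p * p' - q * q' * nrd e, p * q' + q * p' + q * q' * trd e,
      (ν.map_sub _ _).trans (max_le ?_ ?_),
      (ν.map_add _ _).trans (max_le ((ν.map_add _ _).trans (max_le ?_ ?_)) ?_), ?_⟩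
    any_goals simp only [map_mul]; first
      | exact mul_le_one' (mul_le_one' hq hq') ‹_›
      | exact mul_le_one' ‹_› ‹_›
    simp only [add_mul, mul_add, smul_mul_assoc, mul_smul_comm, mul_one, one_mul, mul_self_eq e]
    module

section Quad

variable {e : ℍ[K,a,b]} {het : ν (trd e) ≤ 1} {hen : ν (nrd e) ≤ 1}

theorem commute_quadOrder {s : ℍ[K,a,b]} (hs : s ∈ quadOrder ν e het hen) (α β : K) :
    s * (α • 1 + β • e) = (α • 1 + β • e) * s := by
  obtain ⟨p, q, -, -, rfl⟩ := hs
  simp only [add_mul, mul_add, smul_mul_assoc, mul_smul_comm, mul_one, one_mul]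
  module

theorem star_mem_quadOrder {s : ℍ[K,a,b]} (hs : s ∈ quadOrder ν e het hen) :
    star s ∈ quadOrder ν e het hen := by
  obtain ⟨p, q, hp, hq, rfl⟩ := hs
  refine ⟨p + q * trd e, -q, (ν.map_add _ _).trans (max_le hp ?_), by rwa [ν.map_neg], ?_⟩
  · rw [map_mul]; exact mul_le_one' hq het
  · rw [star_add, QuaternionAlgebra.star_smul, QuaternionAlgebra.star_smul, star_one,
      star_eq_trd_sub e, smul_sub, smul_smul, add_smul, neg_smul]
    abel

theorem quadOrder_le {O : Subring ℍ[K,a,b]} (hO : IsLocalOrder ν O) (he : e ∈ O) :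
    quadOrder ν e het hen ≤ O := by
  rintro _ ⟨p, q, hp, hq, rfl⟩
  exact O.add_mem (hO.smul_one_mem hp) (hO.smul_mem q hq _ he)

theorem smul_mem_quadOrder {r : K} (hr : ν r ≤ 1) {s : ℍ[K,a,b]}
    (hs : s ∈ quadOrder ν e het hen) : r • s ∈ quadOrder ν e het hen := by
  obtain ⟨p, q, hp, hq, rfl⟩ := hs
  refine ⟨r * p, r * q, ?_, ?_, by rw [smul_add, smul_smul, smul_smul]⟩ <;> rw [map_mul] <;>
    exact mul_le_one' hr ‹_›

theorem mul_smul_one_add {j : ℍ[K,a,b]} (hj : j * e = star e * j) (p q : K) :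
    j * (p • 1 + q • e) = star (p • (1 : ℍ[K,a,b]) + q • e) * j := by
  rw [star_add, QuaternionAlgebra.star_smul, QuaternionAlgebra.star_smul, star_one, mul_add,
    add_mul, mul_smul_comm, mul_smul_comm, smul_mul_assoc, smul_mul_assoc, hj, mul_one, one_mul]

theorem mul_quadOrder {j : ℍ[K,a,b]} (hj : j * e = star e * j) {s : ℍ[K,a,b]}
    (hs : s ∈ quadOrder ν e het hen) : j * s = star s * j := by
  obtain ⟨p, q, -, -, rfl⟩ := hs
  exact mul_smul_one_add hj p q

end Quad

/-- The multiplication table that closes S + (S + Sg)j under products; it shows which multiples of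
j² must lie in S. -/
theorem twisted_mul {R : Type*} [Ring R] {j s₁ s₂ s₃ s₁' s₂' s₃' u₁ u₂ u₃ g g' : R}
    (h1 : j * s₁' = u₁ * j) (h2 : j * s₂' = u₂ * j) (h3 : j * s₃' = u₃ * j)
    (hg : j * g = g' * j) (c1 : u₁ * g = g * u₁) (c2 : u₂ * g = g * u₂) (c3 : u₃ * g = g * u₃) :
    (s₁ + (s₂ + s₃ * g) * j) * (s₁' + (s₂' + s₃' * g) * j) =
      (s₁ * s₁' + s₂ * u₂ * (j * j) + s₃ * u₂ * (g * (j * j)) + s₂ * u₃ * (g' * (j * j)) +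
        s₃ * u₃ * (g * g' * (j * j))) +
      ((s₁ * s₂' + s₂ * u₁) + (s₁ * s₃' + s₃ * u₁) * g) * j := by
  have e1 : j * ((s₂' + s₃' * g) * j) = (u₂ + u₃ * g') * (j * j) := by
    rw [← mul_assoc, mul_add, ← mul_assoc, h2, h3, mul_assoc u₃, hg]
    noncomm_ring
  have e2 : (s₂ + s₃ * g) * (u₂ + u₃ * g') = s₂ * u₂ + s₃ * u₂ * g + s₂ * u₃ * g' +
      s₃ * u₃ * (g * g') := by
    rw [add_mul, mul_add, mul_add, mul_assoc s₃ g, mul_assoc s₃ g, ← c2, ← mul_assoc g, ← c3]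
    noncomm_ring
  have e3 : (s₂ + s₃ * g) * u₁ = s₂ * u₁ + s₃ * u₁ * g := by
    rw [add_mul, mul_assoc s₃ g, ← c1, mul_assoc]
  rw [add_mul, mul_add, mul_add, mul_assoc (s₂ + s₃ * g) j, mul_assoc (s₂ + s₃ * g) j, e1, h1,
    ← mul_assoc (s₂ + s₃ * g) (u₂ + _), e2, ← mul_assoc (s₂ + s₃ * g) u₁, e3]
  noncomm_ring

/-- The order `S + (S + S g) j`. -/
def twistedOrder (e j g : ℍ[K,a,b]) (het : ν (trd e) ≤ 1) (hen : ν (nrd e) ≤ 1) (α β : K)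
    (hg : g = α • 1 + β • e) (hj : j * e = star e * j) (hc : j * j ∈ quadOrder ν e het hen)
    (h1 : g * (j * j) ∈ quadOrder ν e het hen) (h2 : star g * (j * j) ∈ quadOrder ν e het hen)
    (h3 : g * star g * (j * j) ∈ quadOrder ν e het hen) : Subring ℍ[K,a,b] where
  carrier := {x | ∃ s₁ ∈ quadOrder ν e het hen, ∃ s₂ ∈ quadOrder ν e het hen,
    ∃ s₃ ∈ quadOrder ν e het hen, x = s₁ + (s₂ + s₃ * g) * j}
  zero_mem' := ⟨0, Subring.zero_mem _, 0, Subring.zero_mem _, 0, Subring.zero_mem _, by simp⟩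
  one_mem' := ⟨1, Subring.one_mem _, 0, Subring.zero_mem _, 0, Subring.zero_mem _, by simp⟩
  add_mem' := by
    rintro _ _ ⟨s₁, hs₁, s₂, hs₂, s₃, hs₃, rfl⟩ ⟨s₁', hs₁', s₂', hs₂', s₃', hs₃', rfl⟩
    exact ⟨_, add_mem hs₁ hs₁', _, add_mem hs₂ hs₂', _, add_mem hs₃ hs₃', by noncomm_ring⟩
  neg_mem' := by
    rintro _ ⟨s₁, hs₁, s₂, hs₂, s₃, hs₃, rfl⟩
    exact ⟨_, neg_mem hs₁, _, neg_mem hs₂, _, neg_mem hs₃, by noncomm_ring⟩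
  mul_mem' := by
    rintro _ _ ⟨s₁, hs₁, s₂, hs₂, s₃, hs₃, rfl⟩ ⟨s₁', hs₁', s₂', hs₂', s₃', hs₃', rfl⟩
    have hu₁ := star_mem_quadOrder hs₁'
    have hu₂ := star_mem_quadOrder hs₂'
    have hu₃ := star_mem_quadOrder hs₃'
    have hcomm : ∀ {s}, s ∈ quadOrder ν e het hen → s * g = g * s := fun hs => by
      rw [hg]; exact commute_quadOrder hs α β
    have hgj : j * g = star g * j := by rw [hg]; exact mul_smul_one_add hj α β
    refine ⟨_, ?_, _, ?_, _, ?_, twisted_mul (mul_quadOrder hj hs₁') (mul_quadOrder hj hs₂')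
      (mul_quadOrder hj hs₃') hgj (hcomm hu₁) (hcomm hu₂) (hcomm hu₃)⟩
    · exact add_mem (add_mem (add_mem (add_mem (mul_mem hs₁ hs₁') (mul_mem (mul_mem hs₂ hu₂) hc))
        (mul_mem (mul_mem hs₃ hu₂) h1)) (mul_mem (mul_mem hs₂ hu₃) h2))
        (mul_mem (mul_mem hs₃ hu₃) h3)
    · exact add_mem (mul_mem hs₁ hs₂') (mul_mem hs₂ hu₁)
    · exact add_mem (mul_mem hs₁ hs₃') (mul_mem hs₃ hu₁)

end LocalOrders

/-! ### Structure of maximal local orders -/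

section LocalOrders

open WithZero

variable {K : Type*} [Field K] [CharZero K] {a b : K} {ν : Valuation K ℤᵐ⁰}

theorem IsLocalOrder.exists_smul_mem {O : Subring ℍ[K,a,b]} (hO : IsLocalOrder ν O)
    (x : ℍ[K,a,b]) : ∃ r : K, r ≠ 0 ∧ ν r ≤ 1 ∧ r • x ∈ O := by
  obtain ⟨r, hr, h⟩ := hO.spans x
  rcases le_total (ν r) 1 with h1 | h1
  · exact ⟨r, hr, h1, h⟩
  · refine ⟨1, one_ne_zero, (map_one ν).le, ?_⟩
    have := hO.smul_mem r⁻¹ (by rw [map_inv₀]; exact inv_le_one_of_one_le₀ h1) _ h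
    rwa [smul_smul, inv_mul_cancel₀ hr, ← one_smul K x, smul_smul, mul_one] at this

/-- The anticommutant of a separable quadratic subalgebra contains an invertible element. -/
theorem IsLocalOrder.exists_nrd_ne_zero (ha : a ≠ 0) (hb : b ≠ 0) {O : Subring ℍ[K,a,b]}
    (hO : IsLocalOrder ν O) {e : ℍ[K,a,b]} (heO : e ∈ O) (he : ν (trd e ^ 2 - 4 * nrd e) = 1) :
    ∃ m ∈ O, trd m = 0 ∧ trd (m * e) = 0 ∧ nrd m ≠ 0 := by
  by_contra! H
  have hdec := fun x => exists_decomposition he (hO.trd_le_one heO) (hO.nrd_le_one heO) x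
  have H' : ∀ m : ℍ[K,a,b], trd m = 0 → trd (m * e) = 0 → nrd m = 0 := fun m h1 h2 => by
    obtain ⟨r, hr, h⟩ := hO.spans m
    have := H _ h (by rw [trd_smul, h1, mul_zero]) (by rw [smul_mul_assoc, trd_smul, h2, mul_zero])
    rw [nrd_smul] at this
    exact (mul_eq_zero.1 this).resolve_left (pow_ne_zero 2 hr)
  -- If the norm vanished on the whole anticommutant, then by polarization the anticommutant would
  -- lie in the radical of the nondegenerate trace form, and B would be spanned by 1 and e.
  have H0 : ∀ m : ℍ[K,a,b], trd m = 0 → trd (m * e) = 0 → m = 0 := fun m h1 h2 => by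
    refine eq_zero_of_trd_mul_star ha hb fun x => ?_
    obtain ⟨p, q, m', rfl, h1', h2', -⟩ := hdec x
    have h3 := nrd_add m m'
    rw [H' m h1 h2, H' m' h1' h2', H' (m + m') (by rw [trd_add, h1, h1', add_zero])
      (by rw [add_mul, trd_add, h2, h2', add_zero]), zero_add, zero_add] at h3
    rw [star_add, star_add, mul_add, mul_add, trd_add, trd_add, ← h3,
      QuaternionAlgebra.star_smul, QuaternionAlgebra.star_smul, mul_smul_comm, mul_smul_comm,
      trd_smul, trd_smul, star_one, mul_one, h1, trd_mul_star_right, h1, h2]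
    simp
  obtain ⟨l, hl1, hle, hl0⟩ := exists_functional e
  refine hl0 (LinearMap.ext fun x => ?_)
  obtain ⟨p, q, m, rfl, h1, h2, -⟩ := hdec x
  rw [H0 m h1 h2]
  simp [hl1, hle]

theorem exists_mul_eq {j : ℍ[K,a,b]} (hj : nrd j ≠ 0) (y : ℍ[K,a,b]) : ∃ s, s * j = y :=
  ⟨(nrd j)⁻¹ • (y * star j), by
    rw [smul_mul_assoc, mul_assoc, star_mul_eq_nrd, Algebra.algebraMap_eq_smul_one,
      mul_smul_comm, mul_one, smul_smul, inv_mul_cancel₀ hj, one_smul]⟩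

/-- Both y and j twist e into ē, so the quotient s = y j⁻¹ commutes with e. -/
theorem mul_comm_of_anticommute {e j y s : ℍ[K,a,b]} (hj1 : trd j = 0) (hj2 : trd (j * e) = 0)
    (hj0 : nrd j ≠ 0) (hy1 : trd y = 0) (hy2 : trd (y * e) = 0) (hsj : s * j = y) :
    s * e = e * s := by
  have hye := mul_eq_star_mul hy1 hy2
  have hje := mul_eq_star_mul hj1 hj2
  apply mul_right_cancel_of_nrd_ne_zero hj0
  have : star e * j = trd e • j - e * j := by
    rw [star_eq_trd_sub, sub_mul, smul_mul_assoc, one_mul]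
  have h' : e * j = j * star e := by
    rw [star_eq_trd_sub, mul_sub, mul_smul_comm, mul_one, hje, this, sub_sub_cancel]
  rw [mul_assoc, h', ← mul_assoc, hsj, mul_assoc, hsj, star_eq_trd_sub, mul_sub, mul_smul_comm,
    mul_one, hye, star_eq_trd_sub, sub_mul, smul_mul_assoc, one_mul, sub_sub_cancel]

/-- The component of s outside K(e) both commutes with e and twists it, so it is killed by e - ē,
whose norm is minus the discriminant and hence nonzero. -/
theorem exists_eq_of_commute {e : ℍ[K,a,b]} (he : ν (trd e ^ 2 - 4 * nrd e) = 1)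
    (het : ν (trd e) ≤ 1) (hen : ν (nrd e) ≤ 1) {s : ℍ[K,a,b]} (hse : s * e = e * s) :
    ∃ p q : K, s = p • 1 + q • e ∧
      (ν (trd s) ≤ 1 → ν (trd (s * e)) ≤ 1 → ν p ≤ 1 ∧ ν q ≤ 1) := by
  obtain ⟨p, q, m, hpqm, hm1, hm2, hpq⟩ := exists_decomposition he het hen s
  have hme := mul_eq_star_mul hm1 hm2
  have hm0 : m = 0 := by
    have hcomm : m * e = e * m := by
      have hms : m = s - (p • 1 + q • e) := by rw [hpqm]; abel
      rw [hms, sub_mul, mul_sub, hse]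
      simp only [add_mul, mul_add, smul_mul_assoc, mul_smul_comm, mul_one, one_mul]
    rw [hcomm] at hme
    have hne : nrd (e - star e) ≠ 0 := by
      have : nrd (e - star e) = -(trd e ^ 2 - 4 * nrd e) := by
        rw [nrd_eq, nrd_eq, trd_eq]; simp; ring
      rw [this, neg_ne_zero]
      exact (map_ne_zero ν).1 (by rw [he]; exact one_ne_zero)
    refine mul_left_cancel_of_nrd_ne_zero hne ?_
    rw [sub_mul, hme, sub_self, mul_zero]
  exact ⟨p, q, by rw [hpqm, hm0, add_zero], hpq⟩

/-- The trace-zero part of the anticommutant of `e` is generated by a single element over the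
quadratic order of `e`. -/
theorem IsLocalOrder.exists_generator (ha : a ≠ 0) (hb : b ≠ 0) {O : Subring ℍ[K,a,b]}
    (hO : IsLocalOrder ν O) {e : ℍ[K,a,b]} (heO : e ∈ O) (he : ν (trd e ^ 2 - 4 * nrd e) = 1) :
    ∃ j ∈ O, trd j = 0 ∧ trd (j * e) = 0 ∧ nrd j ≠ 0 ∧
      ∀ m ∈ O, trd m = 0 → trd (m * e) = 0 →
        ∃ s ∈ quadOrder ν e (hO.trd_le_one heO) (hO.nrd_le_one heO), m = s * j := by
  obtain ⟨m₀, hm₀, h1, h2, h3⟩ := hO.exists_nrd_ne_zero ha hb heO he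
  obtain ⟨⟨j, hj, hj1, hj2⟩, hj0, hmax⟩ := exists_ne_zero_forall_le
    (T := {m : ℍ[K,a,b] // m ∈ O ∧ trd m = 0 ∧ trd (m * e) = 0}) (fun m => ν (nrd m.1)) 1
    (fun m => hO.nrd_le_one m.2.1) ⟨⟨m₀, hm₀, h1, h2⟩, (map_ne_zero ν).2 h3⟩
  have hjn : nrd j ≠ 0 := (map_ne_zero ν).1 hj0
  refine ⟨j, hj, hj1, hj2, hjn, fun y hy hy1 hy2 => ?_⟩
  obtain ⟨s, hsj⟩ := exists_mul_eq hjn y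
  -- The generator j has norm of greatest valuation, so any multiplier x that keeps xj in this set
  -- has integral norm. Applied to x + 1 this bounds the trace too.
  have hM : ∀ x : ℍ[K,a,b], x * j ∈ O → trd (x * j) = 0 → trd (x * j * e) = 0 → ν (nrd x) ≤ 1 := by
    intro x hx hx1 hx2
    have := hmax ⟨_, hx, hx1, hx2⟩
    simp only [nrd_mul, map_mul] at this
    exact (mul_le_iff_le_one_left (zero_lt_iff.2 hj0)).1 this
  have hM' : ∀ x : ℍ[K,a,b], x * j ∈ O → trd (x * j) = 0 → trd (x * j * e) = 0 →
      ν (trd x) ≤ 1 := by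
    intro x hx hx1 hx2
    have h := nrd_add x 1
    rw [star_one, mul_one, nrd_one] at h
    rw [show trd x = nrd (x + 1) - (nrd x + 1) by linear_combination -h]
    refine (ν.map_sub _ _).trans (max_le (hM (x + 1) ?_ ?_ ?_)
      ((ν.map_add _ _).trans (max_le (hM x hx hx1 hx2) (map_one ν).le)))
    · rw [add_mul, one_mul]; exact O.add_mem hx hj
    · rw [add_mul, one_mul, trd_add, hx1, hj1, add_zero]
    · rw [add_mul, one_mul, add_mul, trd_add, hx2, hj2, add_zero]
  have hye := mul_eq_star_mul hy1 hy2
  have hse := mul_comm_of_anticommute hj1 hj2 hjn hy1 hy2 hsj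
  obtain ⟨p, q, hs, hpq⟩ := exists_eq_of_commute he (hO.trd_le_one heO) (hO.nrd_le_one heO) hse
  obtain ⟨hp, hq⟩ := hpq (hM' s (by rwa [hsj]) (by rwa [hsj]) (by rwa [hsj])) (by
    rw [hse]
    have h3 : e * s * j = e * y := by rw [mul_assoc, hsj]
    refine hM' (e * s) ?_ ?_ ?_ <;> rw [h3]
    · exact O.mul_mem heO hy
    · rw [trd_mul_comm, hy2]
    · rw [mul_assoc, hye, ← mul_assoc, mul_star_eq_nrd, Algebra.algebraMap_eq_smul_one,
        smul_mul_assoc, one_mul, trd_smul, hy1, mul_zero])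
  exact ⟨s, ⟨p, q, hp, hq, hs⟩, hsj.symm⟩

theorem neg_nrd_eq_mul_self {j : ℍ[K,a,b]} (hj : trd j = 0) : j * j = (-nrd j) • 1 := by
  rw [mul_self_eq, hj, zero_smul, zero_sub, neg_smul]

/-- The maximality of `O`, applied to the order `S + (S + S g) j`. -/
theorem IsMaxLocalOrder.mem_of_twisted {O : Subring ℍ[K,a,b]} (hO : IsMaxLocalOrder ν O)
    {e j : ℍ[K,a,b]} (heO : e ∈ O) (he : ν (trd e ^ 2 - 4 * nrd e) = 1) (hjO : j ∈ O)
    (hj1 : trd j = 0) (hj2 : trd (j * e) = 0) (hj0 : nrd j ≠ 0)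
    (hgen : ∀ m ∈ O, trd m = 0 → trd (m * e) = 0 →
      ∃ s ∈ quadOrder ν e (hO.trd_le_one heO) (hO.nrd_le_one heO), m = s * j) (α β : K)
    (h1 : ν (α * nrd j) ≤ 1) (h2 : ν (β * nrd j) ≤ 1)
    (h3 : ν (nrd (α • 1 + β • e : ℍ[K,a,b]) * nrd j) ≤ 1) : α • 1 + β • e ∈ O := by
  have hOl := hO.toIsLocalOrder
  have het := hO.trd_le_one heO
  have hen := hO.nrd_le_one heO
  have hje := mul_eq_star_mul hj1 hj2
  set g : ℍ[K,a,b] := α • 1 + β • e with hg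
  have hc := neg_nrd_eq_mul_self hj1
  have hcm : j * j ∈ quadOrder ν e het hen := ⟨-nrd j, 0, by
    rw [ν.map_neg]; exact hO.nrd_le_one hjO, by simp, by rw [hc, zero_smul, add_zero]⟩
  have hgm : g * (j * j) ∈ quadOrder ν e het hen := by
    refine ⟨-(α * nrd j), -(β * nrd j), by rwa [ν.map_neg], by rwa [ν.map_neg], ?_⟩
    rw [hc, hg, mul_smul_comm, mul_one]
    module
  have hgm' : star g * (j * j) ∈ quadOrder ν e het hen := by
    have := star_mem_quadOrder hgm
    rwa [star_mul, star_mul, star_eq_neg_of_trd_eq_zero hj1, neg_mul_neg, hc, smul_mul_assoc,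
      one_mul, ← mul_one (star g), ← mul_smul_comm, ← hc] at this
  have hggm : g * star g * (j * j) ∈ quadOrder ν e het hen := by
    refine ⟨-(nrd g * nrd j), 0, by rwa [ν.map_neg], by simp, ?_⟩
    rw [hc, mul_star_eq_nrd, Algebra.algebraMap_eq_smul_one, mul_smul_comm, mul_one]
    module
  have hS := quadOrder_le (het := het) (hen := hen) hOl heO
  -- This inclusion is O = S ⊕ Sj; the summand Sgj is what would enlarge `O`, so maximality puts gj
  -- in `O`, and then g in S.
  have hOle : O ≤ twistedOrder e j g het hen α β hg hje hcm hgm hgm' hggm := by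
    intro x hx
    obtain ⟨p, q, m, hx', hm1, hm2, hpq⟩ := exists_decomposition he het hen x
    obtain ⟨hp, hq⟩ := hpq (hO.trd_le_one hx) (hO.trd_le_one (O.mul_mem hx heO))
    have hs : p • 1 + q • e ∈ quadOrder ν e het hen := ⟨p, q, hp, hq, rfl⟩
    obtain ⟨s, hs', hms⟩ := hgen m (by
      rw [show m = x - (p • 1 + q • e) by rw [hx']; abel]; exact O.sub_mem hx (hS hs)) hm1 hm2
    exact ⟨_, hs, s, hs', 0, Subring.zero_mem _, by rw [zero_mul, add_zero, ← hms, ← hx']⟩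
  have hloc : IsLocalOrder ν (twistedOrder e j g het hen α β hg hje hcm hgm hgm' hggm) := by
    refine ⟨?_, ?_, fun x => ?_⟩
    · rintro r hr _ ⟨s₁, hs₁, s₂, hs₂, s₃, hs₃, rfl⟩
      exact ⟨_, smul_mem_quadOrder hr hs₁, _, smul_mem_quadOrder hr hs₂, _,
        smul_mem_quadOrder hr hs₃, by simp only [smul_add, smul_mul_assoc, add_mul]⟩
    · obtain ⟨r, hr0, hr, hrg⟩ := hOl.exists_smul_mem (g * j)
      obtain ⟨C, hC⟩ := hOl.bounded
      have hr0' : 0 < ν r := zero_lt_iff.2 ((map_ne_zero ν).2 hr0)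
      refine ⟨(ν r)⁻¹ * C, ?_⟩
      rintro _ ⟨s₁, hs₁, s₂, hs₂, s₃, hs₃, rfl⟩
      have hmem : r • (s₁ + (s₂ + s₃ * g) * j) ∈ O := by
        rw [show r • (s₁ + (s₂ + s₃ * g) * j) = r • s₁ + (r • s₂) * j + s₃ * (r • (g * j)) by
          simp only [smul_add, smul_mul_assoc, add_mul, mul_smul_comm, mul_assoc, add_assoc]]
        exact O.add_mem (O.add_mem (hOl.smul_mem r hr _ (hS hs₁))
          (O.mul_mem (hOl.smul_mem r hr _ (hS hs₂)) hjO)) (O.mul_mem (hS hs₃) hrg)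
      have h' := hC _ hmem
      simp only [QuaternionAlgebra.re_smul, QuaternionAlgebra.imI_smul,
        QuaternionAlgebra.imJ_smul, QuaternionAlgebra.imK_smul, smul_eq_mul, map_mul] at h'
      simpa only [le_inv_mul_iff₀ hr0'] using h'
    · obtain ⟨r, hr, h⟩ := hO.spans x
      exact ⟨r, hr, hOle h⟩
  have hgj : g * j ∈ O := hO.le_of_le _ hloc hOle
    ⟨0, Subring.zero_mem _, 0, Subring.zero_mem _, 1, Subring.one_mem _, by simp⟩
  obtain ⟨s, hs, hs'⟩ := hgen _ hgj (by
      rw [hg, add_mul, smul_mul_assoc, one_mul, smul_mul_assoc, trd_add, trd_smul, trd_smul, hj1,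
        trd_mul_comm, hj2]; simp) (by
      rw [mul_assoc, hje, hg, add_mul, smul_mul_assoc, one_mul, smul_mul_assoc, ← mul_assoc e,
        mul_star_eq_nrd, Algebra.algebraMap_eq_smul_one, smul_mul_assoc, one_mul, ← hje, trd_add,
        trd_smul, trd_smul, trd_smul, hj1, hj2]; simp)
  rw [mul_right_cancel_of_nrd_ne_zero hj0 hs']
  exact hS hs

/-- The structure of a maximal order over a discrete valuation ring with finite residue field. -/
theorem IsMaxLocalOrder.exists_structure (ha : a ≠ 0) (hb : b ≠ 0) {O : Subring ℍ[K,a,b]}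
    (hO : IsMaxLocalOrder ν O) {ϖ : K} (hϖ : ν ϖ = exp (-1 : ℤ))
    (hperf : ∀ n, ν n ≤ 1 → ν (2 : K) < 1 → ∃ m, ν m ≤ 1 ∧ ν (n - m ^ 2) < 1) :
    ∃ e ∈ O, ∃ j ∈ O, ν (trd e ^ 2 - 4 * nrd e) = 1 ∧ trd j = 0 ∧ trd (j * e) = 0 ∧ nrd j ≠ 0 ∧
      (∀ x ∈ O, ∃ p q r s : K, ν p ≤ 1 ∧ ν q ≤ 1 ∧ ν r ≤ 1 ∧ ν s ≤ 1 ∧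
        x = p • 1 + q • e + (r • j + s • (e * j))) ∧
      (ν (nrd j) = 1 ∨ ν (nrd j) = exp (-1 : ℤ) ∧
        ∀ r, ν r ≤ 1 → ν (r ^ 2 - trd e * r + nrd e) = 1) := by
  have hOl := hO.toIsLocalOrder
  obtain ⟨e, heO, he⟩ := hO.exists_disc_eq_one hϖ hperf
  obtain ⟨j, hjO, hj1, hj2, hj0, hgen⟩ := hOl.exists_generator ha hb heO he
  have het := hO.trd_le_one heO
  have hen := hO.nrd_le_one heO
  have hϖ0 : ϖ ≠ 0 := (map_ne_zero ν).1 (by rw [hϖ]; exact exp_ne_zero)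
  have hϖi : ν ϖ⁻¹ = exp 1 := by rw [map_inv₀, hϖ, ← exp_neg, neg_neg]
  refine ⟨e, heO, j, hjO, he, hj1, hj2, hj0, fun x hx => ?_, ?_⟩
  · obtain ⟨p, q, m, hx', hm1, hm2, hpq⟩ := exists_decomposition he het hen x
    obtain ⟨hp, hq⟩ := hpq (hO.trd_le_one hx) (hO.trd_le_one (O.mul_mem hx heO))
    obtain ⟨_, ⟨r, s, hr, hs, rfl⟩, hms⟩ := hgen m (by
      rw [show m = x - (p • 1 + q • e) by rw [hx']; abel]
      exact O.sub_mem hx (O.add_mem (hO.smul_one_mem hp) (hO.smul_mem _ hq _ heO))) hm1 hm2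
    exact ⟨p, q, r, s, hp, hq, hr, hs, by
      rw [hx', hms, add_mul, smul_mul_assoc, smul_mul_assoc, one_mul]⟩
  · rcases (hO.nrd_le_one hjO).eq_or_lt with h1 | h1
    · exact Or.inl h1
    · have hlog : ∀ m : ℤ, ν (nrd j) ≤ exp m ↔ log (ν (nrd j)) ≤ m := fun m => by
        rw [← log_le_log ((map_ne_zero ν).2 hj0) exp_ne_zero, log_exp]
      rw [lt_one_iff_le_exp] at h1
      have h2 : ν (nrd j) = exp (-1 : ℤ) := by
        by_contra hne
        have h2 : ν (nrd j) ≤ exp (-2 : ℤ) := by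
          rw [hlog]
          have h3 := (hlog _).1 h1
          have h4 : log (ν (nrd j)) ≠ -1 := fun h => hne (by
            rw [← h, exp_log ((map_ne_zero ν).2 hj0)])
          omega
        -- If ϖ² divided nrd j, the scalar g = ϖ⁻¹ would be admissible and hence belong to `O`.
        have hm := hO.mem_of_twisted heO he hjO hj1 hj2 hj0 hgen ϖ⁻¹ 0
          (by
            rw [map_mul, hϖi]
            refine (mul_le_mul_right h1 _).trans ?_
            rw [← exp_add]; simp)
          (by simp)
          (by
            rw [zero_smul, add_zero, nrd_smul, nrd_one, mul_one, map_mul, map_pow, hϖi,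
              ← exp_nsmul]
            refine (mul_le_mul_right h2 _).trans ?_
            rw [← exp_add]; simp)
        have := hO.nrd_le_one hm
        rw [zero_smul, add_zero, nrd_smul, nrd_one, mul_one, map_pow, hϖi, ← exp_nsmul, ← exp_zero,
          exp_le_exp] at this
        simp at this
      refine Or.inr ⟨h2, fun r hr => ?_⟩
      have hle : ν (r ^ 2 - trd e * r + nrd e) ≤ 1 := by
        refine (ν.map_add _ _).trans (max_le ((ν.map_sub _ _).trans (max_le ?_ ?_)) hen)
        · rw [map_pow]; exact pow_le_one' hr 2
        · rw [map_mul]; exact mul_le_one' het hr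
      refine hle.eq_of_not_lt fun hlt => ?_
      rw [lt_one_iff_le_exp] at hlt
      have hng : nrd (-(ϖ⁻¹ * r) • 1 + ϖ⁻¹ • e : ℍ[K,a,b]) =
          ϖ⁻¹ ^ 2 * (r ^ 2 - trd e * r + nrd e) := by
        rw [nrd_eq, nrd_eq, trd_eq]; simp; ring
      have htg : trd (-(ϖ⁻¹ * r) • 1 + ϖ⁻¹ • e : ℍ[K,a,b]) = ϖ⁻¹ * (trd e - 2 * r) := by
        rw [trd_eq, trd_eq]; simp; ring
      -- If r were a root modulo the maximal ideal, g = (e - r)/ϖ would be admissible, but its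
      -- discriminant is ϖ⁻² times a unit.
      have hm := hO.mem_of_twisted heO he hjO hj1 hj2 hj0 hgen (-(ϖ⁻¹ * r)) ϖ⁻¹
        (by
          rw [map_mul, ν.map_neg, map_mul, hϖi, h2, mul_right_comm, ← exp_add]
          simpa using hr)
        (by rw [map_mul, hϖi, h2, ← exp_add]; simp)
        (by
          rw [hng, map_mul, map_mul, map_pow, hϖi, h2, ← exp_nsmul]
          refine (mul_le_mul_left (mul_le_mul_right hlt _) _).trans ?_
          rw [← exp_add, ← exp_add]; simp)
      have h5 : ν (trd (-(ϖ⁻¹ * r) • 1 + ϖ⁻¹ • e : ℍ[K,a,b]) ^ 2 -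
          4 * nrd (-(ϖ⁻¹ * r) • 1 + ϖ⁻¹ • e : ℍ[K,a,b])) ≤ 1 := by
        refine (ν.map_sub _ _).trans (max_le ?_ ?_)
        · rw [map_pow]; exact pow_le_one' (hO.trd_le_one hm) 2
        · rw [map_mul]
          exact mul_le_one' (by exact_mod_cast map_natCast_le_one ν 4) (hO.nrd_le_one hm)
      rw [hng, htg, show (ϖ⁻¹ * (trd e - 2 * r)) ^ 2 - 4 * (ϖ⁻¹ ^ 2 * (r ^ 2 - trd e * r + nrd e)) =
        ϖ⁻¹ ^ 2 * (trd e ^ 2 - 4 * nrd e) by ring, map_mul, he, mul_one, map_pow, hϖi, ← exp_nsmul,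
        ← exp_zero, exp_le_exp] at h5
      simp at h5

end LocalOrders

theorem det_gram_of_eq_sum {F V ι : Type*} [Field F] [AddCommGroup V] [Module F V] [Fintype ι]
    [DecidableEq ι] (Q : LinearMap.BilinForm F V) (A : Matrix ι ι F) {x f : ι → V}
    (h : ∀ i, x i = ∑ k, A i k • f k) :
    (Matrix.of fun i j => Q (x i) (x j)).det =
      A.det ^ 2 * (Matrix.of fun i j => Q (f i) (f j)).det := by
  have : (Matrix.of fun i j => Q (x i) (x j)) =
      A * (Matrix.of fun i j => Q (f i) (f j)) * A.transpose := by
    ext i j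
    simp only [Matrix.of_apply, h, map_sum, map_smul, LinearMap.sum_apply, LinearMap.smul_apply,
      Matrix.mul_apply, Matrix.transpose_apply, smul_eq_mul, Finset.sum_mul, Finset.mul_sum]
    refine Finset.sum_congr rfl fun k _ => ?_
    refine Finset.sum_congr rfl fun l _ => by ring
  rw [this, Matrix.det_mul, Matrix.det_mul, Matrix.det_transpose]
  ring

/-! ### The Gram determinant of a maximal local order -/

section LocalOrders

open WithZero

theorem map_det_le_one {K : Type*} [Field K] (ν : Valuation K ℤᵐ⁰) {n : ℕ}
    (A : Matrix (Fin n) (Fin n) K) (hA : ∀ i j, ν (A i j) ≤ 1) : ν A.det ≤ 1 := by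
  have h : A = (Matrix.of fun i j => (⟨A i j, hA i j⟩ : ν.integer)).map ν.integer.subtype := by
    ext i j; rfl
  rw [h, ← RingHom.mapMatrix_apply, ← RingHom.map_det]
  exact (Matrix.det (Matrix.of fun i j => (⟨A i j, hA i j⟩ : ν.integer))).2

variable {K : Type*} [Field K] [CharZero K] {a b : K} {ν : Valuation K ℤᵐ⁰}

/-- The Gram determinants of the trace-zero part of a maximal order over a discrete valuation ring
with finite residue field. -/
theorem IsMaxLocalOrder.exists_gram (ha : a ≠ 0) (hb : b ≠ 0) {O : Subring ℍ[K,a,b]}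
    (hO : IsMaxLocalOrder ν O) {e j : ℍ[K,a,b]} (heO : e ∈ O) (hjO : j ∈ O)
    (he : ν (trd e ^ 2 - 4 * nrd e) = 1) (hj1 : trd j = 0) (hj2 : trd (j * e) = 0)
    (hgen : ∀ x ∈ O, ∃ p q r s : K, ν p ≤ 1 ∧ ν q ≤ 1 ∧ ν r ≤ 1 ∧ ν s ≤ 1 ∧
        x = p • 1 + q • e + (r • j + s • (e * j))) :
    (∃ f : Fin 3 → B0 a b, (∀ i, (f i : ℍ[K,a,b]) ∈ O) ∧
      ν (Matrix.of fun i k => QB a b (f i) (f k)).det = ν 2 * ν (nrd j) ^ 2) ∧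
    ∀ x : Fin 3 → B0 a b, (∀ i, (x i : ℍ[K,a,b]) ∈ O) →
      ν (Matrix.of fun i k => QB a b (x i) (x k)).det ≤ ν 2 * ν (nrd j) ^ 2 := by
  have hOl := hO.toIsLocalOrder
  have hje := mul_eq_star_mul hj1 hj2
  have hc := neg_nrd_eq_mul_self hj1
  have hΔ0 : trd e ^ 2 - 4 * nrd e ≠ 0 := (map_ne_zero ν).1 (by rw [he]; exact one_ne_zero)
  have h2 : ν (2 : K) ≤ 1 := by exact_mod_cast map_natCast_le_one ν 2
  have het := hO.trd_le_one heO
  have hen := hO.nrd_le_one heO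
  have hej : trd (e * j) = 0 := by rw [trd_mul_comm, hj2]
  -- A basis of O ∩ B⁰ over the valuation ring: trd e - 2e spans the trace-zero part of S, and j, ej
  -- span Sj.
  let f : Fin 3 → B0 a b := ![⟨trd e • 1 - (2 : K) • e, by
      change trd _ = 0; rw [trd_sub, trd_smul, trd_smul, trd_one]; ring⟩, ⟨j, hj1⟩, ⟨e * j, hej⟩]
  have hf : (Matrix.of fun i k => QB a b (f i) (f k)).det =
      -(2 * nrd j ^ 2 * (trd e ^ 2 - 4 * nrd e) ^ 2) := by
    have e00 : trd ((trd e • 1 - (2 : K) • e : ℍ[K,a,b]) * (trd e • 1 - (2 : K) • e)) =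
        2 * (trd e ^ 2 - 4 * nrd e) := by
      rw [trd_eq, nrd_eq, trd_eq]; simp; ring
    have e01 : trd ((trd e • 1 - (2 : K) • e : ℍ[K,a,b]) * j) = 0 := by
      rw [sub_mul, smul_mul_assoc, smul_mul_assoc, one_mul, trd_sub, trd_smul, trd_smul, hj1, hej]
      simp
    have e02 : trd ((trd e • 1 - (2 : K) • e : ℍ[K,a,b]) * (e * j)) = 0 := by
      rw [sub_mul, smul_mul_assoc, smul_mul_assoc, one_mul, ← mul_assoc, mul_self_eq, sub_mul,
        smul_mul_assoc, smul_mul_assoc, one_mul, trd_sub, trd_smul, trd_smul, trd_sub, trd_smul,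
        trd_smul, hj1, hej]
      simp
    have e11 : trd (j * j) = -2 * nrd j := by rw [hc, trd_smul, trd_one]; ring
    have e12 : trd (j * (e * j)) = -(nrd j * trd e) := by
      rw [← mul_assoc, hje, mul_assoc, hc, mul_smul_comm, mul_one, trd_smul, trd_star]; ring
    have e22 : trd (e * j * (e * j)) = -2 * nrd e * nrd j := by
      rw [mul_assoc, ← mul_assoc j, hje, mul_assoc (star e), hc, mul_smul_comm, mul_one,
        mul_smul_comm, mul_star_eq_nrd, Algebra.algebraMap_eq_smul_one, smul_smul, trd_smul,
        trd_one]
      ring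
    rw [Matrix.det_fin_three]
    simp only [Matrix.of_apply, QB_apply, f, Matrix.cons_val_zero, Matrix.cons_val_one,
      Matrix.cons_val, e00, e01, e02, e11, e12, e22, trd_mul_comm j, trd_mul_comm (e * j)]
    ring
  have hνf : ν (Matrix.of fun i k => QB a b (f i) (f k)).det = ν 2 * ν (nrd j) ^ 2 := by
    rw [hf, ν.map_neg, map_mul, map_mul, map_pow, map_pow, he, one_pow, mul_one]
  refine ⟨⟨f, ?_, hνf⟩, fun x hx => ?_⟩
  · intro i
    fin_cases i
    · exact O.sub_mem (hO.smul_one_mem het) (hO.smul_mem _ h2 _ heO)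
    · exact hjO
    · exact O.mul_mem heO hjO
  · have hco : ∀ i, ∃ A : Fin 3 → K, (∀ k, ν (A k) ≤ 1) ∧ x i = ∑ k, A k • f k := by
      intro i
      obtain ⟨p, q, r, s, hp, hq, hr, hs, hxi⟩ := hgen _ (hx i)
      have htr : 2 * p + q * trd e = 0 := by
        have h0 : trd (x i : ℍ[K,a,b]) = 0 := (x i).2
        rw [hxi, trd_add, trd_add, trd_add, trd_smul, trd_smul, trd_smul, trd_smul, trd_one, hj1,
          hej] at h0
        linear_combination h0
      -- If p + qe has trace zero it is c(trd e - 2e). Writing c with the unit discriminant as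
      -- denominator shows integrality even where 2 is not a unit.
      refine ⟨![(trd e * p + 2 * nrd e * q) / (trd e ^ 2 - 4 * nrd e), r, s], ?_, ?_⟩
      · intro k
        fin_cases k
        · change ν ((trd e * p + 2 * nrd e * q) / (trd e ^ 2 - 4 * nrd e)) ≤ 1
          rw [map_div₀, he, div_one]
          refine (ν.map_add _ _).trans (max_le ?_ ?_)
          · rw [map_mul]; exact mul_le_one' het hp
          · rw [map_mul, map_mul]; exact mul_le_one' (mul_le_one' h2 hen) hq
        · exact hr
        · exact hs
      · ext1
        have e1 : (trd e * p + 2 * nrd e * q) / (trd e ^ 2 - 4 * nrd e) * trd e = p := by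
          rw [div_mul_eq_mul_div, div_eq_iff hΔ0]
          linear_combination 2 * nrd e * htr
        have e2 : (trd e * p + 2 * nrd e * q) / (trd e ^ 2 - 4 * nrd e) * 2 = -q := by
          rw [div_mul_eq_mul_div, div_eq_iff hΔ0]
          linear_combination trd e * htr
        rw [Fin.sum_univ_three]
        change (x i : ℍ[K,a,b]) = ((trd e * p + 2 * nrd e * q) / (trd e ^ 2 - 4 * nrd e)) •
          (trd e • 1 - (2 : K) • e) + r • j + s • (e * j)
        rw [hxi, smul_sub, smul_smul, smul_smul, e1, e2]
        module
    choose A hA1 hA2 using hco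
    rw [det_gram_of_eq_sum (QB a b) (Matrix.of A) hA2, map_mul, hνf, map_pow]
    exact mul_le_of_le_one_left' (pow_le_one' (map_det_le_one ν _ hA1) 2)

end LocalOrders

/-! ### Hensel's lemma and norm forms over completions -/

open IsDedekindDomain HeightOneSpectrum

/-- Hensel's lemma for quadratic polynomials. -/
theorem exists_root_of_norm_lt_one {L : Type*} [NormedField L] [CompleteSpace L]
    [IsUltrametricDist L] {A B C : L} (hA : ‖A‖ ≤ 1) (hB : ‖B‖ = 1) (hC : ‖C‖ < 1) :
    ∃ x, ‖x‖ < 1 ∧ A * x ^ 2 + B * x + C = 0 := by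
  have hB0 : B ≠ 0 := norm_ne_zero_iff.1 (by rw [hB]; exact one_ne_zero)
  -- The root is a fixed point of this map, which contracts the closed ball of radius ‖C‖ by the
  -- factor ‖C‖.
  let f : L → L := fun x => -(C + A * x ^ 2) / B
  let s : Set L := Metric.closedBall 0 ‖C‖
  have hs : ∀ {x}, x ∈ s ↔ ‖x‖ ≤ ‖C‖ := by intro x; simp [s]
  have hmaps : Set.MapsTo f s s := fun x hx => by
    rw [hs] at hx ⊢
    rw [norm_div, hB, div_one, norm_neg]
    refine (IsUltrametricDist.norm_add_le_max _ _).trans (max_le le_rfl ?_)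
    rw [norm_mul, norm_pow]
    calc ‖A‖ * ‖x‖ ^ 2 ≤ 1 * ‖C‖ ^ 2 := by gcongr
      _ ≤ ‖C‖ := by nlinarith [norm_nonneg C]
  have hcontr : ContractingWith ‖C‖₊ (hmaps.restrict f s s) := by
    refine ⟨by exact_mod_cast hC, LipschitzWith.of_dist_le_mul ?_⟩
    rintro ⟨x, hx⟩ ⟨y, hy⟩
    rw [hs] at hx hy
    change dist (f x) (f y) ≤ ‖C‖ * dist x y
    rw [dist_eq_norm, dist_eq_norm]
    have : f x - f y = -A * ((x + y) * (x - y)) / B := by simp only [f]; ring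
    rw [this, norm_div, hB, div_one, norm_mul, norm_mul, norm_neg]
    calc ‖A‖ * (‖x + y‖ * ‖x - y‖) ≤ 1 * (‖C‖ * ‖x - y‖) := by
          gcongr
          exact (IsUltrametricDist.norm_add_le_max _ _).trans (max_le hx hy)
      _ = _ := one_mul _
  obtain ⟨x, hx, hfix, -⟩ := hcontr.exists_fixedPoint' Metric.isClosed_closedBall.isComplete hmaps
    (hs.2 (by simp) : (0 : L) ∈ s) (edist_ne_top _ _)
  refine ⟨x, (hs.1 hx).trans_lt hC, ?_⟩
  have : -(C + A * x ^ 2) / B = x := hfix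
  rw [div_eq_iff hB0] at this
  linear_combination -this

variable {K : Type*} [Field K] [NumberField K] (v : HeightOneSpectrum (𝓞 K))

theorem exists_root_adicCompletion {A B C : v.adicCompletion K} (hA : Valued.v A ≤ 1)
    (hB : Valued.v B = 1) (hC : Valued.v C < 1) :
    ∃ x : v.adicCompletion K, Valued.v x < 1 ∧ A * x ^ 2 + B * x + C = 0 := by
  obtain ⟨x, hx, h⟩ := exists_root_of_norm_lt_one (Valued.toNormedField.norm_le_one_iff.2 hA)
    (le_antisymm (Valued.toNormedField.norm_le_one_iff.2 hB.le)
      (not_lt.1 fun h => (Valued.toNormedField.norm_lt_one_iff.1 h).ne hB))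
    (Valued.toNormedField.norm_lt_one_iff.2 hC)
  exact ⟨x, Valued.toNormedField.norm_lt_one_iff.1 hx, h⟩

theorem valued_algebraMap (k : K) :
    Valued.v (algebraMap K (v.adicCompletion K) k) = v.valuation K k := by
  rw [algebraMap_adicCompletion]
  exact valuedAdicCompletion_eq_valuation' v k

/-- Every integral element of the completion is congruent to an element of `K`. -/
theorem exists_valued_sub_lt_one {x : v.adicCompletion K} (hx : Valued.v x ≤ 1) :
    ∃ k : K, v.valuation K k ≤ 1 ∧ Valued.v (x - algebraMap K _ k) < 1 := by
  obtain ⟨k, hk⟩ := (denseRange_algebraMap K v).exists_dist_lt x one_pos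
  rw [dist_eq_norm, Valued.toNormedField.norm_lt_one_iff] at hk
  refine ⟨k, ?_, hk⟩
  rw [← valued_algebraMap]
  have := (Valued.v (R := v.adicCompletion K)).map_sub x (x - algebraMap K _ k)
  rw [sub_sub_cancel] at this
  exact this.trans (max_le hx hk.le)

theorem exists_int_valuation_sub_lt_one {x : K} (hx : v.valuation K x ≤ 1) :
    ∃ y : 𝓞 K, v.valuation K (algebraMap (𝓞 K) K y - x) < 1 := by
  obtain ⟨y, hy⟩ := exists_valuation_sub_lt_of_integer v hx 1
  exact ⟨y, by simpa using hy⟩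

theorem valuation_lt_one_of_sub_mem {x : 𝓞 K} {y : K}
    (hx : Ideal.Quotient.mk v.asIdeal x = 0)
    (h : v.valuation K (algebraMap (𝓞 K) K x - y) < 1) : v.valuation K y < 1 := by
  rw [Ideal.Quotient.eq_zero_iff_mem, ← valuation_lt_one_iff_mem (K := K)] at hx
  have := (v.valuation K).map_sub_lt hx h
  rwa [sub_sub_cancel] at this

/-- The residue field is finite of characteristic two, so each of its elements is a square. -/
theorem exists_sq_sub_lt_one {n : K} (hn : v.valuation K n ≤ 1) (h2 : v.valuation K 2 < 1) :
    ∃ m, v.valuation K m ≤ 1 ∧ v.valuation K (n - m ^ 2) < 1 := by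
  obtain ⟨n', hn'⟩ := exists_int_valuation_sub_lt_one v hn
  letI : Field (𝓞 K ⧸ v.asIdeal) := Ideal.Quotient.field _
  haveI : Finite (𝓞 K ⧸ v.asIdeal) := Ideal.finiteQuotientOfFreeOfNeBot _ v.ne_bot
  have h2' : ((2 : ℕ) : 𝓞 K ⧸ v.asIdeal) = 0 := by
    have h : ((2 : ℕ) : 𝓞 K) ∈ v.asIdeal := by
      rw [← valuation_lt_one_iff_mem (K := K)]
      change v.valuation K (algebraMap (𝓞 K) K ((2 : ℕ) : 𝓞 K)) < 1
      rw [map_natCast]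
      exact h2
    rw [← Ideal.Quotient.eq_zero_iff_mem, map_natCast] at h
    exact h
  obtain ⟨m, hm⟩ := FiniteField.isSquare_of_char_two
    (CharP.ringChar_of_prime_eq_zero Nat.prime_two h2') (Ideal.Quotient.mk v.asIdeal n')
  obtain ⟨m, rfl⟩ := Ideal.Quotient.mk_surjective m
  refine ⟨algebraMap (𝓞 K) K m, valuation_le_one v m, ?_⟩
  refine valuation_lt_one_of_sub_mem v (x := n' - m ^ 2) ?_ ?_
  · rw [map_sub, hm, map_pow, sq, sub_self]
  · rw [map_sub (algebraMap (𝓞 K) K), map_pow (algebraMap (𝓞 K) K), sub_sub_sub_cancel_right]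
    exact hn'

/-- Over a finite field of odd order, a quadratic polynomial in p plus one in r always has a zero,
by counting values. -/
theorem exists_approximate_zero {t n d : K} (ht : v.valuation K t ≤ 1) (hn : v.valuation K n ≤ 1)
    (hd : v.valuation K d = 1) (h2 : v.valuation K 2 = 1) :
    ∃ p r, v.valuation K p ≤ 1 ∧ v.valuation K r ≤ 1 ∧
      v.valuation K (p ^ 2 + t * p + n + d * r ^ 2) < 1 := by
  obtain ⟨t', ht'⟩ := exists_int_valuation_sub_lt_one v ht
  obtain ⟨n', hn'⟩ := exists_int_valuation_sub_lt_one v hn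
  obtain ⟨d', hd'⟩ := exists_int_valuation_sub_lt_one v hd.le
  letI : Field (𝓞 K ⧸ v.asIdeal) := Ideal.Quotient.field _
  haveI : Finite (𝓞 K ⧸ v.asIdeal) := Ideal.finiteQuotientOfFreeOfNeBot _ v.ne_bot
  letI := Fintype.ofFinite (𝓞 K ⧸ v.asIdeal)
  have h2' : ringChar (𝓞 K ⧸ v.asIdeal) ≠ 2 := by
    intro h
    have : ((2 : ℕ) : 𝓞 K ⧸ v.asIdeal) = 0 := by rw [← h]; exact ringChar.Nat.cast_ringChar
    have h' : ((2 : ℕ) : 𝓞 K) ∈ v.asIdeal := Ideal.Quotient.eq_zero_iff_mem.1 (by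
      rw [map_natCast]; exact this)
    rw [← valuation_lt_one_iff_mem (K := K)] at h'
    change v.valuation K (algebraMap (𝓞 K) K ((2 : ℕ) : 𝓞 K)) < 1 at h'
    rw [map_natCast] at h'
    exact h'.ne h2
  have hd0 : Ideal.Quotient.mk v.asIdeal d' ≠ 0 := fun h =>
    (valuation_lt_one_of_sub_mem v h hd').ne hd
  set φ := Ideal.Quotient.mk v.asIdeal
  obtain ⟨p, r, hpr⟩ := FiniteField.exists_root_sum_quadratic
    (f := Polynomial.C 1 * Polynomial.X ^ 2 + Polynomial.C (φ t') * Polynomial.X +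
      Polynomial.C (φ n')) (g := Polynomial.C (φ d') * Polynomial.X ^ 2 +
        Polynomial.C 0 * Polynomial.X + Polynomial.C 0)
    (Polynomial.degree_quadratic one_ne_zero) (Polynomial.degree_quadratic hd0)
    (FiniteField.odd_card_of_char_ne_two h2')
  obtain ⟨p, rfl⟩ := Ideal.Quotient.mk_surjective p
  obtain ⟨r, rfl⟩ := Ideal.Quotient.mk_surjective r
  refine ⟨algebraMap (𝓞 K) K p, algebraMap (𝓞 K) K r, valuation_le_one v p, valuation_le_one v r,
    ?_⟩
  refine valuation_lt_one_of_sub_mem v (x := p ^ 2 + t' * p + n' + d' * r ^ 2) ?_ ?_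
  · simpa using hpr
  · simp only [map_add, map_mul, map_pow]
    rw [show ∀ p t' n' d' r : K, p ^ 2 + t' * p + n' + d' * r ^ 2 -
      (p ^ 2 + t * p + n + d * r ^ 2) = (t' - t) * p + (n' - n) + (d' - d) * r ^ 2 by
        intros; ring]
    refine (v.valuation K).map_add_lt ((v.valuation K).map_add_lt ?_ hn') ?_ <;> rw [map_mul]
    · exact mul_lt_one_left ht' (valuation_le_one v p)
    · rw [map_pow]; exact mul_lt_one_left hd' (pow_le_one' (valuation_le_one v r) 2)

section Completion

variable {v}

local notation "ι" => algebraMap K (v.adicCompletion K)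

/-- The norm form of a quaternion algebra with an unramified quadratic subalgebra and unit
parameter is isotropic. -/
theorem exists_zero_of_unit {t n d : K} (ht : v.valuation K t ≤ 1) (hn : v.valuation K n ≤ 1)
    (hΔ : v.valuation K (t ^ 2 - 4 * n) = 1) (hd : v.valuation K d = 1) :
    ∃ p q r s : v.adicCompletion K, ¬ (p = 0 ∧ q = 0 ∧ r = 0 ∧ s = 0) ∧
      (p ^ 2 + ι t * p * q + ι n * q ^ 2) + ι d * (r ^ 2 + ι t * r * s + ι n * s ^ 2) = 0 := by
  have h2 : v.valuation K 2 ≤ 1 := by exact_mod_cast map_natCast_le_one (v.valuation K) 2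
  have hle : ∀ k, v.valuation K k ≤ 1 → Valued.v (ι k) ≤ 1 := fun k h => by
    rwa [valued_algebraMap]
  rcases h2.lt_or_eq with h2 | h2
  · have ht1 : v.valuation K t = 1 := by
      refine ht.eq_of_not_lt fun hlt => hΔ.not_lt ?_
      refine (v.valuation K).map_sub_lt ?_ ?_
      · rw [map_pow]; exact pow_lt_one' hlt two_ne_zero
      · rw [show (4 : K) * n = 2 * (2 * n) by ring, map_mul]
        refine mul_lt_one_left h2 ?_
        rw [map_mul]; exact mul_le_one' h2.le hn
    -- In residue characteristic two the trace t is a unit. Put p = m with m² ≡ -d, q = 0, r = 1 and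
    -- solve for s; the linear coefficient dt is a unit.
    obtain ⟨m, hm, hdm⟩ := exists_sq_sub_lt_one v (n := -d) (by
      rw [Valuation.map_neg]; exact hd.le) h2
    obtain ⟨x, hx, h⟩ := exists_root_adicCompletion v (A := ι (d * n)) (B := ι (d * t))
      (C := ι (m ^ 2 + d)) (hle _ (by rw [map_mul, hd, one_mul]; exact hn))
      (by rw [valued_algebraMap, map_mul, hd, ht1, one_mul])
      (by
        rw [valued_algebraMap, show m ^ 2 + d = -(-d - m ^ 2) by ring, Valuation.map_neg]
        exact hdm)
    refine ⟨ι m, 0, 1, x, fun h => one_ne_zero h.2.2.1, ?_⟩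
    simp only [map_mul, map_add, map_pow] at h
    linear_combination h
  · obtain ⟨p, r, hp, hr, hpr⟩ := exists_approximate_zero v ht hn hd h2
    have hp1 : v.valuation K (2 * p + t) ≤ 1 :=
      (Valuation.map_add _ _ _).trans (max_le (by rw [map_mul, h2, one_mul]; exact hp) ht)
    rcases hp1.eq_or_lt with hp1 | hp1
    · obtain ⟨x, hx, h⟩ := exists_root_adicCompletion v (A := 1) (B := ι (2 * p + t))
        (C := ι (p ^ 2 + t * p + n + d * r ^ 2)) (by rw [map_one])
        (by rw [valued_algebraMap, hp1]) (by rwa [valued_algebraMap])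
      refine ⟨ι p + x, 1, ι r, 0, fun h => one_ne_zero h.2.1, ?_⟩
      simp only [map_mul, map_add, map_pow, map_ofNat] at h
      linear_combination h
    -- The partial derivatives 2p + t and tp + 2n cannot both be non-units, because t² - 4n = (2p +
    -- t)t - 2(tp + 2n) is a unit.
    · have hq1 : v.valuation K (t * p + 2 * n) = 1 := by
        refine le_antisymm ((Valuation.map_add _ _ _).trans (max_le ?_ ?_)) (not_lt.1 fun hlt => ?_)
        · rw [map_mul]; exact mul_le_one' ht hp
        · rw [map_mul, h2, one_mul]; exact hn
        · refine hΔ.not_lt ?_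
          rw [show t ^ 2 - 4 * n = (2 * p + t) * t - 2 * (t * p + 2 * n) by ring]
          refine (v.valuation K).map_sub_lt ?_ ?_ <;> rw [map_mul]
          · exact mul_lt_one_left hp1 ht
          · rwa [h2, one_mul]
      obtain ⟨x, hx, h⟩ := exists_root_adicCompletion v (A := ι n) (B := ι (t * p + 2 * n))
        (C := ι (p ^ 2 + t * p + n + d * r ^ 2)) (hle _ hn)
        (by rw [valued_algebraMap, hq1]) (by rwa [valued_algebraMap])
      refine ⟨ι p, 1 + x, ι r, 0, fun h => ?_, ?_⟩
      · have hx1 : x = -1 := by linear_combination h.2.1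
        rw [hx1, Valuation.map_neg, map_one] at hx
        exact lt_irrefl _ hx
      · simp only [map_mul, map_add, map_pow, map_ofNat] at h
        linear_combination h

/-- The polynomial X² - tX + n has no root modulo the maximal ideal. In the case |p| ≤ |q| ≠ 0,
factor out q², approximate -p/q by an element of K, and use that the polynomial takes unit values
there. -/
theorem valued_norm_form {t n : K} (ht : v.valuation K t ≤ 1) (hn : v.valuation K n ≤ 1)
    (hr : ∀ r, v.valuation K r ≤ 1 → v.valuation K (r ^ 2 - t * r + n) = 1)
    (p q : v.adicCompletion K) :
    Valued.v (p ^ 2 + ι t * p * q + ι n * q ^ 2) = max (Valued.v p) (Valued.v q) ^ 2 := by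
  have hle : ∀ k, v.valuation K k ≤ 1 → Valued.v (ι k) ≤ 1 := fun k h => by
    rwa [valued_algebraMap]
  rcases lt_or_ge (Valued.v q) (Valued.v p) with h | h
  · rw [max_eq_left h.le, add_assoc, Valuation.map_add_eq_of_lt_left, map_pow]
    have hp : 0 < Valued.v p := lt_of_le_of_lt zero_le h
    rw [map_pow]
    refine Valuation.map_add_lt _ ?_ ?_
    · rw [map_mul, map_mul, sq]
      calc _ ≤ 1 * Valued.v p * Valued.v q := by gcongr; exact hle t ht
        _ < _ := by rw [one_mul]; exact (mul_lt_mul_iff_right₀ hp).2 h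
    · rw [map_mul, map_pow]
      calc _ ≤ 1 * Valued.v q ^ 2 := by gcongr; exact hle n hn
        _ < _ := by rw [one_mul]; exact pow_lt_pow_left₀ h zero_le two_ne_zero
  · rw [max_eq_right h]
    by_cases hq : q = 0
    · rw [hq, map_zero, le_zero_iff, map_eq_zero] at h
      simp [h, hq]
    · have hq' : 0 < Valued.v q := zero_lt_iff.2 ((map_ne_zero _).2 hq)
      have hu : Valued.v (-(p / q)) ≤ 1 := by
        rw [Valuation.map_neg, map_div₀]; exact div_le_one_of_le₀ h zero_le
      obtain ⟨k, hk, hku⟩ := exists_valued_sub_lt_one v hu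
      set u := -(p / q)
      have e : p ^ 2 + ι t * p * q + ι n * q ^ 2 = q ^ 2 * (u ^ 2 - ι t * u + ι n) := by
        simp only [u]; field_simp; ring
      have hval : Valued.v (u ^ 2 - ι t * u + ι n) = 1 := by
        have e2 : u ^ 2 - ι t * u + ι n = (u - ι k) * (u + ι k - ι t) +
            ι (k ^ 2 - t * k + n) := by
          simp only [map_add, map_sub, map_mul, map_pow]; ring
        have h1 : Valued.v (ι (k ^ 2 - t * k + n)) = 1 := by rw [valued_algebraMap, hr k hk]
        rw [e2, Valuation.map_add_eq_of_lt_right, h1]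
        rw [h1, map_mul]
        exact mul_lt_one_left hku ((Valuation.map_sub _ _ _).trans (max_le
          ((Valuation.map_add _ _ _).trans (max_le hu (hle k hk))) (hle t ht)))
      rw [e, map_mul, hval, mul_one, map_pow]

/-- The norm form of a quaternion algebra with an inert quadratic subalgebra and uniformizing
parameter is anisotropic. -/
theorem eq_zero_of_uniformizer {t n d : K} (ht : v.valuation K t ≤ 1) (hn : v.valuation K n ≤ 1)
    (hr : ∀ r, v.valuation K r ≤ 1 → v.valuation K (r ^ 2 - t * r + n) = 1)
    (hd : v.valuation K d = WithZero.exp (-1 : ℤ)) {p q r s : v.adicCompletion K}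
    (h : (p ^ 2 + ι t * p * q + ι n * q ^ 2) + ι d * (r ^ 2 + ι t * r * s + ι n * s ^ 2) = 0) :
    p = 0 ∧ q = 0 ∧ r = 0 ∧ s = 0 := by
  have h1 : Valued.v (p ^ 2 + ι t * p * q + ι n * q ^ 2) =
      Valued.v (ι d * (r ^ 2 + ι t * r * s + ι n * s ^ 2)) := by
    rw [eq_neg_of_add_eq_zero_left h, Valuation.map_neg]
  rw [map_mul, valued_norm_form ht hn hr, valued_norm_form ht hn hr, valued_algebraMap, hd] at h1
  have hmax : ∀ x y : v.adicCompletion K, max (Valued.v x) (Valued.v y) = 0 → x = 0 ∧ y = 0 := by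
    intro x y hxy
    have hx := le_zero_iff.1 ((le_max_left _ _).trans hxy.le)
    have hy := le_zero_iff.1 ((le_max_right _ _).trans hxy.le)
    rw [map_eq_zero] at hx hy
    exact ⟨hx, hy⟩
  by_cases hrs : max (Valued.v r) (Valued.v s) = 0
  · rw [hrs, zero_pow two_ne_zero, mul_zero] at h1
    obtain ⟨hr0, hs0⟩ := hmax _ _ hrs
    obtain ⟨hp0, hq0⟩ := hmax _ _ ((pow_eq_zero_iff two_ne_zero).1 h1)
    exact ⟨hp0, hq0, hr0, hs0⟩
  · exfalso
    have hpq : max (Valued.v p) (Valued.v q) ≠ 0 := by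
      intro h0
      rw [h0, zero_pow two_ne_zero] at h1
      exact mul_ne_zero WithZero.exp_ne_zero (pow_ne_zero 2 hrs) h1.symm
    -- One side has even valuation, the other odd.
    have h2 := congrArg WithZero.log h1
    rw [WithZero.log_mul WithZero.exp_ne_zero (pow_ne_zero 2 hrs), WithZero.log_pow,
      WithZero.log_pow, WithZero.log_exp] at h2
    simp only [nsmul_eq_mul, Nat.cast_ofNat] at h2
    omega

end Completion

/-! ### Isotropy of the norm form and ramification -/

open IsDedekindDomain HeightOneSpectrum WithZero

section Isotropy

variable {L : Type*} [Field L] [CharZero L] {a b : L} {ν : Valuation L ℤᵐ⁰}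

theorem nrd_smul_one_add (p q : L) (e : ℍ[L,a,b]) :
    nrd (p • 1 + q • e) = p ^ 2 + trd e * p * q + nrd e * q ^ 2 := by
  rw [nrd_eq, nrd_eq, trd_eq]; simp; ring

theorem nrd_quad {e j : ℍ[L,a,b]} (hj1 : trd j = 0) (hj2 : trd (j * e) = 0) (p q r s : L) :
    nrd (p • 1 + q • e + (r • 1 + s • e) * j) = (p ^ 2 + trd e * p * q + nrd e * q ^ 2) +
      nrd j * (r ^ 2 + trd e * r * s + nrd e * s ^ 2) := by
  have hej : trd (e * j) = 0 := by rw [trd_mul_comm, hj2]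
  have heej : trd (e * (e * j)) = 0 := by
    rw [← mul_assoc, mul_self_eq, sub_mul, smul_mul_assoc, smul_mul_assoc, one_mul, trd_sub,
      trd_smul, trd_smul, hej, hj1]
    simp
  have h0 : trd ((r • 1 + s • e) * j) = 0 := by
    rw [add_mul, smul_mul_assoc, smul_mul_assoc, one_mul, trd_add, trd_smul, trd_smul, hej, hj1]
    simp
  rw [nrd_add, star_eq_neg_of_trd_eq_zero h0, nrd_mul, nrd_smul_one_add, nrd_smul_one_add]
  have h1 : trd ((p • 1 + q • e) * -((r • 1 + s • e) * j)) = 0 := by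
    rw [mul_neg, ← neg_one_smul L, trd_smul, add_mul (r • _), add_mul (p • _), mul_add, mul_add]
    simp only [smul_mul_assoc, mul_smul_comm, one_mul, trd_add, trd_smul, hj1, hej, heej]
    simp
  rw [h1]
  ring

/-- Expresses the norm form in the coordinates of B = K(e) ⊕ K(e)j. The point is that p + qe + (r +
se)j = 0 forces all four coordinates to vanish, which the traces detect. -/
theorem exists_nrd_eq_zero_iff {e j : ℍ[L,a,b]} (he : ν (trd e ^ 2 - 4 * nrd e) = 1)
    (het : ν (trd e) ≤ 1) (hen : ν (nrd e) ≤ 1) (hj1 : trd j = 0) (hj2 : trd (j * e) = 0)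
    (hj0 : nrd j ≠ 0) :
    (∃ w : ℍ[L,a,b], w ≠ 0 ∧ nrd w = 0) ↔ ∃ p q r s : L, ¬ (p = 0 ∧ q = 0 ∧ r = 0 ∧ s = 0) ∧
      (p ^ 2 + trd e * p * q + nrd e * q ^ 2) +
        nrd j * (r ^ 2 + trd e * r * s + nrd e * s ^ 2) = 0 := by
  have hΔ : trd e ^ 2 - 4 * nrd e ≠ 0 := (map_ne_zero ν).1 (by rw [he]; exact one_ne_zero)
  have hej : trd (e * j) = 0 := by rw [trd_mul_comm, hj2]
  constructor
  · rintro ⟨w, hw0, hw⟩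
    obtain ⟨p, q, m, rfl, hm1, hm2, -⟩ := exists_decomposition he het hen w
    obtain ⟨x, rfl⟩ := exists_mul_eq hj0 m
    obtain ⟨r, s, rfl, -⟩ := exists_eq_of_commute he het hen
      (mul_comm_of_anticommute hj1 hj2 hj0 hm1 hm2 rfl)
    refine ⟨p, q, r, s, ?_, by rw [← nrd_quad hj1 hj2, hw]⟩
    rintro ⟨rfl, rfl, rfl, rfl⟩
    simp at hw0
  · rintro ⟨p, q, r, s, hne, h⟩
    refine ⟨p • 1 + q • e + (r • 1 + s • e) * j, fun h0 => hne ?_, by rw [nrd_quad hj1 hj2, h]⟩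
    have htr0 : trd (0 : ℍ[L,a,b]) = 0 := by rw [trd_eq]; simp
    have hind : ∀ p q : L, trd (p • 1 + q • e) = 0 → trd ((p • 1 + q • e) * e) = 0 →
        p = 0 ∧ q = 0 := by
      intro p q h1 h2
      rw [trd_add, trd_smul, trd_smul, trd_one] at h1
      rw [add_mul, smul_mul_assoc, smul_mul_assoc, one_mul, trd_add, trd_smul, trd_smul,
        trd_mul_self] at h2
      constructor
      · refine (mul_eq_zero.1 ?_).resolve_left hΔ
        linear_combination (trd e ^ 2 - 2 * nrd e) * h1 - trd e * h2
      · refine (mul_eq_zero.1 ?_).resolve_left hΔ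
        linear_combination 2 * h2 - trd e * h1
    have htj : trd ((r • 1 + s • e) * j) = 0 := by
      rw [add_mul, smul_mul_assoc, smul_mul_assoc, one_mul, trd_add, trd_smul, trd_smul, hej, hj1]
      simp
    have hte : trd ((r • 1 + s • e) * j * e) = 0 := by
      rw [mul_assoc, mul_eq_star_mul hj1 hj2, add_mul, smul_mul_assoc, smul_mul_assoc, one_mul,
        ← mul_assoc, mul_star_eq_nrd, Algebra.algebraMap_eq_smul_one, smul_mul_assoc, one_mul,
        ← mul_eq_star_mul hj1 hj2, trd_add, trd_smul, trd_smul, trd_smul, hj1, hj2]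
      simp
    obtain ⟨rfl, rfl⟩ := hind p q
      (by
        have h1 := congrArg trd h0
        rwa [trd_add, htj, add_zero, htr0] at h1)
      (by
        have h2 := congrArg (fun x => trd (x * e)) h0
        rwa [add_mul, trd_add, hte, add_zero, zero_mul, htr0] at h2)
    rw [zero_smul, zero_smul, add_zero, zero_add] at h0
    have hrs : r • 1 + s • e = 0 := mul_right_cancel_of_nrd_ne_zero hj0 (by rw [h0, zero_mul])
    exact ⟨rfl, rfl, hind r s (by rw [hrs, htr0]) (by rw [hrs, zero_mul, htr0])⟩

theorem exists_conic_point_iff (b : L) :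
    (∃ x y z : L, (x, y, z) ≠ (0, 0, 0) ∧ a * x ^ 2 + b * y ^ 2 = z ^ 2) ↔
      ∃ w : ℍ[L,a,b], w ≠ 0 ∧ nrd w = 0 := by
  constructor
  · rintro ⟨x, y, z, hne, h⟩
    refine ⟨⟨z, x, y, 0⟩, fun h0 => hne ?_, ?_⟩
    · have h1 := congrArg QuaternionAlgebra.re h0
      have h2 := congrArg QuaternionAlgebra.imI h0
      have h3 := congrArg QuaternionAlgebra.imJ h0
      simp at h1 h2 h3
      rw [h1, h2, h3]
    · rw [nrd_eq]
      simp only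
      linear_combination -h
  · rintro ⟨⟨p, q, r, s⟩, hne, h⟩
    rw [nrd_eq] at h
    simp only at h
    by_cases hN : r ^ 2 - a * s ^ 2 = 0
    · by_cases hrs : r = 0 ∧ s = 0
      · refine ⟨q, 0, p, fun h0 => hne ?_, by linear_combination -h - b * hN⟩
        simp only [Prod.mk.injEq] at h0
        rw [h0.1, h0.2.2, hrs.1, hrs.2]
        rfl
      · refine ⟨s, 0, r, fun h0 => hrs ?_, by linear_combination -hN⟩
        simp only [Prod.mk.injEq] at h0
        exact ⟨h0.2.2, h0.1⟩
    -- With N(x, y) = x² - ay², vanishing of the norm says N(p, q) = b N(r, s). Multiply by N(r, s)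
    -- and use multiplicativity of N.
    · refine ⟨p * s - q * r, r ^ 2 - a * s ^ 2, p * r - a * q * s, fun h0 => ?_, ?_⟩
      · simp only [Prod.mk.injEq] at h0
        exact hN h0.2.1
      · linear_combination (-(r ^ 2 - a * s ^ 2)) * h

end Isotropy

variable {K : Type*} [Field K] [NumberField K] {v : HeightOneSpectrum (𝓞 K)} {a b : K}

instance charZero_adicCompletion : CharZero (v.adicCompletion K) :=
  charZero_of_injective_algebraMap (algebraMap K (v.adicCompletion K)).injective

open scoped Classical in
/-- Ramification is detected by the parameter of a maximal order. -/
theorem isRamifiedAt_iff {e j : ℍ[K,a,b]} (he : v.valuation K (trd e ^ 2 - 4 * nrd e) = 1)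
    (het : v.valuation K (trd e) ≤ 1) (hen : v.valuation K (nrd e) ≤ 1) (hj1 : trd j = 0)
    (hj2 : trd (j * e) = 0) (hj0 : nrd j ≠ 0)
    (hj : v.valuation K (nrd j) = 1 ∨ v.valuation K (nrd j) = exp (-1 : ℤ) ∧
        ∀ r, v.valuation K r ≤ 1 → v.valuation K (r ^ 2 - trd e * r + nrd e) = 1) :
    v.valuation K (nrd j) = if IsRamifiedAt a b v then exp (-1 : ℤ) else 1 := by
  set ι := algebraMap K (v.adicCompletion K) with hι
  have hram : IsRamifiedAt a b v ↔ ¬ ∃ p q r s : v.adicCompletion K,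
      ¬ (p = 0 ∧ q = 0 ∧ r = 0 ∧ s = 0) ∧ (p ^ 2 + ι (trd e) * p * q + ι (nrd e) * q ^ 2) +
        ι (nrd j) * (r ^ 2 + ι (trd e) * r * s + ι (nrd e) * s ^ 2) = 0 := by
    have h1 : trd (qmap ι e : ℍ[v.adicCompletion K,ι a,ι b]) = ι (trd e) := trd_qmap ι e
    have h2 : nrd (qmap ι e : ℍ[v.adicCompletion K,ι a,ι b]) = ι (nrd e) := nrd_qmap ι rfl rfl e
    have h3 : nrd (qmap ι j : ℍ[v.adicCompletion K,ι a,ι b]) = ι (nrd j) := nrd_qmap ι rfl rfl j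
    have h := exists_nrd_eq_zero_iff (ν := Valued.v)
      (e := (qmap ι e : ℍ[v.adicCompletion K,ι a,ι b])) (j := qmap ι j)
      (by
        rw [h1, h2, show ι (trd e) ^ 2 - 4 * ι (nrd e) = ι (trd e ^ 2 - 4 * nrd e) by
          rw [map_sub, map_mul, map_pow, map_ofNat],
          valued_algebraMap, he])
      (by rwa [h1, valued_algebraMap]) (by rwa [h2, valued_algebraMap])
      (by rw [trd_qmap, hj1, map_zero])
      (by rw [← qmap_mul ι rfl rfl, trd_qmap, hj2, map_zero])
      (by rw [h3]; exact (map_ne_zero ι).2 hj0)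
    rw [h1, h2, h3] at h
    rw [← h, IsRamifiedAt, not_iff_not]
    exact exists_conic_point_iff (ι b)
  rcases hj with hj | ⟨hj, hr⟩
  · rw [if_neg, hj]
    rw [hram, not_not]
    exact exists_zero_of_unit het hen he hj
  · rw [if_pos, hj]
    rw [hram]
    rintro ⟨p, q, r, s, hne, h⟩
    exact hne (eq_zero_of_uniformizer het hen hr hj h)

open scoped Classical in
/-- The local discriminant of the trace-zero part of a maximal order. -/
theorem IsMaxLocalOrder.gram (ha : a ≠ 0) (hb : b ≠ 0) {O : Subring ℍ[K,a,b]}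
    (hO : IsMaxLocalOrder (v.valuation K) O) :
    (∃ f : Fin 3 → B0 a b, (∀ i, (f i : ℍ[K,a,b]) ∈ O) ∧
      v.valuation K (Matrix.of fun i k => QB a b (f i) (f k)).det =
        v.valuation K 2 * (if IsRamifiedAt a b v then exp (-1 : ℤ) else 1) ^ 2) ∧
    ∀ x : Fin 3 → B0 a b, (∀ i, (x i : ℍ[K,a,b]) ∈ O) →
      v.valuation K (Matrix.of fun i k => QB a b (x i) (x k)).det ≤
        v.valuation K 2 * (if IsRamifiedAt a b v then exp (-1 : ℤ) else 1) ^ 2 := by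
  obtain ⟨ϖ, hϖ⟩ := v.valuation_exists_uniformizer K
  obtain ⟨e, heO, j, hjO, he, hj1, hj2, hj0, hgen, hj⟩ := hO.exists_structure ha hb hϖ
    fun n hn h2 => exists_sq_sub_lt_one v hn h2
  have hν := isRamifiedAt_iff he (hO.trd_le_one heO) (hO.nrd_le_one heO) hj1 hj2 hj0 hj
  have h := hO.exists_gram ha hb heO hjO he hj1 hj2 hgen
  rw [hν] at h
  exact h

/-! ### Localization and gluing of orders -/

open IsDedekindDomain HeightOneSpectrum WithZero

variable {K : Type*} [Field K] [NumberField K] {a b : K}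

theorem ringOfIntegers_smul_eq (r : 𝓞 K) (x : ℍ[K,a,b]) : r • x = algebraMap (𝓞 K) K r • x :=
  (algebraMap_smul K r x).symm

theorem ringOfIntegers_smul_mul (r s : 𝓞 K) (x y : ℍ[K,a,b]) :
    (r * s) • (x * y) = (r • x) * (s • y) := by
  rw [ringOfIntegers_smul_eq, ringOfIntegers_smul_eq r, ringOfIntegers_smul_eq s, map_mul,
    smul_mul_smul_comm]

theorem IsOrder.exists_smul_mem {O : Subalgebra (𝓞 K) ℍ[K,a,b]} (hO : IsOrder O) (x : ℍ[K,a,b]) :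
    ∃ r : 𝓞 K, r ≠ 0 ∧ r • x ∈ O := by
  have hx : x ∈ Submodule.span K (O : Set ℍ[K,a,b]) := by rw [hO.2]; trivial
  induction hx using Submodule.span_induction with
  | mem x hx => exact ⟨1, one_ne_zero, by rwa [one_smul]⟩
  | zero => exact ⟨1, one_ne_zero, by rw [smul_zero]; exact O.zero_mem⟩
  | add x y _ _ hx hy =>
    obtain ⟨r, hr, hx⟩ := hx
    obtain ⟨s, hs, hy⟩ := hy
    refine ⟨r * s, mul_ne_zero hr hs, ?_⟩
    rw [smul_add]
    exact O.add_mem (by rw [mul_comm, mul_smul]; exact O.smul_mem hx s)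
      (by rw [mul_smul]; exact O.smul_mem hy r)
  | smul k x _ hx =>
    obtain ⟨r, hr, hx⟩ := hx
    obtain ⟨n, d, hd, rfl⟩ := IsFractionRing.div_surjective (A := 𝓞 K) k
    have hd0 : d ≠ 0 := nonZeroDivisors.ne_zero hd
    refine ⟨d * r, mul_ne_zero hd0 hr, ?_⟩
    have hd1 : algebraMap (𝓞 K) K d ≠ 0 := by simpa using hd0
    have : (d * r) • ((algebraMap (𝓞 K) K n / algebraMap (𝓞 K) K d) • x) = n • r • x := by
      rw [ringOfIntegers_smul_eq, ringOfIntegers_smul_eq n, ringOfIntegers_smul_eq r, smul_smul,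
        smul_smul, map_mul]
      congr 1
      field_simp
    rw [this]
    exact O.smul_mem hx n

variable (v : HeightOneSpectrum (𝓞 K))

/-- The localization of an order at a finite place. -/
def localOrder (O : Subalgebra (𝓞 K) ℍ[K,a,b]) : Subring ℍ[K,a,b] where
  carrier := {x | ∃ s : 𝓞 K, s ∉ v.asIdeal ∧ s • x ∈ O}
  zero_mem' := ⟨1, v.isPrime.one_notMem, by rw [smul_zero]; exact O.zero_mem⟩
  one_mem' := ⟨1, v.isPrime.one_notMem, by rw [one_smul]; exact O.one_mem⟩
  add_mem' := by
    rintro x y ⟨s, hs, hx⟩ ⟨t, ht, hy⟩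
    refine ⟨s * t, v.isPrime.mul_notMem hs ht, ?_⟩
    rw [smul_add]
    exact O.add_mem (by rw [mul_comm, mul_smul]; exact O.smul_mem hx t)
      (by rw [mul_smul]; exact O.smul_mem hy s)
  neg_mem' := by
    rintro x ⟨s, hs, hx⟩
    exact ⟨s, hs, by rw [smul_neg]; exact O.neg_mem hx⟩
  mul_mem' := by
    rintro x y ⟨s, hs, hx⟩ ⟨t, ht, hy⟩
    refine ⟨s * t, v.isPrime.mul_notMem hs ht, ?_⟩
    rw [ringOfIntegers_smul_mul]
    exact O.mul_mem hx hy

theorem valuation_eq_one_of_notMem {s : 𝓞 K} (hs : s ∉ v.asIdeal) :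
    v.valuation K (algebraMap (𝓞 K) K s) = 1 := v.valuation_eq_one_iff_notMem.2 hs

/-- Boundedness comes from finite generation: a functional is bounded on `O` by its values on
generators, and the denominators allowed by localization are units at v. -/
theorem IsOrder.isLocalOrder {O : Subalgebra (𝓞 K) ℍ[K,a,b]} (hO : IsOrder O) :
    IsLocalOrder (v.valuation K) (localOrder v O) where
  smul_mem := by
    rintro r hr x ⟨s, hs, hx⟩
    obtain ⟨n, ⟨d, hd⟩, hnd⟩ := exists_primeCompl_mul_eq_of_integer v r hr
    refine ⟨d * s, v.isPrime.mul_notMem hd hs, ?_⟩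
    have : (d * s) • r • x = n • s • x := by
      rw [ringOfIntegers_smul_eq, ringOfIntegers_smul_eq n, ringOfIntegers_smul_eq s, smul_smul,
        smul_smul, map_mul]
      congr 1
      have hnd' : r * algebraMap (𝓞 K) K d = algebraMap (𝓞 K) K n := hnd
      linear_combination algebraMap (𝓞 K) K s * hnd'
    rw [this]
    exact O.smul_mem hx n
  bounded := by
    obtain ⟨S, hS⟩ := hO.1
    have key : ∀ l : ℍ[K,a,b] →ₗ[K] K, ∃ C, ∀ x ∈ localOrder v O, v.valuation K (l x) ≤ C := by
      intro l
      refine ⟨S.sup fun x => v.valuation K (l x), ?_⟩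
      have hOb : ∀ x ∈ O, v.valuation K (l x) ≤ S.sup fun x => v.valuation K (l x) := by
        intro x hx
        have hx' : x ∈ Subalgebra.toSubmodule O := hx
        rw [← hS] at hx'
        clear hx
        induction hx' using Submodule.span_induction with
        | mem x hx => exact Finset.le_sup (f := fun x => v.valuation K (l x)) hx
        | zero => simp
        | add x y _ _ h1 h2 =>
          rw [map_add]
          exact (Valuation.map_add _ _ _).trans (max_le h1 h2)
        | smul r x _ h =>
          refine le_of_eq_of_le (congrArg (fun y => v.valuation K (l y))
            (ringOfIntegers_smul_eq r x)) ?_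
          rw [map_smul, smul_eq_mul, map_mul]
          exact (mul_le_of_le_one_left' (valuation_le_one v r)).trans h
      rintro x ⟨s, hs, hx⟩
      have := hOb _ hx
      rwa [ringOfIntegers_smul_eq, map_smul, smul_eq_mul, map_mul, valuation_eq_one_of_notMem v hs,
        one_mul] at this
    obtain ⟨C₁, h₁⟩ := key (QuaternionAlgebra.reₗ _ _ _)
    obtain ⟨C₂, h₂⟩ := key (QuaternionAlgebra.imIₗ _ _ _)
    obtain ⟨C₃, h₃⟩ := key (QuaternionAlgebra.imJₗ _ _ _)
    obtain ⟨C₄, h₄⟩ := key (QuaternionAlgebra.imKₗ _ _ _)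
    exact ⟨max (max C₁ C₂) (max C₃ C₄), fun x hx =>
      ⟨(h₁ x hx).trans (by simp), (h₂ x hx).trans (by simp), (h₃ x hx).trans (by simp),
        (h₄ x hx).trans (by simp)⟩⟩
  spans x := by
    obtain ⟨r, hr, hx⟩ := hO.exists_smul_mem x
    exact ⟨algebraMap (𝓞 K) K r, by simpa using hr, 1, v.isPrime.one_notMem, by
      rwa [one_smul, ← ringOfIntegers_smul_eq]⟩

theorem le_localOrder {O : Subalgebra (𝓞 K) ℍ[K,a,b]} {x : ℍ[K,a,b]} (hx : x ∈ O) :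
    x ∈ localOrder v O := ⟨1, v.isPrime.one_notMem, by rwa [one_smul]⟩

variable {v}

/-- Two local orders are commensurable. -/
theorem IsLocalOrder.exists_smul_le {O₁ O₂ : Subring ℍ[K,a,b]}
    (h₁ : IsLocalOrder (v.valuation K) O₁) (h₂ : IsLocalOrder (v.valuation K) O₂) :
    ∃ D : 𝓞 K, D ≠ 0 ∧ ∀ x ∈ O₂, D • x ∈ O₁ := by
  obtain ⟨C, hC⟩ := h₂.bounded
  obtain ⟨r₁, hr₁, -, h1⟩ := h₁.exists_smul_mem ⟨1, 0, 0, 0⟩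
  obtain ⟨r₂, hr₂, -, h2⟩ := h₁.exists_smul_mem ⟨0, 1, 0, 0⟩
  obtain ⟨r₃, hr₃, -, h3⟩ := h₁.exists_smul_mem ⟨0, 0, 1, 0⟩
  obtain ⟨r₄, hr₄, -, h4⟩ := h₁.exists_smul_mem ⟨0, 0, 0, 1⟩
  have hC0 : max C 1 ≠ 0 := (zero_lt_one.trans_le (le_max_right C 1)).ne'
  obtain ⟨u, hu⟩ := v.valuation_surjective K (max C 1)⁻¹
  have hu0 : u ≠ 0 := (map_ne_zero (v.valuation K)).1 (by rw [hu]; exact inv_ne_zero hC0)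
  have hf : ∀ r : K, r ≠ 0 → ∃ D : 𝓞 K, D ≠ 0 ∧
      ∀ y, v.valuation K y ≤ C → v.valuation K (algebraMap (𝓞 K) K D * y / r) ≤ 1 := by
    intro r hr
    obtain ⟨n, d, hd, hnd⟩ := IsFractionRing.div_surjective (A := 𝓞 K) (u * r)
    have hd0 : algebraMap (𝓞 K) K d ≠ 0 := by simpa using nonZeroDivisors.ne_zero hd
    refine ⟨n, ?_, fun y hy => ?_⟩
    · rintro rfl
      rw [map_zero, zero_div] at hnd
      exact mul_ne_zero hu0 hr hnd.symm
    · rw [div_eq_iff hd0] at hnd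
      rw [hnd, show u * r * algebraMap (𝓞 K) K d * y / r = algebraMap (𝓞 K) K d * (u * y) by
        field_simp, map_mul, map_mul, hu]
      refine mul_le_one' (valuation_le_one v d) ?_
      rw [inv_mul_le_iff₀ (zero_lt_iff.2 hC0), mul_one]
      exact hy.trans (le_max_left _ _)
  obtain ⟨D₁, hD₁, g₁⟩ := hf r₁ hr₁
  obtain ⟨D₂, hD₂, g₂⟩ := hf r₂ hr₂
  obtain ⟨D₃, hD₃, g₃⟩ := hf r₃ hr₃
  obtain ⟨D₄, hD₄, g₄⟩ := hf r₄ hr₄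
  refine ⟨D₁ * D₂ * (D₃ * D₄), mul_ne_zero (mul_ne_zero hD₁ hD₂) (mul_ne_zero hD₃ hD₄),
    fun x hx => ?_⟩
  obtain ⟨b1, b2, b3, b4⟩ := hC x hx
  have hint : ∀ (s : 𝓞 K), ∀ y ∈ O₁, s • y ∈ O₁ := fun s y hy => by
    rw [ringOfIntegers_smul_eq]; exact h₁.smul_mem _ (valuation_le_one v s) _ hy
  have hmem : ∀ (r : K) (D : 𝓞 K) (y : K) (w : ℍ[K,a,b]), r ≠ 0 → r • w ∈ O₁ →
      v.valuation K (algebraMap (𝓞 K) K D * y / r) ≤ 1 → D • y • w ∈ O₁ := by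
    intro r D y w hr hw hy
    have := h₁.smul_mem _ hy _ hw
    rwa [smul_smul, div_mul_cancel₀ _ hr, mul_smul, ← ringOfIntegers_smul_eq] at this
  have e : x = x.re • ⟨1, 0, 0, 0⟩ + x.imI • ⟨0, 1, 0, 0⟩ +
      (x.imJ • ⟨0, 0, 1, 0⟩ + x.imK • ⟨0, 0, 0, 1⟩) := by
    ext <;> simp
  rw [e, smul_add, smul_add, smul_add]
  refine O₁.add_mem (O₁.add_mem ?_ ?_) (O₁.add_mem ?_ ?_)
  · rw [show D₁ * D₂ * (D₃ * D₄) = D₂ * (D₃ * D₄) * D₁ by ring, mul_smul]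
    exact hint _ _ (hmem _ _ _ _ hr₁ h1 (g₁ _ b1))
  · rw [show D₁ * D₂ * (D₃ * D₄) = D₁ * (D₃ * D₄) * D₂ by ring, mul_smul]
    exact hint _ _ (hmem _ _ _ _ hr₂ h2 (g₂ _ b2))
  · rw [show D₁ * D₂ * (D₃ * D₄) = D₁ * D₂ * D₄ * D₃ by ring, mul_smul]
    exact hint _ _ (hmem _ _ _ _ hr₃ h3 (g₃ _ b3))
  · rw [← mul_assoc, mul_smul]
    exact hint _ _ (hmem _ _ _ _ hr₄ h4 (g₄ _ b4))

variable (v) in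
/-- The elements of a local order `O'` at `v` that belong to the order `O` away from `v`. -/
def glueOrder (O : Subalgebra (𝓞 K) ℍ[K,a,b]) (O' : Subring ℍ[K,a,b])
    (hO' : IsLocalOrder (v.valuation K) O') : Subalgebra (𝓞 K) ℍ[K,a,b] where
  carrier := {x | x ∈ O' ∧ ∃ m : ℕ, ∀ s ∈ v.asIdeal ^ m, s • x ∈ O}
  zero_mem' := ⟨O'.zero_mem, 0, fun s _ => by rw [smul_zero]; exact O.zero_mem⟩
  one_mem' := ⟨O'.one_mem, 0, fun s _ => O.smul_mem O.one_mem s⟩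
  add_mem' := by
    rintro x y ⟨hx, m, hm⟩ ⟨hy, n, hn⟩
    refine ⟨O'.add_mem hx hy, m + n, fun s hs => ?_⟩
    rw [smul_add]
    rw [pow_add] at hs
    have h1 := hm s (Ideal.mul_le_left hs)
    have h2 := hn s (Ideal.mul_le_right hs)
    exact O.add_mem h1 h2
  mul_mem' := by
    rintro x y ⟨hx, m, hm⟩ ⟨hy, n, hn⟩
    refine ⟨O'.mul_mem hx hy, m + n, fun s hs => ?_⟩
    rw [pow_add] at hs
    induction hs using Submodule.mul_induction_on' with
    | mem_mul_mem s hs t ht =>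
      rw [ringOfIntegers_smul_mul]
      exact O.mul_mem (hm s hs) (hn t ht)
    | add s _ t _ hs ht =>
      rw [add_smul]
      exact O.add_mem hs ht
  algebraMap_mem' r := by
    refine ⟨?_, 0, fun s _ => O.smul_mem (O.algebraMap_mem r) s⟩
    have h := hO'.smul_one_mem (valuation_le_one v r)
    rw [← ringOfIntegers_smul_eq] at h
    rw [Algebra.algebraMap_eq_smul_one]
    exact h

/-- The localizations of a maximal order are maximal. -/
theorem IsMaximalOrder.isMaxLocalOrder {O : Subalgebra (𝓞 K) ℍ[K,a,b]} (hO : IsMaximalOrder O) :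
    IsMaxLocalOrder (v.valuation K) (localOrder v O) := by
  refine ⟨hO.1.isLocalOrder v, fun O' hO' hle => ?_⟩
  -- The strategy is to glue a larger local order `O'` with `O` away from v to a global order
  -- containing `O`. Maximality makes it equal to `O`; a common multiplier D controls its size.
  obtain ⟨D, hD0, hD⟩ := (hO.1.isLocalOrder v).exists_smul_le hO'
  have hOle : O ≤ glueOrder v O O' hO' := fun x hx =>
    ⟨hle (le_localOrder v hx), 0, fun s _ => O.smul_mem hx s⟩
  have hglue : ∀ x ∈ glueOrder v O O' hO', D • x ∈ O := by
    rintro x ⟨hx, m, hm⟩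
    obtain ⟨s, hs, h⟩ := hD x hx
    -- Both s and 𝔭_v^m multiply Dx into `O`, and they generate the unit ideal.
    have htop : Ideal.span {s} ⊔ v.asIdeal ^ m = ⊤ := by
      rw [← Ideal.isCoprime_iff_sup_eq]
      refine IsCoprime.pow_right (Ideal.isCoprime_iff_exists.2 ?_)
      obtain ⟨y, i, hi, h⟩ := v.isMaximal.exists_inv hs
      exact ⟨y * s, Ideal.mul_mem_left _ _ (Ideal.mem_span_singleton_self s), i, hi, h⟩
    have h1 : (1 : 𝓞 K) ∈ Ideal.span {s} ⊔ v.asIdeal ^ m := by rw [htop]; trivial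
    obtain ⟨y, hy, w, hw, hyw⟩ := Submodule.mem_sup.1 h1
    obtain ⟨c, rfl⟩ := Ideal.mem_span_singleton'.1 hy
    rw [← one_smul (𝓞 K) (D • x), ← hyw, add_smul]
    refine O.add_mem ?_ ?_
    · rw [mul_smul]; exact O.smul_mem h c
    · rw [smul_comm]; exact O.smul_mem (hm w hw) D
  have hord : IsOrder (glueOrder v O O' hO') := by
    refine ⟨?_, ?_⟩
    · have hmap : (Subalgebra.toSubmodule (glueOrder v O O' hO')).map
          (LinearMap.lsmul (𝓞 K) ℍ[K,a,b] D) ≤ Subalgebra.toSubmodule O := by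
        rintro _ ⟨x, hx, rfl⟩
        exact hglue x hx
      refine Submodule.fg_of_fg_map_injective (LinearMap.lsmul (𝓞 K) ℍ[K,a,b] D) ?_
        (hO.1.1.of_le hmap)
      intro x y hxy
      have hxy' : D • x = D • y := hxy
      rw [ringOfIntegers_smul_eq, ringOfIntegers_smul_eq] at hxy'
      exact smul_right_injective _ (by simpa using hD0 : algebraMap (𝓞 K) K D ≠ 0) hxy'
    · refine top_le_iff.1 ?_
      rw [← hO.1.2]
      exact Submodule.span_mono hOle
  have hfin : ∀ x ∈ glueOrder v O O' hO', x ∈ O := fun x hx => hO.2 hord hOle hx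
  intro x hx
  obtain ⟨s, hs, h⟩ := hD x hx
  -- Write (D) = 𝔭_v^m 𝔠 with 𝔠 prime to v, and take t in 𝔠 outside 𝔭_v. Multiplication by ts then
  -- moves any x of `O'` into the glued order.
  obtain ⟨m, t, ht, htm⟩ : ∃ (m : ℕ) (t : 𝓞 K), t ∉ v.asIdeal ∧
      ∀ w ∈ v.asIdeal ^ m, w * t ∈ Ideal.span {D} := by
    obtain ⟨c, hc, hvc⟩ := (FiniteMultiplicity.of_prime_left v.prime
      (by simpa using hD0 : Ideal.span {D} ≠ 0)).exists_eq_pow_mul_and_not_dvd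
    obtain ⟨t, htc, ht⟩ := SetLike.not_le_iff_exists.1 (mt Ideal.dvd_iff_le.2 hvc)
    exact ⟨_, t, ht, fun w hw => by rw [hc]; exact Ideal.mul_mem_mul hw htc⟩
  refine ⟨t * s, v.isPrime.mul_notMem ht hs, hfin _ ⟨?_, m, fun w hw => ?_⟩⟩
  · rw [ringOfIntegers_smul_eq]
    exact hO'.smul_mem _ (valuation_le_one v _) _ hx
  · obtain ⟨c, hc⟩ := Ideal.mem_span_singleton'.1 (htm w hw)
    rw [← mul_smul, ← mul_assoc, ← hc, show c * D * s = c * (s * D) by ring, mul_smul, mul_smul]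
    exact O.smul_mem h c

/-! ### The discriminant ideal from local data -/

open IsDedekindDomain HeightOneSpectrum WithZero

variable {K : Type*} [Field K] [NumberField K] {a b : K}

/-- A fractional ideal is determined by local conditions. -/
theorem mem_submodule_iff_valuation (I : Submodule (𝓞 K) K)
    (δ : HeightOneSpectrum (𝓞 K) → ℤᵐ⁰) (hδ : ∀ v, δ v ≠ 0)
    (hle : ∀ v, ∀ x ∈ I, v.valuation K x ≤ δ v)
    (hex : ∀ v, ∃ x ∈ I, v.valuation K x = δ v) (x : K) :
    x ∈ I ↔ ∀ v : HeightOneSpectrum (𝓞 K), v.valuation K x ≤ δ v := by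
  refine ⟨fun hx v => hle v x hx, fun hx => ?_⟩
  -- The ideal of multipliers carrying x into `I`; an element of `I` of extremal valuation at v
  -- shows that it is not contained in 𝔭_v.
  let J : Ideal (𝓞 K) := I.comap (LinearMap.toSpanSingleton (𝓞 K) K x)
  have hJ : J = ⊤ := by
    by_contra hJ
    obtain ⟨M, hM, hJM⟩ := Ideal.exists_le_maximal J hJ
    have hM0 : M ≠ ⊥ := Ring.ne_bot_of_isMaximal_of_not_isField hM
      (NumberField.RingOfIntegers.not_isField K)
    let v : HeightOneSpectrum (𝓞 K) := ⟨M, hM.isPrime, hM0⟩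
    obtain ⟨d, hd, hdv⟩ := hex v
    have hd0 : d ≠ 0 := (map_ne_zero (v.valuation K)).1 (by rw [hdv]; exact hδ v)
    obtain ⟨n, ⟨s, hs⟩, hns⟩ := exists_primeCompl_mul_eq_of_integer v (x / d) (by
      rw [map_div₀, hdv]; exact div_le_one_of_le₀ (hx v) zero_le)
    refine hs (hJM ?_)
    change s • x ∈ I
    have hns' : x / d * algebraMap (𝓞 K) K s = algebraMap (𝓞 K) K n := hns
    have : s • x = n • d := by
      rw [Algebra.smul_def, Algebra.smul_def, ← hns']
      field_simp
    rw [this]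
    exact I.smul_mem n hd
  have h1 : (1 : 𝓞 K) ∈ J := by rw [hJ]; trivial
  have h2 : (1 : 𝓞 K) • x ∈ I := h1
  rwa [one_smul] at h2

theorem submodule_eq_of_valuation {I J : Submodule (𝓞 K) K}
    (δ : HeightOneSpectrum (𝓞 K) → ℤᵐ⁰) (hδ : ∀ v, δ v ≠ 0)
    (hle : ∀ v, ∀ x ∈ I, v.valuation K x ≤ δ v)
    (hex : ∀ v, ∃ x ∈ I, v.valuation K x = δ v)
    (hle' : ∀ v, ∀ x ∈ J, v.valuation K x ≤ δ v)
    (hex' : ∀ v, ∃ x ∈ J, v.valuation K x = δ v) : I = J := by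
  ext x
  rw [mem_submodule_iff_valuation I δ hδ hle hex, mem_submodule_iff_valuation J δ hδ hle' hex']

variable (a b) in
open scoped Classical in
/-- The absolute value of the local discriminant. -/
def discValuation (v : HeightOneSpectrum (𝓞 K)) : ℤᵐ⁰ :=
  v.valuation K 2 * (if IsRamifiedAt a b v then exp (-1 : ℤ) else 1) ^ 2

theorem discValuation_ne_zero (v : HeightOneSpectrum (𝓞 K)) : discValuation a b v ≠ 0 := by
  refine mul_ne_zero ((map_ne_zero _).2 two_ne_zero) (pow_ne_zero 2 ?_)
  split_ifs
  exacts [exp_ne_zero, one_ne_zero]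

theorem B0_smul_eq (s : 𝓞 K) (x : B0 a b) : s • x = algebraMap (𝓞 K) K s • x :=
  Subtype.ext (ringOfIntegers_smul_eq s (x : ℍ[K,a,b]))

theorem valuation_le_of_mem_latticeDisc (ha : a ≠ 0) (hb : b ≠ 0) {O : Subalgebra (𝓞 K) ℍ[K,a,b]}
    (hO : IsMaximalOrder O) (v : HeightOneSpectrum (𝓞 K)) (d : K)
    (hd : d ∈ latticeDisc 3 (QB a b) (traceZeroLattice O)) :
    v.valuation K d ≤ discValuation a b v := by
  induction hd using Submodule.span_induction with
  | mem d hd =>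
    obtain ⟨x, hx, rfl⟩ := hd
    exact ((hO.isMaxLocalOrder (v := v)).gram ha hb).2 x fun i => le_localOrder v (hx i)
  | zero => simp
  | add d d' _ _ h h' => exact (Valuation.map_add _ _ _).trans (max_le h h')
  | smul s d _ h =>
    rw [Algebra.smul_def, map_mul]
    exact (mul_le_of_le_one_left' (valuation_le_one v s)).trans h

/-- Local basis vectors become elements of `O` after multiplication by an integer t prime to v,
which does not change the valuation of the determinant. -/
theorem exists_mem_latticeDisc (ha : a ≠ 0) (hb : b ≠ 0) {O : Subalgebra (𝓞 K) ℍ[K,a,b]}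
    (hO : IsMaximalOrder O) (v : HeightOneSpectrum (𝓞 K)) :
    ∃ d ∈ latticeDisc 3 (QB a b) (traceZeroLattice O),
      v.valuation K d = discValuation a b v := by
  obtain ⟨f, hf, hd⟩ := ((hO.isMaxLocalOrder (v := v)).gram ha hb).1
  choose s hs hsf using hf
  let t : 𝓞 K := ∏ i, s i
  have ht : v.valuation K (algebraMap (𝓞 K) K t) = 1 := by
    rw [map_prod, map_prod]
    exact Finset.prod_eq_one fun i _ => valuation_eq_one_of_notMem v (hs i)
  have hx : ∀ i, t • f i ∈ traceZeroLattice O := fun i => by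
    have : t = (∏ k ∈ Finset.univ.erase i, s k) * s i := by
      rw [Finset.prod_erase_mul _ _ (Finset.mem_univ i)]
    rw [this, mul_smul]
    exact Submodule.smul_mem _ _ (hsf i)
  refine ⟨_, Submodule.subset_span ⟨fun i => t • f i, hx, rfl⟩, ?_⟩
  rw [det_gram_of_eq_sum (QB a b) (algebraMap (𝓞 K) K t • (1 : Matrix (Fin 3) (Fin 3) K)) (f := f)
    (fun i => by
      simp only [Matrix.smul_apply, Matrix.one_apply, smul_eq_mul, mul_ite, mul_one, mul_zero,
        ite_smul, zero_smul, Finset.sum_ite_eq, Finset.mem_univ, if_true]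
      exact B0_smul_eq t (f i)), Matrix.det_smul, Matrix.det_one, map_mul,
    mul_one, map_pow, map_pow, ht, one_pow, one_pow, one_mul]
  exact hd

/-- A nonzero element of the discriminant has positive order at every ramified place, hence there
are finitely many of them. -/
theorem finite_isRamifiedAt (ha : a ≠ 0) (hb : b ≠ 0) {O : Subalgebra (𝓞 K) ℍ[K,a,b]}
    (hO : IsMaximalOrder O) : {v | IsRamifiedAt a b v}.Finite := by
  classical
  by_cases hne : ∃ v, IsRamifiedAt a b v
  · obtain ⟨v₀, -⟩ := hne
    obtain ⟨d, hd, hdv⟩ := exists_mem_latticeDisc ha hb hO v₀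
    have hd0 : d ≠ 0 := (map_ne_zero (v₀.valuation K)).1 (by
      rw [hdv]; exact discValuation_ne_zero v₀)
    refine (HeightOneSpectrum.Support.finite (𝓞 K) d⁻¹).subset fun v hv => ?_
    change 1 < v.valuation K d⁻¹
    rw [map_inv₀, one_lt_inv₀ (zero_lt_iff.2 ((map_ne_zero _).2 hd0))]
    refine (valuation_le_of_mem_latticeDisc ha hb hO v d hd).trans_lt ?_
    have hv' : IsRamifiedAt a b v := hv
    rw [discValuation, if_pos hv', mul_comm]
    refine mul_lt_one_left (pow_lt_one' ?_ two_ne_zero)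
      (by exact_mod_cast map_natCast_le_one (v.valuation K) 2)
    exact lt_one_iff_le_exp.2 le_rfl
  · convert Set.finite_empty
    ext v
    simp only [Set.mem_ofPred_eq, Set.mem_empty_iff_false, iff_false]
    exact fun hv => hne ⟨v, hv⟩

theorem quatDisc_eq_prod (hfin : {v | IsRamifiedAt a b v}.Finite) :
    quatDisc a b = ∏ v ∈ hfin.toFinset, v.asIdeal :=
  finprod_mem_eq_finite_toFinset_prod _ hfin

theorem exists_mem_prod_notMem (S : Finset (HeightOneSpectrum (𝓞 K)))
    (v : HeightOneSpectrum (𝓞 K)) (hv : v ∉ S) :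
    ∃ t ∈ ∏ w ∈ S, w.asIdeal, t ∉ v.asIdeal := by
  refine SetLike.not_le_iff_exists.1 fun h => ?_
  obtain ⟨w, hw, hwv⟩ := (Ideal.IsPrime.prod_le v.isPrime).1 h
  have : w = v := HeightOneSpectrum.ext (w.isMaximal.eq_of_le v.isPrime.ne_top hwv)
  exact hv (this ▸ hw)

theorem exists_mem_quatDisc (hfin : {v | IsRamifiedAt a b v}.Finite)
    (v : HeightOneSpectrum (𝓞 K)) [Decidable (IsRamifiedAt a b v)] : ∃ z ∈ quatDisc a b,
      v.valuation K (algebraMap (𝓞 K) K z) = if IsRamifiedAt a b v then exp (-1 : ℤ) else 1 := by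
  classical
  rw [quatDisc_eq_prod hfin]
  split_ifs with hv
  · obtain ⟨π, hπ⟩ := v.intValuation_exists_uniformizer
    obtain ⟨t, ht, htv⟩ := exists_mem_prod_notMem (hfin.toFinset.erase v) v (by simp)
    refine ⟨π * t, ?_, ?_⟩
    · rw [← Finset.mul_prod_erase _ _ (hfin.mem_toFinset.2 hv)]
      refine Ideal.mul_mem_mul ?_ ht
      rw [← intValuation_lt_one_iff_mem, hπ]
      exact lt_one_iff_le_exp.2 le_rfl
    · rw [map_mul, map_mul, valuation_eq_one_of_notMem v htv, mul_one]
      exact (v.valuation_of_algebraMap π).trans hπ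
  · obtain ⟨t, ht, htv⟩ := exists_mem_prod_notMem hfin.toFinset v (by simpa using hv)
    exact ⟨t, ht, valuation_eq_one_of_notMem v htv⟩

theorem valuation_le_of_mem_quatDisc_sq (hfin : {v | IsRamifiedAt a b v}.Finite)
    (v : HeightOneSpectrum (𝓞 K)) [Decidable (IsRamifiedAt a b v)] {z : 𝓞 K}
    (hz : z ∈ quatDisc a b ^ 2) : v.valuation K (algebraMap (𝓞 K) K z) ≤
      (if IsRamifiedAt a b v then exp (-1 : ℤ) else 1) ^ 2 := by
  split_ifs with hv
  · have h : quatDisc a b ≤ v.asIdeal := by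
      rw [quatDisc_eq_prod hfin]
      exact Ideal.le_of_dvd (Finset.dvd_prod_of_mem _ (hfin.mem_toFinset.2 hv))
    have hz' := Ideal.pow_right_mono h 2 hz
    rw [← intValuation_le_pow_iff_mem] at hz'
    refine ((v.valuation_of_algebraMap z).trans_le hz').trans_eq ?_
    rw [← exp_nsmul]; rfl
  · rw [one_pow]; exact valuation_le_one v z

/-- The discriminant of the trace-zero lattice of a maximal order. -/
theorem latticeDisc_eq (ha : a ≠ 0) (hb : b ≠ 0) {O : Subalgebra (𝓞 K) ℍ[K,a,b]}
    (hO : IsMaximalOrder O) : latticeDisc 3 (QB a b) (traceZeroLattice O) =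
      IsLocalization.coeSubmodule K (Ideal.span {2} * quatDisc a b ^ 2) := by
  classical
  have hfin := finite_isRamifiedAt ha hb hO
  refine submodule_eq_of_valuation (discValuation a b) discValuation_ne_zero
    (valuation_le_of_mem_latticeDisc ha hb hO) (exists_mem_latticeDisc ha hb hO) ?_ ?_
  · intro v x hx
    obtain ⟨y, hy, rfl⟩ := (IsLocalization.mem_coeSubmodule _ _).1 hx
    obtain ⟨z, hz, rfl⟩ := Ideal.mem_span_singleton_mul.1 hy
    rw [map_mul, map_ofNat, map_mul, discValuation]
    exact mul_le_mul_right (valuation_le_of_mem_quatDisc_sq hfin v hz) _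
  · intro v
    obtain ⟨z, hz, hzv⟩ := exists_mem_quatDisc hfin v
    refine ⟨algebraMap (𝓞 K) K (2 * z ^ 2), (IsLocalization.mem_coeSubmodule _ _).2
      ⟨_, Ideal.mem_span_singleton_mul.2 ⟨z ^ 2, Ideal.pow_mem_pow hz 2, rfl⟩, rfl⟩, ?_⟩
    rw [map_mul, map_ofNat, map_mul, map_pow, map_pow, hzv, discValuation]

/-- Integrality holds at every finite place by the local statement. -/
theorem trd_mem_range {O : Subalgebra (𝓞 K) ℍ[K,a,b]} (hO : IsOrder O) {x : ℍ[K,a,b]}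
    (hx : x ∈ O) : ∃ z : 𝓞 K, algebraMap (𝓞 K) K z = trd x := by
  obtain ⟨z, hz⟩ := mem_integers_of_valuation_le_one K (trd x) fun v =>
    (hO.isLocalOrder v).trd_le_one (le_localOrder v hx)
  exact ⟨z, hz⟩

theorem exists_mem_traceZeroLattice {O : Subalgebra (𝓞 K) ℍ[K,a,b]} {x : CorSpace K (B0 a b)}
    (hx : x ∈ corLattice (traceZeroLattice O)) :
    ∃ u : B0 a b, (u : ℍ[K,a,b]) ∈ O ∧ corDiag u = x := hx

theorem corForm_integral {O : Subalgebra (𝓞 K) ℍ[K,a,b]} (hO : IsOrder O)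
    {x y : CorSpace K (B0 a b)} (hx : x ∈ corLattice (traceZeroLattice O))
    (hy : y ∈ corLattice (traceZeroLattice O)) : ∃ n : ℤ, corForm (QB a b) x y = n := by
  obtain ⟨u, hu, rfl⟩ := exists_mem_traceZeroLattice hx
  obtain ⟨w, hw, rfl⟩ := exists_mem_traceZeroLattice hy
  obtain ⟨z, hz⟩ := trd_mem_range hO (O.mul_mem hu hw)
  refine ⟨Algebra.trace ℤ (𝓞 K) z, ?_⟩
  rw [corForm_corDiag, QB_apply, ← hz, ← Algebra.coe_trace_int]
  simp

/-! ### Bases of fractional ideals and determinants of trace forms -/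

open NumberField Module

open scoped nonZeroDivisors

variable {K : Type*} [Field K] [NumberField K]

/-- A `ℚ`-basis of `K` that is a `ℤ`-basis of a given fractional ideal. -/
theorem exists_basis_fractionalIdeal {n : ℕ} (hK : finrank ℚ K = n)
    (I : (FractionalIdeal (𝓞 K)⁰ K)ˣ) :
    ∃ β : Basis (Fin n) ℚ K, (∀ k, β k ∈ I.1) ∧ (∀ x ∈ I.1, ∃ c : Fin n → ℤ, x = ∑ k, c k • β k) ∧
      Algebra.discr ℚ β = discr K * FractionalIdeal.absNorm I.1 ^ 2 := by
  classical
  have hc : Fintype.card (Free.ChooseBasisIndex ℤ I) = n := by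
    rw [← finrank_eq_card_basis (basisOfFractionalIdeal K I), hK]
  let e : Free.ChooseBasisIndex ℤ I ≃ Fin n := Fintype.equivFinOfCardEq hc
  have hc' : Fintype.card (Free.ChooseBasisIndex ℤ (𝓞 K)) =
      Fintype.card (Free.ChooseBasisIndex ℤ I) := by
    rw [hc, ← finrank_eq_card_basis (integralBasis K), hK]
  let e' : Free.ChooseBasisIndex ℤ (𝓞 K) ≃ Free.ChooseBasisIndex ℤ I := Fintype.equivOfCardEq hc'
  refine ⟨(basisOfFractionalIdeal K I).reindex e, fun k => ?_, fun x hx => ?_, ?_⟩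
  · rw [Basis.reindex_apply, basisOfFractionalIdeal_apply]
    exact (fractionalIdealBasis K I.1 (e.symm k)).2
  · have hx' := (mem_span_basisOfFractionalIdeal K (I := I) (x := x)).2 hx
    obtain ⟨c, hc⟩ := (Submodule.mem_span_range_iff_exists_fun ℤ).1 hx'
    refine ⟨c ∘ e.symm, ?_⟩
    rw [← hc]
    exact (Fintype.sum_equiv e _ _ fun k => by simp)
  · have h := det_basisOfFractionalIdeal_eq_absNorm K I e'
    set β' := (basisOfFractionalIdeal K I).reindex e'.symm
    have h1 : Algebra.discr ℚ β' = discr K * FractionalIdeal.absNorm I.1 ^ 2 := by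
      rw [← h, sq_abs, coe_discr, mul_comm, Basis.det_apply, ← Algebra.discr_of_matrix_vecMul,
        Basis.toMatrix_map_vecMul]
    rw [← h1, Basis.coe_reindex, Algebra.discr_reindex, Basis.coe_reindex, Algebra.discr_reindex]

/-- The determinant of the trace form of a hermitian-like block matrix over a number field. -/
theorem det_trace_block {n m : ℕ} (hK : finrank ℚ K = n) (β : Fin m → Basis (Fin n) ℚ K)
    (q : Matrix (Fin m) (Fin m) K) :
    (Matrix.of fun p p' : Fin n × Fin m =>
      Algebra.trace ℚ K (β p.2 p.1 * β p'.2 p'.1 * q p.2 p'.2)).det =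
      (∏ i, Algebra.discr ℚ (β i)) * Algebra.norm ℚ q.det := by
  classical
  apply (algebraMap ℚ (AlgebraicClosure ℚ)).injective
  let e : Fin n ≃ (K →ₐ[ℚ] AlgebraicClosure ℚ) := (Fintype.equivFinOfCardEq (by
    rw [AlgHom.card, hK])).symm
  let E : Fin m → Matrix (Fin n) (Fin n) (AlgebraicClosure ℚ) := fun i =>
    Algebra.embeddingsMatrixReindex ℚ (AlgebraicClosure ℚ) (β i) e
  have hE : ∀ i k l, E i k l = e l (β i k) := fun i k l => rfl
  let D := Matrix.blockDiagonal E
  -- The Gram matrix factors as D S Dᵀ. Here D is block diagonal with the embedding matrices of the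
  -- bases, whose squared determinants are discriminants, and S is block diagonal after a
  -- permutation, with blocks the conjugates of `q`.
  let S := (Matrix.blockDiagonal fun l => q.map (e l)).submatrix
    (Equiv.prodComm (Fin n) (Fin m)) (Equiv.prodComm (Fin n) (Fin m))
  have hG : (algebraMap ℚ (AlgebraicClosure ℚ)).mapMatrix (Matrix.of fun p p' : Fin n × Fin m =>
      Algebra.trace ℚ K (β p.2 p.1 * β p'.2 p'.1 * q p.2 p'.2)) = D * S * D.transpose := by
    ext ⟨k, i⟩ ⟨l, j⟩
    rw [RingHom.mapMatrix_apply, Matrix.map_apply, Matrix.of_apply,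
      trace_eq_sum_embeddings (AlgebraicClosure ℚ), ← Fintype.sum_equiv e _ _ fun _ => rfl]
    simp only [Matrix.mul_apply, Matrix.transpose_apply, D, S, Matrix.blockDiagonal_apply,
      Matrix.submatrix_apply, Equiv.prodComm_apply, Prod.swap, Fintype.sum_prod_type, hE,
      Matrix.map_apply, ite_mul, zero_mul, mul_ite, mul_zero, Finset.sum_ite_eq, Finset.sum_ite_eq',
      Finset.mem_univ, if_true, map_mul]
    refine Finset.sum_congr rfl fun r _ => ?_
    rw [Finset.sum_eq_single r (fun x _ hx => by simp [hx]) (by simp)]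
    simp only [if_true, Finset.sum_ite_eq, Finset.mem_univ]
    ring
  rw [RingHom.map_det, hG, Matrix.det_mul, Matrix.det_mul, Matrix.det_transpose,
    Matrix.det_submatrix_equiv_self, Matrix.det_blockDiagonal, Matrix.det_blockDiagonal, map_mul,
    map_prod, Algebra.norm_eq_prod_embeddings ℚ (AlgebraicClosure ℚ),
    ← Fintype.prod_equiv e _ _ fun _ => rfl]
  simp_rw [Algebra.discr_eq_det_embeddingsMatrixReindex_pow_two ℚ (AlgebraicClosure ℚ) _ e,
    AlgHom.map_det, AlgHom.mapMatrix_apply]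
  rw [Finset.prod_pow]
  ring

/-! ### Pseudo-bases of lattices -/

open NumberField Module IsDedekindDomain HeightOneSpectrum

open scoped nonZeroDivisors

variable {K : Type*} [Field K] [NumberField K]

/-- A lattice splits along a linear functional. -/
theorem exists_lattice_splitting {V : Type*} [AddCommGroup V] [Module K V] [Module (𝓞 K) V]
    [IsScalarTower (𝓞 K) K V] {Λ : Submodule (𝓞 K) V} (hfg : Λ.FG) (l : V →ₗ[K] K)
    (hl : ∃ x ∈ Λ, l x ≠ 0) :
    ∃ (I : (FractionalIdeal (𝓞 K)⁰ K)ˣ) (f : V), l f = 1 ∧ (∀ α ∈ I.1, α • f ∈ Λ) ∧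
      (∀ x ∈ Λ, l x ∈ I.1) ∧ ∀ k : V →ₗ[K] K, (∀ x ∈ Λ, k x = 0) → k f = 0 := by
  let M : Submodule (𝓞 K) K := Λ.map (l.restrictScalars (𝓞 K))
  let J : FractionalIdeal (𝓞 K)⁰ K := ⟨M, FractionalIdeal.isFractional_of_fg (hfg.map _)⟩
  have hJ : ∀ y, y ∈ J ↔ ∃ x ∈ Λ, l x = y := fun y => Iff.rfl
  have hJ0 : J ≠ 0 := by
    intro h
    obtain ⟨x, hx, hlx⟩ := hl
    exact hlx (FractionalIdeal.eq_zero_iff.1 h _ ((hJ _).2 ⟨x, hx, rfl⟩))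
  -- The image J of the functional is invertible. Writing 1 as a sum of products l(x)d with d in
  -- J⁻¹, the sum of the vectors dx is the required f.
  have key : ∀ y ∈ J * J⁻¹, ∃ f : V, l f = y ∧ (∀ α ∈ J, α • f ∈ Λ) ∧
      ∀ k : V →ₗ[K] K, (∀ x ∈ Λ, k x = 0) → k f = 0 := by
    intro y hy
    refine FractionalIdeal.mul_induction_on hy ?_ ?_
    · intro c hc d hd
      obtain ⟨x, hx, rfl⟩ := (hJ c).1 hc
      refine ⟨d • x, by rw [map_smul, smul_eq_mul, mul_comm], fun α hα => ?_, fun k hk => by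
        rw [map_smul, hk x hx, smul_zero]⟩
      have h1 : α * d ∈ (1 : FractionalIdeal (𝓞 K)⁰ K) := by
        rw [← mul_inv_cancel₀ hJ0]; exact FractionalIdeal.mul_mem_mul hα hd
      obtain ⟨r, hr⟩ := (FractionalIdeal.mem_one_iff _).1 h1
      rw [smul_smul, ← hr, algebraMap_smul]
      exact Λ.smul_mem r hx
    · rintro y z ⟨f, hf, h1, h2⟩ ⟨g, hg, h3, h4⟩
      refine ⟨f + g, by rw [map_add, hf, hg], fun α hα => ?_, fun k hk => by
        rw [map_add, h2 k hk, h4 k hk, add_zero]⟩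
      rw [smul_add]
      exact Λ.add_mem (h1 α hα) (h3 α hα)
  obtain ⟨f, hf, h1, h2⟩ := key 1 (by rw [mul_inv_cancel₀ hJ0]; exact FractionalIdeal.one_mem_one _)
  exact ⟨Units.mk0 J hJ0, f, hf, h1, fun x hx => (hJ _).2 ⟨x, hx, rfl⟩, h2⟩

variable {a b : K}

instance isScalarTower_B0 : IsScalarTower (𝓞 K) K (B0 a b) :=
  IsScalarTower.of_algebraMap_smul fun r x => (B0_smul_eq r x).symm

theorem traceZeroLattice_fg {O : Subalgebra (𝓞 K) ℍ[K,a,b]} (hO : IsOrder O) :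
    (traceZeroLattice O).FG := by
  let ι : B0 a b →ₗ[𝓞 K] ℍ[K,a,b] :=
    { toFun := fun x => x
      map_add' := fun x y => rfl
      map_smul' := fun r x => rfl }
  refine Submodule.fg_of_fg_map_injective ι (fun x y h => Subtype.ext h) (hO.1.of_le ?_)
  rintro _ ⟨x, hx, rfl⟩
  exact hx

theorem exists_smul_mem_traceZeroLattice {O : Subalgebra (𝓞 K) ℍ[K,a,b]} (hO : IsOrder O)
    (x : B0 a b) : ∃ r : K, r ≠ 0 ∧ r • x ∈ traceZeroLattice O := by
  obtain ⟨r, hr, h⟩ := hO.exists_smul_mem (x : ℍ[K,a,b])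
  refine ⟨algebraMap (𝓞 K) K r, by simpa using hr, ?_⟩
  rw [← B0_smul_eq]
  exact h

theorem det_gram_B0basis :
    (Matrix.of fun i j => QB a b (B0basis a b i) (B0basis a b j)).det = -8 * (a * b) ^ 2 := by
  rw [Matrix.det_fin_three]
  simp [QB_apply, trd_eq, B0basis]
  ring

/-- A pseudo-basis of the trace-zero lattice. -/
theorem exists_pseudoBasis {O : Subalgebra (𝓞 K) ℍ[K,a,b]} (hO : IsOrder O) :
    ∃ (I : Fin 3 → (FractionalIdeal (𝓞 K)⁰ K)ˣ) (f : Basis (Fin 3) K (B0 a b)),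
      (∀ i, ∀ α ∈ (I i).1, α • f i ∈ traceZeroLattice O) ∧
      (∀ x ∈ traceZeroLattice O, ∀ i, f.repr x i ∈ (I i).1) ∧
      (Matrix.of fun i j => QB a b (f i) (f j)).det = -8 * (a * b) ^ 2 := by
  set Λ := traceZeroLattice O
  let c : Fin 3 → B0 a b →ₗ[K] K := (B0basis a b).coord
  have hc : ∀ i j, c i (B0basis a b j) = if i = j then 1 else 0 := fun i j => by
    simp [c, Finsupp.single_apply, eq_comm]
  have hfg := traceZeroLattice_fg hO
  have hspan : ∀ i, ∃ x ∈ Λ, c i x ≠ 0 ∧ ∀ j ≠ i, c j x = 0 := fun i => by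
    obtain ⟨r, hr, h⟩ := exists_smul_mem_traceZeroLattice hO (B0basis a b i)
    exact ⟨_, h, by simp [hc, hr], fun j hj => by simp [hc, hj]⟩
  -- Split off one coordinate at a time along the flag of kernels.
  let Λ₁ : Submodule (𝓞 K) (B0 a b) := Λ ⊓ LinearMap.ker ((c 0).restrictScalars (𝓞 K))
  let Λ₂ : Submodule (𝓞 K) (B0 a b) := Λ₁ ⊓ LinearMap.ker ((c 1).restrictScalars (𝓞 K))
  have hΛ₁ : ∀ x, x ∈ Λ₁ ↔ x ∈ Λ ∧ c 0 x = 0 := fun x => Iff.rfl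
  have hΛ₂ : ∀ x, x ∈ Λ₂ ↔ x ∈ Λ₁ ∧ c 1 x = 0 := fun x => Iff.rfl
  obtain ⟨I₀, f₀, h00, hm0, hI0, -⟩ := exists_lattice_splitting hfg (c 0) (by
    obtain ⟨x, hx, h, -⟩ := hspan 0; exact ⟨x, hx, h⟩)
  obtain ⟨I₁, f₁, h11, hm1, hI1, hv1⟩ := exists_lattice_splitting
    (hfg.of_le (inf_le_left : Λ₁ ≤ Λ)) (c 1) (by
      obtain ⟨x, hx, h, h'⟩ := hspan 1
      exact ⟨x, (hΛ₁ x).2 ⟨hx, h' 0 (by decide)⟩, h⟩)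
  obtain ⟨I₂, f₂, h22, hm2, hI2, hv2⟩ := exists_lattice_splitting
    (hfg.of_le (inf_le_left.trans inf_le_left : Λ₂ ≤ Λ)) (c 2) (by
      obtain ⟨x, hx, h, h'⟩ := hspan 2
      exact ⟨x, (hΛ₂ x).2 ⟨(hΛ₁ x).2 ⟨hx, h' 0 (by decide)⟩, h' 1 (by decide)⟩, h⟩)
  have h01 : c 0 f₁ = 0 := hv1 (c 0) fun x hx => ((hΛ₁ x).1 hx).2
  have h02 : c 0 f₂ = 0 := hv2 (c 0) fun x hx => ((hΛ₁ x).1 ((hΛ₂ x).1 hx).1).2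
  have h12 : c 1 f₂ = 0 := hv2 (c 1) fun x hx => ((hΛ₂ x).1 hx).2
  let g : Fin 3 → B0 a b := ![f₀, f₁, f₂]
  have hzero : ∀ x, c 0 x = 0 → c 1 x = 0 → c 2 x = 0 → x = 0 := fun x h0 h1 h2 => by
    refine (B0basis a b).ext_elem fun i => ?_
    rw [map_zero]
    fin_cases i
    exacts [h0, h1, h2]
  have hind : LinearIndependent K g := by
    rw [Fintype.linearIndependent_iff]
    intro d hd
    rw [Fin.sum_univ_three] at hd
    have hd' : d 0 • f₀ + d 1 • f₁ + d 2 • f₂ = 0 := hd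
    have e0 := congrArg (c 0) hd'
    have e1 := congrArg (c 1) hd'
    have e2 := congrArg (c 2) hd'
    simp only [map_add, map_smul, smul_eq_mul, map_zero, h00, h01, h02, h11, h12, h22, mul_zero,
      mul_one, add_zero] at e0 e1 e2
    rw [e0, zero_mul, zero_add] at e1
    rw [e0, e1, zero_mul, zero_mul, zero_add, zero_add] at e2
    intro i
    fin_cases i
    exacts [e0, e1, e2]
  have hfr : Fintype.card (Fin 3) = finrank K (B0 a b) := by
    rw [finrank_eq_card_basis (B0basis a b)]
  let f : Basis (Fin 3) K (B0 a b) := basisOfLinearIndependentOfCardEqFinrank hind hfr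
  have hf : ∀ i, f i = g i := fun i => by simp [f]
  have hsum : ∀ d : Fin 3 → K, ∀ i, f.repr (d 0 • f₀ + d 1 • f₁ + d 2 • f₂) i = d i := by
    intro d i
    have : d 0 • f₀ + d 1 • f₁ + d 2 • f₂ = ∑ k, d k • f k := by
      rw [Fin.sum_univ_three, hf, hf, hf]; rfl
    rw [this, f.repr_sum_self]
  refine ⟨![I₀, I₁, I₂], f, fun i α hα => ?_, fun x hx i => ?_, ?_⟩
  · rw [hf]
    fin_cases i
    · exact hm0 α hα
    · exact ((hΛ₁ _).1 (hm1 α hα)).1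
    · exact ((hΛ₁ _).1 ((hΛ₂ _).1 (hm2 α hα)).1).1
  · set x₁ := x - c 0 x • f₀ with hx₁
    have hx₁m : x₁ ∈ Λ₁ := (hΛ₁ _).2 ⟨Λ.sub_mem hx (hm0 _ (hI0 x hx)), by simp [x₁, h00]⟩
    set x₂ := x₁ - c 1 x₁ • f₁ with hx₂
    have hx₂m : x₂ ∈ Λ₂ := (hΛ₂ _).2 ⟨Λ₁.sub_mem hx₁m (hm1 _ (hI1 x₁ hx₁m)), by simp [x₂, h11]⟩
    have hx₃ : x₂ - c 2 x₂ • f₂ = 0 := hzero _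
      (by simp [((hΛ₁ x₂).1 ((hΛ₂ x₂).1 hx₂m).1).2, h02])
      (by simp [((hΛ₂ x₂).1 hx₂m).2, h12]) (by simp [h22])
    have hxe : x = c 0 x • f₀ + c 1 x₁ • f₁ + c 2 x₂ • f₂ := by
      rw [← sub_eq_zero.1 hx₃, hx₂, hx₁]
      abel
    have := hsum ![c 0 x, c 1 x₁, c 2 x₂] i
    simp only [Matrix.cons_val_zero, Matrix.cons_val_one, Matrix.cons_val] at this
    rw [← hxe] at this
    rw [this]
    fin_cases i
    · exact hI0 x hx
    · exact hI1 x₁ hx₁m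
    · exact hI2 x₂ hx₂m
  -- The change of basis from i, j, k is unitriangular, so the Gram determinant is that of i, j, k.
  · rw [det_gram_of_eq_sum (QB a b) (Matrix.of fun i k => c k (f i)) (f := B0basis a b)
      (fun i => ((B0basis a b).sum_repr (f i)).symm), det_gram_B0basis, Matrix.det_fin_three]
    have e0 : f 0 = f₀ := hf 0
    have e1 : f 1 = f₁ := hf 1
    have e2 : f 2 = f₂ := hf 2
    simp only [Matrix.of_apply, e0, e1, e2, h00, h01, h02, h11, h12, h22]
    ring

/-! ### The norm of the discriminant in terms of a pseudo-basis -/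

open NumberField Module IsDedekindDomain HeightOneSpectrum

open scoped nonZeroDivisors

variable {K : Type*} [Field K] [NumberField K] {a b : K}

/-- Provides a local generator of `I` at v; the denominator bounds the valuations. -/
theorem exists_max_valuation (I : (FractionalIdeal (𝓞 K)⁰ K)ˣ) (v : HeightOneSpectrum (𝓞 K)) :
    ∃ g ∈ I.1, g ≠ 0 ∧ ∀ x ∈ I.1, v.valuation K x ≤ v.valuation K g := by
  have hd : algebraMap (𝓞 K) K I.1.den ≠ 0 := by
    simpa using nonZeroDivisors.coe_ne_zero I.1.den
  obtain ⟨⟨g, hg⟩, hg0, hmax⟩ := exists_ne_zero_forall_le (T := {x // x ∈ I.1})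
    (fun x => v.valuation K x.1) (v.valuation K (algebraMap (𝓞 K) K I.1.den))⁻¹
    (fun ⟨x, hx⟩ => by
      have hx' : algebraMap (𝓞 K) K I.1.den * x ∈ ((I.1.num : FractionalIdeal (𝓞 K)⁰ K)) := by
        rw [← FractionalIdeal.den_mul_self_eq_num']
        exact FractionalIdeal.mul_mem_mul (FractionalIdeal.mem_spanSingleton_self _ _) hx
      obtain ⟨y, -, hy⟩ := (FractionalIdeal.mem_coeIdeal _).1 hx'
      have h1 : v.valuation K (algebraMap (𝓞 K) K y) ≤ 1 := valuation_le_one v y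
      rw [hy, map_mul] at h1
      rwa [← mul_one (v.valuation K _)⁻¹, le_inv_mul_iff₀ (zero_lt_iff.2 ((map_ne_zero _).2 hd))])
    (by
      by_contra! h
      refine I.ne_zero (FractionalIdeal.eq_zero_iff.2 fun x hx => ?_)
      exact (map_eq_zero _).1 (h ⟨x, hx⟩))
  exact ⟨g, hg, (map_ne_zero _).1 hg0, fun x hx => hmax ⟨x, hx⟩⟩

/-- The discriminant of the trace-zero lattice in terms of a pseudo-basis. -/
theorem prod_sq_mul_spanSingleton_eq (ha : a ≠ 0) (hb : b ≠ 0) {O : Subalgebra (𝓞 K) ℍ[K,a,b]}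
    (hO : IsMaximalOrder O) (I : Fin 3 → (FractionalIdeal (𝓞 K)⁰ K)ˣ)
    (f : Basis (Fin 3) K (B0 a b))
    (hI : ∀ i, ∀ α ∈ (I i).1, α • f i ∈ traceZeroLattice O)
    (hI' : ∀ x ∈ traceZeroLattice O, ∀ i, f.repr x i ∈ (I i).1) :
    FractionalIdeal.spanSingleton (𝓞 K)⁰ (Matrix.of fun i j => QB a b (f i) (f j)).det *
        (∏ i, (I i).1) ^ 2 =
      ((Ideal.span {2} * quatDisc a b ^ 2 : Ideal (𝓞 K)) : FractionalIdeal (𝓞 K)⁰ K) := by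
  set q := (Matrix.of fun i j => QB a b (f i) (f j)).det with hq
  set J : FractionalIdeal (𝓞 K)⁰ K := FractionalIdeal.spanSingleton (𝓞 K)⁰ q * (∏ i, (I i).1) ^ 2
  choose g hgI hg0 hgmax using fun (v : HeightOneSpectrum (𝓞 K)) i => exists_max_valuation (I i) v
  have hprod : ∀ v : HeightOneSpectrum (𝓞 K), ∀ x ∈ ∏ i, (I i).1,
      v.valuation K x ≤ v.valuation K (∏ i, g v i) := by
    intro v x hx
    rw [Fin.prod_univ_three] at hx ⊢
    rw [map_mul, map_mul]
    refine FractionalIdeal.mul_induction_on hx ?_ fun y z hy hz =>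
      (Valuation.map_add _ _ _).trans (max_le hy hz)
    intro y hy z hz
    rw [map_mul]
    refine mul_le_mul' ?_ (hgmax v 2 z hz)
    refine FractionalIdeal.mul_induction_on hy ?_ fun y z hy hz =>
      (Valuation.map_add _ _ _).trans (max_le hy hz)
    intro y hy z hz
    rw [map_mul]
    exact mul_le_mul' (hgmax v 0 y hy) (hgmax v 1 z hz)
  have hJle : ∀ v : HeightOneSpectrum (𝓞 K), ∀ x ∈ J,
      v.valuation K x ≤ v.valuation K (q * (∏ i, g v i) ^ 2) := by
    intro v x hx
    obtain ⟨y, hy, rfl⟩ := FractionalIdeal.mem_singleton_mul.1 hx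
    rw [map_mul, map_mul, map_pow]
    refine mul_le_mul_right ?_ _
    rw [sq] at hy ⊢
    refine FractionalIdeal.mul_induction_on hy ?_ fun y z hy hz =>
      (Valuation.map_add _ _ _).trans (max_le hy hz)
    intro y hy z hz
    rw [map_mul]
    exact mul_le_mul' (hprod v y hy) (hprod v z hz)
  have hgprod : ∀ v, ∏ i, g v i ∈ ∏ i, (I i).1 := fun v => by
    rw [Fin.prod_univ_three, Fin.prod_univ_three]
    exact FractionalIdeal.mul_mem_mul (FractionalIdeal.mul_mem_mul (hgI v 0) (hgI v 1)) (hgI v 2)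
  have hJmem : ∀ v, q * (∏ i, g v i) ^ 2 ∈ J := fun v => by
    refine FractionalIdeal.mul_mem_mul (FractionalIdeal.mem_spanSingleton_self _ _) ?_
    rw [sq, sq]
    exact FractionalIdeal.mul_mem_mul (hgprod v) (hgprod v)
  have hval : ∀ v : HeightOneSpectrum (𝓞 K),
      v.valuation K (q * (∏ i, g v i) ^ 2) = discValuation a b v := by
    intro v
    apply le_antisymm
    · refine valuation_le_of_mem_latticeDisc ha hb hO v _ (Submodule.subset_span
        ⟨fun i => g v i • f i, fun i => hI i _ (hgI v i), ?_⟩)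
      rw [det_gram_of_eq_sum (QB a b) (Matrix.diagonal (g v)) (f := f)
        (fun i => by simp [Matrix.diagonal_apply]), Matrix.det_diagonal, ← hq, mul_comm]
    · obtain ⟨d, hd, hdv⟩ := exists_mem_latticeDisc ha hb hO v
      rw [← hdv]
      clear hdv
      induction hd using Submodule.span_induction with
      | mem d hd =>
        obtain ⟨x, hx, rfl⟩ := hd
        rw [det_gram_of_eq_sum (QB a b) (Matrix.of fun i k => f.repr (x i) k) (f := f)
          (fun i => (f.sum_repr (x i)).symm), ← hq, mul_comm]
        -- Dividing each column by a local generator of the corresponding ideal leaves a v-integral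
        -- matrix.
        have hdet : (Matrix.of fun i k => f.repr (x i) k) =
            (Matrix.of fun i k => f.repr (x i) k / g v k) * Matrix.diagonal (g v) := by
          ext i k
          rw [Matrix.mul_diagonal, Matrix.of_apply, Matrix.of_apply, div_mul_cancel₀ _ (hg0 v k)]
        rw [hdet, Matrix.det_mul, Matrix.det_diagonal, mul_pow, map_mul, map_mul, map_mul]
        refine mul_le_mul_right (mul_le_of_le_one_left' ?_) _
        rw [map_pow]
        refine pow_le_one' (map_det_le_one _ _ fun i k => ?_) 2
        rw [Matrix.of_apply, map_div₀]
        exact div_le_one_of_le₀ (hgmax v k _ (hI' _ (hx i) k)) zero_le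
      | zero => simp
      | add d d' _ _ h h' => exact (Valuation.map_add _ _ _).trans (max_le h h')
      | smul s d _ h =>
        rw [Algebra.smul_def, map_mul]
        exact (mul_le_of_le_one_left' (valuation_le_one v s)).trans h
  apply FractionalIdeal.coeToSubmodule_injective
  dsimp only
  rw [FractionalIdeal.coe_coeIdeal, ← latticeDisc_eq ha hb hO]
  refine submodule_eq_of_valuation (discValuation a b) discValuation_ne_zero
    (fun v x hx => (hJle v x hx).trans_eq (hval v)) (fun v => ⟨_, hJmem v, hval v⟩)
    (valuation_le_of_mem_latticeDisc ha hb hO) (exists_mem_latticeDisc ha hb hO)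

/-- Taking norms of ideals gives only the absolute value. The sign is read off from the determinant
-8(ab)², whose norm in odd degree is negative. -/
theorem absNorm_pseudoBasis (hK : finrank ℚ K = 3) (ha : a ≠ 0) (hb : b ≠ 0)
    {O : Subalgebra (𝓞 K) ℍ[K,a,b]}
    (hO : IsMaximalOrder O) (I : Fin 3 → (FractionalIdeal (𝓞 K)⁰ K)ˣ)
    (f : Basis (Fin 3) K (B0 a b))
    (hI : ∀ i, ∀ α ∈ (I i).1, α • f i ∈ traceZeroLattice O)
    (hI' : ∀ x ∈ traceZeroLattice O, ∀ i, f.repr x i ∈ (I i).1)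
    (hdet : (Matrix.of fun i j => QB a b (f i) (f j)).det = -8 * (a * b) ^ 2) :
    (∏ i, FractionalIdeal.absNorm (I i).1) ^ 2 *
        Algebra.norm ℚ (Matrix.of fun i j => QB a b (f i) (f j)).det =
      -(2 ^ 3 * (Ideal.absNorm (quatDisc a b) : ℚ) ^ 2) := by
  have h := congrArg FractionalIdeal.absNorm (prod_sq_mul_spanSingleton_eq ha hb hO I f hI hI')
  rw [map_mul, map_pow, map_prod, FractionalIdeal.absNorm_span_singleton,
    FractionalIdeal.coeIdeal_absNorm, map_mul, map_pow, Ideal.absNorm_span_singleton] at h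
  have h8 : Algebra.norm ℚ (-8 * (a * b) ^ 2 : K) = -(8 ^ 3 * Algebra.norm ℚ (a * b) ^ 2) := by
    rw [map_mul, map_pow, show (-8 : K) = algebraMap ℚ K (-8) by simp, Algebra.norm_algebraMap, hK]
    ring
  have h2 : Algebra.norm ℤ (2 : 𝓞 K) = 2 ^ 3 := by
    have := Algebra.norm_algebraMap (S := 𝓞 K) (2 : ℤ)
    rw [RingOfIntegers.rank, hK, map_ofNat] at this
    exact this
  rw [h2] at h
  rw [hdet, h8] at h ⊢
  rw [abs_neg, abs_of_nonneg (by positivity)] at h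
  push_cast at h
  linear_combination -h

/-! ### The Gram determinant of the corestricted lattice -/

open NumberField Module

variable {K : Type*} [Field K] [NumberField K] {a b : K}

/-- The Gram determinant of a biadditive map does not depend on the `ℤ`-basis. -/
theorem det_gram_int_basis_eq {C R ι : Type*} [AddCommGroup C] [CommRing R] [Fintype ι]
    [DecidableEq ι] (T : C →+ C →+ R) {S : Submodule ℤ C} (e g : Basis ι ℤ S) :
    (Matrix.of fun i j => T (e i) (e j)).det = (Matrix.of fun i j => T (g i) (g j)).det := by
  have hP : ((g.toMatrix e).map (Int.castRingHom R)).det ^ 2 = 1 := by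
    -- A base change over ℤ has determinant ±1, and it enters squared.
    have h : IsUnit (g.toMatrix e).det := IsUnit.of_mul_eq_one (e.toMatrix g).det (by
      rw [← Matrix.det_mul, Basis.toMatrix_mul_toMatrix_flip, Matrix.det_one])
    rw [← RingHom.mapMatrix_apply, ← RingHom.map_det, ← map_pow, Int.isUnit_sq h, map_one]
  have he : ∀ i, (e i : C) = ∑ p, g.toMatrix e p i • (g p : C) := fun i => by
    conv_lhs => rw [← g.sum_toMatrix_smul_self e i]
    rw [Submodule.coe_sum]
    rfl
  have h : (Matrix.of fun i j => T (e i) (e j)) =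
      ((g.toMatrix e).map (Int.castRingHom R)).transpose * (Matrix.of fun i j => T (g i) (g j)) *
        (g.toMatrix e).map (Int.castRingHom R) := by
    ext i j
    rw [Matrix.of_apply, he, he, map_sum, Matrix.mul_apply]
    refine Finset.sum_congr rfl fun q _ => ?_
    rw [map_zsmul, map_sum, AddMonoidHom.finsetSum_apply, zsmul_eq_mul, mul_comm, Matrix.mul_apply]
    congr 1
    refine Finset.sum_congr rfl fun p _ => ?_
    rw [map_zsmul, AddMonoidHom.zsmul_apply, zsmul_eq_mul]
    rfl
  rw [h, Matrix.det_mul, Matrix.det_mul, Matrix.det_transpose]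
  linear_combination (Matrix.of fun i j => T (g i) (g j)).det * hP

theorem exists_basis_map_of_injective {C N ι : Type*} [AddCommGroup C] [AddCommGroup N] [Fintype ι]
    {φ : N →+ C} (hφ : Function.Injective φ) {Λ : AddSubgroup N} {u : ι → N} (hu : ∀ p, u p ∈ Λ)
    (hli : ∀ c : ι → ℤ, ∑ p, c p • u p = 0 → ∀ p, c p = 0)
    (hspan : ∀ x ∈ Λ, ∃ c : ι → ℤ, x = ∑ p, c p • u p) :
    ∃ g : Basis ι ℤ (AddSubgroup.toIntSubmodule (Λ.map φ)), ∀ p, (g p : C) = φ (u p) := by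
  let v : ι → AddSubgroup.toIntSubmodule (Λ.map φ) := fun p => ⟨φ (u p), u p, hu p, rfl⟩
  have hv : ∀ c : ι → ℤ, ((∑ p, c p • v p : AddSubgroup.toIntSubmodule (Λ.map φ)) : C) =
      φ (∑ p, c p • u p) := by
    intro c
    rw [Submodule.coe_sum, map_sum]
    refine Finset.sum_congr rfl fun p _ => ?_
    rw [map_zsmul]
    rfl
  have hli' : LinearIndependent ℤ v := Fintype.linearIndependent_iff.2 fun c hc =>
    hli c (hφ (by rw [← hv, hc, map_zero]; rfl))
  have hspan' : ⊤ ≤ Submodule.span ℤ (Set.range v) := by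
    rintro ⟨_, y, hy, rfl⟩ -
    obtain ⟨c, hc⟩ := hspan y hy
    have h : (⟨φ y, y, hy, rfl⟩ : AddSubgroup.toIntSubmodule (Λ.map φ)) = ∑ p, c p • v p :=
      Subtype.ext (by rw [hv, ← hc])
    rw [h]
    exact Submodule.sum_mem _ fun p _ => Submodule.smul_mem _ _ (Submodule.subset_span ⟨p, rfl⟩)
  exact ⟨Basis.mk hli' hspan', fun p => by rw [Basis.mk_apply]⟩

section

variable {V : Type*} [AddCommGroup V] [Module K V]

/-- The corestricted form as a biadditive map. -/
def corFormAddHom (Q : LinearMap.BilinForm K V) :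
    CorSpace K V →+ CorSpace K V →+ AlgebraicClosure ℚ :=
  AddMonoidHom.mk' (fun x => AddMonoidHom.mk' (fun y => corForm Q x y) fun y z => by
    simp only [corForm, ← Finset.sum_add_distrib]
    exact Finset.sum_congr rfl fun σ _ =>
      map_add (LinearMap.BilinForm.baseChange (Emb σ) Q (x.1 σ)) _ _) fun x y => by
    ext z
    simp only [AddMonoidHom.mk'_apply, AddMonoidHom.add_apply, corForm, ← Finset.sum_add_distrib]
    exact Finset.sum_congr rfl fun σ _ =>
      LinearMap.map_add₂ (LinearMap.BilinForm.baseChange (Emb σ) Q) _ _ _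

end

/-- A `ℤ`-basis of the corestricted trace-zero lattice, and its Gram determinant. -/
theorem exists_basis_corLattice (hK : finrank ℚ K = 3) (ha : a ≠ 0) (hb : b ≠ 0)
    {O : Subalgebra (𝓞 K) ℍ[K,a,b]} (hO : IsMaximalOrder O) :
    ∃ g : Basis (Fin 9) ℤ (corLattice (traceZeroLattice O)),
      (Matrix.of fun i j => corForm (QB a b) (g i : CorSpace K (B0 a b)) (g j)).det =
        ((-(2 ^ 3 * discr K ^ 3 * (Ideal.absNorm (quatDisc a b) : ℤ) ^ 2) : ℤ) :
          AlgebraicClosure ℚ) := by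
  obtain ⟨I, f, hI, hI', hdet⟩ := exists_pseudoBasis (a := a) (b := b) hO.1
  choose β hβ hβ' hβdisc using fun i => exists_basis_fractionalIdeal hK (I i)
  -- Multiplying the ℤ-bases of the three ideals by the vectors of the pseudo-basis gives a ℤ-basis
  -- of O ∩ B⁰ with nine elements.
  let u : Fin 3 × Fin 3 → B0 a b := fun p => β p.2 p.1 • f p.2
  have hu : ∀ c : Fin 3 × Fin 3 → ℤ, ∀ i,
      f.repr (∑ p, c p • u p) i = ∑ k, c (k, i) • β i k := by
    intro c i
    rw [map_sum, Finsupp.finsetSum_apply, Fintype.sum_prod_type]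
    refine Finset.sum_congr rfl fun k _ => ?_
    rw [Finset.sum_eq_single i]
    · simp [u]
    · intro j _ hj
      simp [u, Finsupp.single_apply, hj]
    · simp
  have hex : ∃ g : Basis (Fin 3 × Fin 3) ℤ (corLattice (traceZeroLattice O)),
      ∀ p, (g p : CorSpace K (B0 a b)) = corDiag (u p) := exists_basis_map_of_injective
    (φ := (corDiag : B0 a b →+ CorSpace K (B0 a b)))
    corDiag_bijective.1 (Λ := (traceZeroLattice O).toAddSubgroup) (u := u)
    (fun p => hI p.2 _ (hβ p.2 p.1))
    (fun c h0 => by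
      rintro ⟨k, i⟩
      have h1 := hu c i
      rw [h0, map_zero, Finsupp.zero_apply] at h1
      have h2 := Fintype.linearIndependent_iff.1 (β i).linearIndependent (fun k => (c (k, i) : ℚ))
        (by rw [h1]; exact Finset.sum_congr rfl fun k _ => Int.cast_smul_eq_zsmul ℚ _ _) k
      exact_mod_cast h2)
    (fun y hy => by
      choose c hc using fun i => hβ' i _ (hI' y hy i)
      refine ⟨fun p => c p.2 p.1, f.repr.injective (Finsupp.ext fun i => ?_)⟩
      rw [hu (fun p => c p.2 p.1), hc])
  obtain ⟨g, hg⟩ := hex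
  refine ⟨g.reindex finProdFinEquiv, ?_⟩
  have hgram : (Matrix.of fun i j => corForm (QB a b)
      (g.reindex finProdFinEquiv i : CorSpace K (B0 a b)) (g.reindex finProdFinEquiv j)) =
      Matrix.reindex finProdFinEquiv finProdFinEquiv ((algebraMap ℚ (AlgebraicClosure ℚ)).mapMatrix
        (Matrix.of fun p p' : Fin 3 × Fin 3 => Algebra.trace ℚ K
          (β p.2 p.1 * β p'.2 p'.1 * (Matrix.of fun i j => QB a b (f i) (f j)) p.2 p'.2))) := by
    ext i j
    have hr : ∀ i, ((g.reindex finProdFinEquiv i : corLattice (traceZeroLattice O)) :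
        CorSpace K (B0 a b)) = corDiag (u (finProdFinEquiv.symm i)) := fun i =>
      (congrArg Subtype.val (g.reindex_apply finProdFinEquiv i)).trans (hg _)
    rw [Matrix.of_apply, hr, hr, corForm_corDiag,
      LinearMap.BilinForm.smul_left, LinearMap.BilinForm.smul_right, ← mul_assoc]
    exact (eq_ratCast (algebraMap ℚ (AlgebraicClosure ℚ)) _).symm
  rw [hgram, Matrix.det_reindex_self, ← RingHom.map_det, det_trace_block hK β,
    Finset.prod_congr rfl fun i _ => hβdisc i, Finset.prod_mul_distrib, Finset.prod_const,
    Finset.prod_pow, mul_assoc, absNorm_pseudoBasis hK ha hb hO I f hI hI' hdet]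
  simp
  ring

theorem det_gram_corLattice (hK : finrank ℚ K = 3) (ha : a ≠ 0) (hb : b ≠ 0)
    {O : Subalgebra (𝓞 K) ℍ[K,a,b]} (hO : IsMaximalOrder O)
    (e : Basis (Fin 9) ℤ (corLattice (traceZeroLattice O))) :
    (Matrix.of fun i j => corForm (QB a b) (e i : CorSpace K (B0 a b)) (e j)).det =
      ((-(2 ^ 3 * discr K ^ 3 * (Ideal.absNorm (quatDisc a b) : ℤ) ^ 2) : ℤ) :
        AlgebraicClosure ℚ) := by
  obtain ⟨g, hg⟩ := exists_basis_corLattice hK ha hb hO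
  rw [← hg]
  exact det_gram_int_basis_eq (corFormAddHom (QB a b)) e g

end Mumford

end

/-! ### The main theorem -/

open Mumford in
theorem theorem1 {K : Type*} [Field K] [NumberField K] [NumberField.IsTotallyReal K]
    (hK : Module.finrank ℚ K = 3) (a b : K) (ha : a ≠ 0) (hb : b ≠ 0) :
    -- the canonical lattice and its discriminant
    (∀ O : Subalgebra (𝓞 K) ℍ[K,a,b], IsMaximalOrder O →
      latticeDisc 3 (QB a b) (traceZeroLattice O) =
        IsLocalization.coeSubmodule K (Ideal.span {2} * quatDisc a b ^ 2) ∧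
      (∀ x ∈ corLattice (traceZeroLattice O), ∀ y ∈ corLattice (traceZeroLattice O),
        ∃ n : ℤ, corForm (QB a b) x y = n) ∧
      Nonempty (Module.Basis (Fin 9) ℤ (corLattice (traceZeroLattice O))) ∧
      ∀ e : Module.Basis (Fin 9) ℤ (corLattice (traceZeroLattice O)),
        (Matrix.of fun i j => corForm (QB a b) (e i : CorSpace K (B0 a b)) (e j)).det =
          ((-(2 ^ 3 * NumberField.discr K ^ 3 * (Ideal.absNorm (quatDisc a b) : ℤ) ^ 2) : ℤ) :
            AlgebraicClosure ℚ)) ∧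
    -- the quadratic space `V_{K3}` under the conditions of Mumford
    (Nonempty (ℝ ⊗[ℚ] ℍ[K,a,b] ≃ₐ[ℝ] ℍ[ℝ] × ℍ[ℝ] × Matrix (Fin 2) (Fin 2) ℝ) →
      ∀ ρ : CorAlg a b ≃ₐ[ℚ] Matrix (Fin 8) (Fin 8) ℚ,
        (∃ ψ, IsInvariantSymplectic ρ ψ) ∧
        (∃! ρC, IsComplexification ρ ρC) ∧
        ∀ ρC, IsComplexification ρ ρC →
          ∃ W, IsVK3 ρC W ∧ (∀ W', IsVK3 ρC W' → W' = W) ∧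
            Module.finrank ℚ W = 9 ∧ W ≤ symTensors ℚ 8 ∧
            IsGStable ρ W ∧ (∀ W' ≤ W, IsGStable ρ W' → W' = ⊥ ∨ W' = W) ∧
            (∀ σ₀ θ₀,
              hodgePiece ρC σ₀ θ₀ W 2 0 ⊔ hodgePiece ρC σ₀ θ₀ W 1 1 ⊔ hodgePiece ρC σ₀ θ₀ W 0 2 =
                complexSpan W ∧
              Module.finrank ℂ (hodgePiece ρC σ₀ θ₀ W 2 0) = 1 ∧
              Module.finrank ℂ (hodgePiece ρC σ₀ θ₀ W 1 1) = 7 ∧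
              Module.finrank ℂ (hodgePiece ρC σ₀ θ₀ W 0 2) = 1) ∧
            ∀ ψ, IsInvariantSymplectic ρ ψ →
              ∃ f : CorSpace K (B0 a b) ≃ₗ[ℚ] W,
                (∀ x y, algebraMap ℚ (AlgebraicClosure ℚ) (intersectionForm ψ (f x) (f y)) =
                  corForm (QB a b) x y) ∧
                ∀ γ : ℍ[K,a,b], nrd γ = 1 → ∀ x,
                  (f (CorSpace.map (Ad γ) x) : (Fin 8 → ℚ) ⊗[ℚ] (Fin 8 → ℚ)) =
                    act (ρ (NmCor γ)) (f x)) := by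
  refine ⟨fun O hO => ⟨latticeDisc_eq ha hb hO, fun x hx y hy => corForm_integral hO.1 hx hy,
    ?_, det_gram_corLattice hK ha hb hO⟩, fun _ ρ => mumford_vk3 hK ha hb ρ⟩
  obtain ⟨g, -⟩ := exists_basis_corLattice hK ha hb hO
  exact ⟨g⟩
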